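/- **Setting.** Let $N\in\mathbb N_0$ and $T>0$. For $0\le n\le N$ let $a_n(t,x)$, $\gamma_n(t,x)$ be polynomials in $x$, of degree bounded uniformly in $t\in[0,T]$, with $a_n(\cdot,x),\gamma_n(\cdot,x)\in L^\infty([0,T])$ for every $x$, and let $\nu_n(t,x,dz)=\sum_{m=0}^{M_n}x^m\,\nu_{n,m}(t,dz)$, where each $\nu_{n,m}=\nu_{n,m}^+-\nu_{n,m}^-$ is a difference of two nonnegative measures depending measurably on $t$, such that $\bar\nu^\pm_{n,m}:=\sup_{t\in[0,T]}\nu^\pm_{n,m}(t,\cdot)$ (least dominating measure) satisfies $\int\min\{|z|,z^2\}\,\bar\nu^\pm_{n,m}(dz)<\infty$ and $\int_{|z|\ge1}e^z\,\bar\nu^\pm_{n,m}(dz)<\infty$. Suppose that $a_0(t,x)=a_0(t)$ and $\gamma_0(t,x)=\gamma_0(t)$ do not depend on $x$, that $M_0=0$, $\nu_0:=\nu_{0,0}\ge0$, and that for some $\lambda>0$, $\int_{|z|\ge1}e^{\lambda|z|}\nu_0(t,dz)<\infty$ for all $t\in[0,T]$. (These are the data of an $N$-th order polynomial expansion.) Suppose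 also that $a_0(t)>0$ for a.e. $t\in[0,T]$. Put $$\mathcal A_n(t,x)f=a_n(t,x)(f''-f')+\gamma_n(t,x)(f'-f)+\sum_{m=0}^{M_n}x^m\Big(-\!\int(e^z-1-z)\,\nu_{n,m}(t,dz)\,f'(x)+\!\int\big(f(x+z)-f(x)-zf'(x)\big)\nu_{n,m}(t,dz)\Big),$$ $$\mathbf m(t,s)=\int_t^s\Big(\gamma_0(r)-a_0(r)-\int(e^z-1-z)\nu_0(r,dz)\Big)dr,\qquad \mathbf C(t,s)=\int_t^s2a_0(r)\,dr,$$ $$\Phi_0(t,s,\xi)=i\xi\,\mathbf m(t,s)-\tfrac12\mathbf C(t,s)\xi^2+\int_t^s\!\int(e^{iz\xi}-1-iz\xi)\,\nu_0(r,dz)\,dr-\int_t^s\gamma_0(r)\,dr,$$ $$p_0(t,x;s,y)=\frac1{2\pi}\int_{\mathbb R}e^{-iy\xi}\,e^{i\xi x+\Phi_0(t,s,\xi)}\,d\xi ,\qquad u_0(t,x)=\int_{\mathbb R}p_0(t,x;T,y)\,h(y)\,dy .$$ Define $$\mathcal M^x(t,s)f(x)=\big(x+\mathbf m(t,s)+\mathbf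 C(t,s)\partial_x\big)f(x)+\int_t^s\!\int\big(f(x+z)-f(x)\big)z\,\nu_0(r,dz)\,dr ,$$ let $\mathcal G^x_n(t,s)=\mathcal A_n(s,\mathcal M^x(t,s))$ be obtained from $\mathcal A_n(s,x)$ by substituting $\mathcal M^x(t,s)$ for $x$ in the coefficients (its powers act to the left of the derivatives and jump integrals), and let $$\mathcal L^x_n(s_0,T)=\sum_{r=1}^n\int_{s_0}^Tds_1\int_{s_1}^Tds_2\cdots\int_{s_{r-1}}^Tds_r\sum_{i\in I_{n,r}}\mathcal G^x_{i_1}(s_0,s_1)\cdots\mathcal G^x_{i_r}(s_0,s_r),\qquad I_{n,r}=\{i\in\mathbb N^r: i_1+\dots+i_r=n\},\ \mathbb N=\{1,2,\dots\}.$$ **Data and solutions.** Let $c\in\mathbb R$ be such that $\int_{|z|\ge1}|z|^ke^{cz}\,\bar\nu^\pm_{n,m}(dz)<\infty$ for all $k\in\mathbb N_0$, $n\le N$, $m\le M_n$ (this is automatic if $0<c<1$), and let $h$ be measurable with $\int|h(x)|e^{-cx}(1+|x|)^{-K}dx<\infty$ for some $K\in\mathbb N_0$. Call a smooth function *$c$-tame*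 if each of its derivatives is $O((1+|x|)^Ke^{cx})$ for some $K$. A solution of the nested Cauchy problems is a family $(u_n)_{0\le n\le N}$ of functions on $[0,T)\times\mathbb R$ such that * $u_n(t,\cdot)\in C^2$, and for each $\tau<T$, $j\le 2$ there are $C,K$ with $|\partial_x^ju_n(t,x)|\le C(1+|x|)^Ke^{cx}$ for $t\le\tau$, $x\in\mathbb R$; * for every $x$, $u_n(\cdot,x)$ is absolutely continuous on $[0,\tau]$ for every $\tau<T$, and for a.e. $t\in[0,T)$ $$(\partial_t+\mathcal A_0)u_n(t,x)=-\sum_{k=1}^n\mathcal A_k(t,x)u_{n-k}(t,x);$$ * $u_0(T,\cdot)=h$ and $u_n(T,\cdot)=0$ for $n\ge1$, in the sense that for some $K$, $\int|u_n(t,x)-u_n(T,x)|\,e^{-cx}(1+|x|)^{-K}dx\to0$ as $t\to T^-$. **Theorem.** With $u_0$ given by the formula above: 1. For $t\in[0,T)$, $x\in\mathbb R$, the integral defining $u_0(t,x)$ converges absolutely and $u_0(t,\cdot)$ is $c$-tame; for $1\le r\le n\le N$ and $i\in I_{n,r}$, the function $\mathcal G^x_{i_1}(t,s_1)\cdots\mathcal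 G^x_{i_r}(t,s_r)u_0(t,\cdot)$ is $c$-tame for all $t\le s_1\le\dots\le s_r\le T$, and its value at $x$ is integrable in $(s_1,\dots,s_r)$ over this simplex. So $\mathcal L^x_n(t,T)u_0(t,x)$ is well defined. 2. Every solution of the nested Cauchy problems has $u_0$ as its $0$-th term and satisfies $$u_n(t,x)=\mathcal L^x_n(t,T)\,u_0(t,x),\qquad 0\le t<T,\ x\in\mathbb R,\ 1\le n\le N .$$ 3. If $h$ is $c$-tame, then $u_0$ and $u_n:=\mathcal L^x_n(t,T)u_0$, $1\le n\le N$, are a solution of the nested Cauchy problems, and moreover $u_0(t,x)\to h(x)$ and $u_n(t,x)\to0$ as $t\to T^-$ for every $x\in\mathbb R$. -/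

import Mathlib

open MeasureTheory ProbabilityTheory Filter Topology
open scoped ContDiff

noncomputable section

/-- The two integrability conditions on a Lévy-type measure:
`∫ min(|z|, z²) ν(dz) < ∞` and `∫_{|z| ≥ 1} e^z ν(dz) < ∞`. -/
def LevyCondition (ν : Measure ℝ) : Prop :=
  Integrable (fun z : ℝ => min |z| (z ^ 2)) ν ∧
    IntegrableOn (fun z : ℝ => Real.exp z) {z : ℝ | 1 ≤ |z|} ν

/-- The measure `sup_{0 ≤ t ≤ T} κ(t, dz)`, the least measure that dominates `κ(t, dz)` for every
`t ∈ [0, T]`. -/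
def supMeasure (T : ℝ) (κ : Kernel ℝ ℝ) : Measure ℝ := ⨆ t ∈ Set.Icc (0 : ℝ) T, κ t

/-- The coefficients of an `N`-th order polynomial expansion on the time interval `[0, T]`.
`a n t` and `γ n t` are the polynomials `a_n(t, ·)` and `γ_n(t, ·)`, and
`ν_n(t, x, dz) = ∑_{m = 0}^{M_n} x^m ν_{n,m}(t, dz)`, where the signed (possibly infinite near `0`)
measure `ν_{n,m}(t, dz)` is given as the difference of the two nonnegative kernels
`νp n m t` and `νm n m t`. -/
structure PolynomialExpansion (N : ℕ) (T : ℝ) where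
  a : ℕ → ℝ → Polynomial ℝ
  γ : ℕ → ℝ → Polynomial ℝ
  M : ℕ → ℕ
  νp : ℕ → ℕ → Kernel ℝ ℝ
  νm : ℕ → ℕ → Kernel ℝ ℝ
  a_degree : ∀ n ≤ N, ∃ d : ℕ, ∀ t ∈ Set.Icc (0 : ℝ) T, (a n t).natDegree ≤ d
  γ_degree : ∀ n ≤ N, ∃ d : ℕ, ∀ t ∈ Set.Icc (0 : ℝ) T, (γ n t).natDegree ≤ d
  a_bounded : ∀ n ≤ N, ∀ x : ℝ,
    MemLp (fun t => (a n t).eval x) ⊤ (volume.restrict (Set.Icc (0 : ℝ) T))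
  γ_bounded : ∀ n ≤ N, ∀ x : ℝ,
    MemLp (fun t => (γ n t).eval x) ⊤ (volume.restrict (Set.Icc (0 : ℝ) T))
  a_zero : ∀ t ∈ Set.Icc (0 : ℝ) T, (a 0 t).natDegree = 0
  γ_zero : ∀ t ∈ Set.Icc (0 : ℝ) T, (γ 0 t).natDegree = 0
  νp_levy : ∀ n ≤ N, ∀ m ≤ M n, LevyCondition (supMeasure T (νp n m))
  νm_levy : ∀ n ≤ N, ∀ m ≤ M n, LevyCondition (supMeasure T (νm n m))
  M_zero : M 0 = 0
  ν_zero_nonneg : ∀ t ∈ Set.Icc (0 : ℝ) T, νm 0 0 t = 0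
  ν_zero_exp : ∃ l : ℝ, 0 < l ∧ ∀ t ∈ Set.Icc (0 : ℝ) T,
    IntegrableOn (fun z : ℝ => Real.exp (l * |z|)) {z : ℝ | 1 ≤ |z|} (νp 0 0 t)

namespace PolynomialExpansion

variable {N : ℕ} {T : ℝ}

/-- `a_0(t)`, the value of the constant polynomial `a_0(t, ·)`. -/
def a₀ (E : PolynomialExpansion N T) (t : ℝ) : ℝ := (E.a 0 t).eval 0

/-- `γ_0(t)`, the value of the constant polynomial `γ_0(t, ·)`. -/
def γ₀ (E : PolynomialExpansion N T) (t : ℝ) : ℝ := (E.γ 0 t).eval 0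

/-- `ν_0(t, dz)`, a nonnegative measure. -/
def ν₀ (E : PolynomialExpansion N T) (t : ℝ) : Measure ℝ := E.νp 0 0 t

/-- `∫ g(z) ν_{n,m}(t, dz)`. -/
def levyInt (E : PolynomialExpansion N T) (n m : ℕ) (t : ℝ) (g : ℝ → ℝ) : ℝ :=
  (∫ z, g z ∂(E.νp n m t)) - ∫ z, g z ∂(E.νm n m t)

/-- The operator `𝒜_n(t, x)` applied to `f` at the point `x`. -/
def A (E : PolynomialExpansion N T) (n : ℕ) (t : ℝ) (f : ℝ → ℝ) (x : ℝ) : ℝ :=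
  (E.a n t).eval x * (deriv (deriv f) x - deriv f x)
    + (E.γ n t).eval x * (deriv f x - f x)
    + ∑ m ∈ Finset.range (E.M n + 1), x ^ m *
        (-(E.levyInt n m t (fun z => Real.exp z - 1 - z)) * deriv f x
          + E.levyInt n m t (fun z => f (x + z) - f x - z * deriv f x))

/-- `𝐦(t, s) = ∫_t^s (γ_0(r) - a_0(r) - ∫ (e^z - 1 - z) ν_0(r, dz)) dr`. -/
def mV (E : PolynomialExpansion N T) (t s : ℝ) : ℝ :=
  ∫ r in t..s, (E.γ₀ r - E.a₀ r - ∫ z, (Real.exp z - 1 - z) ∂(E.ν₀ r))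

/-- `𝐂(t, s) = ∫_t^s 2 a_0(r) dr`. -/
def CV (E : PolynomialExpansion N T) (t s : ℝ) : ℝ := ∫ r in t..s, 2 * E.a₀ r

/-- `Ψ(t, s, ξ) = ∫_t^s ∫ (e^{izξ} - 1 - izξ) ν_0(r, dz) dr`. -/
def PsiV (E : PolynomialExpansion N T) (t s ξ : ℝ) : ℂ :=
  ∫ r in t..s, ∫ z : ℝ, (Complex.exp (Complex.I * z * ξ) - 1 - Complex.I * z * ξ) ∂(E.ν₀ r)

/-- `Φ_0(t, s, ξ) = iξ 𝐦(t, s) - 𝐂(t, s) ξ² / 2 + Ψ(t, s, ξ) - ∫_t^s γ_0(r) dr`. -/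
def Phi₀ (E : PolynomialExpansion N T) (t s ξ : ℝ) : ℂ :=
  Complex.I * ξ * (E.mV t s : ℂ) - (1 / 2) * (E.CV t s : ℂ) * (ξ : ℂ) ^ 2 + E.PsiV t s ξ
    - ((∫ r in t..s, E.γ₀ r : ℝ) : ℂ)

/-- `p̂_0(t, x; s, ξ) = exp(iξx + Φ_0(t, s, ξ))`. -/
def p₀hat (E : PolynomialExpansion N T) (t x s ξ : ℝ) : ℂ :=
  Complex.exp (Complex.I * ξ * x + E.Phi₀ t s ξ)

/-- `p_0(t, x; s, y) = (2π)⁻¹ ∫ e^{-iyξ} p̂_0(t, x; s, ξ) dξ`. The integral is a real number because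
`p̂_0(t, x; s, -ξ)` is the complex conjugate of `p̂_0(t, x; s, ξ)`. -/
def p₀ (E : PolynomialExpansion N T) (t x s y : ℝ) : ℝ :=
  ((1 / (2 * Real.pi) : ℂ) * ∫ ξ : ℝ, Complex.exp (-Complex.I * y * ξ) * E.p₀hat t x s ξ).re

/-- `u_0(t, x) = ∫ p_0(t, x; T, y) h(y) dy`. -/
def u₀ (E : PolynomialExpansion N T) (h : ℝ → ℝ) (t x : ℝ) : ℝ := ∫ y, E.p₀ t x T y * h y

/-- The operator `ℳ^x(t, s)`. -/
def opM (E : PolynomialExpansion N T) (t s : ℝ) (f : ℝ → ℝ) (x : ℝ) : ℝ :=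
  (x + E.mV t s) * f x + E.CV t s * deriv f x
    + ∫ r in t..s, ∫ z, (f (x + z) - f x) * z ∂(E.ν₀ r)

/-- The operator `𝒢_n^x(t, s) = 𝒜_n(s, ℳ^x(t, s))`: the variable `x` in the coefficients of
`𝒜_n(s, x)` is replaced by `ℳ^x(t, s)`, which acts after the translation invariant operators. -/
def opG (E : PolynomialExpansion N T) (n : ℕ) (t s : ℝ) (f : ℝ → ℝ) (x : ℝ) : ℝ :=
  ((E.a n s).sum fun k q =>
      q * ((E.opM t s)^[k] (fun y => deriv (deriv f) y - deriv f y)) x)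
    + ((E.γ n s).sum fun k q => q * ((E.opM t s)^[k] (fun y => deriv f y - f y)) x)
    - (∑ k ∈ Finset.range (E.M n + 1), ((E.opM t s)^[k]
        (fun y => E.levyInt n k s (fun z => Real.exp z - 1 - z) * deriv f y)) x)
    + ∑ k ∈ Finset.range (E.M n + 1), ((E.opM t s)^[k]
        (fun y => E.levyInt n k s (fun z => f (y + z) - f y - z * deriv f y))) x

/-- The composition `𝒢_{i_1}(t, s_1) ⋯ 𝒢_{i_r}(t, s_r)` (the operator on the right acts first). -/
def prodG (E : PolynomialExpansion N T) (t : ℝ) :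
    (r : ℕ) → (Fin r → ℕ) → (Fin r → ℝ) → (ℝ → ℝ) → (ℝ → ℝ)
  | 0, _, _, f => f
  | r + 1, i, s, f => E.opG (i 0) t (s 0) (prodG E t r (Fin.tail i) (Fin.tail s) f)

end PolynomialExpansion

/-- `I_{n,r}`: the `r`-tuples of positive integers with sum `n`. -/
def indexSet (n r : ℕ) : Finset (Fin r → ℕ) :=
  (Finset.Nat.antidiagonalTuple r n).filter fun i => ∀ j, 1 ≤ i j

/-- `∫_s^T ds_1 ∫_{s_1}^T ds_2 ⋯ ∫_{s_{r-1}}^T ds_r g(s_1, …, s_r)`. -/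
def iterInt (T : ℝ) : (r : ℕ) → ℝ → ((Fin r → ℝ) → ℝ) → ℝ
  | 0, _, g => g Fin.elim0
  | r + 1, s, g => ∫ s₁ in s..T, iterInt T r s₁ (fun v => g (Fin.cons s₁ v))

/-- The domain of integration `t ≤ s_1 ≤ ⋯ ≤ s_r ≤ T`. -/
def timeSimplex (t T : ℝ) (r : ℕ) : Set (Fin r → ℝ) :=
  {s | (∀ j, s j ∈ Set.Icc t T) ∧ Monotone s}

/-- The operator `ℒ_n^x(t, T)` applied to `f` at the point `x`. -/
def PolynomialExpansion.opL {N : ℕ} {T : ℝ} (E : PolynomialExpansion N T) (n : ℕ) (t : ℝ)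
    (f : ℝ → ℝ) (x : ℝ) : ℝ :=
  ∑ r ∈ Finset.Icc 1 n, iterInt T r t (fun s => ∑ i ∈ indexSet n r, E.prodG t r i s f x)

/-- The growth `|f(t, x)| ≤ C (1 + |x|)^K e^{cx}`, uniformly for `t ∈ S`. -/
def HasGrowth (c : ℝ) (S : Set ℝ) (f : ℝ → ℝ → ℝ) : Prop :=
  ∃ (C : ℝ) (K : ℕ), ∀ t ∈ S, ∀ x : ℝ, |f t x| ≤ C * (1 + |x|) ^ K * Real.exp (c * x)

/-- `f` is smooth and each of its derivatives is `O((1 + |x|)^K e^{cx})` for some `K`. -/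
def SmoothGrowth (c : ℝ) (f : ℝ → ℝ) : Prop :=
  ContDiff ℝ ∞ f ∧ ∀ j : ℕ, ∃ (C : ℝ) (K : ℕ), ∀ x : ℝ,
    |iteratedDeriv j f x| ≤ C * (1 + |x|) ^ K * Real.exp (c * x)

/-- All the measures `|ν_{n,m}|` have finite moments of every order with respect to the weight
`e^{cz}`, away from the origin. -/
def PolynomialExpansion.ExpMoments {N : ℕ} {T : ℝ} (E : PolynomialExpansion N T) (c : ℝ) : Prop :=
  ∀ n ≤ N, ∀ m ≤ E.M n, ∀ k : ℕ,
    IntegrableOn (fun z : ℝ => |z| ^ k * Real.exp (c * z)) {z : ℝ | 1 ≤ |z|}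
      (supMeasure T (E.νp n m)) ∧
    IntegrableOn (fun z : ℝ => |z| ^ k * Real.exp (c * z)) {z : ℝ | 1 ≤ |z|}
      (supMeasure T (E.νm n m))

/-- `(u_n)_{0 ≤ n ≤ N}` solves the nested Cauchy problems
`(∂_t + 𝒜_0) u_n = - ∑_{k=1}^n 𝒜_k u_{n-k}` on `[0, T) × ℝ`, with `u_0(T, ·) = h` and
`u_n(T, ·) = 0` for `n ≥ 1`. As the coefficients are only bounded and measurable in time, `u_n` is
locally absolutely continuous in `t` and the equation holds for almost every `t`; the solutions have
growth `(1 + |x|)^K e^{cx}`, and the terminal value, which may be discontinuous, is attained in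
`L¹` with the weight `(1 + |x|)^{-K} e^{-cx}` for some `K`. -/
structure IsNestedSolution {N : ℕ} {T : ℝ} (E : PolynomialExpansion N T) (c : ℝ) (h : ℝ → ℝ)
    (u : ℕ → ℝ → ℝ → ℝ) : Prop where
  contDiff : ∀ n ≤ N, ∀ t ∈ Set.Ico (0 : ℝ) T, ContDiff ℝ 2 (u n t)
  growth : ∀ n ≤ N, ∀ τ ∈ Set.Ico (0 : ℝ) T, ∀ j ≤ 2,
    HasGrowth c (Set.Icc 0 τ) (fun t => iteratedDeriv j (u n t))
  absCont : ∀ n ≤ N, ∀ τ ∈ Set.Ico (0 : ℝ) T, ∀ x : ℝ,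
    AbsolutelyContinuousOnInterval (fun t => u n t x) 0 τ
  equation : ∀ n ≤ N, ∀ x : ℝ, ∀ᵐ t ∂(volume.restrict (Set.Ico (0 : ℝ) T)),
    deriv (fun s => u n s x) t + E.A 0 t (u n t) x
      = -∑ k ∈ Finset.Icc 1 n, E.A k t (u (n - k) t) x
  terminal : ∀ n ≤ N, ∃ K : ℕ,
    Tendsto (fun t => ∫⁻ x : ℝ, ENNReal.ofReal
        (|u n t x - (if n = 0 then h x else 0)| * Real.exp (-(c * x)) / (1 + |x|) ^ K))
      (𝓝[<] T) (𝓝 0)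

end

/-! Why the expansion solves the nested Cauchy problems, and why nothing else does.

*Reduction.* Finitely many jump measures occur, so they have a common Lévy weight `w`
(`exists_isLevyWeight`). After division by it every jump operator is an average over a finite kernel,
and polynomials in `x`, derivatives, jump operators and time integrals all act on families of functions
that are `c`-tame uniformly in a parameter (`TameFamily`, `IsTameOp`). `ReducedData` records such a
representation of the given expansion, with bounded coefficients measurable in time.

*Algebra.* Let `μ(r)` be the commutator of `𝒜₀(r)` with multiplication by `x`; it is the time
derivative of `ℳ(t, s) = x + ∫_t^s μ(r) dr`, and it commutes with `𝒜₀`. Hence `t ↦ ℳ(t, s)` maps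
solutions of the homogeneous equation `(∂_t + 𝒜₀) F = 0` to solutions, and so does `t ↦ 𝒢_n(t, s)`
(`ExpansionOps.solves_opG`), while `𝒢_n(t, t) = 𝒜_n(t)`. Now let the lower limit `a` of the iterated
integrals be separate from the time `t` at which the operators are taken. For fixed `a`, the expansion
`ℒ_n` maps homogeneous solutions to homogeneous solutions (`ExpansionOps.solves_opL`); on the diagonal
`a = t`, Duhamel's principle (`Solves.duhamel`) produces exactly the source
`∑_k 𝒜_k u_{n-k}` (`ExpansionOps.solves_opL_diag`).

*The zeroth order.* On the line `Re ζ = c` the evolution of `𝒜₀` has the symbol `exp λ(t, s, ζ)`. As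
`a₀ > 0` almost everywhere it has Gaussian decay when `t < s`, so that its kernel decays rapidly,
together with all derivatives (`rapidSymbol_evSym`). A shift of the contour from the imaginary axis
(`symKernel_zero_eq`) identifies this kernel with `p₀` (`p₀_eq`), whence `u₀` is tame and solves the
homogeneous equation before `T` (`tameFamily_u₀`, `solves_u₀`).

*Uniqueness.* The kernel started at `(t, x)`, multiplied on the side of the symbol by `exp (-e ξ²)` so
that it also decays rapidly at the time `t` itself, is paired with a solution of the homogeneous
equation. The pairing is constant in time (`integral_evKer_mul_eq`). Its limit as the time tends to `T`
is given by the terminal condition, and as `e → 0` the pairing at time `t` tends to the value of the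
solution at `x` (`tendsto_integral_evKer_self`). This gives `u₀`. For `n ≥ 1` the difference of a
solution and `ℒ_n u₀` is homogeneous; the terminal value of `ℒ_n u₀` enters through `ℒ_n` with lower
limit `a` applied to the fixed function `u₀(t, ·)`, which vanishes as `a → T`
(`ExpansionOps.opL_bound`), see `IsNestedSolution.eq_opL`.

*Existence.* For smooth data two derivatives move from the kernel to the data, and the symbol gains the
factor `(1 + iξ)⁻²`. The products are integrable with all their derivatives, uniformly up to `T`
(`symFamily_evSym_mul`): the first derivative of the exponent is bounded by the square root of its
damping, and the further ones are bounded. So `u₀` is tame uniformly up to `T` (`tameFamily_u₀Ext`),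
and the algebra above applies on all of `[0, T]` (`ReducedData.isNestedSolution`). -/


open scoped NNReal ENNReal

/-! ### Tame families -/

/-- The weight `(1 + |x|)^K e^{cx}`. -/
noncomputable def expWeight (c : ℝ) (K : ℕ) (x : ℝ) : ℝ := (1 + |x|) ^ K * Real.exp (c * x)

theorem expWeight_pos (c : ℝ) (K : ℕ) (x : ℝ) : 0 < expWeight c K x := by
  unfold expWeight; positivity

theorem expWeight_nonneg (c : ℝ) (K : ℕ) (x : ℝ) : 0 ≤ expWeight c K x :=
  (expWeight_pos c K x).le

theorem expWeight_mono (c : ℝ) {K L : ℕ} (h : K ≤ L) (x : ℝ) :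
    expWeight c K x ≤ expWeight c L x := by
  unfold expWeight
  gcongr
  linarith [abs_nonneg x]

theorem expWeight_add_le (c : ℝ) (K : ℕ) (x z : ℝ) :
    expWeight c K (x + z) ≤ expWeight c K x * expWeight c K z := by
  unfold expWeight
  have h : (1 + |x + z|) ≤ (1 + |x|) * (1 + |z|) := by
    nlinarith [abs_add_le x z, mul_nonneg (abs_nonneg x) (abs_nonneg z)]
  calc (1 + |x + z|) ^ K * Real.exp (c * (x + z))
      ≤ ((1 + |x|) * (1 + |z|)) ^ K * Real.exp (c * (x + z)) := by gcongr
    _ = _ := by rw [mul_pow, mul_add, Real.exp_add]; ring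

theorem abs_mul_expWeight_le (c : ℝ) (K : ℕ) (x : ℝ) :
    |x| * expWeight c K x ≤ expWeight c (K + 1) x := by
  unfold expWeight
  rw [pow_succ]
  have : 0 ≤ (1 + |x|) ^ K * Real.exp (c * x) := by positivity
  nlinarith

theorem continuous_expWeight (c : ℝ) (K : ℕ) : Continuous (expWeight c K) := by
  unfold expWeight; fun_prop

/-- A measurable family of smooth functions each of whose derivatives is
`O((1 + |x|)^K e^{cx})`, uniformly in the parameter. -/
structure TameFamily (c : ℝ) {Q : Type} [MeasurableSpace Q] (F : Q → ℝ → ℝ) : Prop where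
  contDiff : ∀ q, ContDiff ℝ ∞ (F q)
  bound : ∀ j : ℕ, ∃ (C : ℝ) (K : ℕ), 0 ≤ C ∧
    ∀ q x, |iteratedDeriv j (F q) x| ≤ C * expWeight c K x
  meas : ∀ x, Measurable fun q => F q x

theorem iteratedDeriv_eq_of_ladder {G : ℕ → ℝ → ℝ}
    (hG : ∀ j x, HasDerivAt (G j) (G (j + 1) x) x) (j : ℕ) : iteratedDeriv j (G 0) = G j := by
  induction j with
  | zero => simp
  | succ j ih => rw [iteratedDeriv_succ, ih]; ext x; exact (hG j x).deriv

theorem contDiff_of_ladder {G : ℕ → ℝ → ℝ}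
    (hG : ∀ j x, HasDerivAt (G j) (G (j + 1) x) x) : ContDiff ℝ ∞ (G 0) := by
  refine contDiff_of_differentiable_iteratedDeriv fun m _ => ?_
  rw [iteratedDeriv_eq_of_ladder hG]
  exact fun x => (hG m x).differentiableAt

theorem hasDerivAt_iteratedDeriv {f : ℝ → ℝ} (hf : ContDiff ℝ ∞ f) (j : ℕ) (x : ℝ) :
    HasDerivAt (iteratedDeriv j f) (iteratedDeriv (j + 1) f x) x := by
  rw [iteratedDeriv_succ]
  exact ((hf.differentiable_iteratedDeriv j (by exact_mod_cast WithTop.coe_lt_top _)) x).hasDerivAt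

theorem measurable_deriv_of_differentiable {Q : Type*} [MeasurableSpace Q] {F : Q → ℝ → ℝ}
    (hF : ∀ q, Differentiable ℝ (F q)) (hm : ∀ x, Measurable fun q => F q x) (x : ℝ) :
    Measurable fun q => deriv (F q) x := by
  have key : ∀ q, Tendsto (fun n : ℕ => ((n : ℝ) + 1) * (F q (x + 1 / ((n : ℝ) + 1)) - F q x))
      atTop (𝓝 (deriv (F q) x)) := by
    intro q
    have h1 := (hF q x).hasDerivAt.tendsto_slope_zero_right
    have h2 : Tendsto (fun n : ℕ => 1 / ((n : ℝ) + 1)) atTop (𝓝[>] 0) :=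
      tendsto_nhdsWithin_iff.2 ⟨tendsto_one_div_add_atTop_nhds_zero_nat,
        Eventually.of_forall fun n => by simp only [Set.mem_Ioi]; positivity⟩
    refine (h1.comp h2).congr fun n => ?_
    simp
  refine measurable_of_tendsto_metrizable (f := fun (n : ℕ) q =>
    ((n : ℝ) + 1) * (F q (x + 1 / ((n : ℝ) + 1)) - F q x)) (fun n => ?_)
    (tendsto_pi_nhds.2 key)
  exact ((hm _).sub (hm _)).const_mul _

namespace TameFamily

variable {c : ℝ} {P Q : Type} [MeasurableSpace P] [MeasurableSpace Q]

/-- A family is tame as soon as it is the bottom of a sequence of families, each the derivative of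
the one before, with the required bounds. -/
theorem of_ladder {G : ℕ → Q → ℝ → ℝ} (hG : ∀ j q x, HasDerivAt (G j q) (G (j + 1) q x) x)
    (hb : ∀ j, ∃ (C : ℝ) (K : ℕ), ∀ q x, |G j q x| ≤ C * expWeight c K x)
    (hm : ∀ x, Measurable fun q => G 0 q x) : TameFamily c (G 0) := by
  refine ⟨fun q => contDiff_of_ladder (G := fun j => G j q) fun j x => hG j q x, fun j => ?_, hm⟩
  obtain ⟨C, K, h⟩ := hb j
  refine ⟨|C|, K, abs_nonneg C, fun q x => ?_⟩
  rw [iteratedDeriv_eq_of_ladder (G := fun j => G j q) (fun j x => hG j q x) j]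
  exact (h q x).trans (mul_le_mul_of_nonneg_right (le_abs_self C) (expWeight_nonneg c K x))

theorem const {f : ℝ → ℝ} (hf : SmoothGrowth c f) : TameFamily c fun _ : Q => f := by
  refine ⟨fun _ => hf.1, fun j => ?_, fun x => measurable_const⟩
  obtain ⟨C, K, h⟩ := hf.2 j
  refine ⟨|C|, K, abs_nonneg C, fun _ x => (h x).trans ?_⟩
  rw [mul_assoc]
  exact mul_le_mul_of_nonneg_right (le_abs_self C) (expWeight_nonneg c K x)

variable {F G : Q → ℝ → ℝ}

theorem smoothGrowth (hF : TameFamily c F) (q : Q) : SmoothGrowth c (F q) := by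
  refine ⟨hF.contDiff q, fun j => ?_⟩
  obtain ⟨C, K, -, h⟩ := hF.bound j
  exact ⟨C, K, fun x => (h q x).trans_eq (by rw [expWeight, mul_assoc])⟩

theorem comp (hF : TameFamily c F) {φ : P → Q} (hφ : Measurable φ) :
    TameFamily c fun p => F (φ p) :=
  ⟨fun p => hF.contDiff _, fun j => by
    obtain ⟨C, K, hC, h⟩ := hF.bound j
    exact ⟨C, K, hC, fun p x => h _ x⟩, fun x => (hF.meas x).comp hφ⟩

theorem hasDerivAt_iteratedDeriv (hF : TameFamily c F) (j : ℕ) (q : Q) (x : ℝ) :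
    HasDerivAt (iteratedDeriv j (F q)) (iteratedDeriv (j + 1) (F q) x) x :=
  _root_.hasDerivAt_iteratedDeriv (hF.contDiff q) j x

theorem continuous (hF : TameFamily c F) (q : Q) : Continuous (F q) := (hF.contDiff q).continuous

theorem measurable_deriv (hF : TameFamily c F) (x : ℝ) :
    Measurable fun q => _root_.deriv (F q) x :=
  measurable_deriv_of_differentiable
    (fun q => (hF.contDiff q).differentiable (by simp)) hF.meas x

theorem deriv (hF : TameFamily c F) : TameFamily c fun q => _root_.deriv (F q) := by
  refine ⟨fun q => ?_, fun j => ?_, hF.measurable_deriv⟩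
  · exact (contDiff_infty_iff_deriv.1 (hF.contDiff q)).2
  · obtain ⟨C, K, hC, h⟩ := hF.bound (j + 1)
    exact ⟨C, K, hC, fun q x => by rw [← iteratedDeriv_succ']; exact h q x⟩

theorem iteratedDeriv (hF : TameFamily c F) (j : ℕ) :
    TameFamily c fun q => _root_.iteratedDeriv j (F q) := by
  induction j with
  | zero => simpa using hF
  | succ j ih => simpa only [iteratedDeriv_succ] using ih.deriv

theorem measurable_uncurry (hF : TameFamily c F) : Measurable fun p : Q × ℝ => F p.1 p.2 := by
  have := measurable_uncurry_of_continuous_of_measurable (u := fun x q => F q x)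
    (fun q => hF.continuous q) hF.meas
  exact this.comp measurable_swap

theorem bound_zero (hF : TameFamily c F) :
    ∃ (C : ℝ) (K : ℕ), 0 ≤ C ∧ ∀ q x, |F q x| ≤ C * expWeight c K x := by
  simpa using hF.bound 0

theorem add (hF : TameFamily c F) (hG : TameFamily c G) :
    TameFamily c fun q x => F q x + G q x := by
  refine of_ladder (G := fun j q x => _root_.iteratedDeriv j (F q) x +
    _root_.iteratedDeriv j (G q) x) (fun j q x => (hF.hasDerivAt_iteratedDeriv j q x).add
    (hG.hasDerivAt_iteratedDeriv j q x)) (fun j => ?_)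
    (fun x => by simp only [iteratedDeriv_zero]; exact (hF.meas x).add (hG.meas x))
  obtain ⟨C, K, hC, h⟩ := hF.bound j
  obtain ⟨C', K', hC', h'⟩ := hG.bound j
  refine ⟨C + C', max K K', fun q x => (abs_add_le _ _).trans ?_⟩
  rw [add_mul]
  exact add_le_add
    ((h q x).trans (mul_le_mul_of_nonneg_left (expWeight_mono c (le_max_left _ _) x) hC))
    ((h' q x).trans (mul_le_mul_of_nonneg_left (expWeight_mono c (le_max_right _ _) x) hC'))

theorem smul (hF : TameFamily c F) {a : Q → ℝ} (ha : Measurable a) {A : ℝ} (hA : ∀ q, |a q| ≤ A) :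
    TameFamily c fun q x => a q * F q x := by
  refine of_ladder (G := fun j q x => a q * _root_.iteratedDeriv j (F q) x)
    (fun j q x => (hF.hasDerivAt_iteratedDeriv j q x).const_mul _) (fun j => ?_)
    (fun x => by simp only [iteratedDeriv_zero]; exact ha.mul (hF.meas x))
  obtain ⟨C, K, hC, h⟩ := hF.bound j
  refine ⟨A * C, K, fun q x => ?_⟩
  rw [abs_mul, mul_assoc]
  exact mul_le_mul (hA q) (h q x) (abs_nonneg _) ((abs_nonneg _).trans (hA q))

theorem const_mul (hF : TameFamily c F) (a : ℝ) : TameFamily c fun q x => a * F q x :=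
  hF.smul measurable_const fun _ => le_rfl

theorem neg (hF : TameFamily c F) : TameFamily c fun q x => -F q x := by
  simpa using hF.const_mul (-1)

theorem sub (hF : TameFamily c F) (hG : TameFamily c G) :
    TameFamily c fun q x => F q x - G q x := by
  simpa [sub_eq_add_neg] using hF.add hG.neg

theorem zero : TameFamily c fun (_ : Q) (_ : ℝ) => (0 : ℝ) :=
  of_ladder (G := fun _ _ _ => 0) (fun _ _ x => hasDerivAt_const x 0)
    (fun _ => ⟨0, 0, by simp⟩) (fun _ => measurable_const)

theorem sum {ι : Type*} (s : Finset ι) {F : ι → Q → ℝ → ℝ} (hF : ∀ i ∈ s, TameFamily c (F i)) :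
    TameFamily c fun q x => ∑ i ∈ s, F i q x := by
  classical
  induction s using Finset.induction_on with
  | empty => simpa using zero
  | insert i s hi ih =>
    simp only [Finset.sum_insert hi]
    exact (hF i (Finset.mem_insert_self _ _)).add
      (ih fun j hj => hF j (Finset.mem_insert_of_mem hj))

theorem mulX (hF : TameFamily c F) : TameFamily c fun q x => x * F q x := by
  have := of_ladder (c := c) (G := fun j q x => x * _root_.iteratedDeriv j (F q) x +
    j * _root_.iteratedDeriv (j - 1) (F q) x) (fun j q x => ?_) (fun j => ?_)
    (fun x => by simpa using (hF.meas x).const_mul x)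
  · simpa using this
  · have h1 := (hasDerivAt_id x).mul (hF.hasDerivAt_iteratedDeriv j q x)
    rcases j with _ | j
    · refine (h1.add_const 0).congr_deriv ?_ |>.congr_of_eventuallyEq ?_
      · simp; ring
      · exact Eventually.of_forall fun y => by simp
    · refine (h1.add ((hF.hasDerivAt_iteratedDeriv j q x).const_mul ((j : ℝ) + 1))).congr_deriv ?_
        |>.congr_of_eventuallyEq ?_
      · simp; ring
      · exact Eventually.of_forall fun y => by simp
  · obtain ⟨C, K, hC, h⟩ := hF.bound j
    obtain ⟨C', K', hC', h'⟩ := hF.bound (j - 1)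
    refine ⟨C + j * C', max (K + 1) K', fun q x => (abs_add_le _ _).trans ?_⟩
    rw [add_mul, abs_mul, abs_mul, Nat.abs_cast, mul_assoc]
    refine add_le_add ?_ (mul_le_mul_of_nonneg_left ?_ (Nat.cast_nonneg j))
    · calc |x| * |_root_.iteratedDeriv j (F q) x| ≤ |x| * (C * expWeight c K x) := by
            gcongr; exact h q x
        _ = C * (|x| * expWeight c K x) := by ring
        _ ≤ C * expWeight c (max (K + 1) K') x := by
            gcongr
            exact (abs_mul_expWeight_le c K x).trans (expWeight_mono c (le_max_left _ _) x)
    · exact (h' q x).trans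
        (mul_le_mul_of_nonneg_left (expWeight_mono c (le_max_right _ _) x) hC')

theorem integrable (hF : TameFamily c F) (μ : Measure Q) [IsFiniteMeasure μ] (x : ℝ) :
    Integrable (fun q => F q x) μ := by
  obtain ⟨C, K, hC, h⟩ := hF.bound_zero
  exact Integrable.of_bound (hF.meas x).aestronglyMeasurable (C * expWeight c K x)
    (Eventually.of_forall fun q => h q x)

/-- Averages of a tame family over a finite kernel form a tame family. -/
theorem integral_kernel {F : P × Q → ℝ → ℝ} (hF : TameFamily c F) (κ : Kernel P Q)
    [IsFiniteKernel κ] : TameFamily c fun p x => ∫ q, F (p, q) x ∂(κ p) := by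
  have hsec : ∀ p, TameFamily c fun q => F (p, q) := fun p =>
    hF.comp (measurable_const.prodMk measurable_id)
  have := of_ladder (c := c)
    (G := fun j p x => ∫ q, _root_.iteratedDeriv j (F (p, q)) x ∂(κ p))
    (fun j p x => ?_) (fun j => ?_) (fun x => ?_)
  · simpa using this
  · obtain ⟨C, K, hC, h⟩ := hF.bound (j + 1)
    obtain ⟨M, hM⟩ := (isCompact_closedBall x 1).exists_bound_of_continuousOn
      (continuous_expWeight c K).continuousOn
    refine (hasDerivAt_integral_of_dominated_loc_of_deriv_le (s := Metric.ball x 1)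
      (F := fun y q => _root_.iteratedDeriv j (F (p, q)) y)
      (F' := fun y q => _root_.iteratedDeriv (j + 1) (F (p, q)) y)
      (bound := fun _ => C * M) (Metric.ball_mem_nhds x one_pos)
      (Eventually.of_forall fun y => (((hsec p).iteratedDeriv j).meas y).aestronglyMeasurable)
      (((hsec p).iteratedDeriv j).integrable _ x)
      ((((hsec p).iteratedDeriv (j + 1)).meas x).aestronglyMeasurable)
      (Eventually.of_forall fun q y hy => ?_) (integrable_const _)
      (Eventually.of_forall fun q y _ => hF.hasDerivAt_iteratedDeriv j (p, q) y)).2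
    rw [Real.norm_eq_abs]
    refine (h _ y).trans (mul_le_mul_of_nonneg_left ?_ hC)
    exact (le_abs_self _).trans (hM y (Metric.ball_subset_closedBall hy))
  · obtain ⟨C, K, hC, h⟩ := hF.bound j
    refine ⟨C * (κ.bound).toReal, K, fun p x => ?_⟩
    have h1 := norm_integral_le_of_norm_le_const (μ := κ p)
      (f := fun q => _root_.iteratedDeriv j (F (p, q)) x) (C := C * expWeight c K x)
      (Eventually.of_forall fun q => h _ x)
    rw [Real.norm_eq_abs] at h1
    refine h1.trans ?_
    have h2 : (κ p).real Set.univ ≤ (κ.bound).toReal :=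
      ENNReal.toReal_mono (κ.bound_lt_top).ne (κ.measure_le_bound p _)
    calc C * expWeight c K x * (κ p).real Set.univ ≤ C * expWeight c K x * (κ.bound).toReal :=
          mul_le_mul_of_nonneg_left h2 (mul_nonneg hC (expWeight_nonneg c K x))
      _ = _ := by ring
  · simp only [iteratedDeriv_zero]
    exact ((hF.meas x).stronglyMeasurable.integral_kernel_prod_right' (κ := κ)).measurable

theorem integral_prod {F : P × Q → ℝ → ℝ} (hF : TameFamily c F) (μ : Measure Q)
    [IsFiniteMeasure μ] : TameFamily c fun p x => ∫ q, F (p, q) x ∂μ := by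
  simpa using hF.integral_kernel (Kernel.const P μ)

theorem integral (hF : TameFamily c F) (μ : Measure Q) [IsFiniteMeasure μ] :
    SmoothGrowth c fun x => ∫ q, F q x ∂μ :=
  (integral_prod (P := Unit) (F := fun p => F p.2) (hF.comp measurable_snd) μ).smoothGrowth ()

/-- `x ↦ ∫_a^b F(r)(x) dr` as an integral over a fixed interval, for `F` supported there. -/
theorem _root_.intervalIntegral_eq_integral_sign {V : Type*} [NormedAddCommGroup V]
    [NormedSpace ℝ V] {T : ℝ} {g : ℝ → V} (hg : ∀ r, r ∉ Set.Icc 0 T → g r = 0) (a b : ℝ) :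
    ∫ r in a..b, g r = ∫ r in Set.Icc 0 T,
      ((Set.Ioc a b).indicator (fun _ => (1 : ℝ)) r - (Set.Ioc b a).indicator (fun _ => (1 : ℝ)) r)
        • g r := by
  have h0 : ∀ s : Set ℝ, MeasurableSet s → ∫ r in s, g r = ∫ r in Set.Icc 0 T,
      s.indicator (fun _ => (1 : ℝ)) r • g r := by
    intro s hs
    rw [← integral_indicator hs, ← integral_indicator measurableSet_Icc]
    congr 1 with r
    by_cases h : r ∈ Set.Icc 0 T <;> by_cases h' : r ∈ s <;> simp [h, h', hg]
  rcases le_total a b with hab | hab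
  · rw [intervalIntegral.integral_of_le hab, h0 _ measurableSet_Ioc]
    simp [Set.Ioc_eq_empty_of_le hab]
  · rw [intervalIntegral.integral_of_ge hab, h0 _ measurableSet_Ioc, ← integral_neg]
    simp [Set.Ioc_eq_empty_of_le hab]

theorem _root_.measurable_indicator_Ioc {a b e : P → ℝ} (ha : Measurable a) (hb : Measurable b)
    (he : Measurable e) :
    Measurable fun p => (Set.Ioc (a p) (b p)).indicator (fun _ => (1 : ℝ)) (e p) := by
  classical
  have : (fun p => (Set.Ioc (a p) (b p)).indicator (fun _ => (1 : ℝ)) (e p)) =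
      {p | a p < e p ∧ e p ≤ b p}.indicator fun _ => (1 : ℝ) := by
    ext p; simp [Set.indicator_apply]
  rw [this]
  exact measurable_const.indicator ((measurableSet_lt ha he).inter (measurableSet_le he hb))

theorem intervalIntegral {F : P × ℝ → ℝ → ℝ} (hF : TameFamily c F) {T : ℝ}
    (h0 : ∀ p r, r ∉ Set.Icc 0 T → ∀ x, F (p, r) x = 0) {a b : P → ℝ} (ha : Measurable a)
    (hb : Measurable b) : TameFamily c fun p x => ∫ r in a p..b p, F (p, r) x := by
  have := (hF.smul (a := fun p => (Set.Ioc (a p.1) (b p.1)).indicator (fun _ => (1 : ℝ)) p.2 -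
    (Set.Ioc (b p.1) (a p.1)).indicator (fun _ => (1 : ℝ)) p.2) (A := 2) ?_ ?_).integral_prod
      (volume.restrict (Set.Icc 0 T))
  · convert this using 3 with p x
    exact intervalIntegral_eq_integral_sign (fun r hr => h0 p r hr x) _ _
  · exact (measurable_indicator_Ioc (ha.comp measurable_fst) (hb.comp measurable_fst)
      measurable_snd).sub (measurable_indicator_Ioc (hb.comp measurable_fst)
      (ha.comp measurable_fst) measurable_snd)
  · intro p
    by_cases h : p.2 ∈ Set.Ioc (a p.1) (b p.1) <;> by_cases h' : p.2 ∈ Set.Ioc (b p.1) (a p.1) <;>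
      simp only [h, h', Set.indicator_of_mem, Set.indicator_of_notMem, not_false_eq_true] <;>
      norm_num

theorem intervalIntegrable {F : ℝ → ℝ → ℝ} (hF : TameFamily c F) (a b x : ℝ) :
    IntervalIntegrable (fun r => F r x) volume a b :=
  ⟨hF.integrable (volume.restrict (Set.Ioc a b)) x, hF.integrable (volume.restrict (Set.Ioc b a)) x⟩

end TameFamily

theorem SmoothGrowth.tame {c : ℝ} {f : ℝ → ℝ} (hf : SmoothGrowth c f) :
    TameFamily c fun _ : Unit => f := TameFamily.const hf

theorem SmoothGrowth.add {c : ℝ} {f g : ℝ → ℝ} (hf : SmoothGrowth c f) (hg : SmoothGrowth c g) :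
    SmoothGrowth c fun x => f x + g x := (hf.tame.add hg.tame).smoothGrowth ()

theorem SmoothGrowth.sub {c : ℝ} {f g : ℝ → ℝ} (hf : SmoothGrowth c f) (hg : SmoothGrowth c g) :
    SmoothGrowth c fun x => f x - g x := (hf.tame.sub hg.tame).smoothGrowth ()

theorem SmoothGrowth.const_mul {c : ℝ} {f : ℝ → ℝ} (hf : SmoothGrowth c f) (a : ℝ) :
    SmoothGrowth c fun x => a * f x := (hf.tame.const_mul a).smoothGrowth ()

theorem SmoothGrowth.deriv {c : ℝ} {f : ℝ → ℝ} (hf : SmoothGrowth c f) :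
    SmoothGrowth c (deriv f) := hf.tame.deriv.smoothGrowth ()

theorem SmoothGrowth.zero {c : ℝ} : SmoothGrowth c fun _ => 0 :=
  (TameFamily.zero (Q := Unit)).smoothGrowth ()

theorem SmoothGrowth.differentiable {c : ℝ} {f : ℝ → ℝ} (hf : SmoothGrowth c f) :
    Differentiable ℝ f := hf.1.differentiable (by simp)

theorem SmoothGrowth.comp_add {c : ℝ} {f : ℝ → ℝ} (hf : SmoothGrowth c f) (z : ℝ) :
    SmoothGrowth c fun x => f (x + z) := by
  have := TameFamily.of_ladder (c := c) (Q := Unit)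
    (G := fun j _ x => iteratedDeriv j f (x + z)) (fun j _ x => ?_) (fun j => ?_)
    (fun _ => measurable_const)
  · simpa using this.smoothGrowth ()
  · exact (hasDerivAt_iteratedDeriv hf.1 j (x + z)).comp_add_const x z
  · obtain ⟨C, K, hC, h⟩ := hf.tame.bound j
    refine ⟨C * expWeight c K z, K, fun _ x => (h () _).trans ?_⟩
    calc C * expWeight c K (x + z) ≤ C * (expWeight c K x * expWeight c K z) :=
          mul_le_mul_of_nonneg_left (expWeight_add_le c K x z) hC
      _ = _ := by ring

/-! ### Families of operators on tame functions -/

/-- A measurable family of linear operators that maps tame families to tame families, uniformly in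
the parameter, and commutes with averages of tame families. -/
structure IsTameOp (c : ℝ) {P : Type} [MeasurableSpace P] (X : P → (ℝ → ℝ) → ℝ → ℝ) : Prop where
  tame : ∀ {Q : Type} [MeasurableSpace Q] {F : Q → ℝ → ℝ}, TameFamily c F →
    TameFamily c fun pq : P × Q => X pq.1 (F pq.2)
  integral : ∀ {Q : Type} [MeasurableSpace Q] {F : Q → ℝ → ℝ}, TameFamily c F →
    ∀ (μ : Measure Q) [IsFiniteMeasure μ] (p : P) (x : ℝ),
      X p (fun y => ∫ q, F q y ∂μ) x = ∫ q, X p (F q) x ∂μ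
  add : ∀ {f g : ℝ → ℝ}, SmoothGrowth c f → SmoothGrowth c g → ∀ p x,
    X p (fun y => f y + g y) x = X p f x + X p g x
  smul : ∀ {f : ℝ → ℝ}, SmoothGrowth c f → ∀ (a : ℝ) p x, X p (fun y => a * f y) x = a * X p f x

/-- A tame family of operators that commute with translations and with the derivative. -/
structure IsTransOp (c : ℝ) {P : Type} [MeasurableSpace P] (X : P → (ℝ → ℝ) → ℝ → ℝ) : Prop
    extends IsTameOp c X where
  shift : ∀ {f : ℝ → ℝ}, SmoothGrowth c f → ∀ p z x, X p (fun y => f (y + z)) x = X p f (x + z)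
  deriv : ∀ {f : ℝ → ℝ}, SmoothGrowth c f → ∀ p x, X p (deriv f) x = deriv (X p f) x

namespace IsTameOp

variable {c : ℝ} {P P' Q : Type} [MeasurableSpace P] [MeasurableSpace P'] [MeasurableSpace Q]
  {X Y : P → (ℝ → ℝ) → ℝ → ℝ}

/-- The image of a tame family whose parameter drives the operator as well. -/
theorem tame' (hX : IsTameOp c X) {F : Q → ℝ → ℝ} (hF : TameFamily c F) {φ : Q → P}
    (hφ : Measurable φ) : TameFamily c fun q => X (φ q) (F q) :=
  (hX.tame hF).comp (φ := fun q => (φ q, q)) (hφ.prodMk measurable_id)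

theorem smoothGrowth (hX : IsTameOp c X) {f : ℝ → ℝ} (hf : SmoothGrowth c f) (p : P) :
    SmoothGrowth c (X p f) := (hX.tame hf.tame).smoothGrowth (p, ())

theorem comp_param (hX : IsTameOp c X) {φ : P' → P} (hφ : Measurable φ) :
    IsTameOp c fun p => X (φ p) where
  tame hF := (hX.tame hF).comp
    (φ := Prod.map φ id) (hφ.prodMap measurable_id)
  integral hF μ _ p x := hX.integral hF μ (φ p) x
  add hf hg p x := hX.add hf hg (φ p) x
  smul hf a p x := hX.smul hf a (φ p) x

theorem map_zero (hX : IsTameOp c X) (p : P) (x : ℝ) : X p (fun _ => 0) x = 0 := by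
  simpa using hX.smul SmoothGrowth.zero 0 p x

theorem map_sub (hX : IsTameOp c X) {f g : ℝ → ℝ} (hf : SmoothGrowth c f) (hg : SmoothGrowth c g)
    (p : P) (x : ℝ) : X p (fun y => f y - g y) x = X p f x - X p g x := by
  have h := hX.add hf (hg.const_mul (-1)) p x
  rw [hX.smul hg] at h
  simpa [sub_eq_add_neg] using h

theorem map_sum (hX : IsTameOp c X) {ι : Type*} (s : Finset ι) {f : ι → ℝ → ℝ}
    (hf : ∀ i ∈ s, SmoothGrowth c (f i)) (p : P) (x : ℝ) :
    X p (fun y => ∑ i ∈ s, f i y) x = ∑ i ∈ s, X p (f i) x := by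
  classical
  induction s using Finset.induction_on with
  | empty => simpa using hX.map_zero p x
  | insert i s hi ih =>
    simp only [Finset.sum_insert hi]
    rw [hX.add (hf i (Finset.mem_insert_self _ _))
      ((TameFamily.sum s fun j hj =>
        (hf j (Finset.mem_insert_of_mem hj)).tame).smoothGrowth ()), ih]
    exact fun j hj => hf j (Finset.mem_insert_of_mem hj)

theorem map_intervalIntegral (hX : IsTameOp c X) {F : ℝ → ℝ → ℝ} (hF : TameFamily c F) (a b : ℝ)
    (p : P) (x : ℝ) :
    X p (fun y => ∫ r in a..b, F r y) x = ∫ r in a..b, X p (F r) x := by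
  rcases le_total a b with h | h
  · simp only [intervalIntegral.integral_of_le h]
    exact hX.integral hF _ p x
  · simp only [intervalIntegral.integral_of_ge h]
    have := hX.smul (hF.integral (volume.restrict (Set.Ioc b a))) (-1) p x
    simp only [neg_one_mul] at this
    rw [this, hX.integral hF _ p x]

theorem ident : IsTameOp c (P := P) fun _ f => f where
  tame hF := hF.comp measurable_snd
  integral _ _ _ _ _ := rfl
  add _ _ _ _ := rfl
  smul _ _ _ _ := rfl

theorem mulX : IsTameOp c (P := P) fun _ f x => x * f x where
  tame hF := hF.mulX.comp measurable_snd
  integral _ _ _ _ _ := (integral_const_mul _ _).symm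
  add _ _ _ _ := mul_add _ _ _
  smul _ _ _ _ := by ring

theorem addOp (hX : IsTameOp c X) (hY : IsTameOp c Y) :
    IsTameOp c fun p f x => X p f x + Y p f x where
  tame hF := (hX.tame hF).add (hY.tame hF)
  integral {Q _ F} hF μ _ p x := by
    rw [hX.integral hF, hY.integral hF, integral_add]
    · exact (hX.tame' hF (φ := fun _ => p) measurable_const).integrable μ x
    · exact (hY.tame' hF (φ := fun _ => p) measurable_const).integrable μ x
  add hf hg p x := by rw [hX.add hf hg, hY.add hf hg]; ring
  smul hf a p x := by rw [hX.smul hf, hY.smul hf]; ring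

theorem smulOp (hX : IsTameOp c X) {a : P → ℝ} (ha : Measurable a) {A : ℝ} (hA : ∀ p, |a p| ≤ A) :
    IsTameOp c fun p f x => a p * X p f x where
  tame hF := (hX.tame hF).smul (ha.comp measurable_fst) (fun q => hA q.1)
  integral {Q _ F} hF μ _ p x := by rw [hX.integral hF, integral_const_mul]
  add hf hg p x := by rw [hX.add hf hg]; ring
  smul hf a p x := by rw [hX.smul hf]; ring

theorem zeroOp : IsTameOp c (P := P) fun _ _ _ => 0 := by
  simpa using (ident (c := c) (P := P)).smulOp (a := fun _ => 0) measurable_const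
    (A := 0) (by simp)

theorem sumOp {ι : Type*} (s : Finset ι) {X : ι → P → (ℝ → ℝ) → ℝ → ℝ}
    (hX : ∀ i ∈ s, IsTameOp c (X i)) : IsTameOp c fun p f x => ∑ i ∈ s, X i p f x := by
  classical
  induction s using Finset.induction_on with
  | empty => simpa using zeroOp
  | insert i s hi ih =>
    simp only [Finset.sum_insert hi]
    exact (hX i (Finset.mem_insert_self _ _)).addOp
      (ih fun j hj => hX j (Finset.mem_insert_of_mem hj))

theorem compOp (hX : IsTameOp c X) (hY : IsTameOp c Y) : IsTameOp c fun p f => X p (Y p f) where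
  tame hF := hX.tame' (hY.tame hF) measurable_fst
  integral {Q _ F} hF μ _ p x := by
    rw [funext fun y => hY.integral hF μ p y,
      hX.integral (hY.tame' hF (φ := fun _ => p) measurable_const)]
  add hf hg p x := by
    rw [funext fun y => hY.add hf hg p y, hX.add (hY.smoothGrowth hf p) (hY.smoothGrowth hg p)]
  smul hf a p x := by
    rw [funext fun y => hY.smul hf a p y, hX.smul (hY.smoothGrowth hf p)]

theorem iterateOp (hX : IsTameOp c X) (k : ℕ) : IsTameOp c fun p => (X p)^[k] := by
  induction k with
  | zero => exact ident
  | succ k ih =>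
    simp only [Function.iterate_succ']
    exact hX.compOp ih

theorem derivOp : IsTameOp c (P := P) fun _ f => deriv f where
  tame hF := hF.deriv.comp measurable_snd
  integral {Q _ F} hF μ _ p x := by
    have h1 := (TameFamily.integral_prod (P := Unit) (F := fun p => F p.2)
      (hF.comp measurable_snd) μ)
    obtain ⟨C, K, hC, h⟩ := hF.bound 1
    obtain ⟨M, hM⟩ := (isCompact_closedBall x 1).exists_bound_of_continuousOn
      (continuous_expWeight c K).continuousOn
    refine (hasDerivAt_integral_of_dominated_loc_of_deriv_le (s := Metric.ball x 1)
      (F := fun y q => F q y) (F' := fun y q => deriv (F q) y)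
      (bound := fun _ => C * M) (Metric.ball_mem_nhds x one_pos)
      (Eventually.of_forall fun y => (hF.meas y).aestronglyMeasurable)
      (hF.integrable _ x) ((hF.deriv.meas x).aestronglyMeasurable)
      (Eventually.of_forall fun q y hy => ?_) (integrable_const _)
      (Eventually.of_forall fun q y _ =>
        ((hF.smoothGrowth q).differentiable y).hasDerivAt)).2.deriv
    rw [Real.norm_eq_abs]
    have h2 := h q y
    rw [iteratedDeriv_one] at h2
    exact h2.trans (mul_le_mul_of_nonneg_left
      ((le_abs_self _).trans (hM y (Metric.ball_subset_closedBall hy))) hC)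
  add hf hg p x := by
    exact deriv_fun_add (hf.differentiable x) (hg.differentiable x)
  smul hf a p x := deriv_const_mul a (hf.differentiable x)

/-- The average over a finite kernel of a tame family of operators. -/
theorem integralOp {X : P × P' → (ℝ → ℝ) → ℝ → ℝ} (hX : IsTameOp c X) (κ : Kernel P P')
    [IsFiniteKernel κ] : IsTameOp c fun p f x => ∫ p', X (p, p') f x ∂(κ p) where
  tame {Q _ F} hF := by
    exact ((hX.tame hF).comp (φ := fun r : (P × Q) × P' => ((r.1.1, r.2), r.1.2))
      (by fun_prop)).integral_kernel (κ.comap Prod.fst measurable_fst)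
  integral {Q _ F} hF μ _ p x := by
    simp only [hX.integral hF]
    refine integral_integral_swap ?_
    exact ((hX.tame hF).comp (φ := fun r : P' × Q => ((p, r.1), r.2)) (by fun_prop)).integrable _ x
  add hf hg p x := by
    simp only [hX.add hf hg]
    exact integral_add
      ((hX.tame' (TameFamily.const hf) (φ := fun p' => (p, p')) (by fun_prop)).integrable _ x)
      ((hX.tame' (TameFamily.const hg) (φ := fun p' => (p, p')) (by fun_prop)).integrable _ x)
  smul hf a p x := by simp only [hX.smul hf, integral_const_mul]

theorem intervalOp {X : ℝ → (ℝ → ℝ) → ℝ → ℝ} (hX : IsTameOp c X) {T : ℝ}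
    (h0 : ∀ r, r ∉ Set.Icc 0 T → ∀ f x, X r f x = 0) {a b : P → ℝ} (ha : Measurable a)
    (hb : Measurable b) : IsTameOp c fun p f x => ∫ r in a p..b p, X r f x where
  tame hF := by
    refine ((hX.tame hF).comp (φ := fun r : (P × _) × ℝ => (r.2, r.1.2))
      (by fun_prop)).intervalIntegral (T := T) ?_ (ha.comp measurable_fst) (hb.comp measurable_fst)
    exact fun p r hr x => h0 r hr _ x
  integral {Q _ F} hF μ _ p x := by
    simp only [hX.integral hF]
    have : IsFiniteMeasure (volume.restrict (Set.uIoc (a p) (b p))) :=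
      ⟨by rw [Measure.restrict_apply_univ]; simp [Set.uIoc]⟩
    exact intervalIntegral_integral_swap ((hX.tame hF).integrable _ x)
  add hf hg p x := by
    simp only [hX.add hf hg]
    exact intervalIntegral.integral_add
      ((hX.tame' (TameFamily.const hf) (φ := id) measurable_id).intervalIntegrable _ _ x)
      ((hX.tame' (TameFamily.const hg) (φ := id) measurable_id).intervalIntegrable _ _ x)
  smul hf a p x := by simp only [hX.smul hf, intervalIntegral.integral_const_mul]

end IsTameOp

namespace IsTransOp

variable {c : ℝ} {P P' Q : Type} [MeasurableSpace P] [MeasurableSpace P'] [MeasurableSpace Q]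
  {X Y : P → (ℝ → ℝ) → ℝ → ℝ}

theorem comp_param (hX : IsTransOp c X) {φ : P' → P} (hφ : Measurable φ) :
    IsTransOp c fun p => X (φ p) where
  toIsTameOp := hX.toIsTameOp.comp_param hφ
  shift hf p z x := hX.shift hf (φ p) z x
  deriv hf p x := hX.deriv hf (φ p) x

theorem ident : IsTransOp c (P := P) fun _ f => f where
  toIsTameOp := IsTameOp.ident
  shift _ _ _ _ := rfl
  deriv _ _ _ := rfl

theorem derivOp : IsTransOp c (P := P) fun _ f => _root_.deriv f where
  toIsTameOp := IsTameOp.derivOp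
  shift {f} _ _ z x := by rw [deriv_comp_add_const f z x]
  deriv _ _ _ := rfl

theorem compOp (hX : IsTransOp c X) (hY : IsTransOp c Y) : IsTransOp c fun p f => X p (Y p f) where
  toIsTameOp := hX.toIsTameOp.compOp hY.toIsTameOp
  shift hf p z x := by
    rw [funext fun y => hY.shift hf p z y, hX.shift (hY.smoothGrowth hf p)]
  deriv hf p x := by
    rw [funext fun y => hY.deriv hf p y, hX.deriv (hY.smoothGrowth hf p)]

theorem addOp (hX : IsTransOp c X) (hY : IsTransOp c Y) :
    IsTransOp c fun p f x => X p f x + Y p f x where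
  toIsTameOp := hX.toIsTameOp.addOp hY.toIsTameOp
  shift hf p z x := by rw [hX.shift hf, hY.shift hf]
  deriv hf p x := by
    rw [hX.deriv hf, hY.deriv hf, deriv_fun_add ((hX.smoothGrowth hf p).differentiable x)
      ((hY.smoothGrowth hf p).differentiable x)]

theorem smulOp (hX : IsTransOp c X) {a : P → ℝ} (ha : Measurable a) {A : ℝ}
    (hA : ∀ p, |a p| ≤ A) : IsTransOp c fun p f x => a p * X p f x where
  toIsTameOp := hX.toIsTameOp.smulOp ha hA
  shift hf p z x := by rw [hX.shift hf]
  deriv hf p x := by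
    rw [hX.deriv hf, deriv_const_mul _ ((hX.smoothGrowth hf p).differentiable x)]

theorem negOp (hX : IsTransOp c X) : IsTransOp c fun p f x => -X p f x := by
  simpa using hX.smulOp (a := fun _ => -1) measurable_const (A := 1) (by simp)

theorem subOp (hX : IsTransOp c X) (hY : IsTransOp c Y) :
    IsTransOp c fun p f x => X p f x - Y p f x := by
  simpa [sub_eq_add_neg] using hX.addOp hY.negOp

theorem integralOp {X : P × P' → (ℝ → ℝ) → ℝ → ℝ} (hX : IsTransOp c X) (κ : Kernel P P')
    [IsFiniteKernel κ] : IsTransOp c fun p f x => ∫ p', X (p, p') f x ∂(κ p) where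
  toIsTameOp := hX.toIsTameOp.integralOp κ
  shift hf p z x := by simp only [hX.shift hf]
  deriv hf p x := by
    simp only [hX.deriv hf]
    have h := (hX.tame' (TameFamily.const hf) (φ := fun p' => (p, p')) (by fun_prop))
    exact ((IsTameOp.derivOp (c := c) (P := Unit)).integral h (κ p) () x).symm

end IsTransOp

/-! ### Evolution equations and the Duhamel principle -/

/-- Fubini's theorem on a triangle. -/
theorem intervalIntegral_triangle_swap {g : ℝ × ℝ → ℝ} (hg : Measurable g) {C : ℝ}
    (hC : ∀ p, |g p| ≤ C) {a b : ℝ} (hab : a ≤ b) :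
    ∫ s in a..b, ∫ r in a..s, g (r, s) = ∫ r in a..b, ∫ s in r..b, g (r, s) := by
  have hset : MeasurableSet {p : ℝ × ℝ | p.1 < p.2} := measurableSet_lt measurable_fst measurable_snd
  have hI : Integrable (fun p : ℝ × ℝ => {p : ℝ × ℝ | p.1 < p.2}.indicator g p)
      ((volume.restrict (Set.Ioc a b)).prod (volume.restrict (Set.Ioc a b))) :=
    Integrable.of_bound (hg.indicator hset).aestronglyMeasurable C (Eventually.of_forall fun p => by
      by_cases h : p ∈ {p : ℝ × ℝ | p.1 < p.2}
      · rw [Set.indicator_of_mem h]; exact hC p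
      · rw [Set.indicator_of_notMem h]; simpa using (abs_nonneg _).trans (hC p))
  have h1 : ∫ s in a..b, ∫ r in a..s, g (r, s) = ∫ s in Set.Ioc a b, ∫ r in Set.Ioc a b,
      {p : ℝ × ℝ | p.1 < p.2}.indicator g (r, s) := by
    rw [intervalIntegral.integral_of_le hab]
    refine setIntegral_congr_fun measurableSet_Ioc fun s hs => ?_
    rw [intervalIntegral.integral_of_le hs.1.le, integral_Ioc_eq_integral_Ioo,
      ← integral_indicator measurableSet_Ioo, ← integral_indicator measurableSet_Ioc]
    congr 1 with r
    simp only [Set.indicator_apply, Set.mem_Ioo, Set.mem_Ioc, Set.mem_ofPred_eq]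
    have := hs.2
    split_ifs <;> first | rfl | (exfalso; grind)
  have h2 : ∫ r in a..b, ∫ s in r..b, g (r, s) = ∫ r in Set.Ioc a b, ∫ s in Set.Ioc a b,
      {p : ℝ × ℝ | p.1 < p.2}.indicator g (r, s) := by
    rw [intervalIntegral.integral_of_le hab]
    refine setIntegral_congr_fun measurableSet_Ioc fun r hr => ?_
    rw [intervalIntegral.integral_of_le hr.2,
      ← integral_indicator measurableSet_Ioc, ← integral_indicator measurableSet_Ioc]
    congr 1 with s
    simp only [Set.indicator_apply, Set.mem_Ioc, Set.mem_ofPred_eq]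
    have := hr.1
    split_ifs <;> first | rfl | (exfalso; grind)
  rw [h1, h2]
  exact (integral_integral_swap hI).symm

/-- `F` satisfies `∂_t F + A F = -g` for `t ∈ I`, in integrated form. -/
def Solves (A : ℝ → (ℝ → ℝ) → ℝ → ℝ) (I : Set ℝ) (F g : ℝ → ℝ → ℝ) : Prop :=
  ∀ t ∈ I, ∀ t' ∈ I, t ≤ t' → ∀ x, F t' x = F t x - ∫ r in t..t', (A r (F r) x + g r x)

namespace Solves

variable {c : ℝ} {A : ℝ → (ℝ → ℝ) → ℝ → ℝ} {I : Set ℝ} {F G f g : ℝ → ℝ → ℝ}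

theorem add (hA : IsTameOp c A) (hF : TameFamily c F) (hG : TameFamily c G)
    (hf : TameFamily c f) (hg : TameFamily c g) (h : Solves A I F f) (h' : Solves A I G g) :
    Solves A I (fun t x => F t x + G t x) fun t x => f t x + g t x := by
  intro t ht t' ht' htt x
  simp only
  rw [h t ht t' ht' htt, h' t ht t' ht' htt]
  have e : ∀ r, A r (fun x => F r x + G r x) x + (f r x + g r x) =
      (A r (F r) x + f r x) + (A r (G r) x + g r x) := fun r => by
    rw [hA.add (hF.smoothGrowth r) (hG.smoothGrowth r)]; ring
  simp only [e]
  rw [intervalIntegral.integral_add (f := fun r => A r (F r) x + f r x)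
    (g := fun r => A r (G r) x + g r x)]
  · ring
  · exact ((hA.tame' hF measurable_id).intervalIntegrable t t' x).add (hf.intervalIntegrable t t' x)
  · exact ((hA.tame' hG measurable_id).intervalIntegrable t t' x).add (hg.intervalIntegrable t t' x)

theorem sum (hA : IsTameOp c A) {ι : Type*} (s : Finset ι) {F f : ι → ℝ → ℝ → ℝ}
    (hF : ∀ i ∈ s, TameFamily c (F i)) (hf : ∀ i ∈ s, TameFamily c (f i))
    (h : ∀ i ∈ s, Solves A I (F i) (f i)) :
    Solves A I (fun t x => ∑ i ∈ s, F i t x) fun t x => ∑ i ∈ s, f i t x := by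
  classical
  induction s using Finset.induction_on with
  | empty =>
    intro t _ t' _ _ x
    simp only [Finset.sum_empty, hA.map_zero]
    simp
  | insert i s hi ih =>
    simp only [Finset.sum_insert hi]
    have hF' := fun j hj => hF j (Finset.mem_insert_of_mem hj)
    have hf' := fun j hj => hf j (Finset.mem_insert_of_mem hj)
    exact add hA (hF i (Finset.mem_insert_self _ _)) (TameFamily.sum s hF')
      (hf i (Finset.mem_insert_self _ _)) (TameFamily.sum s hf') (h i (Finset.mem_insert_self _ _))
      (ih hF' hf' fun j hj => h j (Finset.mem_insert_of_mem hj))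

theorem smul (hA : IsTameOp c A) (hF : TameFamily c F) (a : ℝ) (h : Solves A I F f) :
    Solves A I (fun t x => a * F t x) fun t x => a * f t x := by
  intro t ht t' ht' htt x
  simp only
  rw [h t ht t' ht' htt, mul_sub, ← intervalIntegral.integral_const_mul]
  congr 2 with r
  rw [hA.smul (hF.smoothGrowth r)]; ring

/-- An operator that commutes with `A` maps solutions of the homogeneous equation to solutions. -/
theorem map (hA : IsTameOp c A) {P : Type} [MeasurableSpace P] {X : P → (ℝ → ℝ) → ℝ → ℝ}
    (hX : IsTameOp c X) (hAX : ∀ {f}, SmoothGrowth c f → ∀ r p x, A r (X p f) x = X p (A r f) x)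
    (hF : TameFamily c F) (h : Solves A I F fun _ _ => 0) (p : P) :
    Solves A I (fun t => X p (F t)) fun _ _ => 0 := by
  intro t ht t' ht' htt x
  have e := funext (h t ht t' ht' htt)
  simp only [add_zero] at e ⊢
  have hAF : TameFamily c fun r => A r (F r) := hA.tame' hF measurable_id
  have hi : SmoothGrowth c fun x => ∫ r in t..t', A r (F r) x := by
    simp only [intervalIntegral.integral_of_le htt]
    exact hAF.integral _
  rw [e, hX.map_sub (hF.smoothGrowth t) hi, hX.map_intervalIntegral hAF]
  congr 2 with r
  rw [hAX (hF.smoothGrowth r)]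

theorem integral (hA : IsTameOp c A) {Q : Type} [MeasurableSpace Q] {F : ℝ × Q → ℝ → ℝ}
    (hF : TameFamily c F) (h : ∀ q, Solves A I (fun t => F (t, q)) fun _ _ => 0)
    (μ : Measure Q) [IsFiniteMeasure μ] :
    Solves A I (fun t x => ∫ q, F (t, q) x ∂μ) fun _ _ => 0 := by
  intro t ht t' ht' htt x
  have hsec : ∀ t, TameFamily c fun q => F (t, q) := fun t =>
    hF.comp (measurable_const.prodMk measurable_id)
  have hAF := hA.tame' hF measurable_fst
  have e : ∀ q, F (t', q) x = F (t, q) x - ∫ r in t..t', A r (F (r, q)) x := fun q => by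
    simpa using h q t ht t' ht' htt x
  simp only [add_zero, e]
  simp only [hA.integral (hsec _)]
  rw [intervalIntegral_integral_swap, integral_sub ((hsec t).integrable μ x)]
  · simp only [intervalIntegral.integral_of_le htt]
    have h1 := (hAF.comp (φ := fun r : Q × ℝ => (r.2, r.1)) (by fun_prop)).integral_prod
      (volume.restrict (Set.Ioc t t'))
    exact h1.integrable μ x
  · have : IsFiniteMeasure (volume.restrict (Set.uIoc t t')) :=
      ⟨by rw [Measure.restrict_apply_univ]; simp [Set.uIoc]⟩
    exact hAF.integrable _ x

theorem intervalIntegral (hA : IsTameOp c A) {F : ℝ × ℝ → ℝ → ℝ}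
    (hF : TameFamily c F) (h : ∀ q, Solves A I (fun t => F (t, q)) fun _ _ => 0) (a b : ℝ) :
    Solves A I (fun t x => ∫ q in a..b, F (t, q) x) fun _ _ => 0 := by
  have h1 := integral hA hF h (volume.restrict (Set.Ioc a b))
  have h2 := (integral hA hF h (volume.restrict (Set.Ioc b a))).smul hA
    (hF.integral_prod (volume.restrict (Set.Ioc b a))) (-1)
  have := add hA (hF.integral_prod _)
    ((hF.integral_prod (volume.restrict (Set.Ioc b a))).const_mul (-1)) TameFamily.zero
    (TameFamily.zero.const_mul (-1)) h1 h2
  simpa [_root_.intervalIntegral, sub_eq_add_neg] using this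

/-- **Duhamel's principle**: if `Y(·, s)` solves the homogeneous equation for every `s`, then
`t ↦ ∫_t^b Y(t, s) ds` solves the equation with source `t ↦ Y(t, t)`. -/
theorem duhamel (hA : IsTameOp c A) {τ T : ℝ} {Y : ℝ × ℝ → ℝ → ℝ} (hY : TameFamily c Y)
    (h0 : ∀ t s, s ∉ Set.Icc 0 T → ∀ x, Y (t, s) x = 0)
    (h : ∀ s, Solves A (Set.Icc 0 τ) (fun t => Y (t, s)) fun _ _ => 0) (b : ℝ) :
    TameFamily c (fun t x => ∫ s in t..b, Y (t, s) x) ∧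
    Solves A (Set.Icc 0 τ) (fun t x => ∫ s in t..b, Y (t, s) x) fun t => Y (t, t) := by
  refine ⟨hY.intervalIntegral h0 measurable_id measurable_const, ?_⟩
  intro t ht t' ht' htt x
  have hAY := hA.tame' hY measurable_fst
  have hsec : ∀ t, TameFamily c fun q => Y (t, q) := fun t =>
    hY.comp (measurable_const.prodMk measurable_id)
  have hdiag : TameFamily c fun q => Y (q, q) := hY.comp (measurable_id.prodMk measurable_id)
  have hAYs : ∀ r, TameFamily c fun s => A r (Y (r, s)) := fun r =>
    hAY.comp (φ := fun s => (r, s)) (by fun_prop)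
  obtain ⟨C, K, hC, hb⟩ := hAY.bound_zero
  have hIr : ∀ a b, TameFamily c fun s x => ∫ r in Set.Ioc a b, A r (Y (r, s)) x := fun a b =>
    (hAY.comp (φ := fun r : ℝ × ℝ => (r.2, r.1)) (by fun_prop)).integral_prod _
  have hIs : ∀ b, TameFamily c fun r x => ∫ s in r..b, A r (Y (r, s)) x := fun b =>
    hAY.intervalIntegral (fun p r hr x => by
      rw [show Y (p, r) = fun _ => 0 from funext (h0 p r hr)]; exact hA.map_zero _ _)
      measurable_id measurable_const
  -- the equation for `Y(·, s)` is integrated over `s`, and Fubini's theorem is applied to the rectangle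
  -- `s ∈ [t', b]` and to the triangle `t ≤ r ≤ s ≤ t'`
  have e : ∀ t ∈ Set.Icc 0 τ, ∀ t' ∈ Set.Icc 0 τ, t ≤ t' → ∀ s,
      Y (t', s) x = Y (t, s) x - ∫ r in t..t', A r (Y (r, s)) x := fun t ht t' ht' htt s => by
    simpa using h s t ht t' ht' htt x
  have e1 : ∫ s in t'..b, Y (t', s) x = (∫ s in t'..b, Y (t, s) x) -
      ∫ r in t..t', ∫ s in t'..b, A r (Y (r, s)) x := by
    simp only [e t ht t' ht' htt]
    rw [intervalIntegral.integral_sub ((hsec t).intervalIntegrable _ _ x)]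
    · congr 1
      refine intervalIntegral_intervalIntegral_swap (F := fun s r => A r (Y (r, s)) x) ?_
      rw [IntegrableOn, Measure.volume_eq_prod, ← Measure.prod_restrict]
      have h1 : ∀ a b : ℝ, IsFiniteMeasure (volume.restrict (Set.uIoc a b)) := fun a b =>
        ⟨by rw [Measure.restrict_apply_univ]; simp [Set.uIoc]⟩
      have := h1 t' b
      have := h1 t t'
      exact (hAY.comp (φ := fun r : ℝ × ℝ => (r.2, r.1)) (by fun_prop)).integrable _ x
    · simp only [intervalIntegral.integral_of_le htt]
      exact (hIr t t').intervalIntegrable _ _ x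
  have e2 : ∫ s in t..t', Y (t, s) x = (∫ s in t..t', Y (s, s) x) +
      ∫ r in t..t', ∫ s in r..t', A r (Y (r, s)) x := by
    rw [← intervalIntegral_triangle_swap (g := fun p => A p.1 (Y p) x)
      (hAY.meas x) (fun p => hb p x) htt, ← sub_eq_iff_eq_add', ← intervalIntegral.integral_sub
      ((hsec t).intervalIntegrable _ _ x) (hdiag.intervalIntegrable _ _ x)]
    refine intervalIntegral.integral_congr fun s hs => ?_
    rw [Set.uIcc_of_le htt] at hs
    have := e t ht s ⟨ht.1.trans hs.1, hs.2.trans ht'.2⟩ hs.1 s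
    simp only [this]
    ring
  have hAZ : ∀ r, A r (fun x => ∫ s in r..b, Y (r, s) x) x = (∫ s in r..t', A r (Y (r, s)) x) +
      ∫ s in t'..b, A r (Y (r, s)) x := fun r => by
    rw [hA.map_intervalIntegral (hsec r), intervalIntegral.integral_add_adjacent_intervals]
    · exact (hAYs r).intervalIntegrable _ _ x
    · exact (hAYs r).intervalIntegrable _ _ x
  have e3 : ∫ s in t..b, Y (t, s) x = (∫ s in t..t', Y (t, s) x) + ∫ s in t'..b, Y (t, s) x :=
    (intervalIntegral.integral_add_adjacent_intervals ((hsec t).intervalIntegrable _ _ x)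
      ((hsec t).intervalIntegrable _ _ x)).symm
  have hI2 : TameFamily c fun r x => ∫ s in t'..b, A r (Y (r, s)) x := by
    refine (hAY.comp (φ := fun r : ℝ × ℝ => (r.1, r.2)) (by fun_prop)).intervalIntegral (T := T)
      (a := fun _ => t') (b := fun _ => b) (fun p r hr x => ?_) measurable_const measurable_const
    simp only
    rw [show Y (p, r) = fun _ => 0 from funext (h0 p r hr)]
    exact hA.map_zero _ _
  have hAZ' : IntervalIntegrable (fun r => (∫ s in r..t', A r (Y (r, s)) x) +
      ∫ s in t'..b, A r (Y (r, s)) x) volume t t' :=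
    ((hIs t').intervalIntegrable _ _ x).add (hI2.intervalIntegrable _ _ x)
  simp only [hAZ]
  rw [e1, e3, e2, intervalIntegral.integral_add hAZ' (hdiag.intervalIntegrable _ _ x),
    intervalIntegral.integral_add ((hIs t').intervalIntegrable _ _ x)
      (hI2.intervalIntegrable _ _ x)]
  ring

end Solves

/-! ### The algebra of the expansion -/

/-- The operators of a polynomial expansion, reduced to what the algebra uses: the generator `A₀`
of order zero, its commutator `μ` with multiplication by `x`, and the translation invariant
operators `B n k` such that `𝒜_n(t, x) = ∑_k x^k B n k t`. -/
structure ExpansionOps (c T : ℝ) where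
  A₀ : ℝ → (ℝ → ℝ) → ℝ → ℝ
  μ : ℝ → (ℝ → ℝ) → ℝ → ℝ
  B : ℕ → ℕ → ℝ → (ℝ → ℝ) → ℝ → ℝ
  deg : ℕ → ℕ
  tame_A₀ : IsTransOp c A₀
  trans_μ : IsTransOp c μ
  trans_B : ∀ n k, IsTransOp c (B n k)
  supp_μ : ∀ r, r ∉ Set.Icc 0 T → ∀ f x, μ r f x = 0
  supp_B : ∀ n k r, r ∉ Set.Icc 0 T → ∀ f x, B n k r f x = 0
  comm_mulX : ∀ {f}, SmoothGrowth c f → ∀ r x,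
    A₀ r (fun y => y * f y) x = x * A₀ r f x + μ r f x
  comm_trans : ∀ {P : Type} [MeasurableSpace P] {X : P → (ℝ → ℝ) → ℝ → ℝ}, IsTransOp c X →
    ∀ {f}, SmoothGrowth c f → ∀ r p x, A₀ r (X p f) x = X p (A₀ r f) x

namespace ExpansionOps

variable {c T : ℝ} (D : ExpansionOps c T)

/-- The operator `ℳ(t, s) = x + ∫_t^s μ(r) dr`. -/
noncomputable def opM (t s : ℝ) (f : ℝ → ℝ) (x : ℝ) : ℝ := x * f x + ∫ r in t..s, D.μ r f x

/-- The operator `𝒢_n(t, s) = ∑_k ℳ(t, s)^k B n k s`. -/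
noncomputable def opG (n : ℕ) (t s : ℝ) (f : ℝ → ℝ) (x : ℝ) : ℝ :=
  ∑ k ∈ Finset.range (D.deg n + 1), (D.opM t s)^[k] (D.B n k s f) x

/-- The operator `𝒜_n(t, x) = ∑_k x^k B n k t`. -/
noncomputable def opA (n : ℕ) (t : ℝ) (f : ℝ → ℝ) (x : ℝ) : ℝ :=
  ∑ k ∈ Finset.range (D.deg n + 1), x ^ k * D.B n k t f x

/-- The composition `𝒢_{i_1}(t, s_1) ⋯ 𝒢_{i_r}(t, s_r)`. -/
noncomputable def prodG (t : ℝ) :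
    (r : ℕ) → (Fin r → ℕ) → (Fin r → ℝ) → (ℝ → ℝ) → (ℝ → ℝ)
  | 0, _, _, f => f
  | r + 1, i, s, f => D.opG (i 0) t (s 0) (prodG t r (Fin.tail i) (Fin.tail s) f)

/-- The sum over `i ∈ I_{n,r}` of the iterated integrals of `𝒢_{i_1}(t, s_1) ⋯ 𝒢_{i_r}(t, s_r) f`
over `a ≤ s_1 ≤ ⋯ ≤ s_r ≤ T`, with the lower limit `a` kept apart from `t`, by recursion on `r`. -/
noncomputable def opW (t : ℝ) (f : ℝ → ℝ) : ℕ → ℕ → ℝ → ℝ → ℝ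
  | 0, n, _ => if n = 0 then f else fun _ => 0
  | r + 1, n, a => fun x =>
      ∫ s in a..T, ∑ k ∈ Finset.Icc 1 n, D.opG k t s (opW t f r (n - k) s) x

theorem isTameOp_opM : IsTameOp c fun p : ℝ × ℝ => D.opM p.1 p.2 :=
  IsTameOp.mulX.addOp (D.trans_μ.toIsTameOp.intervalOp D.supp_μ measurable_fst measurable_snd)

theorem isTameOp_opG (n : ℕ) : IsTameOp c fun p : ℝ × ℝ => D.opG n p.1 p.2 :=
  IsTameOp.sumOp _ fun k _ => (D.isTameOp_opM.iterateOp k).compOp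
    ((D.trans_B n k).toIsTameOp.comp_param measurable_snd)

theorem opG_supp (n : ℕ) {t s : ℝ} (hs : s ∉ Set.Icc 0 T) (f : ℝ → ℝ) (x : ℝ) :
    D.opG n t s f x = 0 := by
  refine Finset.sum_eq_zero fun k _ => ?_
  rw [show D.B n k s f = fun _ => 0 from funext fun y => D.supp_B n k s hs f y]
  exact (D.isTameOp_opM.iterateOp k).map_zero (t, s) x

theorem iterate_opM_self (t : ℝ) (f : ℝ → ℝ) (k : ℕ) (x : ℝ) :
    (D.opM t t)^[k] f x = x ^ k * f x := by
  induction k generalizing x with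
  | zero => simp
  | succ k ih =>
    rw [Function.iterate_succ', Function.comp_apply, opM, ih]
    simp
    ring

theorem opG_self (n : ℕ) (t : ℝ) (f : ℝ → ℝ) (x : ℝ) : D.opG n t t f x = D.opA n t f x := by
  simp only [opG, opA, iterate_opM_self]

theorem tame_prodG {r : ℕ} (i : Fin r → ℕ) {Q : Type} [MeasurableSpace Q] {F : Q → ℝ → ℝ}
    (hF : TameFamily c F) :
    TameFamily c fun p : (ℝ × Q) × (Fin r → ℝ) => D.prodG p.1.1 r i p.2 (F p.1.2) := by
  induction r with
  | zero => exact hF.comp (measurable_snd.comp measurable_fst)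
  | succ r ih =>
    have h := (ih (Fin.tail i)).comp
      (φ := fun p : (ℝ × Q) × (Fin (r + 1) → ℝ) => (p.1, Fin.tail p.2)) (by
        refine measurable_fst.prodMk (measurable_pi_lambda _ fun j => ?_)
        exact (measurable_pi_apply _).comp measurable_snd)
    exact (D.isTameOp_opG (i 0)).tame' h
      (φ := fun p : (ℝ × Q) × (Fin (r + 1) → ℝ) => (p.1.1, p.2 0))
      ((measurable_fst.comp measurable_fst).prodMk
        ((measurable_pi_apply _).comp measurable_snd))

theorem smoothGrowth_prodG {r : ℕ} (i : Fin r → ℕ) {f : ℝ → ℝ} (hf : SmoothGrowth c f) (t : ℝ)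
    (s : Fin r → ℝ) : SmoothGrowth c (D.prodG t r i s f) :=
  (D.tame_prodG i hf.tame).smoothGrowth ((t, ()), s)

/-- The integrand in the recursion for `opW`. -/
theorem tame_opW_integrand {u : ℝ → ℝ → ℝ} {r : ℕ}
    (ih : ∀ n, TameFamily c fun p : ℝ × ℝ => D.opW p.1 (u p.1) r n p.2) (n : ℕ) :
    TameFamily c fun (p : ℝ × ℝ) x =>
      ∑ k ∈ Finset.Icc 1 n, D.opG k p.1 p.2 (D.opW p.1 (u p.1) r (n - k) p.2) x :=
  TameFamily.sum _ fun k _ => (D.isTameOp_opG k).tame' (ih (n - k)) measurable_id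

theorem tame_opW {u : ℝ → ℝ → ℝ} (hu : TameFamily c u) (r n : ℕ) :
    TameFamily c fun p : ℝ × ℝ => D.opW p.1 (u p.1) r n p.2 := by
  induction r generalizing n with
  | zero =>
    by_cases hn : n = 0
    · simpa only [opW, hn, if_true] using hu.comp measurable_fst
    · simpa only [opW, hn, if_false] using TameFamily.zero
  | succ r ih =>
    refine ((D.tame_opW_integrand ih n).comp (φ := fun p : (ℝ × ℝ) × ℝ => (p.1.1, p.2))
      (by fun_prop)).intervalIntegral (T := T) ?_ measurable_snd measurable_const
    exact fun p s hs x => Finset.sum_eq_zero fun k _ => D.opG_supp k hs _ x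

theorem tame_opW_fixed {f : ℝ → ℝ} (hf : SmoothGrowth c f) (t : ℝ) (r n : ℕ) :
    TameFamily c fun a => D.opW t f r n a :=
  (D.tame_opW (u := fun _ => f) (TameFamily.const hf) r n).comp
    (φ := fun a => (t, a)) (by fun_prop)

theorem opW_eq_zero_of_lt (t : ℝ) (f : ℝ → ℝ) {r n : ℕ} (h : n < r) (a x : ℝ) :
    D.opW t f r n a x = 0 := by
  induction r generalizing n a x with
  | zero => omega
  | succ r ih =>
    simp only [opW]
    rw [intervalIntegral.integral_congr (g := fun _ => 0), intervalIntegral.integral_zero]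
    intro s _
    refine Finset.sum_eq_zero fun k hk => ?_
    rw [Finset.mem_Icc] at hk
    rw [show D.opW t f r (n - k) s = fun _ => 0 from funext fun y => ih (by omega) s y]
    exact (D.isTameOp_opG k).map_zero (t, s) x

/-- The iterated integrals are small when the lower limit is close to `T`. -/
theorem opW_bound {u : ℝ → ℝ → ℝ} (hu : TameFamily c u) (r n : ℕ) :
    ∃ (C : ℝ) (K : ℕ), 0 ≤ C ∧
      ∀ t a x, |D.opW t (u t) (r + 1) n a x| ≤ |T - a| * (C * expWeight c K x) := by
  obtain ⟨C, K, hC, h⟩ := (D.tame_opW_integrand (fun n => D.tame_opW hu r n) n).bound_zero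
  refine ⟨C, K, hC, fun t a x => ?_⟩
  have := intervalIntegral.norm_integral_le_of_norm_le_const (a := a) (b := T)
    (f := fun s => ∑ k ∈ Finset.Icc 1 n, D.opG k t s (D.opW t (u t) r (n - k) s) x)
    (C := C * expWeight c K x) fun s _ => h (t, s) x
  rw [Real.norm_eq_abs] at this
  simp only [opW]
  linarith [this]

variable {τ : ℝ}

/-- `ℳ(t, s) = x + ∫_t^s μ` preserves homogeneous solutions: the commutator of `𝒜₀` with `x` cancels
the derivative of the lower limit. -/
theorem solves_opM {F : ℝ → ℝ → ℝ} (hF : TameFamily c F)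
    (h : Solves D.A₀ (Set.Icc 0 τ) F fun _ _ => 0) (s : ℝ) :
    Solves D.A₀ (Set.Icc 0 τ) (fun t => D.opM t s (F t)) fun _ _ => 0 := by
  have hA := D.tame_A₀.toIsTameOp
  have hμ := D.trans_μ.toIsTameOp
  have hμF : TameFamily c fun p : ℝ × ℝ => D.μ p.2 (F p.1) :=
    hμ.tame' (hF.comp measurable_fst) measurable_snd
  have hd : TameFamily c fun r => D.μ r (F r) := hμF.comp (φ := fun r => (r, r)) (by fun_prop)
  obtain ⟨h2, h3⟩ := Solves.duhamel hA hμF (fun t s hs x => D.supp_μ s hs _ x)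
    (fun s => h.map hA hμ (fun hf r p x => D.comm_trans D.trans_μ hf r p x) hF s) s
  have h1 : Solves D.A₀ (Set.Icc 0 τ) (fun t x => x * F t x) fun t x => -D.μ t (F t) x := by
    intro t ht t' ht' htt x
    simp only [h t ht t' ht' htt x, D.comm_mulX (hF.smoothGrowth _)]
    rw [mul_sub, ← intervalIntegral.integral_const_mul]
    simp
  have := h1.add hA hF.mulX h2 hd.neg hd h3
  simp only [neg_add_cancel] at this
  exact this

theorem solves_iterate_opM {F : ℝ → ℝ → ℝ} (hF : TameFamily c F)
    (h : Solves D.A₀ (Set.Icc 0 τ) F fun _ _ => 0) (s : ℝ) (k : ℕ) :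
    Solves D.A₀ (Set.Icc 0 τ) (fun t => (D.opM t s)^[k] (F t)) fun _ _ => 0 := by
  induction k with
  | zero => simpa using h
  | succ k ih =>
    simp only [Function.iterate_succ', Function.comp_apply]
    refine D.solves_opM ?_ ih s
    exact (D.isTameOp_opM.iterateOp k).tame' hF (φ := fun t => (t, s)) (by fun_prop)

/-- The operators `𝒢_n(t, s)` preserve solutions of the homogeneous equation in `t`. -/
theorem solves_opG {F : ℝ → ℝ → ℝ} (hF : TameFamily c F)
    (h : Solves D.A₀ (Set.Icc 0 τ) F fun _ _ => 0) (s : ℝ) (n : ℕ) :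
    Solves D.A₀ (Set.Icc 0 τ) (fun t => D.opG n t s (F t)) fun _ _ => 0 := by
  have hA := D.tame_A₀.toIsTameOp
  have hB : ∀ k, TameFamily c fun t => D.B n k s (F t) := fun k =>
    (D.trans_B n k).toIsTameOp.tame' hF (φ := fun _ => s) measurable_const
  have := Solves.sum hA (I := Set.Icc 0 τ) (Finset.range (D.deg n + 1))
    (F := fun k t => (D.opM t s)^[k] (D.B n k s (F t))) (f := fun _ _ _ => 0)
    (fun k _ => (D.isTameOp_opM.iterateOp k).tame' (hB k) (φ := fun t => (t, s)) (by fun_prop))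
    (fun _ _ => TameFamily.zero) (fun k _ => D.solves_iterate_opM (hB k)
      (h.map hA (D.trans_B n k).toIsTameOp (fun hf r p x => D.comm_trans (D.trans_B n k) hf r p x)
        hF s) s k)
  simp only [Finset.sum_const_zero] at this
  exact this

theorem solves_opW {u : ℝ → ℝ → ℝ} (hu : TameFamily c u)
    (h : Solves D.A₀ (Set.Icc 0 τ) u fun _ _ => 0) (r n : ℕ) (a : ℝ) :
    Solves D.A₀ (Set.Icc 0 τ) (fun t => D.opW t (u t) r n a) fun _ _ => 0 := by
  have hA := D.tame_A₀.toIsTameOp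
  induction r generalizing n a with
  | zero =>
    by_cases hn : n = 0
    · simpa only [opW, hn, if_true] using h
    · simp only [opW, hn, if_false]
      intro t _ t' _ _ x
      simp [hA.map_zero]
  | succ r ih =>
    refine Solves.intervalIntegral hA (D.tame_opW_integrand (fun n => D.tame_opW hu r n) n)
      (fun s => ?_) a T
    have hW : ∀ n, TameFamily c fun t => D.opW t (u t) r n s := fun n =>
      (D.tame_opW hu r n).comp (φ := fun t => (t, s)) (by fun_prop)
    have := Solves.sum hA (I := Set.Icc 0 τ) (Finset.Icc 1 n)
      (F := fun k t => D.opG k t s (D.opW t (u t) r (n - k) s)) (f := fun _ _ _ => 0)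
      (fun k _ => (D.isTameOp_opG k).tame' (hW (n - k)) (φ := fun t => (t, s)) (by fun_prop))
      (fun _ _ => TameFamily.zero) (fun k _ => D.solves_opG (hW _) (ih (n - k) s) s k)
    simpa using this

/-- The operator `ℒ_n`, with the lower limit `a` kept apart from `t`. -/
noncomputable def opL (n : ℕ) (t a : ℝ) (f : ℝ → ℝ) (x : ℝ) : ℝ :=
  ∑ r ∈ Finset.range (n + 1), D.opW t f r n a x

theorem tame_opL {u : ℝ → ℝ → ℝ} (hu : TameFamily c u) (n : ℕ) :
    TameFamily c fun p : ℝ × ℝ => D.opL n p.1 p.2 (u p.1) :=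
  TameFamily.sum _ fun r _ => D.tame_opW hu r n

theorem tame_opL_diag {u : ℝ → ℝ → ℝ} (hu : TameFamily c u) (n : ℕ) :
    TameFamily c fun t => D.opL n t t (u t) :=
  (D.tame_opL hu n).comp (φ := fun t => (t, t)) (by fun_prop)

theorem opL_zero (t a : ℝ) (f : ℝ → ℝ) : D.opL 0 t a f = f := by
  ext x; simp [opL, opW]

theorem opL_bound {u : ℝ → ℝ → ℝ} (hu : TameFamily c u) {n : ℕ} (hn : 1 ≤ n) :
    ∃ (C : ℝ) (K : ℕ), 0 ≤ C ∧
      ∀ t a x, |D.opL n t a (u t) x| ≤ |T - a| * (C * expWeight c K x) := by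
  choose C K hC h using fun r => D.opW_bound hu r n
  refine ⟨∑ r ∈ Finset.range n, C r, (Finset.range n).sup K, Finset.sum_nonneg fun r _ => hC r,
    fun t a x => ?_⟩
  rw [opL, Finset.sum_range_succ', show D.opW t (u t) 0 n a x = 0 by
    simp [opW, Nat.one_le_iff_ne_zero.1 hn], add_zero, Finset.sum_mul, Finset.mul_sum]
  refine (Finset.abs_sum_le_sum_abs _ _).trans (Finset.sum_le_sum fun r hr => (h r t a x).trans ?_)
  exact mul_le_mul_of_nonneg_left (mul_le_mul_of_nonneg_left
    (expWeight_mono c (Finset.le_sup hr) x) (hC r)) (abs_nonneg _)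

theorem solves_opL {u : ℝ → ℝ → ℝ} (hu : TameFamily c u)
    (h : Solves D.A₀ (Set.Icc 0 τ) u fun _ _ => 0) (n : ℕ) (a : ℝ) :
    Solves D.A₀ (Set.Icc 0 τ) (fun t => D.opL n t a (u t)) fun _ _ => 0 := by
  have := Solves.sum D.tame_A₀.toIsTameOp (I := Set.Icc 0 τ) (Finset.range (n + 1))
    (F := fun r t => D.opW t (u t) r n a) (f := fun _ _ _ => 0)
    (fun r _ => (D.tame_opW hu r n).comp (φ := fun t => (t, a)) (by fun_prop))
    (fun _ _ => TameFamily.zero) (fun r _ => D.solves_opW hu h r n a)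
  simp only [Finset.sum_const_zero] at this
  exact this

/-- The functions `t ↦ ℒ_n(t, T) u(t)` solve the nested equations. -/
theorem solves_opL_diag {u : ℝ → ℝ → ℝ} (hu : TameFamily c u)
    (h : Solves D.A₀ (Set.Icc 0 τ) u fun _ _ => 0) (n : ℕ) :
    Solves D.A₀ (Set.Icc 0 τ) (fun t => D.opL n t t (u t)) fun t x =>
      ∑ k ∈ Finset.Icc 1 n, D.opA k t (D.opL (n - k) t t (u t)) x := by
  have hA := D.tame_A₀.toIsTameOp
  have hdiag : ∀ r, TameFamily c fun t x =>
      ∑ k ∈ Finset.Icc 1 n, D.opG k t t (D.opW t (u t) r (n - k) t) x := fun r =>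
    (D.tame_opW_integrand (fun n => D.tame_opW hu r n) n).comp (φ := fun t => (t, t)) (by fun_prop)
  have hW : ∀ r n s, TameFamily c fun t => D.opW t (u t) r n s := fun r n s =>
      (D.tame_opW hu r n).comp (φ := fun t => (t, s)) (by fun_prop)
  have hs : ∀ r, Solves D.A₀ (Set.Icc 0 τ) (fun t => D.opW t (u t) (r + 1) n t) fun t x =>
      ∑ k ∈ Finset.Icc 1 n, D.opG k t t (D.opW t (u t) r (n - k) t) x := fun r => by
    refine (Solves.duhamel hA (D.tame_opW_integrand (fun n => D.tame_opW hu r n) n)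
      (fun t s hs x => Finset.sum_eq_zero fun k _ => D.opG_supp k hs _ x) (fun s => ?_) T).2
    have := Solves.sum hA (I := Set.Icc 0 τ) (Finset.Icc 1 n)
      (F := fun k t => D.opG k t s (D.opW t (u t) r (n - k) s)) (f := fun _ _ _ => 0)
      (fun k _ => (D.isTameOp_opG k).tame' (hW r (n - k) s) (φ := fun t => (t, s)) (by fun_prop))
      (fun _ _ => TameFamily.zero)
      (fun k _ => D.solves_opG (hW _ _ _) (D.solves_opW hu h r (n - k) s) s k)
    simpa using this
  have hWd : ∀ r, TameFamily c fun t => D.opW t (u t) r n t := fun r =>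
    (D.tame_opW hu r n).comp (φ := fun t => (t, t)) (by fun_prop)
  have h0 : Solves D.A₀ (Set.Icc 0 τ) (fun t => D.opW t (u t) 0 n t) fun _ _ => 0 :=
    D.solves_opW hu h 0 n 0
  have h1 := Solves.sum hA (I := Set.Icc 0 τ) (Finset.range n)
    (F := fun r t => D.opW t (u t) (r + 1) n t) (fun r _ => hWd (r + 1)) (fun r _ => hdiag r)
    (fun r _ => hs r)
  have h2 := h1.add hA (TameFamily.sum _ fun r _ => hWd (r + 1)) (hWd 0)
    (TameFamily.sum _ fun r _ => hdiag r) TameFamily.zero h0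
  convert h2 using 3 with t x t x
  · simp only [opL, Finset.sum_range_succ']
  · rw [add_zero, Finset.sum_comm]
    refine Finset.sum_congr rfl fun k hk => ?_
    rw [Finset.mem_Icc] at hk
    rw [← opG_self, ← (D.isTameOp_opG k).map_sum (Finset.range n)
      (f := fun r => D.opW t (u t) r (n - k) t)
      (fun r _ => (D.tame_opW hu r (n - k)).smoothGrowth (t, t)) (t, t) x]
    congr 1
    ext y
    rw [opL]
    refine Finset.sum_subset (Finset.range_subset_range.2 (by omega)) fun r _ hr => ?_
    rw [Finset.mem_range] at hr
    exact D.opW_eq_zero_of_lt t _ (by omega) t y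

theorem sum_indexSet_succ {M : Type*} [AddCommMonoid M] (n r : ℕ) (φ : (Fin (r + 1) → ℕ) → M) :
    ∑ i ∈ indexSet n (r + 1), φ i =
      ∑ k ∈ Finset.Icc 1 n, ∑ i ∈ indexSet (n - k) r, φ (Fin.cons k i) := by
  rw [Finset.sum_sigma']
  refine Finset.sum_bij' (fun i _ => ⟨i 0, Fin.tail i⟩) (fun p _ => Fin.cons p.1 p.2)
    (fun i hi => ?_) (fun p hp => ?_) (fun i _ => Fin.cons_self_tail i) (fun p _ => by simp)
    (fun i _ => by simp [Fin.cons_self_tail])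
  · simp only [indexSet, Finset.mem_filter, Finset.Nat.mem_antidiagonalTuple] at hi
    simp only [indexSet, Finset.mem_sigma, Finset.mem_Icc, Finset.mem_filter,
      Finset.Nat.mem_antidiagonalTuple]
    rw [Fin.sum_univ_succ] at hi
    refine ⟨⟨hi.2 0, by omega⟩, ?_, fun j => hi.2 j.succ⟩
    simp only [Fin.tail]
    omega
  · simp only [indexSet, Finset.mem_sigma, Finset.mem_Icc, Finset.mem_filter,
      Finset.Nat.mem_antidiagonalTuple] at hp
    simp only [indexSet, Finset.mem_filter, Finset.Nat.mem_antidiagonalTuple]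
    rw [Fin.sum_univ_succ]
    refine ⟨?_, fun j => ?_⟩
    · simp only [Fin.cons_zero, Fin.cons_succ]
      omega
    · refine Fin.cases ?_ (fun j => ?_) j
      · exact hp.1.1
      · exact hp.2.2 j

theorem sum_indexSet_zero {M : Type*} [AddCommMonoid M] (n : ℕ) (φ : (Fin 0 → ℕ) → M) :
    ∑ i ∈ indexSet n 0, φ i = if n = 0 then φ Fin.elim0 else 0 := by
  rcases n with _ | n
  · simp [indexSet]
    congr
  · simp [indexSet]

/-- The nested integral of the sum over the index set is the operator `opW`, defined by recursion. The
operators `O j` in front are those already pulled out of the integrals in the induction. -/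
theorem iterInt_sum_prodG {f : ℝ → ℝ} (hf : SmoothGrowth c f) (t : ℝ) (r : ℕ) {ι : Type}
    (S : Finset ι) (O : ι → Unit → (ℝ → ℝ) → ℝ → ℝ) (hO : ∀ j, IsTameOp c (O j)) (n : ι → ℕ)
    (a x : ℝ) :
    iterInt T r a (fun s => ∑ j ∈ S, O j () (fun y => ∑ i ∈ indexSet (n j) r,
      D.prodG t r i s f y) x) = ∑ j ∈ S, O j () (D.opW t f r (n j) a) x := by
  induction r generalizing ι a with
  | zero =>
    simp only [iterInt, sum_indexSet_zero, prodG, opW]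
    refine Finset.sum_congr rfl fun j _ => ?_
    congr 1
    ext y
    split_ifs <;> rfl
  | succ r ih =>
    have hI : ∀ n, TameFamily c fun s x =>
        ∑ k ∈ Finset.Icc 1 n, D.opG k t s (D.opW t f r (n - k) s) x := fun n =>
      (D.tame_opW_integrand (u := fun _ => f)
        (fun n => D.tame_opW (TameFamily.const hf) r n) n).comp (φ := fun s => (t, s)) (by fun_prop)
    have hG : ∀ k s, IsTameOp c fun _ : Unit => D.opG k t s := fun k s =>
      (D.isTameOp_opG k).comp_param (φ := fun _ : Unit => (t, s)) measurable_const
    have hP : ∀ m (s' : Fin r → ℝ), SmoothGrowth c fun y =>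
        ∑ i ∈ indexSet m r, D.prodG t r i s' f y := fun m s' =>
      (TameFamily.sum _ fun i _ => (D.smoothGrowth_prodG i hf t s').tame).smoothGrowth ()
    simp only [iterInt]
    have e : ∀ s, iterInt T r s (fun v => ∑ j ∈ S, O j () (fun y => ∑ i ∈ indexSet (n j) (r + 1),
        D.prodG t (r + 1) i (Fin.cons s v) f y) x) = ∑ j ∈ S, O j () (fun y =>
          ∑ k ∈ Finset.Icc 1 (n j), D.opG k t s (D.opW t f r (n j - k) s) y) x := by
      intro s
      have h1 := ih (S.sigma fun j => Finset.Icc 1 (n j))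
        (fun p _ g => O p.1 () (D.opG p.2 t s g)) (fun p => (hO p.1).compOp (hG p.2 s))
        (fun p => n p.1 - p.2) s
      simp only [Finset.sum_sigma] at h1
      calc _ = _ := ?_
        _ = _ := h1
        _ = _ := ?_
      · congr 1
        ext v
        refine Finset.sum_congr rfl fun j _ => ?_
        rw [← (hO j).map_sum _ (fun k _ => (hG k s).smoothGrowth (hP _ _) ())]
        congr 1
        ext y
        rw [sum_indexSet_succ]
        refine Finset.sum_congr rfl fun k _ => ?_
        rw [(hG k s).map_sum _ (fun i _ => D.smoothGrowth_prodG i hf t v) ()]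
        simp [prodG]
      · refine Finset.sum_congr rfl fun j _ => ?_
        rw [← (hO j).map_sum _ (fun k _ => (hG k s).smoothGrowth
          ((D.tame_opW_fixed hf t r _).smoothGrowth s) ())]
    simp only [e]
    rw [intervalIntegral.integral_finsetSum]
    · refine Finset.sum_congr rfl fun j _ => ?_
      rw [← (hO j).map_intervalIntegral (hI (n j))]
      rfl
    · intro j _
      exact ((hO j).tame' (hI (n j)) (φ := fun _ => ()) measurable_const).intervalIntegrable _ _ x

/-- The operator `ℒ_n` as the sum of iterated integrals that defines it. -/
theorem opL_eq_sum_iterInt {f : ℝ → ℝ} (hf : SmoothGrowth c f) {n : ℕ} (hn : 1 ≤ n) (t a x : ℝ) :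
    D.opL n t a f x = ∑ r ∈ Finset.Icc 1 n, iterInt T r a fun s =>
      ∑ i ∈ indexSet n r, D.prodG t r i s f x := by
  have h : ∀ r, iterInt T r a (fun s => ∑ i ∈ indexSet n r, D.prodG t r i s f x) =
      D.opW t f r n a x := fun r => by
    simpa using D.iterInt_sum_prodG hf t r (Finset.univ : Finset Unit) (fun _ _ g => g)
      (fun _ => IsTameOp.ident) (fun _ => n) a x
  simp only [h, opL]
  symm
  refine Finset.sum_subset (fun r hr => ?_) fun r hr hr' => ?_
  · simp only [Finset.mem_Icc, Finset.mem_range] at *; omega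
  · have : r = 0 := by simp only [Finset.mem_Icc, Finset.mem_range] at *; omega
    subst this
    simp [opW, Nat.one_le_iff_ne_zero.1 hn]

end ExpansionOps

/-! ### Jump operators -/

/-- A measurable weight `w` on the jump sizes, integrable for `ν`, that controls the integrands of
all jump operators on tame functions. Dividing by `w` turns these into uniformly tame families of
operators, averaged over the finite measure `w ν`. -/
structure IsLevyWeight (c : ℝ) (ν : Measure ℝ) (w : ℝ → ℝ≥0) : Prop where
  meas : Measurable w
  lintegral_lt_top : ∫⁻ z, w z ∂ν < ⊤
  bound : ∀ K, ∃ C : ℝ, 0 ≤ C ∧ ∀ z, w z ≠ 0 → min |z| (z ^ 2) * (1 + expWeight c K z) ≤ C * w z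
  exp_bound : ∃ C : ℝ, 0 ≤ C ∧ ∀ z, w z ≠ 0 → |Real.exp z - 1 - z| ≤ C * w z
  ae_ne_zero : ∀ᵐ z ∂ν, w z = 0 → z = 0

theorem IsLevyWeight.mono {c : ℝ} {ν ν' : Measure ℝ} {w : ℝ → ℝ≥0} (hw : IsLevyWeight c ν w)
    (h : ν' ≤ ν) : IsLevyWeight c ν' w :=
  ⟨hw.meas, (lintegral_mono' h le_rfl).trans_lt hw.lintegral_lt_top, hw.bound, hw.exp_bound,
    (Measure.absolutelyContinuous_of_le h).ae_le hw.ae_ne_zero⟩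

theorem abs_sub_le_of_deriv_bound {f : ℝ → ℝ} (hf : Differentiable ℝ f) {x z S : ℝ}
    (hS : ∀ v, |v| ≤ |z| → |deriv f (x + v)| ≤ S) : |f (x + z) - f x| ≤ S * |z| := by
  have := Convex.norm_image_sub_le_of_norm_hasDerivWithin_le (f := f) (f' := deriv f) (C := S)
    (s := Set.uIcc x (x + z)) (x := x) (y := x + z)
    (fun y _ => (hf y).hasDerivAt.hasDerivWithinAt) (fun y hy => ?_) (convex_uIcc _ _)
    Set.left_mem_uIcc Set.right_mem_uIcc
  · simpa using this
  · have h1 := Set.abs_sub_left_of_mem_uIcc hy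
    have := hS (y - x) (by simpa using h1)
    simpa using this

theorem abs_sub_sub_le_of_deriv_bound {f : ℝ → ℝ} (hf : ContDiff ℝ 2 f) {x z S : ℝ}
    (hS : ∀ v, |v| ≤ |z| → |deriv (deriv f) (x + v)| ≤ S) :
    |f (x + z) - f x - z * deriv f x| ≤ S * z ^ 2 := by
  have hd : Differentiable ℝ f := hf.differentiable (by norm_num)
  have hd' : Differentiable ℝ (deriv f) :=
    ((contDiff_succ_iff_deriv (n := 1)).1 (by exact_mod_cast hf)).2.2.differentiable (by norm_num)
  have hg : Differentiable ℝ fun y => f y - y * deriv f x := by fun_prop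
  have := abs_sub_le_of_deriv_bound hg (x := x) (z := z) (S := S * |z|) fun v hv => ?_
  · rw [mul_assoc, abs_mul_abs_self, ← sq] at this
    calc _ = _ := by congr 1; ring
      _ ≤ _ := this
  · have e : deriv (fun y => f y - y * deriv f x) (x + v) = deriv f (x + v) - deriv f x := by
      rw [deriv_fun_sub (hd _) (by fun_prop)]
      simp
    rw [e]
    have h1 := abs_sub_le_of_deriv_bound hd' (x := x) (z := v) (S := S)
      fun v' hv' => hS v' (hv'.trans hv)
    have hS0 : 0 ≤ S := (abs_nonneg _).trans (hS 0 (by simp))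
    exact h1.trans (mul_le_mul_of_nonneg_left hv hS0)

/-- The jump operators `f ↦ ((f(x + z) - f(x)) α(z) - β(z) f'(x)) / w(z)`. -/
noncomputable def incrOp (w : ℝ → ℝ≥0) (α β : ℝ → ℝ) (z : ℝ) (f : ℝ → ℝ) (x : ℝ) : ℝ :=
  ((f (x + z) - f x) * α z - β z * deriv f x) / w z

/-- The compensated jump operators `f ↦ (f(x + z) - f(x) - z f'(x)) / w(z)`. -/
noncomputable def jumpOp (w : ℝ → ℝ≥0) : ℝ → (ℝ → ℝ) → ℝ → ℝ := incrOp w (fun _ => 1) fun z => z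

/-- The operators `f ↦ (f(x + z) - f(x)) z / w(z)`. -/
noncomputable def jumpMulOp (w : ℝ → ℝ≥0) : ℝ → (ℝ → ℝ) → ℝ → ℝ := incrOp w (fun z => z) fun _ => 0

/-- Jump operators that are bounded, uniformly in the jump size, on functions whose derivatives up
to order two have the growth `(1 + |x|)^K e^{cx}`. -/
def IncrBound (c : ℝ) (w : ℝ → ℝ≥0) (α β : ℝ → ℝ) : Prop :=
  ∀ K, ∃ C : ℝ, 0 ≤ C ∧ ∀ f : ℝ → ℝ, ContDiff ℝ 2 f → ∀ A : ℝ, 0 ≤ A →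
    (∀ i ≤ 2, ∀ x, |iteratedDeriv i f x| ≤ A * expWeight c K x) →
    ∀ z x, |incrOp w α β z f x| ≤ C * (A * expWeight c K x)

theorem expWeight_le_of_abs_le_one (c : ℝ) (K : ℕ) {v : ℝ} (hv : |v| ≤ 1) :
    expWeight c K v ≤ 2 ^ K * Real.exp |c| := by
  unfold expWeight
  have h1 : c * v ≤ |c| := by
    calc c * v ≤ |c * v| := le_abs_self _
      _ = |c| * |v| := abs_mul _ _
      _ ≤ |c| * 1 := by gcongr
      _ = _ := mul_one _
  gcongr
  linarith

theorem min_abs_sq_of_abs_le_one {z : ℝ} (h : |z| ≤ 1) : min |z| (z ^ 2) = z ^ 2 := by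
  rw [← sq_abs]
  exact min_eq_right (by nlinarith [abs_nonneg z])

theorem min_abs_sq_of_one_le_abs {z : ℝ} (h : 1 ≤ |z|) : min |z| (z ^ 2) = |z| := by
  rw [← sq_abs]
  exact min_eq_left (by nlinarith [abs_nonneg z])

theorem min_abs_sq_nonneg (z : ℝ) : 0 ≤ min |z| (z ^ 2) := le_min (abs_nonneg _) (sq_nonneg _)

/-- To bound a jump operator it suffices to bound its numerator, for small and for large jumps. -/
theorem incrBound_of {c : ℝ} {ν : Measure ℝ} {w : ℝ → ℝ≥0} (hw : IsLevyWeight c ν w) {α β : ℝ → ℝ}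
    (hsmall : ∀ f : ℝ → ℝ, ContDiff ℝ 2 f → ∀ z x S, |z| ≤ 1 →
      (∀ v, |v| ≤ 1 → |deriv f (x + v)| ≤ S) → (∀ v, |v| ≤ 1 → |deriv (deriv f) (x + v)| ≤ S) →
      |(f (x + z) - f x) * α z - β z * deriv f x| ≤ S * z ^ 2)
    (hlarge : ∀ z, 1 ≤ |z| → |α z| ≤ |z| ∧ |β z| ≤ |z|) : IncrBound c w α β := by
  intro K
  obtain ⟨C, hC, hb⟩ := hw.bound K
  refine ⟨(2 ^ K * Real.exp |c| + 2) * C, by positivity, fun f hf A hA h z x => ?_⟩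
  have hx := expWeight_nonneg c K x
  by_cases hz : w z = 0
  · simp only [incrOp, hz, NNReal.coe_zero, div_zero, abs_zero]
    positivity
  have hwz : (0 : ℝ) < w z := NNReal.coe_pos.2 (pos_iff_ne_zero.2 hz)
  rw [incrOp, abs_div, abs_of_pos hwz, div_le_iff₀ hwz]
  have key : |(f (x + z) - f x) * α z - β z * deriv f x| ≤
      (2 ^ K * Real.exp |c| + 2) * (A * expWeight c K x) *
        (min |z| (z ^ 2) * (1 + expWeight c K z)) := by
    have hz0 := expWeight_nonneg c K z
    have h0 := fun x => h 0 (by norm_num) x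
    have h1 := fun x => h 1 (by norm_num) x
    have h2 := fun x => h 2 le_rfl x
    simp only [iteratedDeriv_zero] at h0
    simp only [iteratedDeriv_one] at h1
    simp only [iteratedDeriv_succ, iteratedDeriv_zero] at h2
    rcases le_total |z| 1 with hz1 | hz1
    · rw [min_abs_sq_of_abs_le_one hz1]
      have hv : ∀ v, |v| ≤ 1 → A * expWeight c K (x + v) ≤
          (2 ^ K * Real.exp |c|) * (A * expWeight c K x) := fun v hv => by
        calc A * expWeight c K (x + v) ≤ A * (expWeight c K x * (2 ^ K * Real.exp |c|)) := by
              refine mul_le_mul_of_nonneg_left ((expWeight_add_le c K x v).trans ?_) hA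
              exact mul_le_mul_of_nonneg_left (expWeight_le_of_abs_le_one c K hv) hx
          _ = _ := by ring
      refine (hsmall f hf z x _ hz1 (fun v h => (h1 _).trans (hv v h))
        (fun v h => (h2 _).trans (hv v h))).trans ?_
      have e : (0 : ℝ) ≤ A * expWeight c K x := by positivity
      have e' : (0 : ℝ) ≤ 2 ^ K * Real.exp |c| := by positivity
      calc _ ≤ (2 ^ K * Real.exp |c| + 2) * (A * expWeight c K x) * (z ^ 2 * 1) := by
            rw [mul_one]; gcongr; linarith
        _ ≤ _ := by gcongr; linarith
    · rw [min_abs_sq_of_one_le_abs hz1]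
      obtain ⟨hα, hβ⟩ := hlarge z hz1
      have e1 : |f (x + z)| ≤ A * expWeight c K x * expWeight c K z := by
        refine (h0 _).trans ?_
        rw [mul_assoc]
        exact mul_le_mul_of_nonneg_left (expWeight_add_le c K x z) hA
      have e2 := h0 x
      have e3 := h1 x
      have e : (0 : ℝ) ≤ A * expWeight c K x := by positivity
      calc |(f (x + z) - f x) * α z - β z * deriv f x|
          ≤ (|f (x + z)| + |f x|) * |z| + |z| * |deriv f x| := by
            refine (abs_sub _ _).trans ?_
            rw [abs_mul, abs_mul]
            gcongr
            exact abs_sub _ _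
        _ ≤ (A * expWeight c K x * expWeight c K z + A * expWeight c K x) * |z| +
              |z| * (A * expWeight c K x) := by gcongr
        _ ≤ 2 * (A * expWeight c K x) * (|z| * (1 + expWeight c K z)) := by
            have : 0 ≤ A * expWeight c K x * expWeight c K z * |z| := by positivity
            linarith
        _ ≤ _ := by
            have : (0 : ℝ) ≤ 2 ^ K * Real.exp |c| := by positivity
            gcongr
            linarith
  refine key.trans ?_
  calc _ ≤ (2 ^ K * Real.exp |c| + 2) * (A * expWeight c K x) * (C * w z) :=
        mul_le_mul_of_nonneg_left (hb z hz) (by positivity)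
    _ = _ := by ring

theorem incrBound_jumpOp {c : ℝ} {ν : Measure ℝ} {w : ℝ → ℝ≥0} (hw : IsLevyWeight c ν w) :
    IncrBound c w (fun _ => 1) fun z => z := by
  refine incrBound_of hw (fun f hf z x S hz _ h2 => ?_) fun z hz => ⟨by simpa using hz, le_rfl⟩
  rw [mul_one]
  exact abs_sub_sub_le_of_deriv_bound hf fun v hv => h2 v (hv.trans hz)

theorem incrBound_jumpMulOp {c : ℝ} {ν : Measure ℝ} {w : ℝ → ℝ≥0} (hw : IsLevyWeight c ν w) :
    IncrBound c w (fun z => z) fun _ => 0 := by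
  refine incrBound_of hw (fun f hf z x S hz h1 _ => ?_) fun z hz => ⟨le_rfl, by simp⟩
  have := abs_sub_le_of_deriv_bound (hf.differentiable (by norm_num)) (x := x) (z := z) (S := S)
    fun v hv => h1 v (hv.trans hz)
  rw [zero_mul, sub_zero, abs_mul, ← sq_abs z, sq, ← mul_assoc]
  gcongr

theorem TameFamily.bound_le {c : ℝ} {Q : Type} [MeasurableSpace Q] {F : Q → ℝ → ℝ}
    (hF : TameFamily c F) (n : ℕ) : ∃ (C : ℝ) (K : ℕ), 0 ≤ C ∧ ∀ j ≤ n, ∀ q x,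
      |_root_.iteratedDeriv j (F q) x| ≤ C * expWeight c K x := by
  choose C K hC h using hF.bound
  refine ⟨∑ j ∈ Finset.range (n + 1), C j, (Finset.range (n + 1)).sup K,
    Finset.sum_nonneg fun j _ => hC j, fun j hj q x => (h j q x).trans ?_⟩
  have hj' : j ∈ Finset.range (n + 1) := Finset.mem_range.2 (by omega)
  exact mul_le_mul (Finset.single_le_sum (f := C) (fun j _ => hC j) hj')
    (expWeight_mono c (Finset.le_sup hj') x) (expWeight_nonneg _ _ _)
    (Finset.sum_nonneg fun j _ => hC j)

theorem isTransOp_incrOp {c : ℝ} {w : ℝ → ℝ≥0} (hw : Measurable w) {α β : ℝ → ℝ}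
    (hα : Measurable α) (hβ : Measurable β) (h : IncrBound c w α β) :
    IsTransOp c (incrOp w α β) where
  tame {Q _ F} hF := by
    have := TameFamily.of_ladder (c := c) (Q := ℝ × Q)
      (G := fun j p => incrOp w α β p.1 (iteratedDeriv j (F p.2))) (fun j p x => ?_)
      (fun j => ?_) (fun x => ?_)
    · simpa using this
    · have h1 := hF.hasDerivAt_iteratedDeriv j p.2
      have h2 := hF.hasDerivAt_iteratedDeriv (j + 1) p.2 x
      have e : ∀ j, deriv (iteratedDeriv j (F p.2)) = iteratedDeriv (j + 1) (F p.2) := fun j =>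
        iteratedDeriv_succ.symm
      have e' : incrOp w α β p.1 (iteratedDeriv j (F p.2)) = fun y =>
          ((iteratedDeriv j (F p.2) (y + p.1) - iteratedDeriv j (F p.2) y) * α p.1 -
            β p.1 * iteratedDeriv (j + 1) (F p.2) y) / w p.1 := by
        ext y; rw [incrOp, e]
      rw [e', incrOp, e]
      exact ((((h1 (x + p.1)).comp_add_const x p.1).sub (h1 x)).mul_const _ |>.sub
        (h2.const_mul _)).div_const _
    · obtain ⟨A, K, hA, hb⟩ := (hF.iteratedDeriv j).bound_le 2
      obtain ⟨C, hC, hc⟩ := h K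
      refine ⟨C * A, K, fun p x => ?_⟩
      rw [mul_assoc]
      exact hc _ (by exact_mod_cast contDiff_infty.1 ((hF.iteratedDeriv j).contDiff p.2) 2) A hA
        (fun i hi x => hb i hi p.2 x) _ _
    · simp only [iteratedDeriv_zero, incrOp]
      have h1 : Measurable fun p : ℝ × Q => F p.2 (x + p.1) :=
        hF.measurable_uncurry.comp (measurable_snd.prodMk (measurable_const.add measurable_fst))
      have h2 : Measurable fun p : ℝ × Q => F p.2 x := (hF.meas x).comp measurable_snd
      have h3 : Measurable fun p : ℝ × Q => deriv (F p.2) x :=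
        (hF.measurable_deriv x).comp measurable_snd
      exact (((h1.sub h2).mul (hα.comp measurable_fst)).sub
        ((hβ.comp measurable_fst).mul h3)).div (hw.comp measurable_fst).coe_nnreal_real
  integral {Q _ F} hF μ _ z x := by
    have h1 := (IsTameOp.derivOp (c := c) (P := Unit)).integral hF μ () x
    simp only [incrOp] at h1 ⊢
    rw [h1, ← integral_sub (hF.integrable μ _) (hF.integrable μ _), ← integral_mul_const,
      ← integral_const_mul, ← integral_sub, integral_div]
    · exact ((hF.integrable μ _).sub (hF.integrable μ _)).mul_const _
    · exact (hF.deriv.integrable μ _).const_mul _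
  add hf hg z x := by
    simp only [incrOp]
    rw [deriv_fun_add (hf.differentiable x) (hg.differentiable x)]
    ring
  smul hf a z x := by
    simp only [incrOp]
    rw [deriv_const_mul _ (hf.differentiable x)]
    ring
  shift {f} hf z y x := by
    simp only [incrOp]
    rw [deriv_comp_add_const f y x, show x + z + y = x + y + z by ring]
  deriv {f} hf z x := by
    simp only [incrOp]
    have h1 := fun y => (hf.differentiable y).hasDerivAt
    have h2 := (hf.deriv.differentiable x).hasDerivAt
    symm
    exact (((((h1 (x + z)).comp_add_const x z).sub (h1 x)).mul_const _ |>.sub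
        (h2.const_mul _)).div_const _).deriv

theorem isTransOp_jumpOp {c : ℝ} {ν : Measure ℝ} {w : ℝ → ℝ≥0} (hw : IsLevyWeight c ν w) :
    IsTransOp c (jumpOp w) :=
  isTransOp_incrOp hw.meas measurable_const measurable_id (incrBound_jumpOp hw)

theorem isTransOp_jumpMulOp {c : ℝ} {ν : Measure ℝ} {w : ℝ → ℝ≥0} (hw : IsLevyWeight c ν w) :
    IsTransOp c (jumpMulOp w) :=
  isTransOp_incrOp hw.meas measurable_id measurable_const (incrBound_jumpMulOp hw)

/-- Jump operators commute with operators that are invariant under translations. -/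
theorem jumpOp_comm {c : ℝ} (w : ℝ → ℝ≥0) {P : Type} [MeasurableSpace P]
    {X : P → (ℝ → ℝ) → ℝ → ℝ} (hX : IsTransOp c X) {f : ℝ → ℝ} (hf : SmoothGrowth c f) (z : ℝ)
    (p : P) (x : ℝ) : jumpOp w z (X p f) x = X p (jumpOp w z f) x := by
  have e : jumpOp w z f = fun y => (w z : ℝ)⁻¹ * (f (y + z) - f y - z * deriv f y) := by
    ext y; simp only [jumpOp, incrOp]; ring
  have h1 := hf.comp_add z
  have h2 := hf.deriv.const_mul z
  rw [e, hX.smul ((h1.sub hf).sub h2), hX.map_sub (h1.sub hf) h2, hX.map_sub h1 hf,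
    hX.smul hf.deriv, hX.shift hf, hX.deriv hf]
  simp only [jumpOp, incrOp]
  ring

theorem jumpOp_mulX {f : ℝ → ℝ} (hf : Differentiable ℝ f) (w : ℝ → ℝ≥0) (z x : ℝ) :
    jumpOp w z (fun y => y * f y) x = x * jumpOp w z f x + jumpMulOp w z f x := by
  have : deriv (fun y => y * f y) x = f x + x * deriv f x := by
    rw [deriv_fun_mul differentiableAt_fun_id (hf x)]
    simp
  simp only [jumpOp, jumpMulOp, incrOp, this]
  ring

/-- The finite kernel `w ν_t`, for `0 ≤ t ≤ T`. -/
noncomputable def levyKernel (T : ℝ) (w : ℝ → ℝ≥0) (hw : Measurable w) (κ : Kernel ℝ ℝ) :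
    Kernel ℝ ℝ where
  toFun t := if t ∈ Set.Icc 0 T then (κ t).withDensity (fun z => (w z : ℝ≥0∞)) else 0
  measurable' := by
    classical
    refine Measurable.ite measurableSet_Icc ?_ measurable_const
    refine Measure.measurable_of_measurable_coe _ fun s hs => ?_
    have : ∀ t, (κ t).withDensity (fun z => (w z : ℝ≥0∞)) s =
        ∫⁻ z, s.indicator (fun z => (w z : ℝ≥0∞)) z ∂(κ t) := fun t => by
      rw [withDensity_apply _ hs, lintegral_indicator hs]
    simp only [this]
    exact (hw.coe_nnreal_ennreal.indicator hs).lintegral_kernel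

theorem le_supMeasure (T : ℝ) (κ : Kernel ℝ ℝ) {t : ℝ} (ht : t ∈ Set.Icc 0 T) :
    κ t ≤ supMeasure T κ := le_iSup₂_of_le t ht le_rfl

variable {c T : ℝ} {κ : Kernel ℝ ℝ} {w : ℝ → ℝ≥0}

theorem levyKernel_apply (hw : Measurable w) {t : ℝ} (ht : t ∈ Set.Icc 0 T) :
    levyKernel T w hw κ t = (κ t).withDensity fun z => (w z : ℝ≥0∞) := by
  change (if t ∈ Set.Icc 0 T then _ else _) = _
  rw [if_pos ht]

theorem levyKernel_apply_of_notMem (hw : Measurable w) {t : ℝ} (ht : t ∉ Set.Icc 0 T) :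
    levyKernel T w hw κ t = 0 := by
  change (if t ∈ Set.Icc 0 T then _ else _) = _
  rw [if_neg ht]

/-- The finite measure that dominates all `w ν_t`. -/
theorem levyKernel_le (hw : Measurable w) (t : ℝ) :
    levyKernel T w hw κ t ≤ (supMeasure T κ).withDensity fun z => (w z : ℝ≥0∞) := by
  by_cases ht : t ∈ Set.Icc 0 T
  · rw [levyKernel_apply hw ht]
    refine Measure.le_iff.2 fun s hs => ?_
    rw [withDensity_apply _ hs, withDensity_apply _ hs]
    exact lintegral_mono' (Measure.restrict_mono_measure (le_supMeasure T κ ht) s) le_rfl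
  · rw [levyKernel_apply_of_notMem hw ht]
    exact Measure.zero_le _

theorem isFiniteKernel_levyKernel (hw : IsLevyWeight c (supMeasure T κ) w) :
    IsFiniteKernel (levyKernel T w hw.meas κ) := by
  refine ⟨⟨∫⁻ z, w z ∂(supMeasure T κ), hw.lintegral_lt_top, fun t => ?_⟩⟩
  refine (levyKernel_le hw.meas t _).trans_eq ?_
  simp

theorem integral_levyKernel {F : Type*} [NormedAddCommGroup F] [NormedSpace ℝ F]
    (hw : IsLevyWeight c (supMeasure T κ) w) {t : ℝ} (ht : t ∈ Set.Icc 0 T) {g : ℝ → F}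
    (hg : g 0 = 0) :
    ∫ z, g z ∂(κ t) = ∫ z, ((w z : ℝ)⁻¹) • g z ∂(levyKernel T w hw.meas κ t) := by
  rw [levyKernel_apply hw.meas ht, integral_withDensity_eq_integral_smul hw.meas]
  refine integral_congr_ae ?_
  filter_upwards [(Measure.absolutelyContinuous_of_le (le_supMeasure T κ ht)).ae_le hw.ae_ne_zero]
    with z hz
  by_cases h : w z = 0
  · simp [hz h, hg]
  · have : (w z : ℝ) ≠ 0 := by exact_mod_cast h
    rw [NNReal.smul_def, smul_smul, mul_inv_cancel₀ this, one_smul]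

/-! ### Weights and coefficients of an expansion -/

/-- A sequence of functions with finite integrals has a common multiple with a finite integral. -/
theorem exists_common_weight {α : Type*} [MeasurableSpace α] (ν : Measure α) (φ : ℕ → α → ℝ≥0∞)
    (hφ : ∀ k, Measurable (φ k)) (hI : ∀ k, ∫⁻ z, φ k z ∂ν < ⊤) :
    ∃ W : α → ℝ≥0∞, Measurable W ∧ ∫⁻ z, W z ∂ν < ⊤ ∧
      ∀ k, ∃ C : ℝ≥0, ∀ z, φ k z ≤ C * W z := by
  set J : ℕ → ℝ≥0 := fun k => (∫⁻ z, φ k z ∂ν).toNNReal + 1 with hJ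
  have hJ0 : ∀ k, J k ≠ 0 := fun k => by simp [hJ]
  set b : ℕ → ℝ≥0 := fun k => (1 / 2) ^ k / J k with hb
  have hb0 : ∀ k, b k ≠ 0 := fun k => by
    simp only [hb]; exact div_ne_zero (pow_ne_zero _ (by norm_num)) (hJ0 k)
  refine ⟨fun z => ∑' k, (b k : ℝ≥0∞) * φ k z,
    Measurable.tsum fun k => (hφ k).const_mul _, ?_, fun k => ⟨(b k)⁻¹, fun z => ?_⟩⟩
  · rw [lintegral_tsum fun k => ((hφ k).const_mul _).aemeasurable]
    have : ∀ k, ∫⁻ z, (b k : ℝ≥0∞) * φ k z ∂ν ≤ ((((1 / 2 : ℝ≥0) ^ k : ℝ≥0)) : ℝ≥0∞) := fun k => by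
      rw [lintegral_const_mul _ (hφ k)]
      have h1 : ∫⁻ z, φ k z ∂ν ≤ J k := by
        rw [hJ]
        push_cast
        rw [ENNReal.coe_toNNReal (hI k).ne]
        exact le_self_add
      calc (b k : ℝ≥0∞) * ∫⁻ z, φ k z ∂ν ≤ b k * J k := by gcongr
        _ = _ := by
          rw [← ENNReal.coe_mul]
          congr 1
          simp only [hb]
          exact div_mul_cancel₀ _ (hJ0 k)
    refine (ENNReal.tsum_le_tsum this).trans_lt ?_
    rw [← ENNReal.coe_tsum]
    · exact ENNReal.coe_lt_top
    · exact NNReal.summable_geometric (by rw [← NNReal.coe_lt_coe]; norm_num)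
  · calc φ k z = ((b k)⁻¹ : ℝ≥0) * (b k * φ k z) := by
          rw [← mul_assoc, ← ENNReal.coe_mul, inv_mul_cancel₀ (hb0 k)]; simp
      _ ≤ _ := by
          gcongr
          exact ENNReal.le_tsum (f := fun k => (b k : ℝ≥0∞) * φ k z) k

theorem integrable_levy_bound {c : ℝ} {ν : Measure ℝ} (hν : LevyCondition ν)
    (hm : ∀ k : ℕ, IntegrableOn (fun z : ℝ => |z| ^ k * Real.exp (c * z)) {z : ℝ | 1 ≤ |z|} ν)
    (K : ℕ) : Integrable (fun z => min |z| (z ^ 2) * (1 + expWeight c K z)) ν := by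
  have hs : MeasurableSet {z : ℝ | 1 ≤ |z|} := measurableSet_le measurable_const (by fun_prop)
  have hmeas : Measurable fun z => min |z| (z ^ 2) * (1 + expWeight c K z) := by
    have := (continuous_expWeight c K).measurable
    fun_prop
  rw [← integrableOn_univ, ← Set.union_compl_self {z : ℝ | 1 ≤ |z|}]
  refine IntegrableOn.union ?_ ?_
  · refine Integrable.mono' (g := fun z => min |z| (z ^ 2) + 2 ^ K * (|z| ^ (K + 1) *
      Real.exp (c * z))) (hν.1.integrableOn.add ((hm (K + 1)).const_mul _))
      hmeas.aestronglyMeasurable ?_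
    filter_upwards [ae_restrict_mem hs] with z hz
    have hz1 : 1 ≤ |z| := hz
    rw [Real.norm_eq_abs, abs_of_nonneg (mul_nonneg (min_abs_sq_nonneg z)
      (by linarith [expWeight_nonneg c K z])), min_abs_sq_of_one_le_abs hz1, mul_add, mul_one]
    refine add_le_add le_rfl ?_
    rw [expWeight]
    calc |z| * ((1 + |z|) ^ K * Real.exp (c * z)) ≤ |z| * ((2 * |z|) ^ K * Real.exp (c * z)) := by
          gcongr; linarith
      _ = _ := by ring
  · refine Integrable.mono' (g := fun z => (1 + 2 ^ K * Real.exp |c|) * min |z| (z ^ 2))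
      (hν.1.integrableOn.const_mul _) hmeas.aestronglyMeasurable ?_
    filter_upwards [ae_restrict_mem hs.compl] with z hz
    have hz1 : |z| ≤ 1 := (not_le.1 (show ¬ 1 ≤ |z| from hz)).le
    rw [Real.norm_eq_abs, abs_of_nonneg (mul_nonneg (min_abs_sq_nonneg z)
      (by linarith [expWeight_nonneg c K z])), mul_comm]
    exact mul_le_mul_of_nonneg_right (by linarith [expWeight_le_of_abs_le_one c K hz1])
      (min_abs_sq_nonneg z)

theorem integrable_exp_sub {ν : Measure ℝ} (hν : LevyCondition ν) :
    Integrable (fun z => |Real.exp z - 1 - z|) ν := by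
  have hs : MeasurableSet {z : ℝ | 1 ≤ |z|} := measurableSet_le measurable_const (by fun_prop)
  rw [← integrableOn_univ, ← Set.union_compl_self {z : ℝ | 1 ≤ |z|}]
  refine IntegrableOn.union ?_ ?_
  · refine Integrable.mono' (g := fun z => Real.exp z + 2 * min |z| (z ^ 2))
      (hν.2.add (hν.1.integrableOn.const_mul 2)) (by fun_prop) ?_
    filter_upwards [ae_restrict_mem hs] with z hz
    have hz1 : 1 ≤ |z| := hz
    rw [Real.norm_eq_abs, abs_abs, min_abs_sq_of_one_le_abs hz1]
    have h1 := Real.exp_pos z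
    rw [abs_le]
    constructor <;> linarith [neg_abs_le z, le_abs_self z]
  · refine Integrable.mono' (g := fun z => min |z| (z ^ 2))
      hν.1.integrableOn (by fun_prop) ?_
    filter_upwards [ae_restrict_mem hs.compl] with z hz
    have hz1 : |z| ≤ 1 := (not_le.1 (show ¬ 1 ≤ |z| from hz)).le
    rw [Real.norm_eq_abs, abs_abs, min_abs_sq_of_abs_le_one hz1]
    exact Real.abs_exp_sub_one_sub_id_le hz1

/-- The moments to be dominated are countably many, which is what makes a single weight possible. -/
theorem exists_isLevyWeight {c : ℝ} {ν : Measure ℝ} (hν : LevyCondition ν)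
    (hm : ∀ k : ℕ, IntegrableOn (fun z : ℝ => |z| ^ k * Real.exp (c * z)) {z : ℝ | 1 ≤ |z|} ν) :
    ∃ w, IsLevyWeight c ν w := by
  have hmin : ∀ K z, 0 ≤ min |z| (z ^ 2) * (1 + expWeight c K z) := fun K z =>
    mul_nonneg (min_abs_sq_nonneg z) (by linarith [expWeight_nonneg c K z])
  obtain ⟨W, hW, hWI, hb⟩ := exists_common_weight ν
    (fun k z => Nat.casesOn (motive := fun _ => ℝ≥0∞) k (ENNReal.ofReal |Real.exp z - 1 - z|)
      fun K => ENNReal.ofReal (min |z| (z ^ 2) * (1 + expWeight c K z)))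
    (fun k => by
      cases k with
      | zero => simp only; fun_prop
      | succ K =>
        have := (continuous_expWeight c K).measurable
        simp only; fun_prop)
    (fun k => by
      cases k with
      | zero => exact (integrable_exp_sub hν).lintegral_lt_top
      | succ K => exact (integrable_levy_bound hν hm K).lintegral_lt_top)
  have hreal : ∀ {x : ℝ} {C : ℝ≥0} {z : ℝ}, 0 ≤ x → (W z).toNNReal ≠ 0 →
      ENNReal.ofReal x ≤ C * W z → x ≤ C * (W z).toNNReal := by
    intro x C z hx hz h
    have hWz : W z ≠ ⊤ := fun h => hz (by simp [h])
    rw [← ENNReal.coe_toNNReal hWz, ← ENNReal.coe_mul, ENNReal.ofReal,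
      ENNReal.coe_le_coe, ← NNReal.coe_le_coe, Real.coe_toNNReal _ hx] at h
    exact_mod_cast h
  refine ⟨fun z => (W z).toNNReal, hW.ennreal_toNNReal, ?_, fun K => ?_, ?_, ?_⟩
  · exact (lintegral_mono fun z => ENNReal.coe_toNNReal_le_self).trans_lt hWI
  · obtain ⟨C, hC⟩ := hb (K + 1)
    exact ⟨C, C.2, fun z hz => hreal (hmin K z) hz (hC z)⟩
  · obtain ⟨C, hC⟩ := hb 0
    exact ⟨C, C.2, fun z hz => hreal (abs_nonneg _) hz (hC z)⟩
  · filter_upwards [ae_lt_top hW hWI.ne] with z hz h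
    obtain ⟨C, hC⟩ := hb 1
    have h0 : W z = 0 := by
      rcases (ENNReal.toNNReal_eq_zero_iff _).1 h with h | h
      · exact h
      · exact absurd h hz.ne
    have h1 : ENNReal.ofReal (min |z| (z ^ 2) * (1 + expWeight c 0 z)) ≤ C * W z := hC z
    simp only [h0, mul_zero, nonpos_iff_eq_zero, ENNReal.ofReal_eq_zero] at h1
    have h2 : min |z| (z ^ 2) ≤ 0 := by
      by_contra hlt
      have := mul_pos (not_le.1 hlt) (show 0 < 1 + expWeight c 0 z by
        linarith [expWeight_pos c 0 z])
      linarith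
    rcases min_le_iff.1 h2 with h | h
    · exact abs_nonpos_iff.1 h
    · exact pow_eq_zero_iff (two_ne_zero) |>.1 (le_antisymm h (sq_nonneg z))

theorem LevyCondition.add {ν ν' : Measure ℝ} (h : LevyCondition ν) (h' : LevyCondition ν') :
    LevyCondition (ν + ν') :=
  ⟨h.1.add_measure h'.1, h.2.add_measure h'.2⟩

/-- One weight serves finitely many measures. -/
theorem exists_isLevyWeight_finset {c : ℝ} {ι : Type*} (s : Finset ι) (ν : ι → Measure ℝ)
    (hν : ∀ i ∈ s, LevyCondition (ν i))
    (hm : ∀ i ∈ s, ∀ k : ℕ,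
      IntegrableOn (fun z : ℝ => |z| ^ k * Real.exp (c * z)) {z : ℝ | 1 ≤ |z|} (ν i)) :
    ∃ w, ∀ i ∈ s, IsLevyWeight c (ν i) w := by
  classical
  have h1 : LevyCondition (∑ i ∈ s, ν i) ∧ ∀ k : ℕ, IntegrableOn
      (fun z : ℝ => |z| ^ k * Real.exp (c * z)) {z : ℝ | 1 ≤ |z|} (∑ i ∈ s, ν i) := by
    induction s using Finset.induction_on with
    | empty => simp [LevyCondition, IntegrableOn]
    | insert i s hi ih =>
      obtain ⟨h1, h2⟩ := ih (fun j hj => hν j (Finset.mem_insert_of_mem hj))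
        (fun j hj => hm j (Finset.mem_insert_of_mem hj))
      simp only [Finset.sum_insert hi]
      refine ⟨(hν i (Finset.mem_insert_self _ _)).add h1, fun k => ?_⟩
      exact (hm i (Finset.mem_insert_self _ _) k).add_measure (h2 k)
  obtain ⟨w, hw⟩ := exists_isLevyWeight h1.1 h1.2
  exact ⟨w, fun i hi => hw.mono (Finset.single_le_sum (f := ν) (fun _ _ => Measure.zero_le _) hi)⟩

/-- A bounded function that is measurable on `[0, T]` agrees almost everywhere there with one that
is bounded and measurable on the line and vanishes off `[0, T]`. -/
theorem exists_bounded_representative {T : ℝ} {g : ℝ → ℝ}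
    (hg : MemLp g ⊤ (volume.restrict (Set.Icc (0 : ℝ) T))) :
    ∃ (q : ℝ → ℝ) (A : ℝ), Measurable q ∧ (∀ t, |q t| ≤ A) ∧ (∀ t, t ∉ Set.Icc 0 T → q t = 0) ∧
      ∀ᵐ t ∂(volume.restrict (Set.Icc (0 : ℝ) T)), g t = q t := by
  obtain ⟨A, hA⟩ : ∃ A, ∀ᵐ t ∂(volume.restrict (Set.Icc (0 : ℝ) T)), ‖g t‖ ≤ A := by
    have h := hg.2
    rw [eLpNorm_exponent_top] at h
    refine ⟨(eLpNormEssSup g (volume.restrict (Set.Icc (0 : ℝ) T))).toReal, ?_⟩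
    filter_upwards [ae_le_eLpNormEssSup (f := g) (μ := volume.restrict (Set.Icc (0 : ℝ) T))]
      with t ht
    rw [← toReal_enorm]
    exact ENNReal.toReal_mono h.ne ht
  set g' := hg.1.mk g with hg'
  have hm : Measurable g' := hg.1.stronglyMeasurable_mk.measurable
  refine ⟨(Set.Icc 0 T).indicator fun t => max (-|A|) (min (g' t) |A|), |A|, ?_, fun t => ?_,
    fun t ht => Set.indicator_of_notMem ht _, ?_⟩
  · exact (measurable_const.max (hm.min measurable_const)).indicator measurableSet_Icc
  · by_cases ht : t ∈ Set.Icc 0 T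
    · rw [Set.indicator_of_mem ht, abs_le]
      exact ⟨le_max_left _ _, max_le (by linarith [abs_nonneg A]) (min_le_right _ _)⟩
    · rw [Set.indicator_of_notMem ht]; simp
  · filter_upwards [hA, hg.1.ae_eq_mk, ae_restrict_mem measurableSet_Icc] with t h1 h2 h3
    rw [Set.indicator_of_mem h3, show g' t = g t from h2.symm]
    have := abs_le.1 (h1.trans (le_abs_self A))
    rw [min_eq_left this.2, max_eq_right this.1]

open Polynomial in
/-- The coefficients of polynomials of bounded degree are linear combinations of values. -/
theorem exists_bounded_coeff {T : ℝ} {p : ℝ → Polynomial ℝ} {d : ℕ}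
    (hd : ∀ t ∈ Set.Icc (0 : ℝ) T, (p t).natDegree ≤ d)
    (hp : ∀ x : ℝ, MemLp (fun t => (p t).eval x) ⊤ (volume.restrict (Set.Icc (0 : ℝ) T))) (k : ℕ) :
    ∃ (q : ℝ → ℝ) (A : ℝ), Measurable q ∧ (∀ t, |q t| ≤ A) ∧ (∀ t, t ∉ Set.Icc 0 T → q t = 0) ∧
      ∀ᵐ t ∂(volume.restrict (Set.Icc (0 : ℝ) T)), (p t).coeff k = q t := by
  refine exists_bounded_representative ?_
  have hinj : Set.InjOn (fun i : ℕ => (i : ℝ)) (Finset.range (d + 1)) :=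
    Nat.cast_injective.injOn
  have e : ∀ t ∈ Set.Icc (0 : ℝ) T, (p t).coeff k = ∑ i ∈ Finset.range (d + 1),
      (Lagrange.basis (Finset.range (d + 1)) (fun i : ℕ => (i : ℝ)) i).coeff k *
        (p t).eval (i : ℝ) := by
    intro t ht
    have h1 := Lagrange.eq_interpolate (f := p t) hinj (by
      rw [Finset.card_range]
      exact (degree_le_of_natDegree_le (hd t ht)).trans_lt
        (by exact_mod_cast Nat.lt_succ_self d))
    conv_lhs => rw [h1]
    rw [Lagrange.interpolate_apply, finsetSum_coeff]
    refine Finset.sum_congr rfl fun i _ => ?_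
    rw [coeff_C_mul, mul_comm]
  have h2 : MemLp (fun t => ∑ i ∈ Finset.range (d + 1),
      (Lagrange.basis (Finset.range (d + 1)) (fun i : ℕ => (i : ℝ)) i).coeff k *
        (p t).eval (i : ℝ)) ⊤ (volume.restrict (Set.Icc (0 : ℝ) T)) :=
    memLp_finsetSum _ fun i _ => (hp i).const_mul _
  refine h2.ae_eq ?_
  filter_upwards [ae_restrict_mem measurableSet_Icc] with t ht
  exact (e t ht).symm

/-! ### The operators of an expansion as tame operators -/

/-- The data of an expansion with the coefficients replaced by bounded measurable functions on the
line that vanish off `[0, T]` and agree with the given ones at almost every time, together with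
one weight for all jump measures. `α n k` and `β n k` stand for the coefficients of `x^k` in `a_n`
and `γ_n`. -/
structure ReducedData {N : ℕ} {T : ℝ} (E : PolynomialExpansion N T) (c : ℝ) where
  w : ℝ → ℝ≥0
  w_meas : Measurable w
  weight_p : ∀ n ≤ N, ∀ m ≤ E.M n, IsLevyWeight c (supMeasure T (E.νp n m)) w
  weight_m : ∀ n ≤ N, ∀ m ≤ E.M n, IsLevyWeight c (supMeasure T (E.νm n m)) w
  α : ℕ → ℕ → ℝ → ℝ
  β : ℕ → ℕ → ℝ → ℝ
  α_meas : ∀ n k, Measurable (α n k)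
  β_meas : ∀ n k, Measurable (β n k)
  α_bound : ∀ n k, ∃ A, ∀ t, |α n k t| ≤ A
  β_bound : ∀ n k, ∃ A, ∀ t, |β n k t| ≤ A
  α_supp : ∀ n k t, t ∉ Set.Icc 0 T → α n k t = 0
  β_supp : ∀ n k t, t ∉ Set.Icc 0 T → β n k t = 0
  α_ae : ∀ n ≤ N, ∀ᵐ t ∂(volume.restrict (Set.Icc (0 : ℝ) T)), ∀ k, (E.a n t).coeff k = α n k t
  β_ae : ∀ n ≤ N, ∀ᵐ t ∂(volume.restrict (Set.Icc (0 : ℝ) T)), ∀ k, (E.γ n t).coeff k = β n k t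
  deg : ℕ → ℕ
  deg_a : ∀ n ≤ N, ∀ t ∈ Set.Icc (0 : ℝ) T, (E.a n t).natDegree ≤ deg n
  deg_γ : ∀ n ≤ N, ∀ t ∈ Set.Icc (0 : ℝ) T, (E.γ n t).natDegree ≤ deg n
  deg_M : ∀ n, E.M n ≤ deg n

theorem nonempty_reducedData {N : ℕ} {T : ℝ} (E : PolynomialExpansion N T) {c : ℝ}
    (hc : E.ExpMoments c) : Nonempty (ReducedData E c) := by
  classical
  have hrep : ∀ p : ℕ → ℝ → Polynomial ℝ,
      (∀ n ≤ N, ∃ d : ℕ, ∀ t ∈ Set.Icc (0 : ℝ) T, (p n t).natDegree ≤ d) →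
      (∀ n ≤ N, ∀ x : ℝ,
        MemLp (fun t => (p n t).eval x) ⊤ (volume.restrict (Set.Icc (0 : ℝ) T))) →
      ∀ n k, ∃ (q : ℝ → ℝ) (A : ℝ), Measurable q ∧ (∀ t, |q t| ≤ A) ∧
        (∀ t, t ∉ Set.Icc 0 T → q t = 0) ∧
        (n ≤ N → ∀ᵐ t ∂(volume.restrict (Set.Icc (0 : ℝ) T)), (p n t).coeff k = q t) := by
    intro p hd hb n k
    by_cases hn : n ≤ N
    · obtain ⟨d, hd⟩ := hd n hn
      obtain ⟨q, A, h1, h2, h3, h4⟩ := exists_bounded_coeff hd (hb n hn) k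
      exact ⟨q, A, h1, h2, h3, fun _ => h4⟩
    · exact ⟨fun _ => 0, 0, measurable_const, by simp, by simp, fun h => absurd h hn⟩
  choose α Aα hα1 hα2 hα3 hα4 using hrep E.a E.a_degree E.a_bounded
  choose β Aβ hβ1 hβ2 hβ3 hβ4 using hrep E.γ E.γ_degree E.γ_bounded
  choose! da hda using E.a_degree
  choose! dγ hdγ using E.γ_degree
  obtain ⟨w, hw⟩ := exists_isLevyWeight_finset (c := c)
    (((Finset.range (N + 1)).sigma fun n => Finset.range (E.M n + 1)) ×ˢ (Finset.univ : Finset Bool))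
    (fun i => supMeasure T (if i.2 then E.νp i.1.1 i.1.2 else E.νm i.1.1 i.1.2))
    (fun i hi => by
      simp only [Finset.mem_product, Finset.mem_sigma, Finset.mem_range, Nat.lt_succ_iff] at hi
      split_ifs
      · exact E.νp_levy _ hi.1.1 _ hi.1.2
      · exact E.νm_levy _ hi.1.1 _ hi.1.2)
    (fun i hi k => by
      simp only [Finset.mem_product, Finset.mem_sigma, Finset.mem_range, Nat.lt_succ_iff] at hi
      split_ifs
      · exact (hc _ hi.1.1 _ hi.1.2 k).1
      · exact (hc _ hi.1.1 _ hi.1.2 k).2)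
  have hwp : ∀ n ≤ N, ∀ m ≤ E.M n, IsLevyWeight c (supMeasure T (E.νp n m)) w :=
    fun n hn m hm => by
      have := hw ⟨⟨n, m⟩, true⟩ (by simp; omega)
      simpa using this
  have hwm : ∀ n ≤ N, ∀ m ≤ E.M n, IsLevyWeight c (supMeasure T (E.νm n m)) w :=
    fun n hn m hm => by
      have := hw ⟨⟨n, m⟩, false⟩ (by simp; omega)
      simpa using this
  exact ⟨{
    w := w
    w_meas := (hwp 0 (Nat.zero_le _) 0 (Nat.zero_le _)).meas
    weight_p := hwp
    weight_m := hwm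
    α := α
    β := β
    α_meas := hα1
    β_meas := hβ1
    α_bound := fun n k => ⟨_, hα2 n k⟩
    β_bound := fun n k => ⟨_, hβ2 n k⟩
    α_supp := hα3
    β_supp := hβ3
    α_ae := fun n hn => ae_all_iff.2 fun k => hα4 n k hn
    β_ae := fun n hn => ae_all_iff.2 fun k => hβ4 n k hn
    deg := fun n => max (max (da n) (dγ n)) (E.M n)
    deg_a := fun n hn t ht =>
      (hda n hn t ht).trans ((le_max_left _ _).trans (le_max_left _ _))
    deg_γ := fun n hn t ht =>
      (hdγ n hn t ht).trans ((le_max_right _ _).trans (le_max_left _ _))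
    deg_M := fun n => le_max_right _ _ }⟩

namespace ReducedData

variable {N : ℕ} {T : ℝ} {E : PolynomialExpansion N T} {c : ℝ} (R : ReducedData E c)

/-- The finite kernel `w ν_{n,m}^+`. -/
noncomputable def kp (n m : ℕ) : Kernel ℝ ℝ :=
  if n ≤ N ∧ m ≤ E.M n then levyKernel T R.w R.w_meas (E.νp n m) else 0

/-- The finite kernel `w ν_{n,m}^-`. -/
noncomputable def km (n m : ℕ) : Kernel ℝ ℝ :=
  if n ≤ N ∧ m ≤ E.M n then levyKernel T R.w R.w_meas (E.νm n m) else 0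

instance (n m : ℕ) : IsFiniteKernel (R.kp n m) := by
  unfold kp
  split_ifs with h
  · exact isFiniteKernel_levyKernel (R.weight_p n h.1 m h.2)
  · infer_instance

instance (n m : ℕ) : IsFiniteKernel (R.km n m) := by
  unfold km
  split_ifs with h
  · exact isFiniteKernel_levyKernel (R.weight_m n h.1 m h.2)
  · infer_instance

theorem kp_apply_of_notMem (n m : ℕ) {t : ℝ} (ht : t ∉ Set.Icc 0 T) : R.kp n m t = 0 := by
  unfold kp
  split_ifs
  · exact levyKernel_apply_of_notMem _ ht
  · simp

theorem km_apply_of_notMem (n m : ℕ) {t : ℝ} (ht : t ∉ Set.Icc 0 T) : R.km n m t = 0 := by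
  unfold km
  split_ifs
  · exact levyKernel_apply_of_notMem _ ht
  · simp

theorem kp_eq_zero (n : ℕ) {m : ℕ} (hm : E.M n < m) : R.kp n m = 0 := by
  unfold kp; rw [if_neg (by omega)]

theorem km_eq_zero (n : ℕ) {m : ℕ} (hm : E.M n < m) : R.km n m = 0 := by
  unfold km; rw [if_neg (by omega)]

theorem km_zero_zero (t : ℝ) : R.km 0 0 t = 0 := by
  by_cases ht : t ∈ Set.Icc 0 T
  · unfold km
    rw [if_pos (by omega), levyKernel_apply _ ht, E.ν_zero_nonneg t ht]
    simp
  · exact R.km_apply_of_notMem 0 0 ht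

theorem weight_zero : IsLevyWeight c (supMeasure T (E.νp 0 0)) R.w :=
  R.weight_p 0 (Nat.zero_le _) 0 (Nat.zero_le _)

/-- `∫ g dν_{n,m}` for `g` of the form `w g'`. -/
noncomputable def lint (n m : ℕ) (t : ℝ) (g : ℝ → ℝ) : ℝ :=
  (∫ z, g z ∂(R.kp n m t)) - ∫ z, g z ∂(R.km n m t)

theorem levyInt_eq {n m : ℕ} (hn : n ≤ N) (hm : m ≤ E.M n) {t : ℝ} (ht : t ∈ Set.Icc 0 T)
    {g : ℝ → ℝ} (hg : g 0 = 0) : E.levyInt n m t g = R.lint n m t fun z => g z / R.w z := by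
  unfold PolynomialExpansion.levyInt lint kp km
  rw [if_pos ⟨hn, hm⟩, if_pos ⟨hn, hm⟩, integral_levyKernel (R.weight_p n hn m hm) ht hg,
    integral_levyKernel (R.weight_m n hn m hm) ht hg]
  simp only [smul_eq_mul, div_eq_inv_mul]

theorem lint_of_notMem (n m : ℕ) {t : ℝ} (ht : t ∉ Set.Icc 0 T) (g : ℝ → ℝ) :
    R.lint n m t g = 0 := by
  simp [lint, R.kp_apply_of_notMem n m ht, R.km_apply_of_notMem n m ht]

theorem lint_of_lt (n : ℕ) {m : ℕ} (hm : E.M n < m) (t : ℝ) (g : ℝ → ℝ) : R.lint n m t g = 0 := by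
  simp [lint, R.kp_eq_zero n hm, R.km_eq_zero n hm]

theorem measurable_lint (n m : ℕ) {g : ℝ → ℝ} (hg : Measurable g) :
    Measurable fun t => R.lint n m t g :=
  ((hg.comp measurable_snd).stronglyMeasurable.integral_kernel_prod_right'
      (f := fun p : ℝ × ℝ => g p.2) (κ := R.kp n m)).measurable.sub
    ((hg.comp measurable_snd).stronglyMeasurable.integral_kernel_prod_right'
      (f := fun p : ℝ × ℝ => g p.2) (κ := R.km n m)).measurable

theorem abs_integral_kernel_le {κ : Kernel ℝ ℝ} [IsFiniteKernel κ] {g : ℝ → ℝ} {C : ℝ}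
    (hg : ∀ z, |g z| ≤ C) (t : ℝ) : |∫ z, g z ∂(κ t)| ≤ C * (κ.bound).toReal := by
  have h1 := norm_integral_le_of_norm_le_const (μ := κ t) (f := g) (C := C)
    (Eventually.of_forall hg)
  have hC : 0 ≤ C := (abs_nonneg _).trans (hg 0)
  exact h1.trans (mul_le_mul_of_nonneg_left
    (ENNReal.toReal_mono (κ.bound_lt_top).ne (κ.measure_le_bound t _)) hC)

theorem lint_bound (n m : ℕ) {g : ℝ → ℝ} {C : ℝ} (hg : ∀ z, |g z| ≤ C) :
    ∃ A, ∀ t, |R.lint n m t g| ≤ A :=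
  ⟨_, fun t => (abs_sub _ _).trans
    (add_le_add (abs_integral_kernel_le hg t) (abs_integral_kernel_le hg t))⟩

/-- `∫ (e^z - 1 - z) ν_{n,m}(t, dz)`. -/
noncomputable def drift (n m : ℕ) (t : ℝ) : ℝ :=
  R.lint n m t fun z => (Real.exp z - 1 - z) / R.w z

theorem measurable_drift (n m : ℕ) : Measurable (R.drift n m) :=
  R.measurable_lint n m (by have := R.w_meas; fun_prop)

theorem drift_bound (n m : ℕ) : ∃ A, ∀ t, |R.drift n m t| ≤ A := by
  obtain ⟨C, hC, h⟩ := R.weight_zero.exp_bound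
  refine R.lint_bound n m (C := C) fun z => ?_
  by_cases hz : R.w z = 0
  · simpa [hz] using hC
  · have hwz : (0 : ℝ) < R.w z := NNReal.coe_pos.2 (pos_iff_ne_zero.2 hz)
    rw [abs_div, abs_of_pos hwz, div_le_iff₀ hwz]
    exact h z hz

theorem isTransOp_lint {X : ℝ → (ℝ → ℝ) → ℝ → ℝ} (hX : IsTransOp c X) (n m : ℕ) :
    IsTransOp c fun t f x => R.lint n m t fun z => X z f x :=
  ((hX.comp_param (measurable_snd (α := ℝ))).integralOp (R.kp n m)).subOp
    ((hX.comp_param (measurable_snd (α := ℝ))).integralOp (R.km n m))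

/-- The translation invariant operator that is the coefficient of `x^k` in `𝒜_n(t, x)`. -/
noncomputable def opB (n k : ℕ) (t : ℝ) (f : ℝ → ℝ) (x : ℝ) : ℝ :=
  R.α n k t * (deriv (deriv f) x - deriv f x) + R.β n k t * (deriv f x - f x) +
    (-(R.drift n k t) * deriv f x + R.lint n k t fun z => jumpOp R.w z f x)

/-- The commutator of `𝒜_0(t)` with multiplication by `x`. -/
noncomputable def opμ (t : ℝ) (f : ℝ → ℝ) (x : ℝ) : ℝ :=
  2 * R.α 0 0 t * deriv f x + (R.β 0 0 t - R.α 0 0 t - R.drift 0 0 t) * f x +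
    R.lint 0 0 t fun z => jumpMulOp R.w z f x

theorem isTransOp_opB (n k : ℕ) : IsTransOp c (R.opB n k) := by
  obtain ⟨A, hA⟩ := R.α_bound n k
  obtain ⟨B, hB⟩ := R.β_bound n k
  obtain ⟨C, hC⟩ := R.drift_bound n k
  have hd : IsTransOp c (P := ℝ) fun _ f => deriv f := IsTransOp.derivOp
  exact ((((hd.compOp hd).subOp hd).smulOp (R.α_meas n k) hA).addOp
    ((hd.subOp IsTransOp.ident).smulOp (R.β_meas n k) hB)).addOp
    ((hd.smulOp (R.measurable_drift n k).neg (A := C) (fun t => by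
      simpa using hC t)).addOp (R.isTransOp_lint (isTransOp_jumpOp R.weight_zero) n k))

theorem isTransOp_opμ : IsTransOp c R.opμ := by
  obtain ⟨A, hA⟩ := R.α_bound 0 0
  obtain ⟨B, hB⟩ := R.β_bound 0 0
  obtain ⟨C, hC⟩ := R.drift_bound 0 0
  have hd : IsTransOp c (P := ℝ) fun _ f => deriv f := IsTransOp.derivOp
  refine ((hd.smulOp (a := fun t => 2 * R.α 0 0 t) ((R.α_meas 0 0).const_mul 2) (A := 2 * A)
    fun t => ?_).addOp (IsTransOp.ident.smulOp
      (a := fun t => R.β 0 0 t - R.α 0 0 t - R.drift 0 0 t)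
      (((R.β_meas 0 0).sub (R.α_meas 0 0)).sub (R.measurable_drift 0 0)) (A := B + A + C)
      fun t => ?_)).addOp (R.isTransOp_lint (isTransOp_jumpMulOp R.weight_zero) 0 0)
  · rw [abs_mul, abs_two]; linarith [hA t]
  · refine (abs_sub _ _).trans (add_le_add ((abs_sub _ _).trans (add_le_add (hB t) (hA t))) (hC t))

theorem lint_comm {P : Type} [MeasurableSpace P] {X : P → (ℝ → ℝ) → ℝ → ℝ} (hX : IsTransOp c X)
    {f : ℝ → ℝ} (hf : SmoothGrowth c f) (n m : ℕ) (t : ℝ) (p : P) (x : ℝ) :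
    (R.lint n m t fun z => jumpOp R.w z (X p f) x) =
      X p (fun y => R.lint n m t fun z => jumpOp R.w z f y) x := by
  have h : TameFamily c fun z => jumpOp R.w z f :=
    (isTransOp_jumpOp R.weight_zero).toIsTameOp.tame' (TameFamily.const (Q := ℝ) hf) measurable_id
  simp only [lint, jumpOp_comm R.w hX hf]
  rw [hX.map_sub (h.integral _) (h.integral _), hX.integral h, hX.integral h]

theorem opB_comm {P : Type} [MeasurableSpace P] {X : P → (ℝ → ℝ) → ℝ → ℝ} (hX : IsTransOp c X)
    {f : ℝ → ℝ} (hf : SmoothGrowth c f) (n k : ℕ) (t : ℝ) (p : P) (x : ℝ) :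
    R.opB n k t (X p f) x = X p (R.opB n k t f) x := by
  have hd := hf.deriv
  have hdd := hd.deriv
  have hj : SmoothGrowth c fun x => R.lint n k t fun z => jumpOp R.w z f x :=
    (R.isTransOp_lint (isTransOp_jumpOp R.weight_zero) n k).toIsTameOp.smoothGrowth hf t
  have e : deriv (X p f) = X p (deriv f) := funext fun y => (hX.deriv hf p y).symm
  have e1 : R.opB n k t f = fun x => (R.α n k t * (deriv (deriv f) x - deriv f x) +
    R.β n k t * (deriv f x - f x)) + (-(R.drift n k t) * deriv f x +
      R.lint n k t fun z => jumpOp R.w z f x) := rfl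
  rw [e1, hX.add (((hdd.sub hd).const_mul _).add ((hd.sub hf).const_mul _))
    ((hd.const_mul _).add hj), hX.add ((hdd.sub hd).const_mul _) ((hd.sub hf).const_mul _),
    hX.add (hd.const_mul _) hj, hX.smul (hdd.sub hd), hX.smul (hd.sub hf), hX.smul hd,
    hX.map_sub hdd hd, hX.map_sub hd hf, ← R.lint_comm hX hf, opB, e, ← hX.deriv hd]

/-- The commutator of the zeroth order operator with multiplication by `x` is `μ`. -/
theorem opB_mulX {f : ℝ → ℝ} (hf : SmoothGrowth c f) (t x : ℝ) :
    R.opB 0 0 t (fun y => y * f y) x = x * R.opB 0 0 t f x + R.opμ t f x := by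
  have h1 : ∀ {g : ℝ → ℝ}, Differentiable ℝ g → ∀ x, HasDerivAt (fun y => y * g y)
      (g x + x * deriv g x) x := fun hg x => by
    simpa using (hasDerivAt_id x).fun_mul (hg x).hasDerivAt
  have d1 : deriv (fun y => y * f y) = fun x => f x + x * deriv f x :=
    funext fun x => (h1 hf.differentiable x).deriv
  have d2 : deriv (deriv (fun y => y * f y)) x = 2 * deriv f x + x * deriv (deriv f) x := by
    rw [d1, (((hf.differentiable x).hasDerivAt).fun_add (h1 hf.deriv.differentiable x)).deriv]
    ring
  have hj := (isTransOp_jumpOp R.weight_zero).toIsTameOp.tame' (TameFamily.const (Q := ℝ) hf)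
    measurable_id
  have hj' := (isTransOp_jumpMulOp R.weight_zero).toIsTameOp.tame' (TameFamily.const (Q := ℝ) hf)
    measurable_id
  have h3 : ∀ (κ : Kernel ℝ ℝ) [IsFiniteKernel κ],
      ∫ z, jumpOp R.w z (fun y => y * f y) x ∂(κ t) =
      x * (∫ z, jumpOp R.w z f x ∂(κ t)) + ∫ z, jumpMulOp R.w z f x ∂(κ t) := fun κ _ => by
    simp only [jumpOp_mulX hf.differentiable]
    rw [integral_add, integral_const_mul]
    · exact (hj.integrable (κ t) x).const_mul x
    · exact hj'.integrable (κ t) x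
  simp only [opB, opμ, lint, h3, d2]
  rw [d1]
  ring

/-- The operators of an expansion in the form in which the algebra uses them. -/
noncomputable def ops : ExpansionOps c T where
  A₀ := R.opB 0 0
  μ := R.opμ
  B := R.opB
  deg := R.deg
  tame_A₀ := R.isTransOp_opB 0 0
  trans_μ := R.isTransOp_opμ
  trans_B := R.isTransOp_opB
  supp_μ r hr f x := by
    simp [opμ, R.α_supp 0 0 r hr, R.β_supp 0 0 r hr, drift, R.lint_of_notMem 0 0 hr]
  supp_B n k r hr f x := by
    simp [opB, R.α_supp n k r hr, R.β_supp n k r hr, drift, R.lint_of_notMem n k hr]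
  comm_mulX hf r x := R.opB_mulX hf r x
  comm_trans {P _ X} hX {f} hf r p x := R.opB_comm hX hf 0 0 r p x

theorem levyInt_drift {n m : ℕ} (hn : n ≤ N) (hm : m ≤ E.M n) {t : ℝ} (ht : t ∈ Set.Icc 0 T) :
    E.levyInt n m t (fun z => Real.exp z - 1 - z) = R.drift n m t :=
  R.levyInt_eq hn hm ht (by simp)

theorem levyInt_jump {n m : ℕ} (hn : n ≤ N) (hm : m ≤ E.M n) {t : ℝ} (ht : t ∈ Set.Icc 0 T)
    (f : ℝ → ℝ) (x : ℝ) : E.levyInt n m t (fun z => f (x + z) - f x - z * deriv f x) =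
      R.lint n m t fun z => jumpOp R.w z f x := by
  rw [R.levyInt_eq hn hm ht (by simp)]
  simp [jumpOp, incrOp]

/-- At almost every time, the operators `𝒜_n(t)` are given by the reduced data. -/
theorem ae_A_eq {n : ℕ} (hn : n ≤ N) : ∀ᵐ t ∂(volume.restrict (Set.Icc (0 : ℝ) T)),
    ∀ f x, E.A n t f x = R.ops.opA n t f x := by
  filter_upwards [R.α_ae n hn, R.β_ae n hn, ae_restrict_mem measurableSet_Icc] with t hα hβ ht f x
  have e1 : ∑ m ∈ Finset.range (E.M n + 1), x ^ m *
        (-(E.levyInt n m t (fun z => Real.exp z - 1 - z)) * deriv f x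
          + E.levyInt n m t (fun z => f (x + z) - f x - z * deriv f x)) =
      ∑ m ∈ Finset.range (R.deg n + 1), x ^ m * (-(R.drift n m t) * deriv f x +
        R.lint n m t fun z => jumpOp R.w z f x) := by
    rw [← Finset.sum_subset (Finset.range_subset_range.2 (Nat.succ_le_succ (R.deg_M n)))]
    · refine Finset.sum_congr rfl fun m hm => ?_
      have hm' : m ≤ E.M n := by rw [Finset.mem_range] at hm; omega
      rw [R.levyInt_drift hn hm' ht, R.levyInt_jump hn hm' ht]
    · intro m _ hm
      have hm' : E.M n < m := by rw [Finset.mem_range] at hm; omega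
      simp [drift, R.lint_of_lt n hm']
  rw [PolynomialExpansion.A, e1, Polynomial.eval_eq_sum_range' (Nat.lt_succ_of_le (R.deg_a n hn t ht)),
    Polynomial.eval_eq_sum_range' (Nat.lt_succ_of_le (R.deg_γ n hn t ht)), ExpansionOps.opA,
    Finset.sum_mul, Finset.sum_mul, ← Finset.sum_add_distrib, ← Finset.sum_add_distrib]
  refine Finset.sum_congr rfl fun k _ => ?_
  rw [hα, hβ]
  change _ = x ^ k * R.opB n k t f x
  rw [opB]
  ring

theorem ae_a₀_eq : ∀ᵐ t ∂(volume.restrict (Set.Icc (0 : ℝ) T)), E.a₀ t = R.α 0 0 t := by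
  filter_upwards [R.α_ae 0 (Nat.zero_le _)] with t ht
  rw [PolynomialExpansion.a₀, ← ht 0, Polynomial.coeff_zero_eq_eval_zero]

theorem ae_γ₀_eq : ∀ᵐ t ∂(volume.restrict (Set.Icc (0 : ℝ) T)), E.γ₀ t = R.β 0 0 t := by
  filter_upwards [R.β_ae 0 (Nat.zero_le _)] with t ht
  rw [PolynomialExpansion.γ₀, ← ht 0, Polynomial.coeff_zero_eq_eval_zero]

theorem ν₀_integral_eq {F : Type*} [NormedAddCommGroup F] [NormedSpace ℝ F] {t : ℝ}
    (ht : t ∈ Set.Icc 0 T) {g : ℝ → F} (hg : g 0 = 0) :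
    ∫ z, g z ∂(E.ν₀ t) = ∫ z, ((R.w z : ℝ)⁻¹) • g z ∂(R.kp 0 0 t) := by
  rw [PolynomialExpansion.ν₀, integral_levyKernel R.weight_zero ht hg, kp, if_pos (by omega)]

theorem lint_zero_zero (t : ℝ) (g : ℝ → ℝ) : R.lint 0 0 t g = ∫ z, g z ∂(R.kp 0 0 t) := by
  simp [lint, R.km_zero_zero]

/-- Integrals over time only see almost every time. -/
theorem intervalIntegral_congr_Icc {F : Type*} [NormedAddCommGroup F] [NormedSpace ℝ F]
    {f g : ℝ → F} {t s : ℝ} (ht : t ∈ Set.Icc 0 T) (hs : s ∈ Set.Icc 0 T)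
    (h : ∀ᵐ r ∂(volume.restrict (Set.Icc (0 : ℝ) T)), f r = g r) :
    ∫ r in t..s, f r = ∫ r in t..s, g r := by
  refine intervalIntegral.integral_congr_ae_restrict ?_
  refine ae_restrict_of_ae_restrict_of_subset (Set.uIoc_subset_uIcc.trans ?_) h
  exact Set.uIcc_subset_Icc ht hs

theorem intervalIntegrable_of_bound {g : ℝ → ℝ} (hg : Measurable g) {A : ℝ} (hA : ∀ t, |g t| ≤ A)
    (t s : ℝ) : IntervalIntegrable g volume t s := by
  rw [intervalIntegrable_iff]
  exact Measure.integrableOn_of_bounded (M := A) (by simp [Set.uIoc]) hg.aestronglyMeasurable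
    (Eventually.of_forall hA)

theorem opM_eq {f : ℝ → ℝ} (hf : SmoothGrowth c f) {t s : ℝ} (ht : t ∈ Set.Icc 0 T)
    (hs : s ∈ Set.Icc 0 T) (x : ℝ) : E.opM t s f x = R.ops.opM t s f x := by
  obtain ⟨A, hA⟩ := R.α_bound 0 0
  obtain ⟨B, hB⟩ := R.β_bound 0 0
  obtain ⟨C, hC⟩ := R.drift_bound 0 0
  have hm : E.mV t s = ∫ r in t..s, (R.β 0 0 r - R.α 0 0 r - R.drift 0 0 r) := by
    refine intervalIntegral_congr_Icc ht hs ?_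
    filter_upwards [R.ae_a₀_eq, R.ae_γ₀_eq, ae_restrict_mem measurableSet_Icc] with r h1 h2 hr
    rw [h1, h2, R.ν₀_integral_eq hr (by simp), drift, lint_zero_zero]
    simp only [smul_eq_mul, div_eq_inv_mul]
  have hC' : E.CV t s = ∫ r in t..s, 2 * R.α 0 0 r := by
    refine intervalIntegral_congr_Icc ht hs ?_
    filter_upwards [R.ae_a₀_eq] with r h1
    rw [h1]
  have hJ : ∫ r in t..s, ∫ z, (f (x + z) - f x) * z ∂(E.ν₀ r) =
      ∫ r in t..s, R.lint 0 0 r fun z => jumpMulOp R.w z f x := by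
    refine intervalIntegral_congr_Icc ht hs ?_
    filter_upwards [ae_restrict_mem measurableSet_Icc] with r hr
    rw [R.ν₀_integral_eq hr (by simp), lint_zero_zero]
    simp only [smul_eq_mul, jumpMulOp, incrOp, div_eq_inv_mul]
    simp
  have hI : TameFamily c fun r x => R.lint 0 0 r fun z => jumpMulOp R.w z f x :=
    (R.isTransOp_lint (isTransOp_jumpMulOp R.weight_zero) 0 0).toIsTameOp.tame'
      (TameFamily.const (Q := ℝ) hf) measurable_id
  have i1 : IntervalIntegrable (fun r => 2 * R.α 0 0 r * deriv f x) volume t s :=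
    (intervalIntegrable_of_bound (R.α_meas 0 0) hA t s).const_mul 2 |>.mul_const _
  have i2 : IntervalIntegrable (fun r => (R.β 0 0 r - R.α 0 0 r - R.drift 0 0 r) * f x)
      volume t s :=
    (((intervalIntegrable_of_bound (R.β_meas 0 0) hB t s).sub
      (intervalIntegrable_of_bound (R.α_meas 0 0) hA t s)).sub
      (intervalIntegrable_of_bound (R.measurable_drift 0 0) hC t s)).mul_const _
  rw [PolynomialExpansion.opM, hm, hC', hJ, ExpansionOps.opM]
  change _ = x * f x + ∫ r in t..s, R.opμ r f x
  simp only [opμ]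
  rw [intervalIntegral.integral_add (i1.add i2) (hI.intervalIntegrable t s x),
    intervalIntegral.integral_add i1 i2, intervalIntegral.integral_mul_const,
    intervalIntegral.integral_mul_const]
  ring

theorem iterate_opM_eq {f : ℝ → ℝ} (hf : SmoothGrowth c f) {t s : ℝ} (ht : t ∈ Set.Icc 0 T)
    (hs : s ∈ Set.Icc 0 T) (k : ℕ) : (E.opM t s)^[k] f = (R.ops.opM t s)^[k] f := by
  induction k with
  | zero => rfl
  | succ k ih =>
    rw [Function.iterate_succ', Function.iterate_succ', Function.comp_apply, Function.comp_apply, ih]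
    exact funext fun x => R.opM_eq
      ((R.ops.isTameOp_opM.iterateOp k).smoothGrowth hf (t, s)) ht hs x

theorem smoothGrowth_jump {f : ℝ → ℝ} (hf : SmoothGrowth c f) (n m : ℕ) (t : ℝ) :
    SmoothGrowth c fun x => R.lint n m t fun z => jumpOp R.w z f x :=
  (R.isTransOp_lint (isTransOp_jumpOp R.weight_zero) n m).toIsTameOp.smoothGrowth hf t

/-- The operator `𝒢_n(t, s)` at a fixed time, in terms of the reduced jump operators. -/
theorem opG_eq_sum {f : ℝ → ℝ} (hf : SmoothGrowth c f) {n : ℕ} (hn : n ≤ N) {t s : ℝ}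
    (ht : t ∈ Set.Icc 0 T) (hs : s ∈ Set.Icc 0 T) (x : ℝ) :
    E.opG n t s f x = ∑ k ∈ Finset.range (R.deg n + 1), (R.ops.opM t s)^[k] (fun y =>
      (E.a n s).coeff k * (deriv (deriv f) y - deriv f y) + (E.γ n s).coeff k * (deriv f y - f y) +
      (-(R.drift n k s) * deriv f y + R.lint n k s fun z => jumpOp R.w z f y)) x := by
  have hd := hf.deriv
  have hdd := hd.deriv
  have hM := fun k => (R.ops.isTameOp_opM.iterateOp k)
  have hj := fun k => R.smoothGrowth_jump hf n k s
  have key : ∀ k, (R.ops.opM t s)^[k] (fun y =>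
      (E.a n s).coeff k * (deriv (deriv f) y - deriv f y) + (E.γ n s).coeff k * (deriv f y - f y) +
      (-(R.drift n k s) * deriv f y + R.lint n k s fun z => jumpOp R.w z f y)) x =
      (E.a n s).coeff k * (R.ops.opM t s)^[k] (fun y => deriv (deriv f) y - deriv f y) x +
      (E.γ n s).coeff k * (R.ops.opM t s)^[k] (fun y => deriv f y - f y) x +
      (-(R.ops.opM t s)^[k] (fun y => R.drift n k s * deriv f y) x +
        (R.ops.opM t s)^[k] (fun y => R.lint n k s fun z => jumpOp R.w z f y) x) := fun k => by
    have a1 := (hM k).add (((hdd.sub hd).const_mul ((E.a n s).coeff k)).add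
      ((hd.sub hf).const_mul ((E.γ n s).coeff k)))
      ((hd.const_mul (-(R.drift n k s))).add (hj k)) (t, s) x
    have a2 := (hM k).add ((hdd.sub hd).const_mul ((E.a n s).coeff k))
      ((hd.sub hf).const_mul ((E.γ n s).coeff k)) (t, s) x
    have a3 := (hM k).add (hd.const_mul (-(R.drift n k s))) (hj k) (t, s) x
    have a4 := (hM k).smul (hdd.sub hd) ((E.a n s).coeff k) (t, s) x
    have a5 := (hM k).smul (hd.sub hf) ((E.γ n s).coeff k) (t, s) x
    have a6 := (hM k).smul hd (-(R.drift n k s)) (t, s) x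
    have a7 := (hM k).smul hd (R.drift n k s) (t, s) x
    simp only at a1 a2 a3 a4 a5 a6 a7
    rw [a1, a2, a3, a4, a5, a6, a7]
    ring
  have e1 : ∀ k, (R.ops.opM t s)^[k] (fun _ => 0) x = 0 := fun k => (hM k).map_zero (t, s) x
  have s1 : ∑ k ∈ Finset.range (E.M n + 1), ((E.opM t s)^[k]
        (fun y => E.levyInt n k s (fun z => Real.exp z - 1 - z) * deriv f y)) x =
      ∑ k ∈ Finset.range (R.deg n + 1), (R.ops.opM t s)^[k] (fun y => R.drift n k s * deriv f y) x := by
    rw [← Finset.sum_subset (Finset.range_subset_range.2 (Nat.succ_le_succ (R.deg_M n)))]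
    · refine Finset.sum_congr rfl fun m hm => ?_
      have hm' : m ≤ E.M n := by rw [Finset.mem_range] at hm; omega
      rw [R.levyInt_drift hn hm' hs, R.iterate_opM_eq (hd.const_mul _) ht hs]
    · intro m _ hm
      have hm' : E.M n < m := by rw [Finset.mem_range] at hm; omega
      simp only [drift, R.lint_of_lt n hm', zero_mul, e1]
  have s2 : ∑ k ∈ Finset.range (E.M n + 1), ((E.opM t s)^[k]
        (fun y => E.levyInt n k s (fun z => f (y + z) - f y - z * deriv f y))) x =
      ∑ k ∈ Finset.range (R.deg n + 1), (R.ops.opM t s)^[k]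
        (fun y => R.lint n k s fun z => jumpOp R.w z f y) x := by
    rw [← Finset.sum_subset (Finset.range_subset_range.2 (Nat.succ_le_succ (R.deg_M n)))]
    · refine Finset.sum_congr rfl fun m hm => ?_
      have hm' : m ≤ E.M n := by rw [Finset.mem_range] at hm; omega
      simp only [R.levyInt_jump hn hm' hs]
      rw [R.iterate_opM_eq (hj m) ht hs]
    · intro m _ hm
      have hm' : E.M n < m := by rw [Finset.mem_range] at hm; omega
      simp only [R.lint_of_lt n hm', e1]
  simp only [key]
  rw [PolynomialExpansion.opG, s1, s2,
    Polynomial.sum_over_range' _ _ _ (Nat.lt_succ_of_le (R.deg_a n hn s hs)),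
    Polynomial.sum_over_range' _ _ _ (Nat.lt_succ_of_le (R.deg_γ n hn s hs)),
    Finset.sum_add_distrib, Finset.sum_add_distrib, Finset.sum_add_distrib, Finset.sum_neg_distrib]
  · simp only [R.iterate_opM_eq (hdd.sub hd) ht hs, R.iterate_opM_eq (hd.sub hf) ht hs]
    ring
  · simp
  · simp

theorem smoothGrowth_opG (R : ReducedData E c) {f : ℝ → ℝ} (hf : SmoothGrowth c f) {n : ℕ} (hn : n ≤ N) {t s : ℝ}
    (ht : t ∈ Set.Icc 0 T) (hs : s ∈ Set.Icc 0 T) : SmoothGrowth c (E.opG n t s f) := by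
  rw [funext fun x => R.opG_eq_sum hf hn ht hs x]
  have hd := hf.deriv
  exact (TameFamily.sum _ fun k _ => ((R.ops.isTameOp_opM.iterateOp k).smoothGrowth
    ((((hd.deriv.sub hd).const_mul _).add ((hd.sub hf).const_mul _)).add
      ((hd.const_mul _).add (R.smoothGrowth_jump hf n k s))) (t, s)).tame).smoothGrowth ()

/-- The times at which the given coefficients agree with the reduced ones. -/
def IsGoodTime (E : PolynomialExpansion N T) (R : ReducedData E c) (s : ℝ) : Prop :=
  s ∈ Set.Icc 0 T ∧ ∀ n ≤ N, ∀ k, (E.a n s).coeff k = R.α n k s ∧ (E.γ n s).coeff k = R.β n k s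

theorem ae_isGoodTime : ∀ᵐ s ∂(volume.restrict (Set.Icc (0 : ℝ) T)), IsGoodTime E R s := by
  have h1 : ∀ᵐ s ∂(volume.restrict (Set.Icc (0 : ℝ) T)), ∀ n, n ≤ N → ∀ k,
      (E.a n s).coeff k = R.α n k s := ae_all_iff.2 fun n => by
    by_cases hn : n ≤ N
    · filter_upwards [R.α_ae n hn] with s hs _ using hs
    · exact Eventually.of_forall fun s h => absurd h hn
  have h2 : ∀ᵐ s ∂(volume.restrict (Set.Icc (0 : ℝ) T)), ∀ n, n ≤ N → ∀ k,
      (E.γ n s).coeff k = R.β n k s := ae_all_iff.2 fun n => by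
    by_cases hn : n ≤ N
    · filter_upwards [R.β_ae n hn] with s hs _ using hs
    · exact Eventually.of_forall fun s h => absurd h hn
  filter_upwards [h1, h2, ae_restrict_mem measurableSet_Icc] with s a b hs
  exact ⟨hs, fun n hn k => ⟨a n hn k, b n hn k⟩⟩

theorem opG_eq {f : ℝ → ℝ} (hf : SmoothGrowth c f) {n : ℕ} (hn : n ≤ N) {t s : ℝ}
    (ht : t ∈ Set.Icc 0 T) (hs : IsGoodTime E R s) : E.opG n t s f = R.ops.opG n t s f := by
  ext x
  rw [R.opG_eq_sum hf hn ht hs.1, ExpansionOps.opG]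
  refine Finset.sum_congr rfl fun k _ => ?_
  rw [(hs.2 n hn k).1, (hs.2 n hn k).2]
  rfl

theorem prodG_eq {f : ℝ → ℝ} (hf : SmoothGrowth c f) {t : ℝ} (ht : t ∈ Set.Icc 0 T) {r : ℕ}
    {i : Fin r → ℕ} (hi : ∀ j, i j ≤ N) {s : Fin r → ℝ} (hs : ∀ j, IsGoodTime E R (s j)) :
    E.prodG t r i s f = R.ops.prodG t r i s f := by
  induction r with
  | zero => rfl
  | succ r ih =>
    rw [PolynomialExpansion.prodG, ExpansionOps.prodG, ih (i := Fin.tail i) (s := Fin.tail s)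
      (fun j => hi j.succ) (fun j => hs j.succ)]
    exact R.opG_eq (R.ops.smoothGrowth_prodG _ hf t _) (hi 0) ht (hs 0)

theorem smoothGrowth_prodG (R : ReducedData E c) {f : ℝ → ℝ} (hf : SmoothGrowth c f) {t : ℝ} (ht : t ∈ Set.Icc 0 T)
    {r : ℕ} {i : Fin r → ℕ} (hi : ∀ j, i j ≤ N) {s : Fin r → ℝ} (hs : ∀ j, s j ∈ Set.Icc 0 T) :
    SmoothGrowth c (E.prodG t r i s f) := by
  induction r with
  | zero => exact hf
  | succ r ih =>
    exact R.smoothGrowth_opG (ih (i := Fin.tail i) (s := Fin.tail s)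
      (fun j => hi j.succ) (fun j => hs j.succ)) (hi 0) ht (hs 0)

theorem iterInt_congr {r : ℕ} {t : ℝ} (ht : t ∈ Set.Icc 0 T) {g g' : (Fin r → ℝ) → ℝ}
    (h : ∀ s, (∀ j, IsGoodTime E R (s j)) → g s = g' s) : iterInt T r t g = iterInt T r t g' := by
  induction r generalizing t with
  | zero => exact h _ fun j => j.elim0
  | succ r ih =>
    simp only [iterInt]
    refine intervalIntegral_congr_Icc ht ⟨ht.1.trans ht.2, le_rfl⟩ ?_
    filter_upwards [R.ae_isGoodTime] with s hs
    exact ih hs.1 fun v hv => h _ fun j => Fin.cases hs hv j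

theorem indexSet_le {n r : ℕ} {i : Fin r → ℕ} (hi : i ∈ indexSet n r) (j : Fin r) : i j ≤ n := by
  simp only [indexSet, Finset.mem_filter, Finset.Nat.mem_antidiagonalTuple] at hi
  rw [← hi.1]
  exact Finset.single_le_sum (fun _ _ => Nat.zero_le _) (Finset.mem_univ j)

theorem opL_eq {f : ℝ → ℝ} (hf : SmoothGrowth c f) {n : ℕ} (hn : 1 ≤ n) (hnN : n ≤ N) {t : ℝ}
    (ht : t ∈ Set.Icc 0 T) (x : ℝ) : E.opL n t f x = R.ops.opL n t t f x := by
  rw [R.ops.opL_eq_sum_iterInt hf hn, PolynomialExpansion.opL]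
  refine Finset.sum_congr rfl fun r _ => R.iterInt_congr ht fun s hs => ?_
  refine Finset.sum_congr rfl fun i hi => ?_
  rw [R.prodG_eq hf ht (fun j => (indexSet_le hi j).trans hnN) hs]

/-- The compositions of the operators `𝒢` are integrable over the simplex of times. -/
theorem integrableOn_prodG (R : ReducedData E c) {f : ℝ → ℝ} (hf : SmoothGrowth c f) {t : ℝ} (ht : t ∈ Set.Icc 0 T)
    {r : ℕ} {i : Fin r → ℕ} (hi : ∀ j, i j ≤ N) (x : ℝ) :
    IntegrableOn (fun s => E.prodG t r i s f x) (timeSimplex t T r) := by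
  have hsub : timeSimplex t T r ⊆ Set.Icc (fun _ => (0 : ℝ)) fun _ => T := fun s hs =>
    ⟨fun j => ht.1.trans (hs.1 j).1, fun j => (hs.1 j).2⟩
  refine IntegrableOn.mono_set ?_ hsub
  have h1 : TameFamily c fun s : Fin r → ℝ => R.ops.prodG t r i s f :=
    (R.ops.tame_prodG i hf.tame).comp (φ := fun s : Fin r → ℝ => ((t, ()), s)) (by fun_prop)
  have : IsFiniteMeasure (volume.restrict (Set.Icc (fun _ : Fin r => (0 : ℝ)) fun _ => T)) :=
    ⟨by rw [Measure.restrict_apply_univ]; exact isCompact_Icc.measure_lt_top⟩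
  refine (h1.integrable (volume.restrict (Set.Icc (fun _ : Fin r => (0 : ℝ)) fun _ => T)) x).congr ?_
  have h2 : ∀ᵐ s : Fin r → ℝ, ∀ j, s j ∈ Set.Icc 0 T → IsGoodTime E R (s j) := by
    refine ae_all_iff.2 fun j => ?_
    have h3 := (ae_restrict_iff' measurableSet_Icc).1 R.ae_isGoodTime
    exact (Measure.quasiMeasurePreserving_eval (fun _ : Fin r => (volume : Measure ℝ)) j).ae h3
  filter_upwards [ae_restrict_of_ae h2, ae_restrict_mem measurableSet_Icc] with s hs hs'
  rw [R.prodG_eq hf ht hi fun j => hs j ⟨hs'.1 j, hs'.2 j⟩]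

end ReducedData

/-! ### Symbols and their decay -/

/-- The weight `(1 + |ξ|)^d`. -/
noncomputable def symWeight (d : ℤ) (ξ : ℝ) : ℝ := (1 + |ξ|) ^ d

theorem symWeight_pos (d : ℤ) (ξ : ℝ) : 0 < symWeight d ξ := by
  unfold symWeight; positivity

theorem symWeight_nonneg (d : ℤ) (ξ : ℝ) : 0 ≤ symWeight d ξ := (symWeight_pos d ξ).le

theorem symWeight_mono {d e : ℤ} (h : d ≤ e) (ξ : ℝ) : symWeight d ξ ≤ symWeight e ξ :=
  zpow_le_zpow_right₀ (by linarith [abs_nonneg ξ]) h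

theorem symWeight_add (d e : ℤ) (ξ : ℝ) : symWeight (d + e) ξ = symWeight d ξ * symWeight e ξ :=
  zpow_add₀ (by positivity) d e

theorem continuous_symWeight (d : ℤ) : Continuous (symWeight d) :=
  Continuous.zpow₀ (by fun_prop) d fun ξ => Or.inl (by positivity)

theorem integrable_symWeight {d : ℤ} (h : d ≤ -2) : Integrable (symWeight d) := by
  have h1 := integrable_one_add_norm (E := ℝ) (μ := volume) (r := 2) (by simp)
  refine h1.mono' (continuous_symWeight d).aestronglyMeasurable (Eventually.of_forall fun ξ => ?_)
  rw [Real.norm_of_nonneg (symWeight_nonneg d ξ)]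
  refine (symWeight_mono h ξ).trans_eq ?_
  rw [symWeight, ← Real.rpow_intCast]
  norm_num

/-- A continuous measurable family of functions of size `O((1 + |ξ|)^d)`. -/
structure SymBound {Q : Type} [MeasurableSpace Q] (d : ℤ) (F : Q → ℝ → ℂ) : Prop where
  cont : ∀ q, Continuous (F q)
  meas : ∀ ξ, Measurable fun q => F q ξ
  bound : ∃ C : ℝ, 0 ≤ C ∧ ∀ q ξ, ‖F q ξ‖ ≤ C * symWeight d ξ

/-- A measurable family of functions whose derivatives up to order `k` are of size
`O((1 + |ξ|)^d)`, uniformly in the parameter. -/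
def SymFamily {Q : Type} [MeasurableSpace Q] : ℕ → ℤ → (Q → ℝ → ℂ) → Prop
  | 0, d, F => SymBound d F
  | k + 1, d, F => SymBound d F ∧
      ∃ F' : Q → ℝ → ℂ, (∀ q ξ, HasDerivAt (F q) (F' q ξ) ξ) ∧ SymFamily k d F'

section

variable {P Q : Type} [MeasurableSpace P] [MeasurableSpace Q] {F G : Q → ℝ → ℂ} {d e : ℤ} {k : ℕ}

theorem SymBound.mono (hF : SymBound d F) (h : d ≤ e) : SymBound e F := by
  obtain ⟨C, hC, hb⟩ := hF.bound
  exact ⟨hF.cont, hF.meas, C, hC, fun q ξ =>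
    (hb q ξ).trans (mul_le_mul_of_nonneg_left (symWeight_mono h ξ) hC)⟩

theorem SymBound.add (hF : SymBound d F) (hG : SymBound d G) :
    SymBound d fun q ξ => F q ξ + G q ξ := by
  obtain ⟨C, hC, hb⟩ := hF.bound
  obtain ⟨D, hD, hb'⟩ := hG.bound
  exact ⟨fun q => (hF.cont q).add (hG.cont q), fun ξ => (hF.meas ξ).add (hG.meas ξ), C + D,
    add_nonneg hC hD, fun q ξ => (norm_add_le _ _).trans (by linarith [hb q ξ, hb' q ξ])⟩

theorem SymBound.mul (hF : SymBound d F) (hG : SymBound e G) :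
    SymBound (d + e) fun q ξ => F q ξ * G q ξ := by
  obtain ⟨C, hC, hb⟩ := hF.bound
  obtain ⟨D, hD, hb'⟩ := hG.bound
  refine ⟨fun q => (hF.cont q).mul (hG.cont q), fun ξ => (hF.meas ξ).mul (hG.meas ξ), C * D,
    mul_nonneg hC hD, fun q ξ => ?_⟩
  rw [norm_mul, symWeight_add]
  calc _ ≤ (C * symWeight d ξ) * (D * symWeight e ξ) :=
        mul_le_mul (hb q ξ) (hb' q ξ) (norm_nonneg _) (mul_nonneg hC (symWeight_nonneg d ξ))
    _ = _ := by ring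

theorem SymBound.measurable_uncurry (hF : SymBound d F) :
    Measurable fun p : Q × ℝ => F p.1 p.2 :=
  (measurable_uncurry_of_continuous_of_measurable (u := fun ξ q => F q ξ) hF.cont hF.meas).comp
    measurable_swap

namespace SymFamily

theorem base (hF : SymFamily k d F) : SymBound d F := by
  cases k with
  | zero => exact hF
  | succ k => exact hF.1

theorem of_succ (hF : SymFamily (k + 1) d F) : SymFamily k d F := by
  induction k generalizing F with
  | zero => exact hF.1
  | succ k ih =>
    obtain ⟨h, F', hd, hF'⟩ := hF
    exact ⟨h, F', hd, ih hF'⟩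

theorem mono (hF : SymFamily k d F) (h : d ≤ e) : SymFamily k e F := by
  induction k generalizing F with
  | zero => exact SymBound.mono hF h
  | succ k ih =>
    obtain ⟨h1, F', hd, hF'⟩ := hF
    exact ⟨h1.mono h, F', hd, ih hF'⟩

theorem of_ladder {G : ℕ → Q → ℝ → ℂ} (hd : ∀ j q ξ, HasDerivAt (G j q) (G (j + 1) q ξ) ξ)
    (hG : ∀ j, SymBound d (G j)) (k : ℕ) : SymFamily k d (G 0) := by
  have : ∀ j, SymFamily k d (G j) := by
    induction k with
    | zero => exact hG
    | succ k ih => exact fun j => ⟨hG j, G (j + 1), hd j, ih (j + 1)⟩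
  exact this 0

theorem comp (hF : SymFamily k d F) {φ : P → Q} (hφ : Measurable φ) :
    SymFamily k d fun p => F (φ p) := by
  have h0 : ∀ {F : Q → ℝ → ℂ}, SymBound d F → SymBound d fun p => F (φ p) := fun h => by
    obtain ⟨C, hC, hb⟩ := h.bound
    exact ⟨fun p => h.cont _, fun ξ => (h.meas ξ).comp hφ, C, hC, fun p => hb _⟩
  induction k generalizing F with
  | zero => exact h0 hF
  | succ k ih =>
    obtain ⟨h1, F', hd, hF'⟩ := hF
    exact ⟨h0 h1, _, fun p => hd _, ih hF'⟩

theorem add (hF : SymFamily k d F) (hG : SymFamily k d G) :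
    SymFamily k d fun q ξ => F q ξ + G q ξ := by
  induction k generalizing F G with
  | zero => exact SymBound.add hF hG
  | succ k ih =>
    obtain ⟨h1, F', hd, hF'⟩ := hF
    obtain ⟨h2, G', hd', hG'⟩ := hG
    exact ⟨h1.add h2, _, fun q ξ => (hd q ξ).add (hd' q ξ), ih hF' hG'⟩

theorem mul (hF : SymFamily k d F) (hG : SymFamily k e G) :
    SymFamily k (d + e) fun q ξ => F q ξ * G q ξ := by
  induction k generalizing F G with
  | zero => exact SymBound.mul hF hG
  | succ k ih =>
    have hF0 := hF.of_succ
    have hG0 := hG.of_succ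
    obtain ⟨h1, F', hd, hF'⟩ := hF
    obtain ⟨h2, G', hd', hG'⟩ := hG
    exact ⟨h1.mul h2, _, fun q ξ => (hd q ξ).mul (hd' q ξ), (ih hF' hG0).add (ih hF0 hG')⟩

theorem param {a : Q → ℂ} (ha : Measurable a) {A : ℝ} (hA : ∀ q, ‖a q‖ ≤ A) (k : ℕ) :
    SymFamily k 0 fun q _ => a q := by
  have h := of_ladder (Q := Q) (d := 0) (G := fun j q _ => if j = 0 then a q else 0)
    (fun j q ξ => by simpa using hasDerivAt_const ξ _) (fun j => ?_) k
  · simpa using h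
  · refine ⟨fun q => continuous_const, fun ξ => ?_, |A|, abs_nonneg A, fun q ξ => ?_⟩
    · by_cases hj : j = 0 <;> simp [hj, ha]
    · rw [symWeight, zpow_zero, mul_one]
      by_cases hj : j = 0
      · simpa [hj] using (hA q).trans (le_abs_self A)
      · simp [hj]

theorem const (a : ℂ) (k : ℕ) : SymFamily k 0 fun (_ : Q) _ => a :=
  param measurable_const (fun _ => le_rfl) k

theorem smul (hF : SymFamily k d F) {a : Q → ℂ} (ha : Measurable a) {A : ℝ} (hA : ∀ q, ‖a q‖ ≤ A) :
    SymFamily k d fun q ξ => a q * F q ξ := by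
  simpa using (param ha hA k).mul hF

theorem const_mul (hF : SymFamily k d F) (a : ℂ) : SymFamily k d fun q ξ => a * F q ξ :=
  hF.smul measurable_const fun _ => le_rfl

theorem neg (hF : SymFamily k d F) : SymFamily k d fun q ξ => -F q ξ := by
  simpa using hF.const_mul (-1)

theorem sub (hF : SymFamily k d F) (hG : SymFamily k d G) :
    SymFamily k d fun q ξ => F q ξ - G q ξ := by
  simpa [sub_eq_add_neg] using hF.add hG.neg

theorem affine (a b : ℂ) (k : ℕ) : SymFamily k 1 fun (_ : Q) ξ => a + b * ξ := by
  have h0 : SymBound (Q := Q) 1 fun _ ξ => a + b * ξ := by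
    refine ⟨fun _ => by fun_prop, fun _ => measurable_const, ‖a‖ + ‖b‖, by positivity,
      fun _ ξ => ?_⟩
    rw [symWeight, zpow_one]
    refine (norm_add_le _ _).trans ?_
    rw [norm_mul, Complex.norm_real, Real.norm_eq_abs]
    have := mul_nonneg (norm_nonneg a) (abs_nonneg ξ)
    nlinarith [norm_nonneg b]
  cases k with
  | zero => exact h0
  | succ k =>
    refine ⟨h0, fun _ _ => b, fun _ ξ => ?_, (const b k).mono (by norm_num)⟩
    simpa using ((hasDerivAt_id ξ).ofReal_comp.const_mul b).const_add a

theorem inv_affine (k : ℕ) : SymFamily k (-1) fun (_ : Q) ξ => (1 + Complex.I * ξ)⁻¹ := by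
  have hne : ∀ ξ : ℝ, (1 + Complex.I * ξ) ≠ 0 := fun ξ h => by
    have := congrArg Complex.re h
    simp at this
  have h0 : SymBound (Q := Q) (-1) fun _ ξ => (1 + Complex.I * ξ)⁻¹ := by
    refine ⟨fun _ => Continuous.inv₀ (by fun_prop) hne, fun _ => measurable_const, 2, by norm_num,
      fun _ ξ => ?_⟩
    rw [symWeight, zpow_neg_one, norm_inv, ← div_eq_mul_inv, inv_le_comm₀ (norm_pos_iff.2 (hne ξ))
      (by positivity), inv_div]
    have h1 := Complex.abs_re_le_norm (1 + Complex.I * ξ)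
    have h2 := Complex.abs_im_le_norm (1 + Complex.I * ξ)
    simp at h1 h2
    linarith
  induction k with
  | zero => exact h0
  | succ k ih =>
    refine ⟨h0, fun _ ξ => -Complex.I * ((1 + Complex.I * ξ)⁻¹ * (1 + Complex.I * ξ)⁻¹),
      fun _ ξ => ?_, ((ih.mul ih).const_mul _).mono (by norm_num)⟩
    have h1 : HasDerivAt (fun ξ : ℝ => 1 + Complex.I * ξ) Complex.I ξ := by
      simpa using ((hasDerivAt_id ξ).ofReal_comp.const_mul Complex.I).const_add 1
    exact (h1.fun_inv (hne ξ)).congr_deriv (by rw [div_eq_mul_inv, sq, mul_inv])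

/-- Exponentials of symbols of order two: each derivative loses two orders. -/
theorem exp {Ψ : Q → ℝ → ℂ} (hΨ : ∀ k, SymFamily k 2 Ψ) {A : ℝ}
    (hA : ∀ q ξ, ‖Complex.exp (Ψ q ξ)‖ ≤ A * symWeight d ξ) (k : ℕ) :
    SymFamily k (d + 2 * k) fun q ξ => Complex.exp (Ψ q ξ) := by
  have h0 : SymBound d fun q ξ => Complex.exp (Ψ q ξ) := by
    refine ⟨fun q => ((hΨ 0).base.cont q).cexp, fun ξ => ((hΨ 0).base.meas ξ).cexp, |A|,
      abs_nonneg A, fun q ξ => (hA q ξ).trans ?_⟩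
    exact mul_le_mul_of_nonneg_right (le_abs_self A) (symWeight_nonneg d ξ)
  induction k with
  | zero => exact h0.mono (by simp)
  | succ k ih =>
    obtain ⟨-, Ψ', hd, hΨ'⟩ := hΨ (k + 1)
    refine ⟨h0.mono (by push_cast; omega), _, fun q ξ => (hd q ξ).cexp, ?_⟩
    refine (ih.mul hΨ').mono ?_
    push_cast; omega

theorem _root_.SymBound.aestronglyMeasurable_kernel {F : P × Q → ℝ → ℂ} (h : SymBound d F)
    (κ : Kernel P Q) (p : P) (ξ : ℝ) : AEStronglyMeasurable (fun q => F (p, q) ξ) (κ p) :=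
  ((h.meas ξ).comp (measurable_const.prodMk measurable_id)).aestronglyMeasurable

theorem _root_.SymBound.hasDerivAt_integral_kernel {F F' : P × Q → ℝ → ℂ} (hF : SymBound d F)
    (hF' : SymBound e F') (hd : ∀ p ξ, HasDerivAt (F p) (F' p ξ) ξ) (κ : Kernel P Q)
    [IsFiniteKernel κ] (p : P) (ξ : ℝ) :
    HasDerivAt (fun ξ => ∫ q, F (p, q) ξ ∂(κ p)) (∫ q, F' (p, q) ξ ∂(κ p)) ξ := by
  obtain ⟨C, hC, hb⟩ := hF'.bound
  obtain ⟨C₀, hC₀, hb₀⟩ := hF.bound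
  obtain ⟨M, hM⟩ := (isCompact_closedBall ξ 1).exists_bound_of_continuousOn
    (continuous_symWeight e).continuousOn
  refine (hasDerivAt_integral_of_dominated_loc_of_deriv_le (s := Metric.ball ξ 1)
    (F := fun η q => F (p, q) η) (F' := fun η q => F' (p, q) η)
    (bound := fun _ => C * M) (Metric.ball_mem_nhds ξ one_pos)
    (Eventually.of_forall fun η => hF.aestronglyMeasurable_kernel κ p η)
    (Integrable.of_bound (hF.aestronglyMeasurable_kernel κ p ξ) _
      (Eventually.of_forall fun q => hb₀ _ _))
    (hF'.aestronglyMeasurable_kernel κ p ξ) (Eventually.of_forall fun q η hη => ?_)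
    (integrable_const _) (Eventually.of_forall fun q η _ => hd (p, q) η)).2
  refine (hb _ _).trans (mul_le_mul_of_nonneg_left ?_ hC)
  exact (le_abs_self _).trans (hM η (Metric.ball_subset_closedBall hη))

/-- Averages of symbols over a finite kernel are symbols. -/
theorem integral_kernel {F : P × Q → ℝ → ℂ} (hF : SymFamily k d F) (κ : Kernel P Q)
    [IsFiniteKernel κ] : SymFamily k d fun p ξ => ∫ q, F (p, q) ξ ∂(κ p) := by
  have h0 : ∀ {F : P × Q → ℝ → ℂ}, SymBound d F →
      SymBound d fun p ξ => ∫ q, F (p, q) ξ ∂(κ p) := fun {F} h => by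
    obtain ⟨C, hC, hb⟩ := h.bound
    refine ⟨fun p => ?_, fun ξ => ?_, C * (κ.bound).toReal, by positivity, fun p ξ => ?_⟩
    · rw [continuous_iff_continuousAt]
      intro ξ
      obtain ⟨M, hM⟩ := (isCompact_closedBall ξ 1).exists_bound_of_continuousOn
        (continuous_symWeight d).continuousOn
      refine continuousAt_of_dominated (bound := fun _ => C * M)
        (Eventually.of_forall fun η => h.aestronglyMeasurable_kernel κ p η) ?_ (integrable_const _)
        (Eventually.of_forall fun q => (h.cont (p, q)).continuousAt)
      filter_upwards [Metric.closedBall_mem_nhds ξ one_pos] with η hη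
      refine Eventually.of_forall fun q => (hb _ _).trans (mul_le_mul_of_nonneg_left ?_ hC)
      exact (le_abs_self _).trans (hM η hη)
    · exact ((h.meas ξ).stronglyMeasurable.integral_kernel_prod_right' (κ := κ)).measurable
    · refine (norm_integral_le_of_norm_le_const (μ := κ p)
        (Eventually.of_forall fun q => hb (p, q) ξ)).trans ?_
      have h2 : (κ p).real Set.univ ≤ (κ.bound).toReal :=
        ENNReal.toReal_mono (κ.bound_lt_top).ne (κ.measure_le_bound p _)
      calc C * symWeight d ξ * (κ p).real Set.univ ≤ C * symWeight d ξ * (κ.bound).toReal :=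
            mul_le_mul_of_nonneg_left h2 (mul_nonneg hC (symWeight_nonneg d ξ))
        _ = _ := by ring
  induction k generalizing F with
  | zero => exact h0 hF
  | succ k ih =>
    obtain ⟨h1, F', hd, hF'⟩ := hF
    exact ⟨h0 h1, _, fun p ξ => h1.hasDerivAt_integral_kernel hF'.base hd κ p ξ, ih hF'⟩

theorem integral_prod {F : P × Q → ℝ → ℂ} (hF : SymFamily k d F) (μ : Measure Q)
    [IsFiniteMeasure μ] : SymFamily k d fun p ξ => ∫ q, F (p, q) ξ ∂μ := by
  simpa using hF.integral_kernel (Kernel.const P μ)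

theorem intervalIntegral {F : P × ℝ → ℝ → ℂ} (hF : SymFamily k d F) {T : ℝ}
    (h0 : ∀ p r, r ∉ Set.Icc 0 T → ∀ ξ, F (p, r) ξ = 0) {a b : P → ℝ} (ha : Measurable a)
    (hb : Measurable b) : SymFamily k d fun p ξ => ∫ r in a p..b p, F (p, r) ξ := by
  have hm : Measurable fun p : P × ℝ => (Set.Ioc (a p.1) (b p.1)).indicator (fun _ => (1 : ℝ)) p.2 -
    (Set.Ioc (b p.1) (a p.1)).indicator (fun _ => (1 : ℝ)) p.2 :=
    (measurable_indicator_Ioc (ha.comp measurable_fst) (hb.comp measurable_fst)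
      measurable_snd).sub (measurable_indicator_Ioc (hb.comp measurable_fst)
      (ha.comp measurable_fst) measurable_snd)
  have := (hF.smul (a := fun p => (((Set.Ioc (a p.1) (b p.1)).indicator (fun _ => (1 : ℝ)) p.2 -
    (Set.Ioc (b p.1) (a p.1)).indicator (fun _ => (1 : ℝ)) p.2 : ℝ) : ℂ)) (A := 2)
      hm.complex_ofReal fun p => ?_).integral_prod (volume.restrict (Set.Icc 0 T))
  · convert this using 3 with p ξ
    exact intervalIntegral_eq_integral_sign (fun r hr => h0 p r hr ξ) _ _
  · rw [Complex.norm_real]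
    by_cases h : p.2 ∈ Set.Ioc (a p.1) (b p.1) <;> by_cases h' : p.2 ∈ Set.Ioc (b p.1) (a p.1) <;>
      simp only [h, h', Set.indicator_of_mem, Set.indicator_of_notMem, not_false_eq_true] <;>
      norm_num

end SymFamily

end

/-! ### Kernels with a given symbol -/

/-- The point `c + iξ` of the vertical line on which symbols are considered. -/
noncomputable def vline (c ξ : ℝ) : ℂ := c + Complex.I * ξ

@[simp] theorem vline_re (c ξ : ℝ) : (vline c ξ).re = c := by simp [vline]

@[simp] theorem vline_im (c ξ : ℝ) : (vline c ξ).im = ξ := by simp [vline]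

@[fun_prop] theorem continuous_vline (c : ℝ) : Continuous (vline c) := by unfold vline; fun_prop

theorem norm_exp_vline_mul (c ξ x : ℝ) :
    ‖Complex.exp (vline c ξ * x)‖ = Real.exp (c * x) := by
  rw [Complex.norm_exp]; simp

/-- The function `x ↦ (2π)⁻¹ Re ∫ e^{(c + iξ)x} b(ξ) dξ` with the symbol `b`. The symbols of
real operators satisfy `b(-ξ) = conj b(ξ)`, and for them taking the real part loses nothing. -/
noncomputable def symKernel (c : ℝ) (b : ℝ → ℂ) (x : ℝ) : ℝ :=
  ((1 / (2 * Real.pi) : ℂ) * ∫ ξ : ℝ, Complex.exp (vline c ξ * x) * b ξ).re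

section

variable {c : ℝ} {b b' : ℝ → ℂ}

theorem integrable_exp_vline_mul (hb : Integrable b) (x : ℝ) :
    Integrable fun ξ : ℝ => Complex.exp (vline c ξ * x) * b ξ :=
  hb.bdd_mul (c := Real.exp (c * x)) (by fun_prop)
    (Eventually.of_forall fun ξ => (norm_exp_vline_mul c ξ x).le)

theorem symKernel_add (hb : Integrable b) (hb' : Integrable b') (x : ℝ) :
    symKernel c (fun ξ => b ξ + b' ξ) x = symKernel c b x + symKernel c b' x := by
  simp only [symKernel, mul_add]
  rw [integral_add (integrable_exp_vline_mul hb x) (integrable_exp_vline_mul hb' x), mul_add,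
    Complex.add_re]

theorem symKernel_const_mul (a : ℝ) (b : ℝ → ℂ) (x : ℝ) :
    symKernel c (fun ξ => a * b ξ) x = a * symKernel c b x := by
  simp only [symKernel]
  have : ∀ ξ : ℝ, Complex.exp (vline c ξ * x) * (a * b ξ) =
      a * (Complex.exp (vline c ξ * x) * b ξ) := fun ξ => by ring
  simp only [this]
  rw [integral_const_mul, mul_left_comm, Complex.re_ofReal_mul]

theorem symKernel_sub (hb : Integrable b) (hb' : Integrable b') (x : ℝ) :
    symKernel c (fun ξ => b ξ - b' ξ) x = symKernel c b x - symKernel c b' x := by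
  have := symKernel_add hb (hb'.const_mul ((-1 : ℝ) : ℂ)) (c := c) x
  rw [symKernel_const_mul] at this
  simpa [sub_eq_add_neg] using this

theorem symKernel_add_right (b : ℝ → ℂ) (x z : ℝ) :
    symKernel c b (x + z) = symKernel c (fun ξ => Complex.exp (vline c ξ * z) * b ξ) x := by
  simp only [symKernel]
  congr 3 with ξ
  rw [← mul_assoc, ← Complex.exp_add]
  push_cast
  ring_nf

theorem hasDerivAt_symKernel (hb : Integrable b) (hb' : Integrable fun ξ => vline c ξ * b ξ)
    (x : ℝ) : HasDerivAt (symKernel c b) (symKernel c (fun ξ => vline c ξ * b ξ) x) x := by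
  obtain ⟨M, hM⟩ := (isCompact_closedBall x 1).exists_bound_of_continuousOn
    (f := fun y => Real.exp (c * y)) (by fun_prop)
  have h := (hasDerivAt_integral_of_dominated_loc_of_deriv_le (s := Metric.ball x 1)
      (F := fun y ξ => Complex.exp (vline c ξ * (y : ℝ)) * b ξ)
      (F' := fun y ξ => Complex.exp (vline c ξ * (y : ℝ)) * (vline c ξ * b ξ))
      (bound := fun ξ => M * ‖vline c ξ * b ξ‖) (Metric.ball_mem_nhds x one_pos)
      (Eventually.of_forall fun y => (integrable_exp_vline_mul hb y).aestronglyMeasurable)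
      (integrable_exp_vline_mul hb x) (integrable_exp_vline_mul hb' x).aestronglyMeasurable
      (Eventually.of_forall fun ξ y hy => ?_) (hb'.norm.const_mul M)
      (Eventually.of_forall fun ξ y _ => ?_)).2
  · have h2 := (h.const_mul (1 / (2 * Real.pi) : ℂ))
    exact (Complex.reCLM.hasFDerivAt.comp_hasDerivAt x h2)
  · rw [norm_mul, norm_exp_vline_mul]
    refine mul_le_mul_of_nonneg_right ?_ (norm_nonneg _)
    exact (le_abs_self _).trans (hM y (Metric.ball_subset_closedBall hy))
  · have h1 := (((hasDerivAt_id y).ofReal_comp.const_mul (vline c ξ)).cexp).mul_const (b ξ)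
    refine h1.congr_deriv ?_
    simp; ring

end

section

variable {P Q : Type} [MeasurableSpace P] [MeasurableSpace Q] {F : Q → ℝ → ℂ} {c : ℝ} {k : ℕ}

theorem SymBound.integrable (hF : SymBound (-2) F) (q : Q) : Integrable (F q) := by
  obtain ⟨C, hC, hb⟩ := hF.bound
  exact ((integrable_symWeight le_rfl).const_mul C).mono' (hF.cont q).aestronglyMeasurable
    (Eventually.of_forall fun ξ => hb q ξ)

theorem SymBound.measurable_symKernel (hF : SymBound (-2) F) (x : ℝ) :
    Measurable fun q => symKernel c (F q) x := by
  have h1 : Measurable fun p : Q × ℝ => Complex.exp (vline c p.2 * x) * F p.1 p.2 := by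
    have h2 : Measurable fun p : Q × ℝ => Complex.exp (vline c p.2 * x) :=
      (((continuous_vline c).measurable.comp measurable_snd).mul_const _).cexp
    exact h2.mul hF.measurable_uncurry
  have h3 := (h1.stronglyMeasurable.integral_prod_right' (ν := volume)).measurable
  exact (Complex.measurable_re).comp (h3.const_mul _)

/-- The kernel of an average of symbols. -/
theorem SymBound.symKernel_integral (hF : SymBound (-2) F) (μ : Measure Q) [IsFiniteMeasure μ]
    (x : ℝ) : symKernel c (fun ξ => ∫ q, F q ξ ∂μ) x = ∫ q, symKernel c (F q) x ∂μ := by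
  obtain ⟨C, hC, hb⟩ := hF.bound
  have hI : Integrable (Function.uncurry fun (ξ : ℝ) q => Complex.exp (vline c ξ * x) * F q ξ)
      (volume.prod μ) := by
    have h1 : Integrable (fun p : ℝ × Q => symWeight (-2) p.1 * 1) (volume.prod μ) :=
      (integrable_symWeight le_rfl).mul_prod (integrable_const 1)
    refine (h1.const_mul (Real.exp (c * x) * C)).mono' ?_ (Eventually.of_forall fun p => ?_)
    · have h2 : Measurable fun p : ℝ × Q => Complex.exp (vline c p.1 * x) :=
        (((continuous_vline c).measurable.comp measurable_fst).mul_const _).cexp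
      exact (h2.mul (hF.measurable_uncurry.comp measurable_swap)).aestronglyMeasurable
    · change ‖Complex.exp (vline c p.1 * x) * F p.2 p.1‖ ≤ _
      rw [norm_mul, norm_exp_vline_mul, mul_one, mul_assoc]
      exact mul_le_mul_of_nonneg_left (hb _ _) (Real.exp_pos _).le
  have key : ∫ ξ : ℝ, Complex.exp (vline c ξ * x) * ∫ q, F q ξ ∂μ =
      ∫ q, (∫ ξ : ℝ, Complex.exp (vline c ξ * x) * F q ξ) ∂μ := by
    simp only [← integral_const_mul]
    exact integral_integral_swap hI
  simp only [symKernel]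
  rw [key, ← integral_const_mul, ← Complex.reCLM_apply, ← ContinuousLinearMap.integral_comp_comm]
  · rfl
  · exact (hI.integral_prod_right).const_mul _

theorem tendsto_symKernel {P : Type} {C : ℝ} {l : Filter P} [l.IsCountablyGenerated] {F : P → ℝ → ℂ}
    {b : ℝ → ℂ}
    (hm : ∀ p, Continuous (F p)) (hC : ∀ p ξ, ‖F p ξ‖ ≤ C * symWeight (-2) ξ)
    (h : ∀ ξ, Tendsto (fun p => F p ξ) l (𝓝 (b ξ))) (x : ℝ) :
    Tendsto (fun p => symKernel c (F p) x) l (𝓝 (symKernel c b x)) := by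
  have h1 := tendsto_integral_filter_of_dominated_convergence (μ := volume) (l := l)
    (F := fun p ξ => Complex.exp (vline c ξ * x) * F p ξ)
    (f := fun ξ => Complex.exp (vline c ξ * x) * b ξ)
    (fun ξ => Real.exp (c * x) * (C * symWeight (-2) ξ))
    (Eventually.of_forall fun p => (Continuous.aestronglyMeasurable
      (by have := hm p; fun_prop)))
    (Eventually.of_forall fun p => Eventually.of_forall fun ξ => by
      rw [norm_mul, norm_exp_vline_mul]
      exact mul_le_mul_of_nonneg_left (hC _ _) (Real.exp_pos _).le)
    (((integrable_symWeight le_rfl).const_mul C).const_mul _)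
    (Eventually.of_forall fun ξ => (h ξ).const_mul _)
  exact (Complex.continuous_re.tendsto _).comp (h1.const_mul _)

/-- A kernel decays relative to `e^{cx}` at the rate given by the regularity of its symbol. -/
theorem SymFamily.symKernel_bound (hF : SymFamily k (-2) F) : ∃ C : ℝ, 0 ≤ C ∧
    ∀ q x, |symKernel c (F q) x| ≤ C * (Real.exp (c * x) / (1 + |x|) ^ k) := by
  have key : ∀ {F : Q → ℝ → ℂ}, SymFamily k (-2) F → ∃ C : ℝ, 0 ≤ C ∧
      ∀ q (x : ℝ), (1 + |x|) ^ k * ‖∫ ξ : ℝ, Complex.exp (Complex.I * ξ * x) * F q ξ‖ ≤ C := by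
    clear hF
    have hn : ∀ ξ x : ℝ, ‖Complex.exp (Complex.I * ξ * x)‖ = 1 := fun ξ x => by
      rw [Complex.norm_exp]; simp
    have hint : ∀ {F : Q → ℝ → ℂ}, SymBound (-2) F → ∀ q (x : ℝ),
        Integrable fun ξ : ℝ => Complex.exp (Complex.I * ξ * x) * F q ξ := fun h q x =>
      (h.integrable q).bdd_mul (c := 1) (by fun_prop) (Eventually.of_forall fun ξ => (hn ξ x).le)
    have h0 : ∀ {F : Q → ℝ → ℂ}, SymBound (-2) F → ∃ C : ℝ, 0 ≤ C ∧
        ∀ q (x : ℝ), ‖∫ ξ : ℝ, Complex.exp (Complex.I * ξ * x) * F q ξ‖ ≤ C := fun {F} h => by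
      obtain ⟨C, hC, hb⟩ := h.bound
      refine ⟨∫ ξ, C * symWeight (-2) ξ, integral_nonneg fun ξ =>
        mul_nonneg hC (symWeight_nonneg _ _), fun q x => ?_⟩
      refine (norm_integral_le_integral_norm _).trans (integral_mono (hint h q x).norm
        ((integrable_symWeight le_rfl).const_mul C) fun ξ => ?_)
      simp only [norm_mul, hn, one_mul]
      exact hb q ξ
    induction k with
    | zero => intro F h; simpa using h0 h
    | succ k ih =>
      intro F h
      obtain ⟨C₁, hC₁, h₁⟩ := ih h.of_succ
      obtain ⟨hB, F', hd, hF'⟩ := h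
      obtain ⟨C₂, hC₂, h₂⟩ := ih hF'
      refine ⟨C₁ + C₂, add_nonneg hC₁ hC₂, fun q x => ?_⟩
      have hparts : |x| * ‖∫ ξ : ℝ, Complex.exp (Complex.I * ξ * x) * F q ξ‖ =
          ‖∫ ξ : ℝ, Complex.exp (Complex.I * ξ * x) * F' q ξ‖ := by
        have hdexp : ∀ ξ : ℝ, HasDerivAt (fun ξ : ℝ => Complex.exp (Complex.I * ξ * x))
            (Complex.I * x * Complex.exp (Complex.I * ξ * x)) ξ := fun ξ => by
          have := (((hasDerivAt_id ξ).ofReal_comp.const_mul Complex.I).mul_const (x : ℂ)).cexp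
          refine this.congr_deriv ?_
          simp; ring
        have hI : ∀ ξ : ℝ, Complex.I * x * Complex.exp (Complex.I * ξ * x) * F q ξ =
            Complex.I * x * (Complex.exp (Complex.I * ξ * x) * F q ξ) := fun ξ => by ring
        have := integral_mul_deriv_eq_deriv_mul_of_integrable
          (u := fun ξ : ℝ => Complex.exp (Complex.I * ξ * x)) (v := F q)
          (u' := fun ξ : ℝ => Complex.I * x * Complex.exp (Complex.I * ξ * x)) (v' := F' q)
          (fun ξ _ => hdexp ξ) (fun ξ _ => hd q ξ) (hint hF'.base q x)
          (by
            have := (hint hB q x).const_mul (Complex.I * x)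
            refine this.congr (Eventually.of_forall fun ξ => ?_)
            simp only [Pi.mul_apply]; ring) (hint hB q x)
        rw [this, norm_neg]
        simp only [hI]
        rw [integral_const_mul, norm_mul]
        simp
      calc (1 + |x|) ^ (k + 1) * ‖∫ ξ : ℝ, Complex.exp (Complex.I * ξ * x) * F q ξ‖
          = (1 + |x|) ^ k * ‖∫ ξ : ℝ, Complex.exp (Complex.I * ξ * x) * F q ξ‖ + (1 + |x|) ^ k *
            (|x| * ‖∫ ξ : ℝ, Complex.exp (Complex.I * ξ * x) * F q ξ‖) := by ring
        _ ≤ C₁ + C₂ := by rw [hparts]; exact add_le_add (h₁ q x) (h₂ q x)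
  obtain ⟨C, hC, h⟩ := key hF
  refine ⟨C, hC, fun q x => ?_⟩
  have e : ∫ ξ : ℝ, Complex.exp (vline c ξ * x) * F q ξ =
      Real.exp (c * x) * ∫ ξ : ℝ, Complex.exp (Complex.I * ξ * x) * F q ξ := by
    rw [← integral_const_mul]
    congr 1 with ξ
    rw [vline, add_mul, Complex.exp_add]
    push_cast
    ring
  have h1 : ‖(1 / (2 * Real.pi) : ℂ)‖ ≤ 1 := by
    have : (1 / (2 * Real.pi) : ℂ) = ((1 / (2 * Real.pi) : ℝ) : ℂ) := by push_cast; rfl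
    rw [this, Complex.norm_real, Real.norm_of_nonneg (by positivity), div_le_one (by positivity)]
    linarith [Real.pi_gt_three]
  refine (Complex.abs_re_le_norm _).trans ?_
  rw [norm_mul, e, norm_mul, Complex.norm_real, Real.norm_of_nonneg (Real.exp_pos _).le,
    mul_div_assoc', le_div_iff₀ (by positivity)]
  calc _ = ‖(1 / (2 * Real.pi) : ℂ)‖ * (Real.exp (c * x) * ((1 + |x|) ^ k *
        ‖∫ ξ : ℝ, Complex.exp (Complex.I * ξ * x) * F q ξ‖)) := by ring
    _ ≤ 1 * (Real.exp (c * x) * C) := by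
        gcongr
        exact h q x
    _ = _ := by ring

end

/-- A measurable family of smooth functions each of whose derivatives is `O(e^{cx} (1 + |x|)^{-k})`
for every `k`, uniformly in the parameter. -/
structure RapidFamily (c : ℝ) {Q : Type} [MeasurableSpace Q] (F : Q → ℝ → ℝ) : Prop where
  contDiff : ∀ q, ContDiff ℝ ∞ (F q)
  bound : ∀ j k : ℕ, ∃ C : ℝ, 0 ≤ C ∧
    ∀ q x, |iteratedDeriv j (F q) x| ≤ C * (Real.exp (c * x) / (1 + |x|) ^ k)
  meas : ∀ x, Measurable fun q => F q x

/-- A measurable family of symbols that decay rapidly together with their derivatives. -/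
def RapidSymbol {Q : Type} [MeasurableSpace Q] (b : Q → ℝ → ℂ) : Prop :=
  ∀ (k : ℕ) (d : ℤ), SymFamily k d b

namespace RapidSymbol

variable {P Q : Type} [MeasurableSpace P] [MeasurableSpace Q] {b : Q → ℝ → ℂ} {c : ℝ}

theorem mul_sym (hb : RapidSymbol b) {a : Q → ℝ → ℂ} {d : ℤ} (ha : ∀ k, SymFamily k d a) :
    RapidSymbol fun q ξ => a q ξ * b q ξ := fun k e => by
  simpa using (ha k).mul (hb k (e - d))

theorem vline_mul (hb : RapidSymbol b) : RapidSymbol fun q ξ => vline c ξ * b q ξ :=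
  hb.mul_sym fun k => SymFamily.affine _ _ k

theorem vline_pow_mul (hb : RapidSymbol b) (j : ℕ) :
    RapidSymbol fun q ξ => vline c ξ ^ j * b q ξ := by
  induction j with
  | zero => simpa using hb
  | succ j ih => simpa only [pow_succ', mul_assoc] using ih.vline_mul (c := c)

theorem integrable (hb : RapidSymbol b) (q : Q) : Integrable (b q) := (hb 0 (-2)).base.integrable q

theorem hasDerivAt (hb : RapidSymbol b) (q : Q) (x : ℝ) : HasDerivAt (symKernel c (b q))
    (symKernel c (fun ξ => vline c ξ * b q ξ) x) x :=
  hasDerivAt_symKernel (hb.integrable q) (hb.vline_mul.integrable q) x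

theorem iteratedDeriv_symKernel (hb : RapidSymbol b) (q : Q) (j : ℕ) :
    iteratedDeriv j (symKernel c (b q)) = symKernel c fun ξ => vline c ξ ^ j * b q ξ := by
  have := iteratedDeriv_eq_of_ladder (G := fun j => symKernel c fun ξ => vline c ξ ^ j * b q ξ)
    (fun j x => by simpa only [pow_succ', mul_assoc] using (hb.vline_pow_mul j).hasDerivAt q x) j
  simpa using this

theorem rapidFamily (hb : RapidSymbol b) : RapidFamily c fun q => symKernel c (b q) where
  contDiff q := by
    have := contDiff_of_ladder (G := fun j => symKernel c fun ξ => vline c ξ ^ j * b q ξ)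
      (fun j x => by simpa only [pow_succ', mul_assoc] using (hb.vline_pow_mul j).hasDerivAt q x)
    simpa using this
  bound j k := by
    simp only [hb.iteratedDeriv_symKernel]
    exact ((hb.vline_pow_mul j) k (-2)).symKernel_bound
  meas x := (hb 0 (-2)).base.measurable_symKernel x

end RapidSymbol

namespace RapidFamily

variable {P Q : Type} [MeasurableSpace P] [MeasurableSpace Q] {K : Q → ℝ → ℝ} {c : ℝ}

theorem tame (hK : RapidFamily c K) : TameFamily c K := by
  refine ⟨hK.contDiff, fun j => ?_, hK.meas⟩
  obtain ⟨C, hC, h⟩ := hK.bound j 0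
  refine ⟨C, 0, hC, fun q x => (h q x).trans_eq ?_⟩
  simp [expWeight]

theorem deriv (hK : RapidFamily c K) : RapidFamily c fun q => deriv (K q) := by
  refine ⟨fun q => (contDiff_infty_iff_deriv.1 (hK.contDiff q)).2, fun j k => ?_,
    hK.tame.measurable_deriv⟩
  obtain ⟨C, hC, h⟩ := hK.bound (j + 1) k
  exact ⟨C, hC, fun q x => by rw [← iteratedDeriv_succ']; exact h q x⟩

theorem expWeight_mul_le (c : ℝ) (k : ℕ) (x y : ℝ) :
    expWeight c k y * (Real.exp (c * (x - y)) / (1 + |x - y|) ^ k) ≤ expWeight c k x := by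
  unfold expWeight
  rw [mul_div_assoc', div_le_iff₀ (by positivity)]
  have h1 : 1 + |y| ≤ (1 + |x|) * (1 + |x - y|) := by
    have h2 : |y| ≤ |x| + |x - y| := by
      calc |y| = |x - (x - y)| := by ring_nf
        _ ≤ _ := abs_sub _ _
    nlinarith [abs_nonneg x, abs_nonneg (x - y), mul_nonneg (abs_nonneg x) (abs_nonneg (x - y))]
  calc (1 + |y|) ^ k * Real.exp (c * y) * Real.exp (c * (x - y))
      = (1 + |y|) ^ k * Real.exp (c * x) := by
        rw [mul_assoc, ← Real.exp_add]; ring_nf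
    _ ≤ ((1 + |x|) * (1 + |x - y|)) ^ k * Real.exp (c * x) := by gcongr
    _ = _ := by rw [mul_pow]; ring

/-- The translates of rapidly decaying functions, weighted with a tame function of the
translation, form a tame family. -/
theorem translate (hK : RapidFamily c K) (k : ℕ) :
    TameFamily c fun (p : Q × ℝ) x => expWeight c k p.2 * K p.1 (x - p.2) := by
  have := TameFamily.of_ladder (c := c) (Q := Q × ℝ)
    (G := fun j p x => expWeight c k p.2 * iteratedDeriv j (K p.1) (x - p.2))
    (fun j p x => ?_) (fun j => ?_) (fun x => ?_)
  · simpa using this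
  · exact ((hK.tame.hasDerivAt_iteratedDeriv j p.1 (x - p.2)).comp_sub_const x p.2).const_mul _
  · obtain ⟨C, hC, h⟩ := hK.bound j k
    refine ⟨C, k, fun p x => ?_⟩
    rw [abs_mul, abs_of_pos (expWeight_pos c k p.2)]
    calc _ ≤ expWeight c k p.2 * (C * (Real.exp (c * (x - p.2)) / (1 + |x - p.2|) ^ k)) :=
          mul_le_mul_of_nonneg_left (h _ _) (expWeight_nonneg _ _ _)
      _ = C * (expWeight c k p.2 * (Real.exp (c * (x - p.2)) / (1 + |x - p.2|) ^ k)) := by ring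
      _ ≤ _ := mul_le_mul_of_nonneg_left (expWeight_mul_le c k x p.2) hC
  · simp only [iteratedDeriv_zero]
    exact ((continuous_expWeight c k).measurable.comp measurable_snd).mul
      (hK.tame.measurable_uncurry.comp (measurable_fst.prodMk (measurable_const.sub measurable_snd)))

end RapidFamily

/-! ### The exponent of the zeroth order operator -/

theorem norm_exp_sub_exp_le {R : ℝ} {a b : ℂ} (ha : ‖a‖ ≤ R) (hb : ‖b‖ ≤ R) :
    ‖Complex.exp a - Complex.exp b‖ ≤ Real.exp R * ‖a - b‖ := by
  refine (convex_closedBall (0 : ℂ) R).norm_image_sub_le_of_norm_hasDerivWithin_le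
    (f := Complex.exp) (f' := Complex.exp)
    (fun z _ => (Complex.hasDerivAt_exp z).hasDerivWithinAt) (fun z hz => ?_)
    (mem_closedBall_zero_iff.2 hb) (mem_closedBall_zero_iff.2 ha)
  exact (Complex.norm_exp_le_exp_norm z).trans (Real.exp_le_exp.2 (mem_closedBall_zero_iff.1 hz))

/-- The chain rule for the exponential of a Lipschitz primitive, in integrated form. -/
theorem exp_intervalIntegral_sub_one {f : ℝ → ℂ} (hf : Measurable f) {M : ℝ}
    (hM : ∀ t, ‖f t‖ ≤ M) (a b : ℝ) :
    Complex.exp (∫ r in a..b, f r) - 1 =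
      ∫ r in a..b, f r * Complex.exp (∫ v in a..r, f v) := by
  have hM0 : 0 ≤ M := (norm_nonneg _).trans (hM 0)
  have hint : ∀ x y, IntervalIntegrable f volume x y := fun x y => by
    rw [intervalIntegrable_iff]
    exact Measure.integrableOn_of_bounded (M := M) (by simp [Set.uIoc]) hf.aestronglyMeasurable
      (Eventually.of_forall hM)
  set F : ℝ → ℂ := fun s => ∫ r in a..s, f r with hF
  have hFL : ∀ x y, ‖F x - F y‖ ≤ M * |x - y| := fun x y => by
    rw [hF]
    simp only
    rw [intervalIntegral.integral_interval_sub_left (hint _ _) (hint _ _)]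
    exact intervalIntegral.norm_integral_le_of_norm_le_const fun t _ => hM t
  have hFc : Continuous F := by
    refine (LipschitzWith.of_dist_le_mul (K := M.toNNReal) fun x y => ?_).continuous
    rw [dist_eq_norm, Real.coe_toNNReal _ hM0]
    exact hFL x y
  have hgm : Measurable fun r => f r * Complex.exp (F r) := hf.mul hFc.cexp.measurable
  obtain ⟨R, hR⟩ := (isCompact_uIcc (a := a) (b := b)).exists_bound_of_continuousOn hFc.continuousOn
  have hgb : ∀ r ∈ Set.uIcc a b, ‖f r * Complex.exp (F r)‖ ≤ M * Real.exp R := fun r hr => by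
    rw [norm_mul]
    exact mul_le_mul (hM r) ((Complex.norm_exp_le_exp_norm _).trans (Real.exp_le_exp.2 (hR r hr)))
      (norm_nonneg _) hM0
  have hgint : IntervalIntegrable (fun r => f r * Complex.exp (F r)) volume a b := by
    rw [intervalIntegrable_iff]
    refine Measure.integrableOn_of_bounded (M := M * Real.exp R) (by simp [Set.uIoc])
      hgm.aestronglyMeasurable ?_
    filter_upwards [ae_restrict_mem measurableSet_uIoc] with r hr
    exact hgb r (Set.uIoc_subset_uIcc hr)
  have hsub : ∀ {x y}, x ∈ Set.uIcc a b → y ∈ Set.uIcc a b →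
      Set.uIcc x y ⊆ Set.uIcc a b := fun hx hy => Set.uIcc_subset_uIcc hx hy
  have hgint' : ∀ {x y}, x ∈ Set.uIcc a b → y ∈ Set.uIcc a b →
      IntervalIntegrable (fun r => f r * Complex.exp (F r)) volume x y := fun hx hy =>
    hgint.mono_set (hsub hx hy)
  set G : ℝ → ℂ := fun s => Complex.exp (F s) - ∫ r in a..s, f r * Complex.exp (F r) with hG
  have hGL : LipschitzOnWith (2 * (M * Real.exp R)).toNNReal G (Set.uIcc a b) := by
    refine LipschitzOnWith.of_dist_le_mul fun x hx y hy => ?_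
    rw [dist_eq_norm, Real.coe_toNNReal _ (by positivity), hG]
    simp only
    have e1 := norm_exp_sub_exp_le (hR x hx) (hR y hy)
    have e2 : ‖(∫ r in a..x, f r * Complex.exp (F r)) - ∫ r in a..y, f r * Complex.exp (F r)‖ ≤
        M * Real.exp R * |x - y| := by
      rw [intervalIntegral.integral_interval_sub_left (hgint' Set.left_mem_uIcc hx)
        (hgint' Set.left_mem_uIcc hy)]
      exact intervalIntegral.norm_integral_le_of_norm_le_const fun t ht =>
        hgb t (hsub hy hx (Set.uIoc_subset_uIcc ht))
    calc _ = ‖(Complex.exp (F x) - Complex.exp (F y)) -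
          ((∫ r in a..x, f r * Complex.exp (F r)) - ∫ r in a..y, f r * Complex.exp (F r))‖ := by
          congr 1; ring
      _ ≤ Real.exp R * (M * |x - y|) + M * Real.exp R * |x - y| := by
          refine (norm_sub_le _ _).trans (add_le_add (e1.trans ?_) e2)
          exact mul_le_mul_of_nonneg_left (hFL x y) (Real.exp_pos R).le
      _ = _ := by rw [Real.dist_eq]; ring
  obtain ⟨C, hC⟩ := hGL.absolutelyContinuousOnInterval.const_of_ae_hasDerivAt_zero (by
    filter_upwards [(hint a b).ae_hasDerivAt_integral, hgint.ae_hasDerivAt_integral] with x h1 h2 hx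
    have e1 := (h1 hx a Set.left_mem_uIcc).cexp
    have e2 := h2 hx a Set.left_mem_uIcc
    exact (e1.fun_sub e2).congr_deriv (by ring))
  have e1 := hC a Set.left_mem_uIcc
  have e2 := hC b Set.right_mem_uIcc
  rw [← e2] at e1
  simp only [hG, hF, intervalIntegral.integral_same, Complex.exp_zero, sub_zero] at e1
  rw [e1]
  ring

/-- The same, for the exponential of an integral up to a fixed final time. -/
theorem exp_intervalIntegral_sub_one' {f : ℝ → ℂ} (hf : Measurable f) {M : ℝ}
    (hM : ∀ t, ‖f t‖ ≤ M) (a b : ℝ) :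
    Complex.exp (∫ r in a..b, f r) - 1 =
      ∫ r in a..b, f r * Complex.exp (∫ v in r..b, f v) := by
  have hint : ∀ x y, IntervalIntegrable f volume x y := fun x y => by
    rw [intervalIntegrable_iff]
    exact Measure.integrableOn_of_bounded (M := M) (by simp [Set.uIoc]) hf.aestronglyMeasurable
      (Eventually.of_forall hM)
  have h := exp_intervalIntegral_sub_one hf.neg (M := M) (by simpa using hM) a b
  simp only [Pi.neg_apply, intervalIntegral.integral_neg, neg_mul] at h
  have e : ∀ r, f r * Complex.exp (∫ v in r..b, f v) = Complex.exp (∫ r in a..b, f r) *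
      (f r * Complex.exp (-∫ v in a..r, f v)) := fun r => by
    rw [← intervalIntegral.integral_add_adjacent_intervals (hint a r) (hint r b),
      Complex.exp_add]
    have : Complex.exp (∫ v in a..r, f v) * Complex.exp (-∫ v in a..r, f v) = 1 := by
      rw [← Complex.exp_add]; simp
    linear_combination (-f r * Complex.exp (∫ v in r..b, f v)) * this
  have h' : ∫ r in a..b, f r * Complex.exp (-∫ v in a..r, f v) =
      -(Complex.exp (-∫ r in a..b, f r) - 1) := by rw [h, neg_neg]
  simp only [e]
  rw [intervalIntegral.integral_const_mul, h', Complex.exp_neg]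
  field_simp
  ring

/-! ### Complex exponentials of jumps -/

theorem norm_exp_mul_ofReal (ζ : ℂ) (z : ℝ) : ‖Complex.exp (ζ * z)‖ = Real.exp (ζ.re * z) := by
  rw [Complex.norm_exp]; simp

theorem exp_mul_le_of_abs_le {θ v z : ℝ} (hv : v ∈ Set.uIcc 0 z) :
    Real.exp (θ * v) ≤ 1 + Real.exp (θ * z) := by
  have h1 := Real.exp_pos (θ * z)
  have h2 : θ * v ≤ 0 ∨ θ * v ≤ θ * z := by
    rcases Set.mem_uIcc.1 hv with ⟨ha, hb⟩ | ⟨ha, hb⟩ <;> rcases le_total 0 θ with ht | ht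
    · exact Or.inr (mul_le_mul_of_nonneg_left hb ht)
    · exact Or.inl (mul_nonpos_of_nonpos_of_nonneg ht ha)
    · exact Or.inl (mul_nonpos_of_nonneg_of_nonpos ht hb)
    · exact Or.inr (mul_le_mul_of_nonpos_left ha ht)
  rcases h2 with h | h
  · exact (Real.exp_le_one_iff.2 h).trans (by linarith)
  · linarith [Real.exp_le_exp.2 h]

theorem abs_le_of_mem_uIcc_zero {v z : ℝ} (hv : v ∈ Set.uIcc 0 z) : |v| ≤ |z| := by
  have := Set.abs_sub_left_of_mem_uIcc hv
  simpa using this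

theorem norm_exp_mul_sub_one_le (ζ : ℂ) (z : ℝ) :
    ‖Complex.exp (ζ * z) - 1‖ ≤ ‖ζ‖ * |z| * (1 + Real.exp (ζ.re * z)) := by
  have := Convex.norm_image_sub_le_of_norm_hasDerivWithin_le
    (f := fun v : ℝ => Complex.exp (ζ * v)) (f' := fun v : ℝ => ζ * Complex.exp (ζ * v))
    (C := ‖ζ‖ * (1 + Real.exp (ζ.re * z))) (s := Set.uIcc 0 z) (x := 0) (y := z)
    (fun v _ => HasDerivAt.hasDerivWithinAt ?_) (fun v hv => ?_) (convex_uIcc _ _)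
    Set.left_mem_uIcc Set.right_mem_uIcc
  · simp only [Complex.ofReal_zero, mul_zero, Complex.exp_zero, sub_zero, Real.norm_eq_abs] at this
    linarith
  · have := (((hasDerivAt_id v).ofReal_comp.const_mul ζ)).cexp
    refine this.congr_deriv ?_
    simp; ring
  · rw [norm_mul, norm_exp_mul_ofReal]
    exact mul_le_mul_of_nonneg_left (exp_mul_le_of_abs_le hv) (norm_nonneg _)

theorem norm_exp_mul_sub_one_sub_le (ζ : ℂ) (z : ℝ) :
    ‖Complex.exp (ζ * z) - 1 - ζ * z‖ ≤ 2 * ‖ζ‖ ^ 2 * z ^ 2 * (1 + Real.exp (ζ.re * z)) := by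
  have := Convex.norm_image_sub_le_of_norm_hasDerivWithin_le
    (f := fun v : ℝ => Complex.exp (ζ * v) - ζ * v)
    (f' := fun v : ℝ => ζ * (Complex.exp (ζ * v) - 1))
    (C := 2 * ‖ζ‖ ^ 2 * |z| * (1 + Real.exp (ζ.re * z))) (s := Set.uIcc 0 z) (x := 0) (y := z)
    (fun v _ => HasDerivAt.hasDerivWithinAt ?_) (fun v hv => ?_) (convex_uIcc _ _)
    Set.left_mem_uIcc Set.right_mem_uIcc
  · simp only [Complex.ofReal_zero, mul_zero, Complex.exp_zero, sub_zero, Real.norm_eq_abs] at this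
    rw [← sq_abs z]
    refine le_trans (le_of_eq ?_) (this.trans (le_of_eq ?_))
    · congr 1; ring
    · ring
  · have h0 := (hasDerivAt_id v).ofReal_comp.const_mul ζ
    refine (h0.cexp.fun_sub h0).congr_deriv ?_
    simp; ring
  · rw [norm_mul]
    have h1 := norm_exp_mul_sub_one_le ζ v
    have h2 := exp_mul_le_of_abs_le (θ := ζ.re) hv
    have h3 := abs_le_of_mem_uIcc_zero hv
    have h4 := Real.exp_pos (ζ.re * z)
    calc ‖ζ‖ * ‖Complex.exp (ζ * v) - 1‖ ≤ ‖ζ‖ * (‖ζ‖ * |v| * (1 + Real.exp (ζ.re * v))) := by gcongr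
      _ ≤ ‖ζ‖ * (‖ζ‖ * |z| * (2 * (1 + Real.exp (ζ.re * z)))) := by
          gcongr
          linarith
      _ = _ := by ring

/-- The functions `e^{ζz} - 1 - ζz`, `z(e^{ζz} - 1)`, `z^j e^{ζz}`, `j ≥ 2`, of which each is the
derivative in `ζ` of the one before. -/
noncomputable def jumpExp (j : ℕ) (ζ : ℂ) (z : ℝ) : ℂ :=
  if j = 0 then Complex.exp (ζ * z) - 1 - ζ * z else
    if j = 1 then z * (Complex.exp (ζ * z) - 1) else z ^ j * Complex.exp (ζ * z)

theorem hasDerivAt_jumpExp (j : ℕ) (ζ : ℂ) (z : ℝ) :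
    HasDerivAt (fun ζ => jumpExp j ζ z) (jumpExp (j + 1) ζ z) ζ := by
  have h0 : HasDerivAt (fun ζ : ℂ => ζ * z) z ζ := by simpa using (hasDerivAt_id ζ).mul_const (z : ℂ)
  have h1 := h0.cexp
  rcases j with _ | _ | j
  · simp only [jumpExp, if_pos]
    exact ((h1.fun_sub (hasDerivAt_const ζ 1)).fun_sub h0).congr_deriv (by simp; ring)
  · simp only [jumpExp]
    exact ((h1.fun_sub (hasDerivAt_const ζ 1)).const_mul _).congr_deriv (by simp; ring)
  · simp only [jumpExp]
    exact (h1.const_mul _).congr_deriv (by simp; ring)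

theorem measurable_jumpExp (j : ℕ) (ζ : ℂ) : Measurable fun z => jumpExp j ζ z := by
  unfold jumpExp
  split_ifs <;> fun_prop

theorem norm_jumpExp_zero_le (ζ : ℂ) (z : ℝ) : ‖jumpExp 0 ζ z‖ ≤
    2 * (1 + ‖ζ‖) ^ 2 * (min |z| (z ^ 2) * (1 + Real.exp (ζ.re * z))) := by
  have h4 := Real.exp_pos (ζ.re * z)
  have hζ := norm_nonneg ζ
  simp only [jumpExp, if_pos]
  rcases le_total |z| 1 with h | h
  · rw [min_abs_sq_of_abs_le_one h]
    refine (norm_exp_mul_sub_one_sub_le ζ z).trans ?_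
    rw [mul_assoc (2 * ‖ζ‖ ^ 2)]
    gcongr
    linarith
  · rw [min_abs_sq_of_one_le_abs h]
    calc ‖Complex.exp (ζ * z) - 1 - ζ * z‖ ≤ Real.exp (ζ.re * z) + 1 + ‖ζ‖ * |z| := by
          refine (norm_sub_le _ _).trans (add_le_add ((norm_sub_le _ _).trans ?_) ?_)
          · rw [norm_exp_mul_ofReal, norm_one]
          · rw [norm_mul, Complex.norm_real, Real.norm_eq_abs]
      _ ≤ (1 + ‖ζ‖) * (|z| * (1 + Real.exp (ζ.re * z))) := by
          have : 0 ≤ (|z| - 1) * (1 + Real.exp (ζ.re * z)) :=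
            mul_nonneg (by linarith) (by linarith)
          have : 0 ≤ ‖ζ‖ * |z| * Real.exp (ζ.re * z) := by positivity
          nlinarith
      _ ≤ _ := by
          gcongr
          nlinarith

theorem norm_jumpExp_one_le (ζ : ℂ) (z : ℝ) : ‖jumpExp 1 ζ z‖ ≤
    (1 + ‖ζ‖) * (min |z| (z ^ 2) * (1 + Real.exp (ζ.re * z))) := by
  have h4 := Real.exp_pos (ζ.re * z)
  have hζ := norm_nonneg ζ
  simp only [jumpExp, one_ne_zero, if_false, if_true]
  rw [norm_mul, Complex.norm_real, Real.norm_eq_abs]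
  rcases le_total |z| 1 with h | h
  · rw [min_abs_sq_of_abs_le_one h, ← sq_abs]
    calc |z| * ‖Complex.exp (ζ * z) - 1‖ ≤ |z| * (‖ζ‖ * |z| * (1 + Real.exp (ζ.re * z))) := by
          gcongr; exact norm_exp_mul_sub_one_le ζ z
      _ = ‖ζ‖ * (|z| ^ 2 * (1 + Real.exp (ζ.re * z))) := by ring
      _ ≤ _ := by gcongr; linarith
  · rw [min_abs_sq_of_one_le_abs h]
    calc |z| * ‖Complex.exp (ζ * z) - 1‖ ≤ |z| * (Real.exp (ζ.re * z) + 1) := by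
          gcongr
          refine (norm_sub_le _ _).trans_eq ?_
          rw [norm_exp_mul_ofReal, norm_one]
      _ = 1 * (|z| * (1 + Real.exp (ζ.re * z))) := by ring
      _ ≤ _ := by gcongr; linarith

theorem norm_jumpExp_add_two_le (j : ℕ) (ζ : ℂ) (z : ℝ) : ‖jumpExp (j + 2) ζ z‖ ≤
    min |z| (z ^ 2) * expWeight ζ.re (j + 1) z := by
  have h4 := Real.exp_pos (ζ.re * z)
  have e : jumpExp (j + 2) ζ z = (z : ℂ) ^ (j + 2) * Complex.exp (ζ * z) := by
    simp [jumpExp]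
  rw [e, norm_mul, norm_pow, Complex.norm_real, Real.norm_eq_abs, norm_exp_mul_ofReal, expWeight,
    ← mul_assoc]
  refine mul_le_mul_of_nonneg_right ?_ h4.le
  have hz := abs_nonneg z
  rcases le_total |z| 1 with h | h
  · rw [min_abs_sq_of_abs_le_one h, ← sq_abs, add_comm, pow_add]
    gcongr
    calc |z| ^ j ≤ 1 := pow_le_one₀ hz h
      _ ≤ _ := one_le_pow₀ (by linarith)
  · rw [min_abs_sq_of_one_le_abs h, pow_succ']
    gcongr
    linarith

theorem norm_vline_le {c θ : ℝ} (hθ : |θ| ≤ |c|) (ξ : ℝ) :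
    1 + ‖vline θ ξ‖ ≤ (1 + |c|) * (1 + |ξ|) := by
  have : ‖vline θ ξ‖ ≤ |θ| + |ξ| := by
    have := Complex.norm_le_abs_re_add_abs_im (vline θ ξ)
    simpa using this
  nlinarith [mul_nonneg (abs_nonneg c) (abs_nonneg ξ)]

section

variable {c : ℝ} {ν : Measure ℝ} {w : ℝ → ℝ≥0}

theorem hasDerivAt_vline (c ξ : ℝ) : HasDerivAt (vline c) Complex.I ξ := by
  change HasDerivAt (fun ξ : ℝ => (c : ℂ) + Complex.I * ξ) Complex.I ξ
  simpa using ((hasDerivAt_id ξ).ofReal_comp.const_mul Complex.I).const_add (c : ℂ)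

theorem hasDerivAt_jumpExp_vline (w : ℝ → ℝ≥0) (j : ℕ) (z ξ : ℝ) : HasDerivAt
    (fun ξ => Complex.I ^ j * jumpExp j (vline c ξ) z / (w z : ℂ))
    (Complex.I ^ (j + 1) * jumpExp (j + 1) (vline c ξ) z / (w z : ℂ)) ξ := by
  have := ((hasDerivAt_jumpExp j (vline c ξ) z).comp ξ (hasDerivAt_vline c ξ)).const_mul
    (Complex.I ^ j)
  exact (this.div_const (w z : ℂ)).congr_deriv (by ring)

theorem symBound_jumpExp_of_le (hw : IsLevyWeight c ν w) {j : ℕ} {d : ℤ}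
    (h : ∃ D : ℝ, 0 ≤ D ∧ ∀ (z : ℝ) ξ, w z ≠ 0 →
      ‖jumpExp j (vline c ξ) z‖ ≤ D * symWeight d ξ * w z) :
    SymBound d fun (z : ℝ) ξ => Complex.I ^ j * jumpExp j (vline c ξ) z / (w z : ℂ) := by
  obtain ⟨D, hD, h⟩ := h
  refine ⟨fun z => ?_, fun ξ => ?_, D, hD, fun z ξ => ?_⟩
  · exact continuous_iff_continuousAt.2 fun ξ => (hasDerivAt_jumpExp_vline w j z ξ).continuousAt
  · have := measurable_jumpExp j (vline c ξ)
    have := hw.meas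
    fun_prop
  · by_cases hz : w z = 0
    · simpa [hz] using mul_nonneg hD (symWeight_nonneg d ξ)
    · have hwz : (0 : ℝ) < w z := NNReal.coe_pos.2 (pos_iff_ne_zero.2 hz)
      have e : ‖((w z : ℝ) : ℂ)‖ = w z := by
        rw [Complex.norm_real, Real.norm_of_nonneg hwz.le]
      rw [norm_div, norm_mul, norm_pow, Complex.norm_I, one_pow, one_mul, e, div_le_iff₀ hwz]
      exact h z ξ hz

theorem symBound_jumpExp_add_two (hw : IsLevyWeight c ν w) (j : ℕ) : SymBound 0 fun (z : ℝ) ξ =>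
    Complex.I ^ (j + 2) * jumpExp (j + 2) (vline c ξ) z / (w z : ℂ) := by
  obtain ⟨C, hC, hb⟩ := hw.bound (j + 1)
  refine symBound_jumpExp_of_le hw ⟨C, hC, fun z ξ hz => ?_⟩
  refine (norm_jumpExp_add_two_le j _ z).trans ?_
  rw [vline_re, symWeight, zpow_zero]
  calc _ ≤ min |z| (z ^ 2) * (1 + expWeight c (j + 1) z) := by
        have := min_abs_sq_nonneg z
        gcongr; linarith
    _ ≤ C * 1 * w z := by rw [mul_one]; exact hb z hz

theorem symBound_jumpExp (hw : IsLevyWeight c ν w) (j : ℕ) : SymBound 2 fun (z : ℝ) ξ =>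
    Complex.I ^ j * jumpExp j (vline c ξ) z / (w z : ℂ) := by
  have hV : ∀ ξ, (1 + ‖vline c ξ‖) ^ 2 ≤ (1 + |c|) ^ 2 * symWeight 2 ξ := fun ξ => by
    have e : symWeight 2 ξ = (1 + |ξ|) ^ 2 := by rw [symWeight]; norm_cast
    rw [e, ← mul_pow]
    exact pow_le_pow_left₀ (by positivity) (norm_vline_le le_rfl ξ) 2
  rcases j with _ | _ | j
  · obtain ⟨C, hC, hb⟩ := hw.bound 0
    refine symBound_jumpExp_of_le hw ⟨2 * (1 + |c|) ^ 2 * C, by positivity, fun z ξ hz => ?_⟩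
    refine (norm_jumpExp_zero_le _ z).trans ?_
    have := hb z hz
    simp only [expWeight, pow_zero, one_mul] at this
    rw [vline_re]
    calc _ ≤ 2 * ((1 + |c|) ^ 2 * symWeight 2 ξ) * (C * w z) := by
          have := hV ξ
          have := min_abs_sq_nonneg z
          have := symWeight_nonneg 2 ξ
          gcongr
      _ = _ := by ring
  · obtain ⟨C, hC, hb⟩ := hw.bound 0
    refine symBound_jumpExp_of_le hw ⟨(1 + |c|) ^ 2 * C, by positivity, fun z ξ hz => ?_⟩
    refine (norm_jumpExp_one_le _ z).trans ?_
    have := hb z hz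
    simp only [expWeight, pow_zero, one_mul] at this
    rw [vline_re]
    have h1 : 1 + ‖vline c ξ‖ ≤ (1 + |c|) ^ 2 * symWeight 2 ξ := by
      have := norm_nonneg (vline c ξ)
      exact le_trans (by nlinarith) (hV ξ)
    calc _ ≤ ((1 + |c|) ^ 2 * symWeight 2 ξ) * (C * w z) := by
          have := min_abs_sq_nonneg z
          have := symWeight_nonneg 2 ξ
          gcongr
      _ = _ := by ring
  · exact (symBound_jumpExp_add_two hw j).mono (by norm_num)

/-- The exponential functions of the jumps, relative to the weight, as symbols of order two. -/
theorem symFamily_jumpExp (hw : IsLevyWeight c ν w) (k : ℕ) :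
    SymFamily k 2 fun z ξ => jumpExp 0 (vline c ξ) z / w z := by
  simpa using SymFamily.of_ladder (d := 2)
    (G := fun j (z : ℝ) ξ => Complex.I ^ j * jumpExp j (vline c ξ) z / (w z : ℂ))
    (fun j z ξ => hasDerivAt_jumpExp_vline w j z ξ) (symBound_jumpExp hw) k

end

theorem jumpOp_symKernel {c : ℝ} (w : ℝ → ℝ≥0) {b : ℝ → ℂ} (hb : Integrable b)
    (hb' : Integrable fun ξ => vline c ξ * b ξ) (z x : ℝ) :
    jumpOp w z (symKernel c b) x =
      symKernel c (fun ξ => jumpExp 0 (vline c ξ) z / w z * b ξ) x := by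
  have h1 := integrable_exp_vline_mul (c := c) hb z
  have h2 : Integrable fun ξ : ℝ => Complex.exp (vline c ξ * z) * b ξ - b ξ := h1.sub hb
  have e : ∀ ξ, jumpExp 0 (vline c ξ) z / w z * b ξ = (((w z : ℝ)⁻¹ : ℝ) : ℂ) *
      ((Complex.exp (vline c ξ * z) * b ξ - b ξ) - (z : ℝ) * (vline c ξ * b ξ)) := fun ξ => by
    simp only [jumpExp, if_pos]
    push_cast
    ring
  simp only [e]
  rw [symKernel_const_mul, symKernel_sub h2 (hb'.const_mul _), symKernel_sub h1 hb,
    symKernel_const_mul, ← symKernel_add_right, jumpOp, incrOp,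
    (hasDerivAt_symKernel hb hb' x).deriv]
  ring

/-! ### The symbol of the zeroth order evolution -/

namespace ReducedData

variable {N : ℕ} {T : ℝ} {E : PolynomialExpansion N T} {c : ℝ} (R : ReducedData E c)

/-- The exponent of `𝒜_0(r)`, that is, the number `e^{-ζx} 𝒜_0(r) e^{ζx}`. -/
noncomputable def expo (r : ℝ) (ζ : ℂ) : ℂ :=
  R.α 0 0 r * (ζ ^ 2 - ζ) + R.β 0 0 r * (ζ - 1) +
    (-(R.drift 0 0 r) * ζ + ∫ z, jumpExp 0 ζ z / R.w z ∂(R.kp 0 0 r))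

theorem expo_of_notMem {r : ℝ} (hr : r ∉ Set.Icc 0 T) (ζ : ℂ) : R.expo r ζ = 0 := by
  simp [expo, R.α_supp 0 0 r hr, R.β_supp 0 0 r hr, drift, R.lint_of_notMem 0 0 hr,
    R.kp_apply_of_notMem 0 0 hr]

theorem symFamily_expo (k : ℕ) : SymFamily k 2 fun r ξ => R.expo r (vline c ξ) := by
  obtain ⟨A, hA⟩ := R.α_bound 0 0
  obtain ⟨B, hB⟩ := R.β_bound 0 0
  obtain ⟨C, hC⟩ := R.drift_bound 0 0
  have hv : SymFamily k 1 fun (_ : ℝ) ξ => vline c ξ := SymFamily.affine _ _ k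
  have hv2 : SymFamily k 2 fun (_ : ℝ) ξ => vline c ξ ^ 2 := by
    simp only [sq]; exact hv.mul hv
  have hJ : SymFamily k 2 fun (r : ℝ) ξ => ∫ z, jumpExp 0 (vline c ξ) z / R.w z ∂(R.kp 0 0 r) :=
    ((symFamily_jumpExp R.weight_zero k).comp (φ := fun p : ℝ × ℝ => p.2)
      measurable_snd).integral_kernel (R.kp 0 0)
  have h1 : SymFamily k 2 fun (r : ℝ) ξ => (R.α 0 0 r : ℂ) * (vline c ξ ^ 2 - vline c ξ) :=
    (hv2.sub (hv.mono (by norm_num))).smul (R.α_meas 0 0).complex_ofReal (A := A)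
      fun r => by rw [Complex.norm_real]; exact hA r
  have h2 : SymFamily k 2 fun (r : ℝ) ξ => (R.β 0 0 r : ℂ) * (vline c ξ - 1) :=
    ((hv.mono (by norm_num)).sub ((SymFamily.const 1 k).mono (by norm_num))).smul
      (R.β_meas 0 0).complex_ofReal (A := B) fun r => by rw [Complex.norm_real]; exact hB r
  have h3 : SymFamily k 2 fun (r : ℝ) ξ => -(R.drift 0 0 r : ℂ) * vline c ξ :=
    (hv.mono (by norm_num)).smul (R.measurable_drift 0 0).complex_ofReal.neg (A := C)
      fun r => by rw [norm_neg, Complex.norm_real]; exact hC r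
  exact (h1.add h2).add (h3.add hJ)

/-- On kernels with a symbol, `𝒜_0(r)` acts by multiplication of the symbol with its exponent. -/
theorem opB_symKernel {Q : Type} [MeasurableSpace Q] {b : Q → ℝ → ℂ} (hb : RapidSymbol b) (q : Q)
    (r x : ℝ) : R.opB 0 0 r (symKernel c (b q)) x =
      symKernel c (fun ξ => R.expo r (vline c ξ) * b q ξ) x := by
  have i0 := hb.integrable q
  have i1 := (hb.vline_mul (c := c)).integrable q
  have i2 := ((hb.vline_mul (c := c)).vline_mul (c := c)).integrable q
  have d1 : deriv (symKernel c (b q)) = symKernel c fun ξ => vline c ξ * b q ξ :=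
    funext fun x => (hb.hasDerivAt q x).deriv
  have d2 : deriv (symKernel c fun ξ => vline c ξ * b q ξ) =
      symKernel c fun ξ => vline c ξ * (vline c ξ * b q ξ) :=
    funext fun x => (hb.vline_mul.hasDerivAt q x).deriv
  have hJ : SymBound (-2) fun (z : ℝ) ξ => jumpExp 0 (vline c ξ) z / R.w z * b q ξ :=
    (((symFamily_jumpExp R.weight_zero 0).mul
      ((hb 0 (-4)).comp (φ := fun _ : ℝ => q) measurable_const)).mono (by norm_num)).base
  have hJi : Integrable fun ξ => ∫ z, jumpExp 0 (vline c ξ) z / R.w z * b q ξ ∂(R.kp 0 0 r) :=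
    ((SymFamily.integral_prod (P := Unit) (k := 0) (d := -2)
      (F := fun p ξ => jumpExp 0 (vline c ξ) p.2 / R.w p.2 * b q ξ)
      (SymFamily.comp (k := 0) (P := Unit × ℝ) (φ := Prod.snd) hJ measurable_snd)
      (R.kp 0 0 r)).base).integrable ()
  have e : ∀ ξ, R.expo r (vline c ξ) * b q ξ =
      ((R.α 0 0 r : ℝ) * (vline c ξ * (vline c ξ * b q ξ) - vline c ξ * b q ξ) +
        (R.β 0 0 r : ℝ) * (vline c ξ * b q ξ - b q ξ)) +
      (((-(R.drift 0 0 r) : ℝ) : ℂ) * (vline c ξ * b q ξ) +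
        ∫ z, jumpExp 0 (vline c ξ) z / R.w z * b q ξ ∂(R.kp 0 0 r)) := fun ξ => by
    rw [integral_mul_const, expo]
    push_cast
    ring
  have j1 : Integrable fun ξ => vline c ξ * (vline c ξ * b q ξ) - vline c ξ * b q ξ := i2.sub i1
  have j2 : Integrable fun ξ => vline c ξ * b q ξ - b q ξ := i1.sub i0
  have j3 : Integrable fun ξ => ((R.α 0 0 r : ℝ) : ℂ) *
      (vline c ξ * (vline c ξ * b q ξ) - vline c ξ * b q ξ) := j1.const_mul _
  have j4 : Integrable fun ξ => ((R.β 0 0 r : ℝ) : ℂ) * (vline c ξ * b q ξ - b q ξ) :=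
    j2.const_mul _
  have j5 : Integrable fun ξ => ((-(R.drift 0 0 r) : ℝ) : ℂ) * (vline c ξ * b q ξ) :=
    i1.const_mul _
  simp only [e]
  rw [symKernel_add (j3.fun_add j4) (j5.fun_add hJi), symKernel_add j3 j4, symKernel_add j5 hJi,
    symKernel_const_mul, symKernel_const_mul, symKernel_const_mul, symKernel_sub i2 i1,
    symKernel_sub i1 i0, hJ.symKernel_integral, opB, lint_zero_zero, d1, d2]
  simp only [jumpOp_symKernel R.w i0 i1]

/-- `∫_t^s` of the exponent. -/
noncomputable def lam (t s : ℝ) (ζ : ℂ) : ℂ := ∫ r in t..s, R.expo r ζ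

theorem symFamily_lam (k : ℕ) :
    SymFamily k 2 fun (p : ℝ × ℝ) ξ => R.lam p.1 p.2 (vline c ξ) :=
  ((R.symFamily_expo k).comp (φ := fun p : (ℝ × ℝ) × ℝ => p.2) measurable_snd).intervalIntegral
    (fun _ _ hr _ => R.expo_of_notMem hr _) measurable_fst measurable_snd

theorem exp_mul_le_of_mem_uIcc {θ : ℝ} (hθ : θ ∈ Set.uIcc 0 c) (z : ℝ) :
    Real.exp (θ * z) ≤ 1 + Real.exp (c * z) := by
  simpa only [mul_comm] using exp_mul_le_of_abs_le (θ := z) hθ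

theorem measurable_expo (ζ : ℂ) : Measurable fun r => R.expo r ζ := by
  have h1 := (R.α_meas 0 0).complex_ofReal
  have h2 := (R.β_meas 0 0).complex_ofReal
  have h3 := (R.measurable_drift 0 0).complex_ofReal
  have h4 : Measurable fun p : ℝ × ℝ => jumpExp 0 ζ p.2 / (R.w p.2 : ℂ) := by
    have := R.w_meas
    have := (measurable_jumpExp 0 ζ).div (g := fun z => ((R.w z : ℝ) : ℂ)) (by fun_prop)
    exact this.comp measurable_snd
  have h5 := (h4.stronglyMeasurable.integral_kernel_prod_right' (κ := R.kp 0 0)).measurable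
  exact ((h1.mul_const _).add (h2.mul_const _)).add ((h3.neg.mul_const _).add h5)

/-- The integrals of the jump exponentials over the jump measures, bounded on the strip between
the imaginary axis and the line `Re ζ = c`. -/
theorem norm_jumpExp_div_le : ∃ C : ℝ, 0 ≤ C ∧ ∀ j ≤ 1, ∀ (ζ : ℂ), ζ.re ∈ Set.uIcc 0 c → ∀ z,
    ‖jumpExp j ζ z / R.w z‖ ≤ C * (1 + ‖ζ‖) ^ 2 := by
  obtain ⟨C, hC, hb⟩ := R.weight_zero.bound 0
  refine ⟨4 * C, by positivity, fun j hj ζ hζ z => ?_⟩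
  by_cases hz : R.w z = 0
  · simp [hz]; positivity
  have hwz : (0 : ℝ) < R.w z := NNReal.coe_pos.2 (pos_iff_ne_zero.2 hz)
  have e : ‖((R.w z : ℝ) : ℂ)‖ = R.w z := by rw [Complex.norm_real, Real.norm_of_nonneg hwz.le]
  rw [norm_div, e, div_le_iff₀ hwz]
  have hn := norm_nonneg ζ
  have h1 : ‖jumpExp j ζ z‖ ≤
      2 * (1 + ‖ζ‖) ^ 2 * (min |z| (z ^ 2) * (1 + Real.exp (ζ.re * z))) := by
    interval_cases j
    · exact norm_jumpExp_zero_le ζ z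
    · refine (norm_jumpExp_one_le ζ z).trans ?_
      have := min_abs_sq_nonneg z
      gcongr
      nlinarith
  have h2 := hb z hz
  simp only [expWeight, pow_zero, one_mul] at h2
  have h3 := exp_mul_le_of_mem_uIcc hζ z
  have h4 := Real.exp_pos (c * z)
  calc _ ≤ 2 * (1 + ‖ζ‖) ^ 2 * (min |z| (z ^ 2) * (2 * (1 + Real.exp (c * z)))) := by
        refine h1.trans ?_
        have := min_abs_sq_nonneg z
        gcongr
        linarith
    _ = 4 * (1 + ‖ζ‖) ^ 2 * (min |z| (z ^ 2) * (1 + Real.exp (c * z))) := by ring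
    _ ≤ 4 * (1 + ‖ζ‖) ^ 2 * (C * R.w z) := by gcongr
    _ = _ := by ring

theorem norm_integral_kernel_le {κ : Kernel ℝ ℝ} [IsFiniteKernel κ] {g : ℝ → ℂ} {C : ℝ}
    (hC : 0 ≤ C) (hg : ∀ z, ‖g z‖ ≤ C) (t : ℝ) : ‖∫ z, g z ∂(κ t)‖ ≤ C * (κ.bound).toReal :=
  (norm_integral_le_of_norm_le_const (μ := κ t) (Eventually.of_forall hg)).trans
    (mul_le_mul_of_nonneg_left
      (ENNReal.toReal_mono (κ.bound_lt_top).ne (κ.measure_le_bound t _)) hC)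

theorem norm_expo_le : ∃ C : ℝ, 0 ≤ C ∧ ∀ r (ζ : ℂ), ζ.re ∈ Set.uIcc 0 c →
    ‖R.expo r ζ‖ ≤ C * (1 + ‖ζ‖) ^ 2 := by
  obtain ⟨A, hA⟩ := R.α_bound 0 0
  obtain ⟨B, hB⟩ := R.β_bound 0 0
  obtain ⟨D, hD⟩ := R.drift_bound 0 0
  obtain ⟨C, hC, hb⟩ := R.norm_jumpExp_div_le
  have hA0 : 0 ≤ A := (abs_nonneg _).trans (hA 0)
  have hB0 : 0 ≤ B := (abs_nonneg _).trans (hB 0)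
  have hD0 : 0 ≤ D := (abs_nonneg _).trans (hD 0)
  refine ⟨A + B + D + C * ((R.kp 0 0).bound).toReal, by positivity, fun r ζ hζ => ?_⟩
  have hn := norm_nonneg ζ
  have h1 : ‖(R.α 0 0 r : ℂ) * (ζ ^ 2 - ζ)‖ ≤ A * (1 + ‖ζ‖) ^ 2 := by
    rw [norm_mul, Complex.norm_real]
    refine mul_le_mul (hA r) ((norm_sub_le _ _).trans ?_) (norm_nonneg _) hA0
    rw [norm_pow]; nlinarith
  have h2 : ‖(R.β 0 0 r : ℂ) * (ζ - 1)‖ ≤ B * (1 + ‖ζ‖) ^ 2 := by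
    rw [norm_mul, Complex.norm_real]
    refine mul_le_mul (hB r) ((norm_sub_le _ _).trans ?_) (norm_nonneg _) hB0
    rw [norm_one]; nlinarith
  have h3 : ‖-(R.drift 0 0 r : ℂ) * ζ‖ ≤ D * (1 + ‖ζ‖) ^ 2 := by
    rw [norm_mul, norm_neg, Complex.norm_real]
    exact mul_le_mul (hD r) (by nlinarith) (norm_nonneg _) hD0
  have h4 := norm_integral_kernel_le (κ := R.kp 0 0) (by positivity)
    (fun z => hb 0 zero_le_one ζ hζ z) r
  rw [expo]
  refine (norm_add_le _ _).trans ((add_le_add (norm_add_le _ _) (norm_add_le _ _)).trans ?_)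
  linarith

/-- The real part of the exponent: diffusion damps high frequencies, and the jumps only help. -/
theorem re_expo_le : ∃ A : ℝ, 0 ≤ A ∧ ∀ θ ∈ Set.uIcc 0 c, ∀ r ξ : ℝ,
    (R.expo r (vline θ ξ)).re ≤ A - R.α 0 0 r * ξ ^ 2 := by
  obtain ⟨C, hC, hb⟩ := R.norm_expo_le
  refine ⟨C * (1 + |c|) ^ 2, by positivity, fun θ hθ r ξ => ?_⟩
  obtain ⟨C', hC', hb'⟩ := R.norm_jumpExp_div_le
  have hθc := abs_le_of_mem_uIcc_zero hθ
  have hint : ∀ ξ : ℝ, Integrable (fun z => jumpExp 0 (vline θ ξ) z / (R.w z : ℂ)) (R.kp 0 0 r) :=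
    fun ξ => by
      have hm : Measurable fun z => jumpExp 0 (vline θ ξ) z / (R.w z : ℂ) := by
        have := R.w_meas
        exact (measurable_jumpExp 0 _).div (by fun_prop)
      exact Integrable.of_bound hm.aestronglyMeasurable (C' * (1 + ‖vline θ ξ‖) ^ 2)
        (Eventually.of_forall fun z => hb' 0 zero_le_one _ (by simpa using hθ) z)
  -- at `ξ = 0` the exponent is real, and it dominates
  have hJ : (∫ z, jumpExp 0 (vline θ ξ) z / R.w z ∂(R.kp 0 0 r)).re ≤
      (∫ z, jumpExp 0 (vline θ 0) z / R.w z ∂(R.kp 0 0 r)).re := by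
    rw [← Complex.reCLM_apply, ← Complex.reCLM_apply,
      ← ContinuousLinearMap.integral_comp_comm _ (hint ξ),
      ← ContinuousLinearMap.integral_comp_comm _ (hint 0)]
    refine integral_mono ((Complex.reCLM.integrable_comp (hint ξ)))
      ((Complex.reCLM.integrable_comp (hint 0))) fun z => ?_
    have hre : ∀ ξ : ℝ, (jumpExp 0 (vline θ ξ) z / (R.w z : ℂ)).re =
        (Real.exp (θ * z) * Real.cos (ξ * z) - 1 - θ * z) / R.w z := fun ξ => by
      rw [show (R.w z : ℂ) = ((R.w z : ℝ) : ℂ) from rfl, Complex.div_ofReal_re]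
      simp [jumpExp, Complex.exp_re]
    simp only [Complex.reCLM_apply, hre]
    refine div_le_div_of_nonneg_right ?_ (R.w z).coe_nonneg
    have := Real.cos_le_one (ξ * z)
    have h2 := Real.exp_pos (θ * z)
    simp only [zero_mul, Real.cos_zero]
    nlinarith
  have h0 : (R.expo r (vline θ ξ)).re ≤ (R.expo r (vline θ 0)).re - R.α 0 0 r * ξ ^ 2 := by
    have e : ∀ ξ : ℝ, (R.expo r (vline θ ξ)).re = R.α 0 0 r * (θ ^ 2 - ξ ^ 2 - θ) +
        R.β 0 0 r * (θ - 1) + (-(R.drift 0 0 r) * θ +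
        (∫ z, jumpExp 0 (vline θ ξ) z / R.w z ∂(R.kp 0 0 r)).re) := fun ξ => by
      rw [expo]
      simp [sq]
    rw [e, e]
    nlinarith
  have h1 := hb r (vline θ 0) (by simpa using hθ)
  have h2 := (Complex.abs_re_le_norm _).trans h1
  have h3 : C * (1 + ‖vline θ 0‖) ^ 2 ≤ C * (1 + |c|) ^ 2 := by
    have := norm_vline_le hθc 0
    rw [abs_zero, add_zero, mul_one] at this
    have h0 := norm_nonneg (vline θ 0)
    gcongr
  have := le_abs_self (R.expo r (vline θ 0)).re
  linarith

theorem intervalIntegrable_expo {ζ : ℂ} (hζ : ζ.re ∈ Set.uIcc 0 c) (t s : ℝ) :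
    IntervalIntegrable (fun r => R.expo r ζ) volume t s := by
  obtain ⟨C, hC, hb⟩ := R.norm_expo_le
  rw [intervalIntegrable_iff]
  exact Measure.integrableOn_of_bounded (M := C * (1 + ‖ζ‖) ^ 2) (by simp [Set.uIoc])
    (R.measurable_expo ζ).aestronglyMeasurable (Eventually.of_forall fun r => hb r ζ hζ)

/-- `∫_t^s a_0(r) dr`. -/
noncomputable def diff (t s : ℝ) : ℝ := ∫ r in t..s, R.α 0 0 r

theorem intervalIntegrable_α (t s : ℝ) : IntervalIntegrable (R.α 0 0) volume t s := by
  obtain ⟨A, hA⟩ := R.α_bound 0 0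
  exact intervalIntegrable_of_bound (R.α_meas 0 0) hA t s

theorem norm_exp_lam_le : ∃ A : ℝ, 0 < A ∧ ∀ θ ∈ Set.uIcc 0 c, ∀ t ∈ Set.Icc 0 T,
    ∀ s ∈ Set.Icc 0 T, t ≤ s → ∀ ξ : ℝ,
      ‖Complex.exp (R.lam t s (vline θ ξ))‖ ≤ A * Real.exp (-(R.diff t s) * ξ ^ 2) := by
  obtain ⟨A, hA, hb⟩ := R.re_expo_le
  refine ⟨Real.exp (A * T), Real.exp_pos _, fun θ hθ t ht s hs hts ξ => ?_⟩
  rw [Complex.norm_exp, ← Real.exp_add]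
  refine Real.exp_le_exp.2 ?_
  have hi := R.intervalIntegrable_expo (ζ := vline θ ξ) (by simpa using hθ) t s
  have e : (R.lam t s (vline θ ξ)).re = ∫ r in t..s, (R.expo r (vline θ ξ)).re := by
    rw [lam, ← Complex.reCLM_apply, ← Complex.reCLM.intervalIntegral_comp_comm hi]
    rfl
  have e2 : ∫ r in t..s, (A - R.α 0 0 r * ξ ^ 2) = A * (s - t) - R.diff t s * ξ ^ 2 := by
    rw [intervalIntegral.integral_sub (by simp) ((R.intervalIntegrable_α t s).mul_const _),
      intervalIntegral.integral_mul_const, intervalIntegral.integral_const, smul_eq_mul, diff]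
    ring
  have h1 : ∫ r in t..s, (R.expo r (vline θ ξ)).re ≤ ∫ r in t..s, (A - R.α 0 0 r * ξ ^ 2) := by
    refine intervalIntegral.integral_mono_on hts ?_ ?_ fun r _ => hb θ hθ r ξ
    · exact ⟨Complex.reCLM.integrable_comp hi.1, Complex.reCLM.integrable_comp hi.2⟩
    · exact IntervalIntegrable.sub (by simp) ((R.intervalIntegrable_α t s).mul_const _)
  rw [e]
  rw [e2] at h1
  have : A * (s - t) ≤ A * T := mul_le_mul_of_nonneg_left (by linarith [hs.2, ht.1]) hA
  linarith

end ReducedData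

/-! ### The kernels of the zeroth order evolution -/

/-- Gaussian decay beats every power. -/
theorem exp_neg_mul_sq_le {δ : ℝ} (hδ : 0 < δ) (d : ℤ) :
    ∃ C : ℝ, 0 ≤ C ∧ ∀ ξ : ℝ, Real.exp (-δ * ξ ^ 2) ≤ C * symWeight d ξ := by
  obtain ⟨n, hn⟩ : ∃ n : ℕ, -(2 * n : ℤ) ≤ d := ⟨d.natAbs, by omega⟩
  refine ⟨Real.exp δ * n.factorial * (2 / δ) ^ n, by positivity, fun ξ => ?_⟩
  have h1 := Real.pow_div_factorial_le_exp (x := δ * (1 + ξ ^ 2)) (by positivity) n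
  have h2 : (1 + |ξ|) ^ (2 * n) ≤ (2 * (1 + ξ ^ 2)) ^ n := by
    rw [pow_mul]
    gcongr
    rw [← sq_abs ξ]
    nlinarith [sq_nonneg (1 - |ξ|)]
  have h3 : symWeight (-(2 * n : ℤ)) ξ * (1 + |ξ|) ^ (2 * n) = 1 := by
    rw [symWeight, zpow_neg, show (2 * n : ℤ) = ((2 * n : ℕ) : ℤ) by push_cast; rfl, zpow_natCast]
    exact inv_mul_cancel₀ (by positivity)
  have h4 : (2 * (1 + ξ ^ 2)) ^ n ≤ (2 / δ) ^ n * (n.factorial * Real.exp (δ * (1 + ξ ^ 2))) := by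
    rw [div_le_iff₀ (by positivity)] at h1
    calc (2 * (1 + ξ ^ 2)) ^ n = (2 / δ) ^ n * (δ * (1 + ξ ^ 2)) ^ n := by
          rw [← mul_pow]; congr 1; field_simp
      _ ≤ _ := by gcongr; linarith
  have h5 : Real.exp (δ * (1 + ξ ^ 2)) * Real.exp (-δ * ξ ^ 2) = Real.exp δ := by
    rw [← Real.exp_add]; ring_nf
  have hw := symWeight_nonneg (-(2 * n : ℤ)) ξ
  calc Real.exp (-δ * ξ ^ 2)
      = symWeight (-(2 * n : ℤ)) ξ * ((1 + |ξ|) ^ (2 * n) * Real.exp (-δ * ξ ^ 2)) := by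
        rw [← mul_assoc, h3, one_mul]
    _ ≤ symWeight (-(2 * n : ℤ)) ξ * (((2 / δ) ^ n * (n.factorial *
          Real.exp (δ * (1 + ξ ^ 2)))) * Real.exp (-δ * ξ ^ 2)) := by
        gcongr
        exact h2.trans h4
    _ = Real.exp δ * n.factorial * (2 / δ) ^ n * symWeight (-(2 * n : ℤ)) ξ := by
        rw [← h5]; ring
    _ ≤ _ := by
        gcongr
        exact symWeight_mono hn ξ

namespace ReducedData

variable {N : ℕ} {T : ℝ} {E : PolynomialExpansion N T} {c : ℝ} (R : ReducedData E c)

/-- The symbol of the evolution from time `s` back to time `t`, multiplied with `e^{-eξ²}`. -/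
noncomputable def evSym (t s e ξ : ℝ) : ℂ :=
  Complex.exp (R.lam t s (vline c ξ) - (e : ℂ) * (ξ : ℂ) ^ 2)

/-- The kernel of the evolution from time `s` back to time `t`, regularised if `e > 0`. -/
noncomputable def evKer (t s e : ℝ) : ℝ → ℝ := symKernel c (R.evSym t s e)

/-- The damping is the integrated diffusion coefficient; jumps do not increase the real part of the
exponent by more than a constant. -/
theorem norm_evSym_le : ∃ A : ℝ, 0 < A ∧ ∀ t s e, 0 ≤ t → t ≤ s → s ≤ T → ∀ ξ : ℝ,
    ‖R.evSym t s e ξ‖ ≤ A * Real.exp (-(R.diff t s + e) * ξ ^ 2) := by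
  obtain ⟨A, hA, h⟩ := R.norm_exp_lam_le
  refine ⟨A, hA, fun t s e ht hts hs ξ => ?_⟩
  have h1 := h c Set.right_mem_uIcc t ⟨ht, hts.trans hs⟩ s ⟨ht.trans hts, hs⟩ hts ξ
  have h2 : ‖Complex.exp ((e : ℂ) * (ξ : ℂ) ^ 2)‖ = Real.exp (e * ξ ^ 2) := by
    rw [Complex.norm_exp]
    congr 1
    rw [← Complex.ofReal_pow, ← Complex.ofReal_mul, Complex.ofReal_re]
  rw [evSym, Complex.exp_sub, norm_div, h2, div_le_iff₀ (Real.exp_pos _), mul_assoc,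
    ← Real.exp_add]
  refine h1.trans_eq ?_
  congr 2
  ring

section

variable {Q : Type} [MeasurableSpace Q] {t s e : Q → ℝ}

theorem symFamily_evSym (ht : Measurable t) (hs : Measurable s) (he : Measurable e)
    (he1 : ∀ q, |e q| ≤ 1) {d : ℤ} {A : ℝ}
    (hA : ∀ q ξ, ‖R.evSym (t q) (s q) (e q) ξ‖ ≤ A * symWeight d ξ) (k : ℕ) :
    SymFamily k (d + 2 * k) fun q => R.evSym (t q) (s q) (e q) := by
  refine SymFamily.exp (Ψ := fun q ξ => R.lam (t q) (s q) (vline c ξ) - (e q : ℂ) * (ξ : ℂ) ^ 2)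
    (fun k => ?_) hA k
  have h1 : SymFamily k 1 fun (_ : Q) (ξ : ℝ) => (ξ : ℂ) := by
    simpa using SymFamily.affine (Q := Q) 0 1 k
  have h2 : SymFamily k 2 fun (_ : Q) (ξ : ℝ) => (ξ : ℂ) ^ 2 := by
    simp only [sq]; exact h1.mul h1
  exact ((R.symFamily_lam k).comp (φ := fun q => (t q, s q)) (ht.prodMk hs)).sub
    (h2.smul he.complex_ofReal (A := 1) fun q => by rw [Complex.norm_real]; exact he1 q)

/-- Away from the final time, the symbols of the evolution decay rapidly. -/
theorem rapidSymbol_evSym (ht : Measurable t) (hs : Measurable s) (he : Measurable e)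
    (he1 : ∀ q, |e q| ≤ 1) (h0 : ∀ q, 0 ≤ t q) (hts : ∀ q, t q ≤ s q) (hsT : ∀ q, s q ≤ T)
    {δ : ℝ} (hδ : 0 < δ) (h : ∀ q, δ ≤ R.diff (t q) (s q) + e q) :
    RapidSymbol fun q => R.evSym (t q) (s q) (e q) := by
  intro k d
  obtain ⟨A, hA, hb⟩ := R.norm_evSym_le
  obtain ⟨C, hC, hb'⟩ := exp_neg_mul_sq_le hδ (d - 2 * k)
  have := R.symFamily_evSym ht hs he he1 (d := d - 2 * k) (A := A * C) (fun q ξ => ?_) k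
  · simpa using this
  · refine (hb _ _ _ (h0 q) (hts q) (hsT q) ξ).trans ?_
    rw [mul_assoc]
    refine mul_le_mul_of_nonneg_left (le_trans (Real.exp_le_exp.2 ?_) (hb' ξ)) hA.le
    exact mul_le_mul_of_nonneg_right (neg_le_neg (h q)) (sq_nonneg ξ)

end

theorem diff_nonneg (hα : ∀ᵐ t ∂(volume.restrict (Set.Icc (0 : ℝ) T)), 0 < R.α 0 0 t) {t s : ℝ}
    (ht : 0 ≤ t) (hts : t ≤ s) (hs : s ≤ T) : 0 ≤ R.diff t s := by
  refine intervalIntegral.integral_nonneg_of_ae_restrict hts ?_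
  have := ae_restrict_of_ae_restrict_of_subset (Set.Icc_subset_Icc ht hs) hα
  filter_upwards [this] with r hr using hr.le

theorem diff_pos (hα : ∀ᵐ t ∂(volume.restrict (Set.Icc (0 : ℝ) T)), 0 < R.α 0 0 t) {t s : ℝ}
    (ht : 0 ≤ t) (hts : t < s) (hs : s ≤ T) : 0 < R.diff t s := by
  have h1 := ae_restrict_of_ae_restrict_of_subset
    (Set.Ioc_subset_Icc_self.trans (Set.Icc_subset_Icc ht hs)) hα
  rw [diff, intervalIntegral.integral_of_le hts.le]
  refine (integral_pos_iff_support_of_nonneg_ae ?_ (R.intervalIntegrable_α t s).1).2 ?_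
  · filter_upwards [h1] with r hr using hr.le
  · have h2 : (Function.support (R.α 0 0)) =ᵐ[volume.restrict (Set.Ioc t s)] Set.univ := by
      filter_upwards [h1] with r hr
      exact propext ⟨fun _ => trivial, fun _ => hr.ne'⟩
    rw [measure_congr h2]
    simpa using hts

theorem diff_le (hα : ∀ᵐ t ∂(volume.restrict (Set.Icc (0 : ℝ) T)), 0 < R.α 0 0 t) {t τ s : ℝ}
    (ht : 0 ≤ t) (htτ : t ≤ τ) (hτ : τ ≤ s) (hs : s ≤ T) : R.diff τ s ≤ R.diff t s := by
  have h1 := R.diff_nonneg hα ht htτ (hτ.trans hs)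
  have h2 : R.diff t τ + R.diff τ s = R.diff t s :=
    intervalIntegral.integral_add_adjacent_intervals (R.intervalIntegrable_α _ _)
      (R.intervalIntegrable_α _ _)
  linarith

theorem lam_add (t s s' ξ : ℝ) :
    R.lam t s (vline c ξ) + R.lam s s' (vline c ξ) = R.lam t s' (vline c ξ) :=
  intervalIntegral.integral_add_adjacent_intervals
    (R.intervalIntegrable_expo (by simp) _ _) (R.intervalIntegrable_expo (by simp) _ _)

theorem norm_expo_vline_le (ξ : ℝ) : ∃ M, ∀ r, ‖R.expo r (vline c ξ)‖ ≤ M := by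
  obtain ⟨C, -, hC⟩ := R.norm_expo_le
  exact ⟨_, fun r => hC r _ (by simp)⟩

theorem evSym_forward (t s s' e ξ : ℝ) : R.evSym t s' e ξ - R.evSym t s e ξ =
    ∫ r in s..s', R.expo r (vline c ξ) * R.evSym t r e ξ := by
  obtain ⟨M, hM⟩ := R.norm_expo_vline_le ξ
  have h := exp_intervalIntegral_sub_one (R.measurable_expo (vline c ξ)) hM s s'
  have h1 : ∀ r, R.evSym t r e ξ = R.evSym t s e ξ * Complex.exp (R.lam s r (vline c ξ)) :=
    fun r => by
      rw [evSym, evSym, ← Complex.exp_add, ← R.lam_add t s r]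
      ring_nf
  have h2 : ∀ r, R.expo r (vline c ξ) * R.evSym t r e ξ = R.evSym t s e ξ *
      (R.expo r (vline c ξ) * Complex.exp (∫ v in s..r, R.expo v (vline c ξ))) := fun r => by
    rw [h1, lam]; ring
  simp only [h2]
  rw [intervalIntegral.integral_const_mul, ← h, h1 s', lam]
  ring

theorem evSym_backward (t t' s e ξ : ℝ) : R.evSym t' s e ξ - R.evSym t s e ξ =
    -∫ r in t..t', R.expo r (vline c ξ) * R.evSym r s e ξ := by
  obtain ⟨M, hM⟩ := R.norm_expo_vline_le ξ
  have h := exp_intervalIntegral_sub_one' (R.measurable_expo (vline c ξ)) hM t t'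
  have h1 : ∀ r, R.evSym r s e ξ = R.evSym t' s e ξ * Complex.exp (R.lam r t' (vline c ξ)) :=
    fun r => by
      rw [evSym, evSym, ← Complex.exp_add, ← R.lam_add r t' s]
      ring_nf
  have h2 : ∀ r, R.expo r (vline c ξ) * R.evSym r s e ξ = R.evSym t' s e ξ *
      (R.expo r (vline c ξ) * Complex.exp (∫ v in r..t', R.expo v (vline c ξ))) := fun r => by
    rw [h1, lam]; ring
  simp only [h2]
  rw [intervalIntegral.integral_const_mul, ← h, h1 t, lam]
  ring

/-- From an equation in time for symbols to the equation for kernels. -/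
theorem symKernel_sub_eq {b : ℝ → ℝ → ℂ} (hb : RapidSymbol b) {s s' : ℝ} (hs : s ≤ s') (κ : ℝ)
    {b₁ b₂ : ℝ → ℂ} (h₁ : Integrable b₁) (h₂ : Integrable b₂)
    (h : ∀ ξ, b₂ ξ - b₁ ξ = κ * ∫ r in s..s', R.expo r (vline c ξ) * b r ξ) (x : ℝ) :
    symKernel c b₂ x - symKernel c b₁ x =
      κ * ∫ r in s..s', R.opB 0 0 r (symKernel c (b r)) x := by
  rw [← symKernel_sub h₂ h₁]
  simp only [h, intervalIntegral.integral_of_le hs]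
  rw [symKernel_const_mul]
  have hF : SymBound (-2) fun r ξ => R.expo r (vline c ξ) * b r ξ :=
    (((R.symFamily_expo 0).mul (hb 0 (-4))).mono (by norm_num)).base
  rw [hF.symKernel_integral]
  simp only [R.opB_symKernel hb]

theorem rapidSymbol_forward (hα : ∀ᵐ t ∂(volume.restrict (Set.Icc (0 : ℝ) T)), 0 < R.α 0 0 t)
    {t e : ℝ} (ht : t ∈ Set.Icc 0 T) (he : 0 < e) (he1 : e ≤ 1) :
    RapidSymbol fun r => R.evSym t (max t (min r T)) e :=
  R.rapidSymbol_evSym measurable_const (by fun_prop) measurable_const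
      (fun _ => by rw [abs_of_pos he]; exact he1) (fun _ => ht.1) (fun _ => le_max_left _ _)
      (fun _ => max_le ht.2 (min_le_right _ _)) he fun r => by
        linarith [R.diff_nonneg hα ht.1 (le_max_left t (min r T)) (max_le ht.2 (min_le_right _ _))]

/-- The regularised kernels solve the forward equation. -/
theorem evKer_forward (hα : ∀ᵐ t ∂(volume.restrict (Set.Icc (0 : ℝ) T)), 0 < R.α 0 0 t)
    {t e : ℝ} (ht : t ∈ Set.Icc 0 T) (he : 0 < e) (he1 : e ≤ 1) {s s' : ℝ} (hts : t ≤ s)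
    (hss : s ≤ s') (hs : s' ≤ T) (x : ℝ) : R.evKer t s' e x - R.evKer t s e x =
      ∫ r in s..s', R.opB 0 0 r (R.evKer t r e) x := by
  have hb := R.rapidSymbol_forward hα ht he he1
  have hcl : ∀ r, t ≤ r → r ≤ T → max t (min r T) = r := fun r h1 h2 => by
    rw [min_eq_left h2, max_eq_right h1]
  have i1 := hb.integrable s
  have i2 := hb.integrable s'
  rw [hcl s hts (hss.trans hs)] at i1
  rw [hcl s' (hts.trans hss) hs] at i2
  have := R.symKernel_sub_eq hb hss 1 i1 i2 (fun ξ => ?_) x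
  · rw [one_mul] at this
    refine this.trans (intervalIntegral.integral_congr fun r hr => ?_)
    rw [Set.uIcc_of_le hss] at hr
    simp only [hcl r (hts.trans hr.1) (hr.2.trans hs)]
    rfl
  · rw [R.evSym_forward]
    push_cast
    rw [one_mul]
    refine intervalIntegral.integral_congr fun r hr => ?_
    rw [Set.uIcc_of_le hss] at hr
    simp only [hcl r (hts.trans hr.1) (hr.2.trans hs)]

theorem rapidSymbol_backward (hα : ∀ᵐ t ∂(volume.restrict (Set.Icc (0 : ℝ) T)), 0 < R.α 0 0 t)
    {τ : ℝ} (h0 : 0 ≤ τ) (hτ : τ < T) :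
    RapidSymbol fun r => R.evSym (max 0 (min r τ)) T 0 :=
  R.rapidSymbol_evSym (by fun_prop) measurable_const measurable_const (by simp)
    (fun _ => le_max_left _ _) (fun _ => (max_le h0 (min_le_right _ _)).trans hτ.le)
    (fun _ => le_rfl) (R.diff_pos hα h0 hτ le_rfl) fun _ => by
      rw [add_zero]
      exact R.diff_le hα (le_max_left _ _) (max_le h0 (min_le_right _ _)) hτ.le le_rfl

/-- The kernels solve the backward equation before the final time. -/
theorem solves_evKer (hα : ∀ᵐ t ∂(volume.restrict (Set.Icc (0 : ℝ) T)), 0 < R.α 0 0 t)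
    {τ : ℝ} (h0 : 0 ≤ τ) (hτ : τ < T) :
    Solves (R.opB 0 0) (Set.Icc 0 τ) (fun t => R.evKer (max 0 (min t τ)) T 0) fun _ _ => 0 := by
  intro t ht t' ht' htt x
  have hb := R.rapidSymbol_backward hα h0 hτ
  have hcl : ∀ r, 0 ≤ r → r ≤ τ → max 0 (min r τ) = r := fun r h1 h2 => by
    rw [min_eq_left h2, max_eq_right h1]
  have := R.symKernel_sub_eq hb htt (-1) (hb.integrable t) (hb.integrable t') (fun ξ => ?_) x
  · simp only [add_zero]
    change R.evKer _ _ _ _ - R.evKer _ _ _ _ = _ at this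
    change _ = _ - ∫ r in t..t', R.opB 0 0 r (symKernel c (R.evSym (max 0 (min r τ)) T 0)) x
    linarith
  · rw [R.evSym_backward, hcl t ht.1 ht.2, hcl t' ht'.1 ht'.2]
    push_cast
    rw [neg_one_mul]
    congr 1
    refine intervalIntegral.integral_congr fun r hr => ?_
    rw [Set.uIcc_of_le htt] at hr
    simp only [hcl r (ht.1.trans hr.1) (hr.2.trans ht'.2)]

end ReducedData

/-! ### Shifting the contour of integration -/

/-- A function that is continuous on a closed interval with zero derivative inside takes the same
values at the end points. -/
theorem eq_of_hasDerivAt_zero {f : ℝ → ℝ} {a b : ℝ} (hf : ContinuousOn f (Set.uIcc a b))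
    (h : ∀ x ∈ Set.uIoo a b, HasDerivAt f 0 x) : f a = f b := by
  have key : ∀ {a b : ℝ}, a < b → ContinuousOn f (Set.uIcc a b) →
      (∀ x ∈ Set.uIoo a b, HasDerivAt f 0 x) → f a = f b := fun {a b} hab hf h => by
    rw [Set.uIcc_of_le hab.le] at hf
    rw [Set.uIoo_of_le hab.le] at h
    obtain ⟨x, -, hx⟩ := exists_hasDerivAt_eq_slope f (fun _ => 0) hab hf h
    have : b - a ≠ 0 := (sub_pos.2 hab).ne'
    rw [eq_comm, div_eq_zero_iff] at hx
    rcases hx with hx | hx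
    · linarith
    · exact absurd hx this
  rcases lt_trichotomy a b with hab | hab | hab
  · exact key hab hf h
  · rw [hab]
  · rw [Set.uIcc_comm] at hf
    rw [Set.uIoo_comm] at h
    exact (key hab hf h).symm

namespace ReducedData

variable {N : ℕ} {T : ℝ} {E : PolynomialExpansion N T} {c : ℝ} (R : ReducedData E c)

/-- The derivative in `ζ` of the exponent of `𝒜_0(r)`. -/
noncomputable def expoDeriv (r : ℝ) (ζ : ℂ) : ℂ :=
  R.α 0 0 r * (2 * ζ - 1) + R.β 0 0 r +
    (-(R.drift 0 0 r) + ∫ z, jumpExp 1 ζ z / R.w z ∂(R.kp 0 0 r))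

theorem measurable_jumpExp_div (j : ℕ) (ζ : ℂ) : Measurable fun z => jumpExp j ζ z / (R.w z : ℂ) := by
  have := R.w_meas
  exact (measurable_jumpExp j ζ).div (by fun_prop)

theorem measurable_expoDeriv (ζ : ℂ) : Measurable fun r => R.expoDeriv r ζ := by
  have h1 := (R.α_meas 0 0).complex_ofReal
  have h2 := (R.β_meas 0 0).complex_ofReal
  have h3 := (R.measurable_drift 0 0).complex_ofReal
  have h4 : Measurable fun p : ℝ × ℝ => jumpExp 1 ζ p.2 / (R.w p.2 : ℂ) :=
    (R.measurable_jumpExp_div 1 ζ).comp measurable_snd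
  have h5 := (h4.stronglyMeasurable.integral_kernel_prod_right' (κ := R.kp 0 0)).measurable
  exact ((h1.mul_const _).add h2).add (h3.neg.add h5)

theorem norm_expoDeriv_le : ∃ C : ℝ, 0 ≤ C ∧ ∀ r (ζ : ℂ), ζ.re ∈ Set.uIcc 0 c →
    ‖R.expoDeriv r ζ‖ ≤ C * (1 + ‖ζ‖) ^ 2 := by
  obtain ⟨A, hA⟩ := R.α_bound 0 0
  obtain ⟨B, hB⟩ := R.β_bound 0 0
  obtain ⟨D, hD⟩ := R.drift_bound 0 0
  obtain ⟨C, hC, hb⟩ := R.norm_jumpExp_div_le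
  have hA0 : 0 ≤ A := (abs_nonneg _).trans (hA 0)
  have hB0 : 0 ≤ B := (abs_nonneg _).trans (hB 0)
  have hD0 : 0 ≤ D := (abs_nonneg _).trans (hD 0)
  refine ⟨2 * A + B + D + C * ((R.kp 0 0).bound).toReal, by positivity, fun r ζ hζ => ?_⟩
  have hn := norm_nonneg ζ
  have h1 : ‖(R.α 0 0 r : ℂ) * (2 * ζ - 1)‖ ≤ 2 * A * (1 + ‖ζ‖) ^ 2 := by
    have : ‖2 * ζ - 1‖ ≤ 2 * (1 + ‖ζ‖) ^ 2 := by
      refine (norm_sub_le _ _).trans ?_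
      rw [norm_mul, norm_one, show ‖(2 : ℂ)‖ = 2 by simp]
      nlinarith
    rw [norm_mul, Complex.norm_real]
    calc _ ≤ A * (2 * (1 + ‖ζ‖) ^ 2) := mul_le_mul (hA r) this (norm_nonneg _) hA0
      _ = _ := by ring
  have h2 : ‖(R.β 0 0 r : ℂ)‖ ≤ B * (1 + ‖ζ‖) ^ 2 := by
    rw [Complex.norm_real]
    exact (hB r).trans (le_mul_of_one_le_right hB0 (one_le_pow₀ (by linarith)))
  have h3 : ‖-(R.drift 0 0 r : ℂ)‖ ≤ D * (1 + ‖ζ‖) ^ 2 := by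
    rw [norm_neg, Complex.norm_real]
    exact (hD r).trans (le_mul_of_one_le_right hD0 (one_le_pow₀ (by linarith)))
  have h4 := norm_integral_kernel_le (κ := R.kp 0 0) (by positivity)
    (fun z => hb 1 le_rfl ζ hζ z) r
  rw [expoDeriv]
  refine (norm_add_le _ _).trans ((add_le_add (norm_add_le _ _) (norm_add_le _ _)).trans ?_)
  linarith

theorem strip_mem_nhds {ζ : ℂ} (hζ : ζ.re ∈ Set.uIoo 0 c) :
    {ζ' : ℂ | ζ'.re ∈ Set.uIoo 0 c} ∩ Metric.ball ζ 1 ∈ 𝓝 ζ :=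
  inter_mem ((isOpen_Ioo.preimage Complex.continuous_re).mem_nhds hζ)
    (Metric.ball_mem_nhds ζ one_pos)

theorem one_add_norm_le_of_mem_ball {ζ ζ' : ℂ} (h : ζ' ∈ Metric.ball ζ 1) :
    1 + ‖ζ'‖ ≤ 2 + ‖ζ‖ := by
  have h1 := norm_sub_norm_le ζ' ζ
  have h2 : ‖ζ' - ζ‖ < 1 := by rwa [← dist_eq_norm]
  linarith

theorem hasDerivAt_expo {ζ : ℂ} (hζ : ζ.re ∈ Set.uIoo 0 c) (r : ℝ) :
    HasDerivAt (R.expo r) (R.expoDeriv r ζ) ζ := by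
  obtain ⟨C, hC, hb⟩ := R.norm_jumpExp_div_le
  have hJ := (hasDerivAt_integral_of_dominated_loc_of_deriv_le
    (s := {ζ' : ℂ | ζ'.re ∈ Set.uIoo 0 c} ∩ Metric.ball ζ 1) (μ := R.kp 0 0 r)
    (F := fun ζ z => jumpExp 0 ζ z / (R.w z : ℂ)) (F' := fun ζ z => jumpExp 1 ζ z / (R.w z : ℂ))
    (bound := fun _ => C * (2 + ‖ζ‖) ^ 2) (strip_mem_nhds hζ)
    (Eventually.of_forall fun ζ => (R.measurable_jumpExp_div 0 ζ).aestronglyMeasurable)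
    (Integrable.of_bound (R.measurable_jumpExp_div 0 ζ).aestronglyMeasurable _
      (Eventually.of_forall fun z => hb 0 zero_le_one ζ (Set.uIoo_subset_uIcc_self hζ) z))
    (R.measurable_jumpExp_div 1 ζ).aestronglyMeasurable
    (Eventually.of_forall fun z ζ' hζ' => ?_) (integrable_const _)
    (Eventually.of_forall fun z ζ' _ => (hasDerivAt_jumpExp 0 ζ' z).div_const _)).2
  · have h1 := ((hasDerivAt_id ζ).fun_pow 2).fun_sub (hasDerivAt_id ζ)
    have h2 := (hasDerivAt_id ζ).sub_const 1
    have h3 := (h1.const_mul (R.α 0 0 r : ℂ)).fun_add (h2.const_mul (R.β 0 0 r : ℂ))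
    have h4 := ((hasDerivAt_id ζ).const_mul (-(R.drift 0 0 r : ℂ))).fun_add hJ
    exact (h3.fun_add h4).congr_deriv (by simp [expoDeriv])
  · refine (hb 1 le_rfl ζ' (Set.uIoo_subset_uIcc_self hζ'.1) z).trans ?_
    have := one_add_norm_le_of_mem_ball hζ'.2
    gcongr

/-- `∫_t^s` of the derivative of the exponent. -/
noncomputable def lamDeriv (t s : ℝ) (ζ : ℂ) : ℂ := ∫ r in t..s, R.expoDeriv r ζ

theorem hasDerivAt_lam {ζ : ℂ} (hζ : ζ.re ∈ Set.uIoo 0 c) (t s : ℝ) :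
    HasDerivAt (R.lam t s) (R.lamDeriv t s ζ) ζ := by
  obtain ⟨C, hC, hb⟩ := R.norm_expoDeriv_le
  refine (intervalIntegral.hasDerivAt_integral_of_dominated_loc_of_deriv_le
    (s := {ζ' : ℂ | ζ'.re ∈ Set.uIoo 0 c} ∩ Metric.ball ζ 1) (μ := volume)
    (F := fun ζ r => R.expo r ζ) (F' := fun ζ r => R.expoDeriv r ζ)
    (bound := fun _ => C * (2 + ‖ζ‖) ^ 2) (strip_mem_nhds hζ)
    (Eventually.of_forall fun ζ => (R.measurable_expo ζ).aestronglyMeasurable)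
    (R.intervalIntegrable_expo (Set.uIoo_subset_uIcc_self hζ) t s)
    (R.measurable_expoDeriv ζ).aestronglyMeasurable
    (Eventually.of_forall fun r _ ζ' hζ' => ?_) (by simp)
    (Eventually.of_forall fun r _ ζ' hζ' => R.hasDerivAt_expo hζ'.1 r)).2
  refine (hb r ζ' (Set.uIoo_subset_uIcc_self hζ'.1)).trans ?_
  have := one_add_norm_le_of_mem_ball hζ'.2
  gcongr

theorem norm_lamDeriv_le : ∃ C : ℝ, 0 ≤ C ∧ ∀ t s (ζ : ℂ), ζ.re ∈ Set.uIcc 0 c →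
    ‖R.lamDeriv t s ζ‖ ≤ C * (1 + ‖ζ‖) ^ 2 * |s - t| := by
  obtain ⟨C, hC, hb⟩ := R.norm_expoDeriv_le
  exact ⟨C, hC, fun t s ζ hζ =>
    intervalIntegral.norm_integral_le_of_norm_le_const fun r _ => hb r ζ hζ⟩

theorem continuousOn_lam (t s : ℝ) :
    ContinuousOn (R.lam t s) {ζ : ℂ | ζ.re ∈ Set.uIcc 0 c} := by
  obtain ⟨C, hC, hb⟩ := R.norm_expo_le
  obtain ⟨C', hC', hb'⟩ := R.norm_jumpExp_div_le
  have hball : ∀ ζ : ℂ, ∀ᶠ ζ' in 𝓝[{ζ : ℂ | ζ.re ∈ Set.uIcc 0 c}] ζ,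
      ζ'.re ∈ Set.uIcc 0 c ∧ 1 + ‖ζ'‖ ≤ 2 + ‖ζ‖ := fun ζ => by
    filter_upwards [self_mem_nhdsWithin,
      mem_nhdsWithin_of_mem_nhds (Metric.ball_mem_nhds ζ one_pos)] with ζ' h1 h2
    exact ⟨h1, one_add_norm_le_of_mem_ball h2⟩
  have hexpo : ∀ r, ContinuousOn (R.expo r) {ζ : ℂ | ζ.re ∈ Set.uIcc 0 c} := fun r => by
    have hJ : ContinuousOn (fun ζ : ℂ => ∫ z, jumpExp 0 ζ z / R.w z ∂(R.kp 0 0 r))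
        {ζ : ℂ | ζ.re ∈ Set.uIcc 0 c} := fun ζ hζ => by
      refine continuousWithinAt_of_dominated (bound := fun _ => C' * (2 + ‖ζ‖) ^ 2)
        (Eventually.of_forall fun ζ => (R.measurable_jumpExp_div 0 _).aestronglyMeasurable)
        ?_ (integrable_const _) (Eventually.of_forall fun z => ?_)
      · filter_upwards [hball ζ] with ζ' h
        refine Eventually.of_forall fun z => (hb' 0 zero_le_one _ h.1 z).trans ?_
        have := h.2
        gcongr
      · have : Continuous fun ζ => jumpExp 0 ζ z :=
          continuous_iff_continuousAt.2 fun ζ => (hasDerivAt_jumpExp 0 ζ z).continuousAt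
        exact (this.div_const _).continuousWithinAt
    unfold expo
    have h := continuousOn_id (s := {ζ : ℂ | ζ.re ∈ Set.uIcc 0 c})
    exact ((continuousOn_const.mul ((h.pow 2).sub h)).add
      (continuousOn_const.mul (h.sub continuousOn_const))).add
      ((continuousOn_const.mul h).add hJ)
  intro ζ hζ
  refine intervalIntegral.continuousWithinAt_of_dominated_interval
    (bound := fun _ => C * (2 + ‖ζ‖) ^ 2)
    (Eventually.of_forall fun ζ => (R.measurable_expo _).aestronglyMeasurable) ?_ (by simp)
    (Eventually.of_forall fun r _ => hexpo r ζ hζ)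
  filter_upwards [hball ζ] with ζ' h
  refine Eventually.of_forall fun r _ => (hb r _ h.1).trans ?_
  have := h.2
  gcongr

/-- The kernel does not depend on the vertical line between `Re ζ = 0` and `Re ζ = c` on
which it is computed (`c` may be negative): the derivative in the real part is the integral of a total derivative in the imaginary
part. -/
theorem symKernel_zero_eq {t s : ℝ} (ht : 0 ≤ t) (hts : t ≤ s) (hs : s ≤ T)
    (hpos : 0 < R.diff t s) (x : ℝ) :
    symKernel 0 (fun ξ => Complex.exp (R.lam t s (vline 0 ξ))) x =
      symKernel c (fun ξ => Complex.exp (R.lam t s (vline c ξ))) x := by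
  obtain ⟨A, hA, hb⟩ := R.norm_exp_lam_le
  obtain ⟨D, hD, hbD⟩ := R.norm_lamDeriv_le
  obtain ⟨B, hB, hsq⟩ := exp_neg_mul_sq_le hpos (-4)
  set G : ℂ → ℂ := fun ζ => Complex.exp (ζ * x) * Complex.exp (R.lam t s ζ) with hG
  set G' : ℂ → ℂ := fun ζ => (x + R.lamDeriv t s ζ) * G ζ with hG'
  have hv : ∀ ξ : ℝ, Continuous fun θ : ℝ => vline θ ξ := fun ξ => by unfold vline; fun_prop
  have hder : ∀ {ζ : ℂ}, ζ.re ∈ Set.uIoo 0 c → HasDerivAt G (G' ζ) ζ := fun {ζ} hζ => by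
    have h1 := ((hasDerivAt_id ζ).mul_const (x : ℂ)).cexp
    exact (h1.fun_mul (R.hasDerivAt_lam hζ t s).cexp).congr_deriv (by simp [hG', hG]; ring)
  -- bounds on the strip
  have hGb : ∀ θ ∈ Set.uIcc 0 c, ∀ ξ : ℝ, ‖G (vline θ ξ)‖ ≤
      Real.exp (|c| * |x|) * (A * B) * symWeight (-4) ξ := fun θ hθ ξ => by
    have h1 := hb θ hθ t ⟨ht, hts.trans hs⟩ s ⟨ht.trans hts, hs⟩ hts ξ
    have h2 : Real.exp (θ * x) ≤ Real.exp (|c| * |x|) := by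
      refine Real.exp_le_exp.2 ((le_abs_self _).trans ?_)
      rw [abs_mul]
      exact mul_le_mul_of_nonneg_right (abs_le_of_mem_uIcc_zero hθ) (abs_nonneg x)
    rw [hG]
    simp only
    rw [norm_mul, norm_exp_vline_mul]
    calc _ ≤ Real.exp (|c| * |x|) * (A * (B * symWeight (-4) ξ)) := by
          gcongr
          exact h1.trans (mul_le_mul_of_nonneg_left (hsq ξ) hA.le)
      _ = _ := by ring
  have hK : 0 ≤ Real.exp (|c| * |x|) * (A * B) := by positivity
  have hGb' : ∀ θ ∈ Set.uIcc 0 c, ∀ ξ : ℝ, ‖G' (vline θ ξ)‖ ≤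
      (|x| + D * (1 + |c|) ^ 2 * |s - t|) * (Real.exp (|c| * |x|) * (A * B)) * symWeight (-2) ξ :=
    fun θ hθ ξ => by
    have h1 := hbD t s (vline θ ξ) (by simpa using hθ)
    have h2 : (1 + ‖vline θ ξ‖) ^ 2 ≤ (1 + |c|) ^ 2 * symWeight 2 ξ := by
      have e : symWeight 2 ξ = (1 + |ξ|) ^ 2 := by rw [symWeight]; norm_cast
      rw [e, ← mul_pow]
      exact pow_le_pow_left₀ (by positivity) (norm_vline_le (abs_le_of_mem_uIcc_zero hθ) ξ) 2
    have h3 : 1 ≤ symWeight 2 ξ := by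
      simpa [symWeight] using symWeight_mono (d := 0) (e := 2) (by norm_num) ξ
    have h4 : ‖(x : ℂ) + R.lamDeriv t s (vline θ ξ)‖ ≤
        (|x| + D * (1 + |c|) ^ 2 * |s - t|) * symWeight 2 ξ := by
      refine (norm_add_le _ _).trans ?_
      rw [Complex.norm_real, Real.norm_eq_abs, add_mul]
      refine add_le_add (le_mul_of_one_le_right (abs_nonneg x) h3) (h1.trans ?_)
      calc _ ≤ D * ((1 + |c|) ^ 2 * symWeight 2 ξ) * |s - t| := by gcongr
        _ = _ := by ring
    have e : symWeight (-2) ξ = symWeight 2 ξ * symWeight (-4) ξ := by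
      rw [← symWeight_add]; norm_num
    rw [hG']
    simp only
    rw [norm_mul, e]
    calc _ ≤ ((|x| + D * (1 + |c|) ^ 2 * |s - t|) * symWeight 2 ξ) *
          (Real.exp (|c| * |x|) * (A * B) * symWeight (-4) ξ) :=
          mul_le_mul h4 (hGb θ hθ ξ) (norm_nonneg _) (by
            have := symWeight_nonneg 2 ξ; positivity)
      _ = _ := by ring
  have hdξ : ∀ θ ∈ Set.uIoo 0 c, ∀ ξ : ℝ,
      HasDerivAt (fun ξ : ℝ => G (vline θ ξ)) (Complex.I * G' (vline θ ξ)) ξ := fun θ hθ ξ => by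
    have h1 : HasDerivAt (vline θ) Complex.I ξ := by
      change HasDerivAt (fun ξ : ℝ => (θ : ℂ) + Complex.I * ξ) Complex.I ξ
      simpa using ((hasDerivAt_id ξ).ofReal_comp.const_mul Complex.I).const_add (θ : ℂ)
    exact ((hder (ζ := vline θ ξ) (by simpa using hθ)).comp ξ h1).congr_deriv (mul_comm _ _)
  have hGm : ∀ θ ∈ Set.uIcc 0 c, AEStronglyMeasurable (fun ξ : ℝ => G (vline θ ξ)) volume :=
    fun θ hθ => by
    have hvξ : Continuous fun ξ : ℝ => vline θ ξ := by unfold vline; fun_prop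
    have := (R.continuousOn_lam t s).comp_continuous hvξ fun ξ => by simpa using hθ
    exact ((hvξ.mul continuous_const).cexp.mul this.cexp).aestronglyMeasurable
  have hGm' : ∀ θ ∈ Set.uIoo 0 c, AEStronglyMeasurable (fun ξ : ℝ => G' (vline θ ξ)) volume :=
    fun θ hθ => by
    have := (measurable_deriv fun ξ : ℝ => G (vline θ ξ)).const_mul (-Complex.I)
    refine this.aestronglyMeasurable.congr (Eventually.of_forall fun ξ => ?_)
    simp only [(hdξ θ hθ ξ).deriv]
    rw [← mul_assoc]; simp
  have hGi : ∀ θ ∈ Set.uIcc 0 c, Integrable fun ξ : ℝ => G (vline θ ξ) := fun θ hθ =>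
    ((integrable_symWeight (by norm_num)).const_mul _).mono' (hGm θ hθ)
      (Eventually.of_forall (hGb θ hθ))
  have hGi' : ∀ θ ∈ Set.uIoo 0 c, Integrable fun ξ : ℝ => G' (vline θ ξ) := fun θ hθ =>
    ((integrable_symWeight le_rfl).const_mul _).mono' (hGm' θ hθ)
      (Eventually.of_forall (hGb' θ (Set.uIoo_subset_uIcc_self hθ)))
  -- `i G'` is the derivative of `G` in the imaginary part
  have hzero : ∀ θ ∈ Set.uIoo 0 c, ∫ ξ : ℝ, G' (vline θ ξ) = 0 := fun θ hθ => by
    have := integral_eq_zero_of_hasDerivAt_of_integrable (hdξ θ hθ) ((hGi' θ hθ).const_mul _)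
      (hGi θ (Set.uIoo_subset_uIcc_self hθ))
    rw [integral_const_mul] at this
    simpa using this
  have hdθ : ∀ θ ∈ Set.uIoo 0 c, HasDerivAt (fun θ : ℝ => ∫ ξ : ℝ, G (vline θ ξ)) 0 θ :=
    fun θ hθ => by
    rw [← hzero θ hθ]
    refine (hasDerivAt_integral_of_dominated_loc_of_deriv_le (s := Set.uIoo 0 c)
      (F := fun (θ ξ : ℝ) => G (vline θ ξ)) (F' := fun (θ ξ : ℝ) => G' (vline θ ξ))
      (bound := fun ξ => (|x| + D * (1 + |c|) ^ 2 * |s - t|) *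
        (Real.exp (|c| * |x|) * (A * B)) * symWeight (-2) ξ)
      (isOpen_Ioo.mem_nhds hθ) ?_ (hGi θ (Set.uIoo_subset_uIcc_self hθ)) (hGm' θ hθ)
      (Eventually.of_forall fun ξ θ' hθ' => hGb' θ' (Set.uIoo_subset_uIcc_self hθ') ξ)
      ((integrable_symWeight le_rfl).const_mul _)
      (Eventually.of_forall fun ξ θ' hθ' => ?_)).2
    · filter_upwards [isOpen_Ioo.mem_nhds hθ] with θ' hθ'
      exact hGm θ' (Set.uIoo_subset_uIcc_self hθ')
    · have h1 : HasDerivAt (fun θ : ℝ => vline θ ξ) 1 θ' := by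
        change HasDerivAt (fun θ : ℝ => (θ : ℂ) + Complex.I * ξ) 1 θ'
        simpa using (hasDerivAt_id θ').ofReal_comp.add_const (Complex.I * (ξ : ℂ))
      exact ((hder (ζ := vline θ' ξ) (by simpa using hθ')).comp θ' h1).congr_deriv (mul_one _)
  have hcont : ContinuousOn (fun θ : ℝ => ∫ ξ : ℝ, G (vline θ ξ)) (Set.uIcc 0 c) := by
    refine continuousOn_of_dominated hGm
      (fun θ hθ => Eventually.of_forall (hGb θ hθ)) ((integrable_symWeight (by norm_num)).const_mul _)
      (Eventually.of_forall fun ξ => ?_)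
    refine ContinuousOn.mul ?_ ((R.continuousOn_lam t s).comp (hv ξ).continuousOn
      fun θ hθ => by simpa using hθ).cexp
    exact (((hv ξ).mul continuous_const).cexp).continuousOn
  have := eq_of_hasDerivAt_zero
    (f := fun θ : ℝ => ((1 / (2 * Real.pi) : ℂ) * ∫ ξ : ℝ, G (vline θ ξ)).re) (a := 0) (b := c)
    (Complex.continuous_re.comp_continuousOn (continuousOn_const.mul hcont))
    fun θ hθ => by
      have := (hdθ θ hθ).const_mul (1 / (2 * Real.pi) : ℂ)
      exact (Complex.reCLM.hasFDerivAt.comp_hasDerivAt θ this).congr_deriv (by simp)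
  exact this

end ReducedData

/-! ### The transition density -/

namespace ReducedData

variable {N : ℕ} {T : ℝ} {E : PolynomialExpansion N T} {c : ℝ} (R : ReducedData E c)

theorem Phi₀_eq {t s : ℝ} (ht : t ∈ Set.Icc 0 T) (hs : s ∈ Set.Icc 0 T) (ξ : ℝ) :
    E.Phi₀ t s ξ = R.lam t s (vline 0 ξ) := by
  obtain ⟨A, hA⟩ := R.α_bound 0 0
  obtain ⟨B, hB⟩ := R.β_bound 0 0
  obtain ⟨D, hD⟩ := R.drift_bound 0 0
  obtain ⟨C, hC, hb⟩ := R.norm_jumpExp_div_le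
  have hm : E.mV t s = ∫ r in t..s, (R.β 0 0 r - R.α 0 0 r - R.drift 0 0 r) := by
    refine intervalIntegral_congr_Icc ht hs ?_
    filter_upwards [R.ae_a₀_eq, R.ae_γ₀_eq, ae_restrict_mem measurableSet_Icc] with r h1 h2 hr
    rw [h1, h2, R.ν₀_integral_eq hr (by simp), drift, lint_zero_zero]
    simp only [smul_eq_mul, div_eq_inv_mul]
  have hC' : E.CV t s = ∫ r in t..s, 2 * R.α 0 0 r := by
    refine intervalIntegral_congr_Icc ht hs ?_
    filter_upwards [R.ae_a₀_eq] with r h1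
    rw [h1]
  have hγ : ∫ r in t..s, E.γ₀ r = ∫ r in t..s, R.β 0 0 r := intervalIntegral_congr_Icc ht hs R.ae_γ₀_eq
  have hΨ : E.PsiV t s ξ = ∫ r in t..s, ∫ z, jumpExp 0 (vline 0 ξ) z / R.w z ∂(R.kp 0 0 r) := by
    refine intervalIntegral_congr_Icc ht hs ?_
    filter_upwards [ae_restrict_mem measurableSet_Icc] with r hr
    rw [R.ν₀_integral_eq hr (by simp)]
    refine integral_congr_ae (Eventually.of_forall fun z => ?_)
    simp only [jumpExp, vline, if_pos, Complex.ofReal_zero, zero_add, Complex.real_smul,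
      Complex.ofReal_inv, div_eq_inv_mul]
    rw [mul_right_comm]
  have i1 : IntervalIntegrable (fun r => R.β 0 0 r - R.α 0 0 r - R.drift 0 0 r) volume t s :=
    ((intervalIntegrable_of_bound (R.β_meas 0 0) hB t s).sub
      (intervalIntegrable_of_bound (R.α_meas 0 0) hA t s)).sub
      (intervalIntegrable_of_bound (R.measurable_drift 0 0) hD t s)
  have i2 : IntervalIntegrable (fun r => 2 * R.α 0 0 r) volume t s :=
    (R.intervalIntegrable_α t s).const_mul 2
  have i3 := intervalIntegrable_of_bound (R.β_meas 0 0) hB t s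
  have i4 : IntervalIntegrable (fun r => ∫ z, jumpExp 0 (vline 0 ξ) z / R.w z ∂(R.kp 0 0 r))
      volume t s := by
    have h4 : Measurable fun p : ℝ × ℝ => jumpExp 0 (vline 0 ξ) p.2 / (R.w p.2 : ℂ) :=
      (R.measurable_jumpExp_div 0 _).comp measurable_snd
    have h5 := (h4.stronglyMeasurable.integral_kernel_prod_right' (κ := R.kp 0 0))
    rw [intervalIntegrable_iff]
    exact Measure.integrableOn_of_bounded (by simp [Set.uIoc]) h5.aestronglyMeasurable
      (Eventually.of_forall (norm_integral_kernel_le (κ := R.kp 0 0) (by positivity)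
        (fun z => hb 0 zero_le_one _ (by simp) z)))
  have e : ∀ r, R.expo r (vline 0 ξ) =
      Complex.I * ξ * ((R.β 0 0 r - R.α 0 0 r - R.drift 0 0 r : ℝ) : ℂ)
        - (1 / 2) * (ξ : ℂ) ^ 2 * ((2 * R.α 0 0 r : ℝ) : ℂ)
        + ∫ z, jumpExp 0 (vline 0 ξ) z / R.w z ∂(R.kp 0 0 r)
        - ((R.β 0 0 r : ℝ) : ℂ) := fun r => by
    rw [expo]
    simp only [vline, Complex.ofReal_zero, zero_add]
    rw [mul_pow, Complex.I_sq]
    push_cast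
    ring
  have cast : ∀ {f : ℝ → ℝ}, IntervalIntegrable f volume t s →
      IntervalIntegrable (fun r => (f r : ℂ)) volume t s := fun hf => ⟨hf.1.ofReal, hf.2.ofReal⟩
  have c1 := cast i1
  have c2 := cast i2
  have c3 := cast i3
  rw [lam]
  simp only [e]
  rw [intervalIntegral.integral_sub (((c1.const_mul _).sub (c2.const_mul _)).add i4) c3,
    intervalIntegral.integral_add ((c1.const_mul _).sub (c2.const_mul _)) i4,
    intervalIntegral.integral_sub (c1.const_mul _) (c2.const_mul _),
    intervalIntegral.integral_const_mul, intervalIntegral.integral_const_mul]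
  simp only [intervalIntegral.integral_ofReal]
  rw [PolynomialExpansion.Phi₀, hm, hC', hγ, hΨ]
  ring

/-- The transition density is the kernel of the evolution. -/
theorem p₀_eq (hα : ∀ᵐ t ∂(volume.restrict (Set.Icc (0 : ℝ) T)), 0 < R.α 0 0 t) {t : ℝ}
    (ht : t ∈ Set.Ico 0 T) (x y : ℝ) : E.p₀ t x T y = R.evKer t T 0 (x - y) := by
  have h0T : (0 : ℝ) ≤ T := ht.1.trans ht.2.le
  have h1 := R.symKernel_zero_eq ht.1 ht.2.le le_rfl
    (R.diff_pos hα ht.1 ht.2 le_rfl) (x - y)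
  have h2 : R.evSym t T 0 = fun ξ => Complex.exp (R.lam t T (vline c ξ)) :=
    funext fun ξ => by simp [evSym]
  rw [evKer, h2]
  rw [← h1, PolynomialExpansion.p₀, symKernel]
  congr 3 with ξ
  rw [PolynomialExpansion.p₀hat, R.Phi₀_eq ⟨ht.1, ht.2.le⟩ ⟨h0T, le_rfl⟩, ← Complex.exp_add,
    ← Complex.exp_add]
  congr 1
  simp only [vline]
  push_cast
  ring

end ReducedData

/-! ### Convolution of kernels with data -/

/-- Integration against an integrable function is integration against a finite measure, up to a
bounded factor. -/
theorem exists_integral_mul_eq {H : ℝ → ℝ} (hH : Integrable H) :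
    ∃ (μ : Measure ℝ) (_ : IsFiniteMeasure μ) (σ : ℝ → ℝ), Measurable σ ∧ (∀ y, |σ y| ≤ 1) ∧
      ∀ f : ℝ → ℝ, ∫ y, f y * H y = ∫ y, f y * σ y ∂μ := by
  set H' := hH.1.mk H with hH'
  have hm : Measurable H' := hH.1.stronglyMeasurable_mk.measurable
  have hi : Integrable H' := hH.congr hH.1.ae_eq_mk
  refine ⟨volume.withDensity fun y => (‖H' y‖₊ : ℝ≥0∞),
    isFiniteMeasure_withDensity hi.2.ne, fun y => H' y / |H' y|,
    hm.div (by fun_prop), fun y => ?_, fun f => ?_⟩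
  · rw [abs_div, abs_abs]
    exact div_self_le_one _
  · rw [integral_withDensity_eq_integral_smul hm.nnnorm]
    refine integral_congr_ae ?_
    filter_upwards [hH.1.ae_eq_mk] with y hy
    rw [hy, NNReal.smul_def, coe_nnnorm, Real.norm_eq_abs, smul_eq_mul]
    by_cases h0 : H' y = 0
    · simp [← hH', h0]
    · rw [← hH']
      field_simp

/-- `h` is integrable with respect to some weight `e^{-cx} / (1 + |x|)^K`. -/
def IsDatum (c : ℝ) (h : ℝ → ℝ) : Prop :=
  ∃ K : ℕ, Integrable (fun x : ℝ => h x * Real.exp (-(c * x)) / (1 + |x|) ^ K)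

namespace IsDatum

variable {c : ℝ} {h : ℝ → ℝ} {P Q : Type} [MeasurableSpace P] [MeasurableSpace Q]

theorem expWeight_mul_eq (c : ℝ) (h : ℝ → ℝ) (k : ℕ) (a y : ℝ) :
    expWeight c k y * a * (h y * Real.exp (-(c * y)) / (1 + |y|) ^ k) = a * h y := by
  have h1 : (1 + |y|) ^ k ≠ 0 := by positivity
  rw [expWeight, Real.exp_neg]
  have := Real.exp_ne_zero (c * y)
  field_simp

/-- The convolution of a datum with a rapid family, with the data absorbed in a finite measure. -/
theorem exists_repr (hh : IsDatum c h) : ∃ (k : ℕ) (μ : Measure ℝ) (_ : IsFiniteMeasure μ)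
    (σ : ℝ → ℝ), Measurable σ ∧ (∀ y, |σ y| ≤ 1) ∧
      ∀ (f : ℝ → ℝ) (x : ℝ), ∫ y, f (x - y) * h y =
        ∫ y, σ y * (expWeight c k y * f (x - y)) ∂μ := by
  obtain ⟨k, hk⟩ := hh
  obtain ⟨μ, hμ, σ, h1, h2, h3⟩ := exists_integral_mul_eq hk
  refine ⟨k, μ, hμ, σ, h1, h2, fun f x => ?_⟩
  have := h3 fun y => expWeight c k y * f (x - y)
  simp only [expWeight_mul_eq] at this
  rw [this]
  simp only [mul_comm]

theorem tame_repr {Ker : Q → ℝ → ℝ} (hK : RapidFamily c Ker) (k : ℕ) {σ : ℝ → ℝ} (h1 : Measurable σ)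
    (h2 : ∀ y, |σ y| ≤ 1) :
    TameFamily c fun (p : Q × ℝ) x => σ p.2 * (expWeight c k p.2 * Ker p.1 (x - p.2)) :=
  (hK.translate k).smul (h1.comp measurable_snd) fun p => h2 p.2

theorem integrable (hh : IsDatum c h) {Ker : Q → ℝ → ℝ} (hK : RapidFamily c Ker) (q : Q) (x : ℝ) :
    Integrable fun y => Ker q (x - y) * h y := by
  obtain ⟨k, hk⟩ := hh
  have ht := hK.translate k
  obtain ⟨C, L, hC, hb⟩ := ht.bound_zero
  have hm : Measurable fun y => expWeight c k y * Ker q (x - y) :=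
    (ht.meas x).comp (measurable_const.prodMk measurable_id)
  have := hk.bdd_mul hm.aestronglyMeasurable (c := C * expWeight c L x)
    (Eventually.of_forall fun y => hb (q, y) x)
  simpa only [expWeight_mul_eq] using this

/-- The convolutions of a datum with a rapid family form a tame family. -/
theorem tame (hh : IsDatum c h) {Ker : Q → ℝ → ℝ} (hK : RapidFamily c Ker) :
    TameFamily c fun q x => ∫ y, Ker q (x - y) * h y := by
  obtain ⟨k, μ, hμ, σ, h1, h2, h3⟩ := hh.exists_repr
  have := (tame_repr hK k h1 h2).integral_prod μ
  simpa only [h3] using this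

/-- The convolution of a datum with a solution is a solution. -/
theorem solves (hh : IsDatum c h) {A : ℝ → (ℝ → ℝ) → ℝ → ℝ} (hA : IsTransOp c A) {I : Set ℝ}
    {Ker : ℝ → ℝ → ℝ} (hK : RapidFamily c Ker) (hS : Solves A I Ker fun _ _ => 0) :
    Solves A I (fun t x => ∫ y, Ker t (x - y) * h y) fun _ _ => 0 := by
  obtain ⟨k, μ, hμ, σ, h1, h2, h3⟩ := hh.exists_repr
  have := Solves.integral hA.toIsTameOp (tame_repr hK k h1 h2) (fun y => ?_) (I := I) μ
  · simpa only [h3] using this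
  · intro t ht t' ht' htt x
    have hsm : ∀ r, SmoothGrowth c fun x => Ker r (x - y) := fun r => by
      simpa only [sub_eq_add_neg] using (hK.tame.smoothGrowth r).comp_add (-y)
    have e : ∀ r, A r (fun x => σ y * (expWeight c k y * Ker r (x - y))) x =
        σ y * expWeight c k y * A r (Ker r) (x - y) := fun r => by
      simp only [← mul_assoc]
      rw [hA.smul (hsm r)]
      simp only [sub_eq_add_neg]
      rw [hA.shift (hK.tame.smoothGrowth r)]
    simp only [add_zero, e]
    rw [intervalIntegral.integral_const_mul]
    have := hS t ht t' ht' htt (x - y)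
    simp only [add_zero] at this
    rw [this]
    ring

end IsDatum

/-! ### Convolution of kernels with smooth data -/

section

variable {c : ℝ} {P Q : Type} [MeasurableSpace Q]

theorem inv_one_add_abs_sq (x : ℝ) : ((1 + |x|) ^ 2)⁻¹ = symWeight (-2) x := by
  rw [symWeight]; norm_cast

theorem isDatum_of_bound {h : ℝ → ℝ} (hm : AEStronglyMeasurable h) {C : ℝ} {K : ℕ}
    (hb : ∀ x, |h x| ≤ C * expWeight c K x) : IsDatum c h := by
  refine ⟨K + 2, ((integrable_symWeight le_rfl).const_mul C).mono' ?_ (Eventually.of_forall fun x => ?_)⟩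
  · simp only [div_eq_mul_inv]
    have h1 : Measurable fun x : ℝ => Real.exp (-(c * x)) := by fun_prop
    have h2 : Measurable fun x : ℝ => ((1 + |x|) ^ (K + 2))⁻¹ := by fun_prop
    exact (hm.mul h1.aestronglyMeasurable).mul h2.aestronglyMeasurable
  · rw [← inv_one_add_abs_sq, Real.norm_eq_abs, abs_div, abs_mul, Real.abs_exp, abs_pow,
      abs_of_pos (show (0 : ℝ) < 1 + |x| by positivity), div_le_iff₀ (by positivity)]
    calc |h x| * Real.exp (-(c * x)) ≤ C * expWeight c K x * Real.exp (-(c * x)) := by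
          gcongr; exact hb x
      _ = C * (1 + |x|) ^ K * (Real.exp (c * x) * Real.exp (-(c * x))) := by rw [expWeight]; ring
      _ = C * ((1 + |x|) ^ 2)⁻¹ * (1 + |x|) ^ (K + 2) := by
        rw [← Real.exp_add, add_neg_cancel, Real.exp_zero, pow_add]
        have : (1 + |x|) ^ 2 ≠ 0 := by positivity
        field_simp

theorem SmoothGrowth.isDatum {h : ℝ → ℝ} (hh : SmoothGrowth c h) : IsDatum c h := by
  obtain ⟨C, K, -, hb⟩ := hh.tame.bound_zero
  exact isDatum_of_bound hh.1.continuous.aestronglyMeasurable fun x => hb () x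

/-- Differentiation of a convolution may be moved from the kernel to the data. -/
theorem integral_deriv_mul_eq {Ker : Q → ℝ → ℝ} (hK : RapidFamily c Ker) {h : ℝ → ℝ}
    (hd : Differentiable ℝ h) (hh : IsDatum c h) (hh' : IsDatum c (deriv h)) (q : Q) (x : ℝ) :
    ∫ y, deriv (Ker q) (x - y) * h y = ∫ y, Ker q (x - y) * deriv h y := by
  have hu : ∀ y, HasDerivAt (fun y => Ker q (x - y)) (-deriv (Ker q) (x - y)) y := fun y => by
    have h1 := ((hK.tame.smoothGrowth q).differentiable (x - y)).hasDerivAt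
    exact (h1.scomp y ((hasDerivAt_id y).const_sub x)).congr_deriv (by simp)
  have := integral_mul_deriv_eq_deriv_mul_of_integrable (u := fun y => Ker q (x - y)) (v := h)
    (u' := fun y => -deriv (Ker q) (x - y)) (v' := deriv h) (fun y _ => hu y)
    (fun y _ => (hd y).hasDerivAt) (hh'.integrable hK q x)
    (by simpa [Pi.mul_def] using (hh.integrable hK.deriv q x).neg) (hh.integrable hK q x)
  rw [this, ← integral_neg]
  simp

/-- Translation invariant operators act on a convolution through the kernel. -/
theorem IsDatum.map_integral {h : ℝ → ℝ} (hh : IsDatum c h) {R : Type} [MeasurableSpace R]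
    {A : R → (ℝ → ℝ) → ℝ → ℝ} (hA : IsTransOp c A) {Ker : Q → ℝ → ℝ} (hK : RapidFamily c Ker)
    (p : R) (q : Q) (x : ℝ) :
    A p (fun x => ∫ y, Ker q (x - y) * h y) x = ∫ y, A p (Ker q) (x - y) * h y := by
  obtain ⟨k, μ, hμ, σ, h1, h2, h3⟩ := hh.exists_repr
  simp only [h3]
  have ht : TameFamily c fun y x => σ y * (expWeight c k y * Ker q (x - y)) :=
    (IsDatum.tame_repr hK k h1 h2).comp (φ := fun y => (q, y)) (by fun_prop)
  rw [hA.toIsTameOp.integral ht μ p x]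
  congr 1 with y
  have hsm : SmoothGrowth c fun x => Ker q (x - y) := by
    simpa only [sub_eq_add_neg] using (hK.tame.smoothGrowth q).comp_add (-y)
  simp only [← mul_assoc]
  rw [hA.smul hsm]
  simp only [sub_eq_add_neg]
  rw [hA.shift (hK.tame.smoothGrowth q)]

theorem IsDatum.deriv_integral {h : ℝ → ℝ} (hh : IsDatum c h) {Ker : Q → ℝ → ℝ}
    (hK : RapidFamily c Ker) (q : Q) (x : ℝ) :
    deriv (fun x => ∫ y, Ker q (x - y) * h y) x = ∫ y, deriv (Ker q) (x - y) * h y :=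
  hh.map_integral (IsTransOp.derivOp (P := Unit)) hK () q x

theorem RapidFamily.iteratedDeriv_integral {Ker : Q → ℝ → ℝ} (hK : RapidFamily c Ker) {h : ℝ → ℝ}
    (hh : SmoothGrowth c h) (q : Q) (j : ℕ) :
    iteratedDeriv j (fun x => ∫ y, Ker q (x - y) * h y) =
      fun x => ∫ y, Ker q (x - y) * iteratedDeriv j h y := by
  induction j with
  | zero => simp
  | succ j ih =>
    have hj : SmoothGrowth c (iteratedDeriv j h) := (hh.tame.iteratedDeriv j).smoothGrowth ()
    rw [iteratedDeriv_succ, ih]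
    ext x
    rw [hj.isDatum.deriv_integral hK, integral_deriv_mul_eq hK hj.differentiable hj.isDatum hj.deriv.isDatum, iteratedDeriv_succ]

/-- The operator `f' + (1 - c) f`, whose symbol on the line `Re ζ = c` is `1 + iξ`. -/
noncomputable def shiftDeriv (c : ℝ) (f : ℝ → ℝ) (x : ℝ) : ℝ := deriv f x + (1 - c) * f x

theorem SmoothGrowth.shiftDeriv_iterate {h : ℝ → ℝ} (hh : SmoothGrowth c h) (L : ℕ) :
    SmoothGrowth c ((shiftDeriv c)^[L] h) := by
  induction L with
  | zero => exact hh
  | succ L ih =>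
    rw [Function.iterate_succ_apply']
    exact ih.deriv.add (ih.const_mul _)

/-- Derivatives of the data buy decay of the symbol. -/
theorem RapidSymbol.integral_symKernel_eq {b : Q → ℝ → ℂ} (hb : RapidSymbol b) {h : ℝ → ℝ}
    (hh : SmoothGrowth c h) (q : Q) (L : ℕ) (x : ℝ) :
    ∫ y, symKernel c (b q) (x - y) * h y =
      ∫ y, symKernel c (fun ξ => (1 + Complex.I * ξ)⁻¹ ^ L * b q ξ) (x - y) *
        (shiftDeriv c)^[L] h y := by
  have hinv : ∀ {b : Q → ℝ → ℂ}, RapidSymbol b →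
      RapidSymbol fun q ξ => (1 + Complex.I * ξ)⁻¹ * b q ξ := fun hb =>
    hb.mul_sym fun k => SymFamily.inv_affine k
  have step : ∀ {b : Q → ℝ → ℂ} {h : ℝ → ℝ}, RapidSymbol b → SmoothGrowth c h →
      ∫ y, symKernel c (b q) (x - y) * h y =
        ∫ y, symKernel c (fun ξ => (1 + Complex.I * ξ)⁻¹ * b q ξ) (x - y) * shiftDeriv c h y := by
    intro b h hb hh
    have hb' := hinv hb
    have hK := hb'.rapidFamily (c := c)
    have e : ∀ w, symKernel c (b q) w =
        deriv (symKernel c fun ξ => (1 + Complex.I * ξ)⁻¹ * b q ξ) w +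
          (1 - c) * symKernel c (fun ξ => (1 + Complex.I * ξ)⁻¹ * b q ξ) w := fun w => by
      rw [(hb'.hasDerivAt q w).deriv, ← symKernel_const_mul, ← symKernel_add
        (hb'.vline_mul.integrable q) ((hb'.integrable q).const_mul _)]
      congr 1 with ξ
      have hne : (1 + Complex.I * ξ) ≠ 0 := fun h => by
        have := congrArg Complex.re h
        simp at this
      rw [vline]
      field_simp
      push_cast
      ring
    simp only [e, shiftDeriv, add_mul, mul_add]
    have i1 := hh.isDatum.integrable hK.deriv q x
    have i2 := hh.isDatum.integrable hK q x
    have i3 := hh.deriv.isDatum.integrable hK q x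
    rw [integral_add i1 (by simpa only [mul_assoc] using i2.const_mul (1 - c)),
      integral_add i3 (by simpa only [mul_left_comm] using i2.const_mul (1 - c)),
      integral_deriv_mul_eq hK hh.differentiable hh.isDatum hh.deriv.isDatum]
    congr 2 with y
    ring
  induction L generalizing b h with
  | zero => simp
  | succ L ih =>
    rw [step hb hh, ih (hinv hb) (h := shiftDeriv c h) (hh.shiftDeriv_iterate 1),
      Function.iterate_succ_apply]
    simp only [pow_succ, mul_assoc]

theorem integral_symWeight_sub (x : ℝ) :
    ∫ y, symWeight (-2) (x - y) = ∫ y, symWeight (-2) y :=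
  integral_sub_left_eq_self _ volume x

/-- The convolution of a kernel with polynomial decay against growing data. -/
theorem abs_mul_le_of_decay {f g : ℝ → ℝ} {C D : ℝ} {K : ℕ} (hC : 0 ≤ C)
    (hf : ∀ x, |f x| ≤ C * (Real.exp (c * x) / (1 + |x|) ^ (K + 2)))
    (hg : ∀ x, |g x| ≤ D * expWeight c K x) (x y : ℝ) :
    |f (x - y) * g y| ≤ C * D * expWeight c K x * symWeight (-2) (x - y) := by
  have hD : 0 ≤ D := by
    have h1 := (abs_nonneg _).trans (hg 0)
    have h2 := expWeight_pos c K 0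
    exact nonneg_of_mul_nonneg_left h1 h2
  rw [abs_mul, ← inv_one_add_abs_sq]
  calc _ ≤ C * (Real.exp (c * (x - y)) / (1 + |x - y|) ^ (K + 2)) * (D * expWeight c K y) :=
        mul_le_mul (hf _) (hg y) (abs_nonneg _) (by positivity)
    _ = C * D * (expWeight c K y * (Real.exp (c * (x - y)) / (1 + |x - y|) ^ K)) *
          ((1 + |x - y|) ^ 2)⁻¹ := by
        rw [pow_add]; field_simp
    _ ≤ _ := by
        have := RapidFamily.expWeight_mul_le c K x y
        gcongr

theorem abs_integral_le_of_decay {f g : ℝ → ℝ} {C D : ℝ} {K : ℕ} (hC : 0 ≤ C)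
    (hf : ∀ x, |f x| ≤ C * (Real.exp (c * x) / (1 + |x|) ^ (K + 2)))
    (hg : ∀ x, |g x| ≤ D * expWeight c K x) (x : ℝ) :
    |∫ y, f (x - y) * g y| ≤ C * D * (∫ y, symWeight (-2) y) * expWeight c K x := by
  have h1 := norm_integral_le_of_norm_le
    (((integrable_symWeight le_rfl).comp_sub_left x).const_mul (C * D * expWeight c K x))
    (f := fun y => f (x - y) * g y)
    (Eventually.of_forall fun y => abs_mul_le_of_decay hC hf hg x y)
  rw [Real.norm_eq_abs, integral_const_mul, integral_symWeight_sub] at h1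
  linarith

theorem measurable_symKernel_apply {b : ℝ → ℂ} (hb : Continuous b) : Measurable (symKernel c b) := by
  have h1 : Continuous fun p : ℝ × ℝ => Complex.exp (vline c p.2 * (p.1 : ℂ)) * b p.2 := by
    unfold vline; fun_prop
  have h2 := (h1.measurable.stronglyMeasurable.integral_prod_right' (ν := volume)).measurable
  exact Complex.measurable_re.comp (h2.const_mul _)

/-- Convergence of symbols with two extra powers of decay gives convergence of convolutions with
growing data. -/
theorem SymFamily.tendsto_integral {K : ℕ} {a : Q → ℝ → ℂ} (ha : SymFamily (K + 2) (-2) a)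
    {g : ℝ → ℝ} (hgm : AEStronglyMeasurable g) {D : ℝ} (hg : ∀ x, |g x| ≤ D * expWeight c K x)
    {l : Filter P} [l.IsCountablyGenerated] {φ : P → Q} {q₀ : Q}
    (h : ∀ ξ, Tendsto (fun p => a (φ p) ξ) l (𝓝 (a q₀ ξ))) (x : ℝ) :
    Tendsto (fun p => ∫ y, symKernel c (a (φ p)) (x - y) * g y) l
      (𝓝 (∫ y, symKernel c (a q₀) (x - y) * g y)) := by
  obtain ⟨C, hC, hb⟩ := ha.symKernel_bound (c := c)
  obtain ⟨C', hC', hb'⟩ := ha.base.bound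
  refine tendsto_integral_filter_of_dominated_convergence
    (fun y => C * D * expWeight c K x * symWeight (-2) (x - y))
    (Eventually.of_forall fun p => ?_)
    (Eventually.of_forall fun p => Eventually.of_forall fun y =>
      abs_mul_le_of_decay hC (hb (φ p)) hg x y)
    (((integrable_symWeight le_rfl).comp_sub_left x).const_mul _)
    (Eventually.of_forall fun y => ?_)
  · exact ((measurable_symKernel_apply (ha.base.cont _)).comp
      (measurable_const.sub measurable_id)).aestronglyMeasurable.mul hgm
  · exact (tendsto_symKernel (fun p => ha.base.cont (φ p)) (fun p ξ => hb' (φ p) ξ) h (x - y)).mul_const _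

end

/-! ### Symbols that are regular up to the final time -/

section

variable {c : ℝ} {Q : Type} [MeasurableSpace Q]

/-- The exponential of an exponent with bounded derivatives from the second on, provided that it
controls the powers of the first derivative. -/
theorem SymFamily.exp_of_deriv {Ψ Ψ' Ψ'' : Q → ℝ → ℂ} {d d' : ℤ}
    (h1 : ∀ q ξ, HasDerivAt (Ψ q) (Ψ' q ξ) ξ) (h2 : ∀ q ξ, HasDerivAt (Ψ' q) (Ψ'' q ξ) ξ)
    (hΨ : SymBound d Ψ) (hΨ' : SymBound d' Ψ') (hΨ'' : ∀ k, SymFamily k 0 Ψ'')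
    (hb : ∀ j : ℕ, ∃ C : ℝ, 0 ≤ C ∧ ∀ q ξ, ‖Ψ' q ξ‖ ^ j * ‖Complex.exp (Ψ q ξ)‖ ≤ C) (k : ℕ) :
    SymFamily k 0 fun q ξ => Complex.exp (Ψ q ξ) := by
  have key : ∀ j : ℕ, SymFamily k 0 fun q ξ => Ψ' q ξ ^ j * Complex.exp (Ψ q ξ) := by
    have h0 : ∀ j : ℕ, SymBound 0 fun q ξ => Ψ' q ξ ^ j * Complex.exp (Ψ q ξ) := fun j => by
      obtain ⟨C, hC, hb⟩ := hb j
      refine ⟨fun q => ((hΨ'.cont q).pow j).mul (hΨ.cont q).cexp,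
        fun ξ => ((hΨ'.meas ξ).pow_const j).mul (hΨ.meas ξ).cexp, C, hC, fun q ξ => ?_⟩
      rw [norm_mul, norm_pow, symWeight, zpow_zero, mul_one]
      exact hb q ξ
    induction k with
    | zero => exact h0
    | succ k ih =>
      refine fun j => ⟨h0 j, _, fun q ξ => ((h2 q ξ).fun_pow j).fun_mul (h1 q ξ).cexp, ?_⟩
      have e1 := (((hΨ'' k).mul (ih (j - 1))).mono (zero_add 0).le).const_mul (j : ℂ)
      have := e1.add (ih (j + 1))
      convert this using 3 with q ξ
      ring
  simpa using key 0

theorem pow_mul_exp_neg_le (j : ℕ) {σ : ℝ} (hσ : 0 ≤ σ) :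
    (1 + √σ) ^ j * Real.exp (-σ) ≤ j.factorial * Real.exp 2 := by
  have h1 := Real.pow_div_factorial_le_exp (x := 1 + √σ) (by positivity) j
  rw [div_le_iff₀ (by positivity)] at h1
  have h2 : Real.exp (1 + √σ) * Real.exp (-σ) ≤ Real.exp 2 := by
    rw [← Real.exp_add]
    refine Real.exp_le_exp.2 ?_
    have := Real.sq_sqrt hσ
    nlinarith [sq_nonneg (√σ - 1)]
  calc _ ≤ Real.exp (1 + √σ) * j.factorial * Real.exp (-σ) := by gcongr
    _ = j.factorial * (Real.exp (1 + √σ) * Real.exp (-σ)) := by ring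
    _ ≤ _ := by gcongr

/-- A bound `x ≤ Bθ + σ/θ` for every `θ ≥ 1` is a bound by the square root of `σ`. -/
theorem le_sqrt_of_forall_le {x B σ : ℝ} (hσ : 0 ≤ σ)
    (h : ∀ θ : ℝ, 1 ≤ θ → x ≤ B * θ + σ / θ) : x ≤ (B + 1) * (1 + √σ) := by
  have h0 := Real.sqrt_nonneg σ
  have h1 := h (1 + √σ) (by linarith)
  have h2 : σ / (1 + √σ) ≤ 1 + √σ := by
    rw [div_le_iff₀ (by positivity)]
    have := Real.sq_sqrt hσ
    nlinarith
  linarith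

/-- The first derivative of the jump exponent is controlled by the damping that the jumps
produce. -/
theorem norm_jumpExp_one_le_damping (c ξ z : ℝ) {θ : ℝ} (hθ : 1 ≤ θ) :
    ‖jumpExp 1 (vline c ξ) z‖ ≤ (4 + |c|) * θ * (min |z| (z ^ 2) * (1 + Real.exp (c * z))) +
      ((jumpExp 0 (vline c 0) z).re - (jumpExp 0 (vline c ξ) z).re) / θ := by
  have hE := Real.exp_pos (c * z)
  have hm := min_abs_sq_nonneg z
  set E := Real.exp (c * z) with hEdef
  have e0 : ∀ ξ : ℝ, Complex.exp (vline c ξ * z) = E * Complex.exp (Complex.I * (ξ * z : ℝ)) := by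
    intro ξ
    rw [hEdef, Complex.ofReal_exp, ← Complex.exp_add, vline]
    push_cast; ring_nf
  have eRe : ∀ v : ℝ, (Complex.exp (Complex.I * v)).re = Real.cos v := fun v => by
    rw [mul_comm, Complex.exp_ofReal_mul_I_re]
  have eIm : ∀ v : ℝ, (Complex.exp (Complex.I * v)).im = Real.sin v := fun v => by
    rw [mul_comm, Complex.exp_ofReal_mul_I_im]
  have e1 : ∀ ξ : ℝ, (jumpExp 0 (vline c ξ) z).re = E * Real.cos (ξ * z) - 1 - c * z := fun ξ => by
    simp only [jumpExp, if_pos, e0, Complex.sub_re, Complex.re_ofReal_mul, eRe, Complex.one_re]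
    rw [mul_comm (vline c ξ), Complex.re_ofReal_mul, vline_re, mul_comm z]
  have e2 : (jumpExp 0 (vline c 0) z).re - (jumpExp 0 (vline c ξ) z).re =
      E * (1 - Real.cos (ξ * z)) := by
    rw [e1, e1]; simp; ring
  have e3 : jumpExp 1 (vline c ξ) z = jumpExp 1 (c : ℂ) z +
      z * (E * (Complex.exp (Complex.I * (ξ * z : ℝ)) - 1)) := by
    have : Complex.exp ((c : ℂ) * z) = E := by rw [hEdef, Complex.ofReal_exp]; push_cast; rfl
    simp only [jumpExp, one_ne_zero, if_false, if_true, e0, this]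
    ring
  have h1 : ‖jumpExp 1 (c : ℂ) z‖ ≤ (1 + |c|) * (min |z| (z ^ 2) * (1 + E)) := by
    simpa using norm_jumpExp_one_le (c : ℂ) z
  have h2 : ‖Complex.exp (Complex.I * (ξ * z : ℝ)) - 1‖ ^ 2 = 2 * (1 - Real.cos (ξ * z)) := by
    rw [← Complex.normSq_eq_norm_sq, Complex.normSq_apply, Complex.sub_re, Complex.sub_im, eRe,
      eIm, Complex.one_re, Complex.one_im]
    nlinarith [Real.sin_sq_add_cos_sq (ξ * z)]
  have hcos := Real.cos_le_one (ξ * z)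
  set x := ‖Complex.exp (Complex.I * (ξ * z : ℝ)) - 1‖ with hx
  have hx0 : 0 ≤ x := norm_nonneg _
  have hx2 : x ≤ 2 := by nlinarith [Real.neg_one_le_cos (ξ * z)]
  have h3 : |z| * (E * x) ≤ 2 * θ * (min |z| (z ^ 2) * (1 + E)) + E * (1 - Real.cos (ξ * z)) / θ := by
    have hq : 0 ≤ E * (1 - Real.cos (ξ * z)) / θ := by
      have : 0 ≤ 1 - Real.cos (ξ * z) := by linarith
      positivity
    rcases le_total |z| 1 with h | h
    · rw [min_abs_sq_of_abs_le_one h]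
      have h4 : |z| * x ≤ θ * z ^ 2 + (1 - Real.cos (ξ * z)) / θ := by
        have h5 : x ^ 2 / 2 = 1 - Real.cos (ξ * z) := by linarith
        rw [← h5, ← sq_abs z, ← sub_nonneg]
        have : θ * |z| ^ 2 + x ^ 2 / 2 / θ - |z| * x =
            (θ ^ 2 * |z| ^ 2 + (θ * |z| - x) ^ 2) / (2 * θ) := by field_simp; ring
        rw [this]
        positivity
      calc |z| * (E * x) = E * (|z| * x) := by ring
        _ ≤ E * (θ * z ^ 2 + (1 - Real.cos (ξ * z)) / θ) := by gcongr
        _ = E * (θ * z ^ 2) + E * (1 - Real.cos (ξ * z)) / θ := by ring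
        _ ≤ _ := by
          gcongr ?_ + _
          have : 0 ≤ θ * z ^ 2 := by positivity
          nlinarith
    · rw [min_abs_sq_of_one_le_abs h]
      have : |z| * (E * x) ≤ 2 * 1 * (|z| * (1 + E)) := by
        have : |z| * (E * x) ≤ |z| * (E * 2) := by gcongr
        have := abs_nonneg z
        nlinarith
      calc _ ≤ 2 * 1 * (|z| * (1 + E)) := this
        _ ≤ 2 * θ * (|z| * (1 + E)) := by gcongr
        _ ≤ _ := by linarith
  rw [e2, e3]
  refine (norm_add_le _ _).trans ?_
  rw [norm_mul, norm_mul, Complex.norm_real, Complex.norm_real, Real.norm_eq_abs,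
    Real.norm_of_nonneg hE.le]
  have h6 : (1 + |c|) * (min |z| (z ^ 2) * (1 + E)) ≤
      (1 + |c|) * θ * (min |z| (z ^ 2) * (1 + E)) := by
    gcongr
    exact le_mul_of_one_le_right (by positivity) hθ
  have h7 : 0 ≤ θ * (min |z| (z ^ 2) * (1 + E)) := by positivity
  nlinarith

end

namespace ReducedData

variable {N : ℕ} {T : ℝ} {E : PolynomialExpansion N T} {c : ℝ} (R : ReducedData E c)

/-- The derivative of `ξ ↦ expo r (c + iξ)`. -/
noncomputable def lineDeriv (r ξ : ℝ) : ℂ :=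
  Complex.I * (R.α 0 0 r * (2 * vline c ξ - 1) + R.β 0 0 r - R.drift 0 0 r) +
    ∫ z, Complex.I ^ 1 * jumpExp 1 (vline c ξ) z / R.w z ∂(R.kp 0 0 r)

/-- The second derivative of `ξ ↦ expo r (c + iξ)`. -/
noncomputable def lineDeriv₂ (r ξ : ℝ) : ℂ :=
  -2 * R.α 0 0 r + ∫ z, Complex.I ^ 2 * jumpExp 2 (vline c ξ) z / R.w z ∂(R.kp 0 0 r)

theorem lineDeriv_of_notMem {r : ℝ} (hr : r ∉ Set.Icc 0 T) (ξ : ℝ) : R.lineDeriv r ξ = 0 := by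
  simp [lineDeriv, R.α_supp 0 0 r hr, R.β_supp 0 0 r hr, drift, R.lint_of_notMem 0 0 hr,
    R.kp_apply_of_notMem 0 0 hr]

theorem lineDeriv₂_of_notMem {r : ℝ} (hr : r ∉ Set.Icc 0 T) (ξ : ℝ) : R.lineDeriv₂ r ξ = 0 := by
  simp [lineDeriv₂, R.α_supp 0 0 r hr, R.kp_apply_of_notMem 0 0 hr]

theorem symBound_jump (j : ℕ) : SymBound 2 fun (p : ℝ × ℝ) ξ =>
    Complex.I ^ j * jumpExp j (vline c ξ) p.2 / (R.w p.2 : ℂ) :=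
  SymFamily.comp (k := 0) (symBound_jumpExp R.weight_zero j) measurable_snd

theorem hasDerivAt_jump_integral (j : ℕ) (r ξ : ℝ) : HasDerivAt
    (fun ξ => ∫ z, Complex.I ^ j * jumpExp j (vline c ξ) z / (R.w z : ℂ) ∂(R.kp 0 0 r))
    (∫ z, Complex.I ^ (j + 1) * jumpExp (j + 1) (vline c ξ) z / (R.w z : ℂ) ∂(R.kp 0 0 r)) ξ :=
  (R.symBound_jump j).hasDerivAt_integral_kernel (R.symBound_jump (j + 1))
    (fun p ξ => hasDerivAt_jumpExp_vline R.w j p.2 ξ) (R.kp 0 0) r ξ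

theorem hasDerivAt_expo_vline (r ξ : ℝ) :
    HasDerivAt (fun ξ => R.expo r (vline c ξ)) (R.lineDeriv r ξ) ξ := by
  have hv := hasDerivAt_vline c ξ
  have h1 := ((hv.fun_pow 2).fun_sub hv).const_mul (R.α 0 0 r : ℂ)
  have h2 := (hv.sub_const 1).const_mul (R.β 0 0 r : ℂ)
  have h3 := (hv.const_mul (-(R.drift 0 0 r : ℂ))).fun_add (R.hasDerivAt_jump_integral 0 r ξ)
  have := (h1.fun_add h2).fun_add h3
  simp only [pow_zero, one_mul] at this
  exact this.congr_deriv (by rw [lineDeriv]; simp; ring)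

theorem hasDerivAt_lineDeriv (r ξ : ℝ) : HasDerivAt (R.lineDeriv r) (R.lineDeriv₂ r ξ) ξ := by
  have hv := hasDerivAt_vline c ξ
  have h1 := ((((hv.const_mul 2).sub_const 1).const_mul (R.α 0 0 r : ℂ)).add_const
    (R.β 0 0 r : ℂ)).sub_const (R.drift 0 0 r : ℂ)
  refine ((h1.const_mul Complex.I).fun_add (R.hasDerivAt_jump_integral 1 r ξ)).congr_deriv ?_
  have := Complex.I_mul_I
  rw [lineDeriv₂]
  linear_combination (2 * (R.α 0 0 r : ℂ)) * this

theorem symBound_lineDeriv : SymBound 2 R.lineDeriv := by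
  obtain ⟨A, hA⟩ := R.α_bound 0 0
  obtain ⟨B, hB⟩ := R.β_bound 0 0
  obtain ⟨C, hC⟩ := R.drift_bound 0 0
  have hv : SymFamily 0 1 fun (_ : ℝ) ξ => 2 * vline c ξ - 1 :=
    ((SymFamily.affine _ _ 0).const_mul 2).sub ((SymFamily.const 1 0).mono (by norm_num))
  have h1 : SymFamily 0 2 fun r ξ => (R.α 0 0 r : ℂ) * (2 * vline c ξ - 1) :=
    (hv.smul (R.α_meas 0 0).complex_ofReal (A := A) fun r => by
      rw [Complex.norm_real]; exact hA r).mono (by norm_num)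
  have h2 : SymFamily 0 2 fun r (_ : ℝ) => (R.β 0 0 r : ℂ) * 1 :=
    ((SymFamily.const 1 0).smul (R.β_meas 0 0).complex_ofReal (A := B) fun r => by
      rw [Complex.norm_real]; exact hB r).mono (by norm_num)
  have h3 : SymFamily 0 2 fun r (_ : ℝ) => (R.drift 0 0 r : ℂ) * 1 :=
    ((SymFamily.const 1 0).smul (R.measurable_drift 0 0).complex_ofReal (A := C) fun r => by
      rw [Complex.norm_real]; exact hC r).mono (by norm_num)
  have h4 : SymFamily 0 2 fun r ξ =>
      ∫ z, Complex.I ^ 1 * jumpExp 1 (vline c ξ) z / (R.w z : ℂ) ∂(R.kp 0 0 r) :=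
    SymFamily.integral_kernel (k := 0) (R.symBound_jump 1) (R.kp 0 0)
  have := (((h1.add h2).sub h3).const_mul Complex.I).add h4
  simp only [mul_one] at this
  exact this

theorem symFamily_lineDeriv₂ (k : ℕ) : SymFamily k 0 R.lineDeriv₂ := by
  obtain ⟨A, hA⟩ := R.α_bound 0 0
  have h1 : SymFamily k 0 fun r (_ : ℝ) => -2 * ((R.α 0 0 r : ℂ) * 1) :=
    ((SymFamily.const 1 k).smul (R.α_meas 0 0).complex_ofReal (A := A) fun r => by
      rw [Complex.norm_real]; exact hA r).const_mul (-2)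
  have h2 : SymFamily k 0 fun (p : ℝ × ℝ) ξ =>
      Complex.I ^ 2 * jumpExp 2 (vline c ξ) p.2 / (R.w p.2 : ℂ) :=
    SymFamily.comp (F := fun z ξ => Complex.I ^ 2 * jumpExp 2 (vline c ξ) z / (R.w z : ℂ))
      (SymFamily.of_ladder
        (G := fun j (z : ℝ) ξ => Complex.I ^ (j + 2) * jumpExp (j + 2) (vline c ξ) z / (R.w z : ℂ))
        (fun j z ξ => hasDerivAt_jumpExp_vline R.w (j + 2) z ξ)
        (symBound_jumpExp_add_two R.weight_zero) k) measurable_snd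
  have := h1.add (h2.integral_kernel (R.kp 0 0))
  simp only [mul_one] at this
  exact this

theorem integrable_jumpExp_zero (r ξ : ℝ) :
    Integrable (fun z => jumpExp 0 (vline c ξ) z / (R.w z : ℂ)) (R.kp 0 0 r) := by
  obtain ⟨C, hC, hb⟩ := R.norm_jumpExp_div_le
  exact Integrable.of_bound (R.measurable_jumpExp_div 0 _).aestronglyMeasurable _
    (Eventually.of_forall fun z => hb 0 zero_le_one _ (by simp) z)

/-- The first derivative of the exponent is controlled by the damping in its real part. -/
theorem norm_lineDeriv_le : ∃ B : ℝ, 0 ≤ B ∧ ∀ r, 0 ≤ R.α 0 0 r → ∀ ξ θ : ℝ, 1 ≤ θ →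
    ‖R.lineDeriv r ξ‖ ≤ B * θ + (R.expo r (vline c 0) - R.expo r (vline c ξ)).re / θ := by
  obtain ⟨A, hA⟩ := R.α_bound 0 0
  obtain ⟨B, hB⟩ := R.β_bound 0 0
  obtain ⟨D, hD⟩ := R.drift_bound 0 0
  obtain ⟨C, hC, hw⟩ := R.weight_zero.bound 0
  have hA0 : 0 ≤ A := (abs_nonneg _).trans (hA 0)
  have hB0 : 0 ≤ B := (abs_nonneg _).trans (hB 0)
  have hD0 : 0 ≤ D := (abs_nonneg _).trans (hD 0)
  set M := (4 + |c|) * C * ((R.kp 0 0).bound).toReal with hM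
  refine ⟨A * (2 * |c| + 2) + B + D + M, by positivity, fun r hr ξ θ hθ => ?_⟩
  have hθ0 : 0 < θ := by linarith
  -- the jump part
  have hJ : ‖∫ z, Complex.I ^ 1 * jumpExp 1 (vline c ξ) z / R.w z ∂(R.kp 0 0 r)‖ ≤ M * θ +
      ((∫ z, jumpExp 0 (vline c 0) z / R.w z ∂(R.kp 0 0 r)) -
        ∫ z, jumpExp 0 (vline c ξ) z / R.w z ∂(R.kp 0 0 r)).re / θ := by
    have i0 := R.integrable_jumpExp_zero r 0
    have i1 := R.integrable_jumpExp_zero r ξ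
    have j0 : Integrable (fun z => (jumpExp 0 (vline c 0) z / (R.w z : ℂ)).re) (R.kp 0 0 r) := i0.re
    have j1 : Integrable (fun z => (jumpExp 0 (vline c ξ) z / (R.w z : ℂ)).re) (R.kp 0 0 r) := i1.re
    have i2 := j0.sub' j1
    have h1 := norm_integral_le_of_norm_le (μ := R.kp 0 0 r)
      (f := fun z => Complex.I ^ 1 * jumpExp 1 (vline c ξ) z / (R.w z : ℂ))
      (g := fun z => (4 + |c|) * C * θ + ((jumpExp 0 (vline c 0) z / (R.w z : ℂ)).re -
        (jumpExp 0 (vline c ξ) z / (R.w z : ℂ)).re) / θ)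
      ((integrable_const _).add (i2.div_const θ)) (Eventually.of_forall fun z => ?_)
    · refine h1.trans ?_
      rw [integral_add (integrable_const _) (i2.div_const θ), integral_div,
        integral_sub j0 j1, integral_const, smul_eq_mul, Complex.sub_re]
      have e : ∀ ξ, ∫ z, (jumpExp 0 (vline c ξ) z / (R.w z : ℂ)).re ∂(R.kp 0 0 r) =
          (∫ z, jumpExp 0 (vline c ξ) z / (R.w z : ℂ) ∂(R.kp 0 0 r)).re := fun ξ =>
        Complex.reCLM.integral_comp_comm (R.integrable_jumpExp_zero r ξ)
      rw [e, e]
      have h2 : (R.kp 0 0 r).real Set.univ ≤ ((R.kp 0 0).bound).toReal :=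
        ENNReal.toReal_mono (R.kp 0 0).bound_lt_top.ne ((R.kp 0 0).measure_le_bound r _)
      gcongr ?_ + _
      calc _ ≤ ((R.kp 0 0).bound).toReal * ((4 + |c|) * C * θ) := by gcongr
        _ = _ := by rw [hM]; ring
    · by_cases hz : R.w z = 0
      · simp [hz]; positivity
      have hwz : (0 : ℝ) < R.w z := NNReal.coe_pos.2 (pos_iff_ne_zero.2 hz)
      have e : ‖((R.w z : ℝ) : ℂ)‖ = R.w z := by rw [Complex.norm_real, Real.norm_of_nonneg hwz.le]
      have h3 := norm_jumpExp_one_le_damping c ξ z hθ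
      have h4 := hw z hz
      simp only [expWeight, pow_zero, one_mul] at h4
      rw [norm_div, norm_mul, norm_pow, Complex.norm_I, one_pow, one_mul, e, Complex.div_ofReal_re,
        Complex.div_ofReal_re, div_le_iff₀ hwz]
      have h5 : ((4 + |c|) * C * θ + ((jumpExp 0 (vline c 0) z).re / R.w z -
          (jumpExp 0 (vline c ξ) z).re / R.w z) / θ) * R.w z = (4 + |c|) * θ * (C * R.w z) +
          ((jumpExp 0 (vline c 0) z).re - (jumpExp 0 (vline c ξ) z).re) / θ := by
        field_simp
      rw [h5]
      refine h3.trans ?_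
      gcongr
  have hre : (R.expo r (vline c 0) - R.expo r (vline c ξ)).re = R.α 0 0 r * ξ ^ 2 +
      ((∫ z, jumpExp 0 (vline c 0) z / R.w z ∂(R.kp 0 0 r)) -
        ∫ z, jumpExp 0 (vline c ξ) z / R.w z ∂(R.kp 0 0 r)).re := by
    simp only [expo, Complex.add_re, Complex.sub_re, vline_re, sq,
      Complex.mul_re, vline_im, Complex.neg_re, Complex.neg_im, Complex.ofReal_re, Complex.ofReal_im,
      Complex.one_re]
    ring
  have hα : R.α 0 0 r * (2 * |ξ|) ≤ A * θ + R.α 0 0 r * ξ ^ 2 / θ := by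
    have h6 : 2 * |ξ| ≤ θ + ξ ^ 2 / θ := by
      rw [← sq_abs, ← sub_nonneg]
      have : θ + |ξ| ^ 2 / θ - 2 * |ξ| = (θ - |ξ|) ^ 2 / θ := by field_simp; ring
      rw [this]; positivity
    calc _ ≤ R.α 0 0 r * (θ + ξ ^ 2 / θ) := by gcongr
      _ = R.α 0 0 r * θ + R.α 0 0 r * ξ ^ 2 / θ := by ring
      _ ≤ _ := by gcongr; exact (le_abs_self _).trans (hA r)
  have hD' : ‖Complex.I * (R.α 0 0 r * (2 * vline c ξ - 1) + R.β 0 0 r - R.drift 0 0 r)‖ ≤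
      (A * (2 * |c| + 1) + B + D) + R.α 0 0 r * (2 * |ξ|) := by
    rw [norm_mul, Complex.norm_I, one_mul]
    have h7 : ‖2 * vline c ξ - 1‖ ≤ (2 * |c| + 1) + 2 * |ξ| := by
      have := Complex.norm_le_abs_re_add_abs_im (vline c ξ)
      rw [vline_re, vline_im] at this
      refine (norm_sub_le _ _).trans ?_
      rw [norm_mul, norm_one, show ‖(2 : ℂ)‖ = 2 by simp]
      linarith
    have h8 : ‖(R.α 0 0 r : ℂ) * (2 * vline c ξ - 1)‖ ≤
        A * (2 * |c| + 1) + R.α 0 0 r * (2 * |ξ|) := by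
      rw [norm_mul, Complex.norm_real, Real.norm_of_nonneg hr]
      calc _ ≤ R.α 0 0 r * ((2 * |c| + 1) + 2 * |ξ|) := by gcongr
        _ = R.α 0 0 r * (2 * |c| + 1) + R.α 0 0 r * (2 * |ξ|) := by ring
        _ ≤ _ := by gcongr; exact (le_abs_self _).trans (hA r)
    refine (norm_sub_le _ _).trans ((add_le_add (norm_add_le _ _) le_rfl).trans ?_)
    rw [Complex.norm_real, Complex.norm_real, Real.norm_eq_abs, Real.norm_eq_abs]
    linarith [hB r, hD r]
  have hK : 0 ≤ A * (2 * |c| + 1) + B + D := by positivity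
  rw [lineDeriv, hre, add_div]
  refine (norm_add_le _ _).trans ?_
  nlinarith

/-- The parameter `θ` is left free, since the bound with `θ` is linear and passes through the time
integral; optimising it afterwards gives the square root of the damping. -/
theorem lineDeriv_integral_le (hα : ∀ᵐ t ∂(volume.restrict (Set.Icc (0 : ℝ) T)), 0 < R.α 0 0 t) :
    ∃ B : ℝ, 0 ≤ B ∧ ∀ t s, 0 ≤ t → t ≤ s → s ≤ T → ∀ ξ θ : ℝ, 1 ≤ θ →
      ‖∫ r in t..s, R.lineDeriv r ξ‖ ≤
        B * θ + (R.lam t s (vline c 0) - R.lam t s (vline c ξ)).re / θ := by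
  obtain ⟨B, hB, hb⟩ := R.norm_lineDeriv_le
  refine ⟨B * |T|, by positivity, fun t s ht hts hs ξ θ hθ => ?_⟩
  have i0 := R.intervalIntegrable_expo (ζ := vline c 0) (by simp) t s
  have i1 := R.intervalIntegrable_expo (ζ := vline c ξ) (by simp) t s
  have i2 := i0.sub i1
  have i3 : IntervalIntegrable (fun r => (R.expo r (vline c 0) - R.expo r (vline c ξ)).re)
      volume t s := ⟨i2.1.re, i2.2.re⟩
  have h1 := intervalIntegral.norm_integral_le_of_norm_le (f := fun r => R.lineDeriv r ξ)
    (g := fun r => B * θ + (R.expo r (vline c 0) - R.expo r (vline c ξ)).re / θ) hts ?_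
    (intervalIntegrable_const.add (i3.div_const θ))
  · refine h1.trans ?_
    have e : ∫ r in t..s, (R.expo r (vline c 0) - R.expo r (vline c ξ)).re =
        (R.lam t s (vline c 0) - R.lam t s (vline c ξ)).re := by
      rw [lam, lam, ← intervalIntegral.integral_sub i0 i1]
      exact Complex.reCLM.intervalIntegral_comp_comm i2
    rw [intervalIntegral.integral_add intervalIntegrable_const (i3.div_const θ),
      intervalIntegral.integral_const, intervalIntegral.integral_div, e, smul_eq_mul]
    gcongr ?_ + _
    have : s - t ≤ |T| := by linarith [le_abs_self T]
    calc (s - t) * (B * θ) ≤ |T| * (B * θ) := by gcongr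
      _ = _ := by ring
  · have h2 := (ae_restrict_iff' measurableSet_Icc).1 hα
    filter_upwards [h2] with r hr hrI
    exact hb r (hr ⟨ht.trans hrI.1.le, hrI.2.trans hs⟩).le ξ θ hθ

/-- Up to the final time, the derivatives of the symbols of the evolution are bounded: the first
derivative of the exponent is controlled by the damping and the further ones are bounded. -/
theorem symFamily_evSym_zero (hα : ∀ᵐ t ∂(volume.restrict (Set.Icc (0 : ℝ) T)), 0 < R.α 0 0 t)
    {Q : Type} [MeasurableSpace Q] {t s e : Q → ℝ} (ht : Measurable t) (hs : Measurable s)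
    (he : Measurable e) (h0 : ∀ q, 0 ≤ t q) (hts : ∀ q, t q ≤ s q) (hsT : ∀ q, s q ≤ T)
    (he0 : ∀ q, 0 ≤ e q) (he1 : ∀ q, e q ≤ 1) (k : ℕ) :
    SymFamily k 0 fun q => R.evSym (t q) (s q) (e q) := by
  have hee : ∀ q, |e q| ≤ 1 := fun q => by rw [abs_of_nonneg (he0 q)]; exact he1 q
  obtain ⟨A, hA, hbA⟩ := R.norm_evSym_le
  obtain ⟨B, hB, hbB⟩ := R.lineDeriv_integral_le hα
  obtain ⟨C, hC, hbC⟩ := ((R.symFamily_lam 0).comp (φ := fun q => (t q, s q)) (ht.prodMk hs)).base.bound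
  have hid : ∀ k, SymFamily k 1 fun (_ : Q) (ξ : ℝ) => (ξ : ℂ) := fun k => by
    simpa using SymFamily.affine (Q := Q) 0 1 k
  have hsm : ∀ (k : ℕ) (d : ℤ) (F : Q → ℝ → ℂ), SymFamily k d F →
      SymFamily k d fun q ξ => (e q : ℂ) * F q ξ := fun k d F hF =>
    hF.smul he.complex_ofReal (A := 1) fun q => by rw [Complex.norm_real]; exact hee q
  have hΨ : SymFamily 0 2 fun q ξ => R.lam (t q) (s q) (vline c ξ) - (e q : ℂ) * (ξ : ℂ) ^ 2 := by
    refine ((R.symFamily_lam 0).comp (φ := fun q => (t q, s q)) (ht.prodMk hs)).sub ?_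
    simp only [sq]
    exact hsm _ _ _ ((hid 0).mul (hid 0))
  have hL1 : SymFamily 0 2 fun q ξ => ∫ r in t q..s q, R.lineDeriv r ξ :=
    (SymFamily.comp (k := 0) (φ := fun p : Q × ℝ => p.2) R.symBound_lineDeriv
      measurable_snd).intervalIntegral (fun _ _ hr _ => R.lineDeriv_of_notMem hr _) ht hs
  have hL2 : ∀ k, SymFamily k 0 fun q ξ => ∫ r in t q..s q, R.lineDeriv₂ r ξ := fun k =>
    ((R.symFamily_lineDeriv₂ k).comp (φ := fun p : Q × ℝ => p.2)
      measurable_snd).intervalIntegral (fun _ _ hr _ => R.lineDeriv₂_of_notMem hr _) ht hs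
  have hΨ' : SymFamily 0 2 fun q (ξ : ℝ) =>
      (∫ r in t q..s q, R.lineDeriv r ξ) - 2 * ((e q : ℂ) * ξ) :=
    hL1.sub (((hsm _ _ _ (hid 0)).const_mul 2).mono (by norm_num))
  have hΨ'' : ∀ k, SymFamily k 0 fun q (ξ : ℝ) =>
      (∫ r in t q..s q, R.lineDeriv₂ r ξ) - 2 * ((e q : ℂ) * 1) := fun k =>
    (hL2 k).sub ((hsm _ _ _ (SymFamily.const 1 k)).const_mul 2)
  have hdl : ∀ {F F' : ℝ → ℝ → ℂ} {d d' : ℤ}, SymBound d F → SymBound d' F' →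
      (∀ r ξ, HasDerivAt (F r) (F' r ξ) ξ) → ∀ q ξ,
      HasDerivAt (fun ξ => ∫ r in t q..s q, F r ξ) (∫ r in t q..s q, F' r ξ) ξ := by
    intro F F' d d' hF hF' hd q ξ
    simp only [intervalIntegral.integral_of_le (hts q)]
    exact (SymBound.hasDerivAt_integral_kernel (P := Unit) (F := fun p => F p.2)
      (F' := fun p => F' p.2) (SymFamily.comp (k := 0) hF measurable_snd)
      (SymFamily.comp (k := 0) hF' measurable_snd) (fun p => hd p.2)
      (Kernel.const Unit (volume.restrict (Set.Ioc (t q) (s q)))) () ξ)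
  refine SymFamily.exp_of_deriv
    (Ψ := fun q ξ => R.lam (t q) (s q) (vline c ξ) - (e q : ℂ) * (ξ : ℂ) ^ 2)
    (Ψ' := fun q ξ => (∫ r in t q..s q, R.lineDeriv r ξ) - 2 * ((e q : ℂ) * ξ))
    (Ψ'' := fun q ξ => (∫ r in t q..s q, R.lineDeriv₂ r ξ) - 2 * ((e q : ℂ) * 1))
    (fun q ξ => ?_) (fun q ξ => ?_) hΨ hΨ' hΨ'' (fun j => ?_) k
  · have h1 := hdl (R.symFamily_expo 0).base R.symBound_lineDeriv R.hasDerivAt_expo_vline q ξ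
    have h2 := (((hasDerivAt_id ξ).ofReal_comp.fun_pow 2).const_mul (e q : ℂ))
    exact (h1.fun_sub h2).congr_deriv (by simp; ring)
  · have h1 := hdl R.symBound_lineDeriv (R.symFamily_lineDeriv₂ 0).base R.hasDerivAt_lineDeriv q ξ
    have h2 := ((hasDerivAt_id ξ).ofReal_comp.const_mul (e q : ℂ)).const_mul 2
    exact (h1.fun_sub h2).congr_deriv (by simp)
  · -- `σ` is the damping, normalised to be nonnegative
    set K := max (Real.log A) C with hK
    have hre : ∀ q (ξ : ℝ), (R.lam (t q) (s q) (vline c ξ) - (e q : ℂ) * (ξ : ℂ) ^ 2).re =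
        (R.lam (t q) (s q) (vline c ξ)).re - e q * ξ ^ 2 := fun q ξ => by
      rw [← Complex.ofReal_pow, ← Complex.ofReal_mul, Complex.sub_re, Complex.ofReal_re]
    refine ⟨(B + 2) ^ j * (Real.exp K * (j.factorial * Real.exp 2)), by positivity, fun q ξ => ?_⟩
    set σ := K - (R.lam (t q) (s q) (vline c ξ) - (e q : ℂ) * (ξ : ℂ) ^ 2).re with hσ
    have hσ0 : 0 ≤ σ := by
      have h1 := hbA (t q) (s q) (e q) (h0 q) (hts q) (hsT q) ξ
      have h2 : Real.exp (-(R.diff (t q) (s q) + e q) * ξ ^ 2) ≤ 1 := by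
        refine Real.exp_le_one_iff.2 ?_
        have := R.diff_nonneg hα (h0 q) (hts q) (hsT q)
        have := he0 q
        have : 0 ≤ (R.diff (t q) (s q) + e q) * ξ ^ 2 := by positivity
        linarith
      have h3 : ‖R.evSym (t q) (s q) (e q) ξ‖ ≤ A := h1.trans (mul_le_of_le_one_right hA.le h2)
      rw [evSym, Complex.norm_exp] at h3
      have h4 := (Real.le_log_iff_exp_le hA).2 h3
      have := le_max_left (Real.log A) C
      linarith
    have hC0 : (R.lam (t q) (s q) (vline c 0)).re ≤ K := by
      have := hbC q 0
      simp only [symWeight, abs_zero, add_zero, one_zpow, mul_one] at this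
      exact (Complex.re_le_norm _).trans (this.trans (le_max_right _ _))
    -- the first derivative of the exponent is at most a multiple of `1 + √σ`
    have hb := le_sqrt_of_forall_le (B := B + 1) hσ0
      (x := ‖(∫ r in t q..s q, R.lineDeriv r ξ) - 2 * ((e q : ℂ) * ξ)‖) fun θ hθ => by
        have hθ0 : 0 < θ := by linarith
        have h1 := hbB (t q) (s q) (h0 q) (hts q) (hsT q) ξ θ hθ
        have h2 : ‖2 * ((e q : ℂ) * ξ)‖ ≤ θ + e q * ξ ^ 2 / θ := by
          rw [norm_mul, norm_mul, Complex.norm_real, Complex.norm_real, Real.norm_of_nonneg (he0 q),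
            Real.norm_eq_abs, show ‖(2 : ℂ)‖ = 2 by simp]
          have h3 : 2 * |ξ| ≤ θ + ξ ^ 2 / θ := by
            rw [← sq_abs, ← sub_nonneg]
            have : θ + |ξ| ^ 2 / θ - 2 * |ξ| = (θ - |ξ|) ^ 2 / θ := by field_simp; ring
            rw [this]; positivity
          calc 2 * (e q * |ξ|) = e q * (2 * |ξ|) := by ring
            _ ≤ e q * (θ + ξ ^ 2 / θ) := mul_le_mul_of_nonneg_left h3 (he0 q)
            _ = e q * θ + e q * ξ ^ 2 / θ := by ring
            _ ≤ 1 * θ + e q * ξ ^ 2 / θ := by gcongr; exact he1 q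
            _ = _ := by ring
        have h4 : (R.lam (t q) (s q) (vline c 0) - R.lam (t q) (s q) (vline c ξ)).re / θ +
            e q * ξ ^ 2 / θ ≤ σ / θ := by
          rw [← add_div, hσ, hre, Complex.sub_re]
          gcongr
          linarith
        refine (norm_sub_le _ _).trans ?_
        linarith
    have hn : ‖Complex.exp (R.lam (t q) (s q) (vline c ξ) - (e q : ℂ) * (ξ : ℂ) ^ 2)‖ =
        Real.exp K * Real.exp (-σ) := by
      rw [Complex.norm_exp, ← Real.exp_add, hσ]
      congr 1; ring
    rw [hn]
    calc _ ≤ ((B + 1 + 1) * (1 + √σ)) ^ j * (Real.exp K * Real.exp (-σ)) := by gcongr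
      _ = (B + 2) ^ j * (Real.exp K * ((1 + √σ) ^ j * Real.exp (-σ))) := by rw [mul_pow]; ring
      _ ≤ _ := by
        refine mul_le_mul_of_nonneg_left (mul_le_mul_of_nonneg_left ?_ (Real.exp_pos K).le)
          (by positivity)
        exact pow_mul_exp_neg_le j hσ0

/-- Up to the final time, the symbols of the evolution gain decay from the factor
`(1 + iξ)^{-2}`. -/
theorem symFamily_evSym_mul (hα : ∀ᵐ t ∂(volume.restrict (Set.Icc (0 : ℝ) T)), 0 < R.α 0 0 t)
    {Q : Type} [MeasurableSpace Q] {t s e : Q → ℝ} (ht : Measurable t) (hs : Measurable s)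
    (he : Measurable e) (h0 : ∀ q, 0 ≤ t q) (hts : ∀ q, t q ≤ s q) (hsT : ∀ q, s q ≤ T)
    (he0 : ∀ q, 0 ≤ e q) (he1 : ∀ q, e q ≤ 1) (k : ℕ) :
    SymFamily k (-2) fun q ξ => (1 + Complex.I * ξ)⁻¹ ^ 2 * R.evSym (t q) (s q) (e q) ξ := by
  simp only [sq]
  exact (((SymFamily.inv_affine k).mul (SymFamily.inv_affine k)).mul
    (R.symFamily_evSym_zero hα ht hs he h0 hts hsT he0 he1 k)).mono (by norm_num)

end ReducedData

/-! ### Gaussian approximate identities -/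

section

variable {c : ℝ}

theorem symKernel_gaussian (c : ℝ) {e : ℝ} (he : 0 < e) (x : ℝ) :
    symKernel c (fun ξ => Complex.exp (-(e : ℂ) * (ξ : ℂ) ^ 2)) x =
      Real.exp (c * x) * (√(Real.pi / e) / (2 * Real.pi) * Real.exp (-x ^ 2 / (4 * e))) := by
  have h1 := fourierIntegral_gaussian (b := (e : ℂ)) (by simpa using he) (x : ℂ)
  have h2 : ∀ ξ : ℝ, Complex.exp (vline c ξ * x) * Complex.exp (-(e : ℂ) * (ξ : ℂ) ^ 2) =
      (Real.exp (c * x) : ℂ) *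
        (Complex.exp (Complex.I * x * ξ) * Complex.exp (-(e : ℂ) * (ξ : ℂ) ^ 2)) := fun ξ => by
    rw [Complex.ofReal_exp, ← Complex.exp_add, ← Complex.exp_add, ← Complex.exp_add, vline]
    congr 1
    push_cast; ring
  have h3 : ((Real.pi / e : ℂ)) ^ (1 / 2 : ℂ) = (√(Real.pi / e) : ℝ) := by
    rw [Real.sqrt_eq_rpow, Complex.ofReal_cpow (by positivity)]
    push_cast; rfl
  have h4 : Complex.exp (-(x : ℂ) ^ 2 / (4 * e)) = (Real.exp (-x ^ 2 / (4 * e)) : ℝ) := by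
    push_cast; rfl
  rw [symKernel]
  simp only [h2]
  rw [integral_const_mul, h1, h3, h4, show (1 / (2 * Real.pi) : ℂ) = ((1 / (2 * Real.pi) : ℝ) : ℂ) by
    push_cast; rfl, ← Complex.ofReal_mul, ← Complex.ofReal_mul, ← Complex.ofReal_mul,
    Complex.ofReal_re]
  ring

theorem integral_gaussian_normalised :
    ∫ v : ℝ, √Real.pi / (2 * Real.pi) * Real.exp (-v ^ 2 / 4) = 1 := by
  have h := integral_gaussian (1 / 4)
  have e : ∀ v : ℝ, Real.exp (-v ^ 2 / 4) = Real.exp (-(1 / 4) * v ^ 2) := fun v => by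
    congr 1; ring
  simp only [e]
  rw [integral_const_mul, h, show Real.pi / (1 / 4) = 2 ^ 2 * Real.pi by ring,
    Real.sqrt_mul (by positivity), Real.sqrt_sq (by norm_num)]
  have := Real.mul_self_sqrt Real.pi_pos.le
  have := Real.pi_pos
  field_simp
  linarith

/-- The Gaussian kernels on the line `Re ζ = c` form an approximate identity for functions of
growth `O((1 + |x|)^K e^{cx})`. -/
theorem tendsto_integral_gaussian {f : ℝ → ℝ} (hf : Continuous f) {D : ℝ} {K : ℕ}
    (hb : ∀ x, |f x| ≤ D * expWeight c K x) (x : ℝ) :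
    Tendsto (fun e : ℝ => ∫ y, symKernel c (fun ξ => Complex.exp (-(e : ℂ) * (ξ : ℂ) ^ 2)) (x - y) *
      f y) (𝓝[>] 0) (𝓝 (f x)) := by
  have hD : 0 ≤ D := by
    have h1 := (abs_nonneg _).trans (hb 0)
    exact nonneg_of_mul_nonneg_left h1 (expWeight_pos c K 0)
  -- rescale to a fixed Gaussian
  have hscale : ∀ e : ℝ, 0 < e →
      ∫ y, symKernel c (fun ξ => Complex.exp (-(e : ℂ) * (ξ : ℂ) ^ 2)) (x - y) * f y =
        ∫ v : ℝ, √Real.pi / (2 * Real.pi) * Real.exp (-v ^ 2 / 4) *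
          (Real.exp (c * (√e * v)) * f (x - √e * v)) := fun e he => by
    have hs : 0 < √e := Real.sqrt_pos.2 he
    have h1 := integral_sub_left_eq_self (fun w => symKernel c
      (fun ξ => Complex.exp (-(e : ℂ) * (ξ : ℂ) ^ 2)) w * f (x - w)) volume x
    simp only [sub_sub_cancel] at h1
    have h2 := Measure.integral_comp_mul_left (fun w => symKernel c
      (fun ξ => Complex.exp (-(e : ℂ) * (ξ : ℂ) ^ 2)) w * f (x - w)) √e
    rw [abs_of_pos (inv_pos.2 hs), smul_eq_mul, eq_inv_mul_iff_mul_eq₀ hs.ne'] at h2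
    rw [h1, ← h2, ← integral_const_mul]
    congr 1 with v
    rw [symKernel_gaussian c he, mul_pow, Real.sq_sqrt he.le, Real.sqrt_div Real.pi_pos.le]
    have e2 : -(e * v ^ 2) / (4 * e) = -v ^ 2 / 4 := by field_simp
    rw [e2]
    field_simp
  have hlim : Tendsto (fun e : ℝ => ∫ v : ℝ, √Real.pi / (2 * Real.pi) * Real.exp (-v ^ 2 / 4) *
      (Real.exp (c * (√e * v)) * f (x - √e * v))) (𝓝[>] 0)
      (𝓝 (∫ v : ℝ, √Real.pi / (2 * Real.pi) * Real.exp (-v ^ 2 / 4) * f x)) := by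
    have hint : Integrable fun v : ℝ => √Real.pi / (2 * Real.pi) * (D * expWeight c K x) *
        (Real.exp (-v ^ 2 / 4) * (1 + |v|) ^ K) := by
      refine Integrable.const_mul ?_ _
      obtain ⟨C, hC, h⟩ := exp_neg_mul_sq_le (δ := 1 / 4) (by norm_num) (-2 - K)
      refine ((integrable_symWeight le_rfl).const_mul C).mono'
        (Continuous.aestronglyMeasurable (by fun_prop)) (Eventually.of_forall fun v => ?_)
      rw [Real.norm_of_nonneg (by positivity)]
      have e3 : symWeight (-2 : ℤ) v = symWeight (-2 - K) v * (1 + |v|) ^ K := by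
        rw [show ((1 + |v|) ^ K : ℝ) = symWeight (K : ℤ) v by rw [symWeight, zpow_natCast],
          ← symWeight_add]
        congr 1; ring
      rw [e3, ← mul_assoc]
      have := h v
      rw [show -(1 / 4 : ℝ) * v ^ 2 = -v ^ 2 / 4 by ring] at this
      gcongr
    refine tendsto_integral_filter_of_dominated_convergence _ (Eventually.of_forall fun e =>
      Continuous.aestronglyMeasurable (by fun_prop)) ?_ hint (Eventually.of_forall fun v => ?_)
    · filter_upwards [Ioo_mem_nhdsGT (show (0 : ℝ) < 1 by norm_num)] with e he
      refine Eventually.of_forall fun v => ?_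
      have hs1 : √e ≤ 1 := Real.sqrt_le_one.2 he.2.le
      have hs0 := Real.sqrt_nonneg e
      have h1 : |f (x - √e * v)| ≤ D * (expWeight c K x * ((1 + |v|) ^ K *
          Real.exp (-(c * (√e * v))))) := by
        refine (hb _).trans (mul_le_mul_of_nonneg_left ?_ hD)
        rw [sub_eq_add_neg]
        refine (expWeight_add_le c K x _).trans (mul_le_mul_of_nonneg_left ?_ (expWeight_nonneg _ _ _))
        rw [expWeight, mul_neg]
        have h2 : |-(√e * v)| ≤ |v| := by
          rw [abs_neg, abs_mul, abs_of_nonneg hs0]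
          exact mul_le_of_le_one_left (abs_nonneg v) hs1
        exact mul_le_mul_of_nonneg_right (pow_le_pow_left₀ (by positivity) (by linarith) K)
          (Real.exp_pos _).le
      rw [norm_mul, norm_mul (Real.exp _), Real.norm_of_nonneg (by positivity :
        0 ≤ √Real.pi / (2 * Real.pi) * Real.exp (-v ^ 2 / 4)), Real.norm_of_nonneg (Real.exp_pos _).le, Real.norm_eq_abs]
      calc _ ≤ √Real.pi / (2 * Real.pi) * Real.exp (-v ^ 2 / 4) * (Real.exp (c * (√e * v)) *
            (D * (expWeight c K x * ((1 + |v|) ^ K * Real.exp (-(c * (√e * v))))))) := by gcongr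
        _ = √Real.pi / (2 * Real.pi) * Real.exp (-v ^ 2 / 4) * (D * expWeight c K x *
            (1 + |v|) ^ K * (Real.exp (c * (√e * v)) * Real.exp (-(c * (√e * v))))) := by ring
        _ = _ := by rw [← Real.exp_add, add_neg_cancel, Real.exp_zero]; ring
    · have hc : Continuous fun e : ℝ => √Real.pi / (2 * Real.pi) * Real.exp (-v ^ 2 / 4) *
          (Real.exp (c * (√e * v)) * f (x - √e * v)) := by fun_prop
      have := (hc.tendsto 0).mono_left (nhdsWithin_le_nhds (s := Set.Ioi 0))
      simpa using this
  rw [integral_mul_const, integral_gaussian_normalised, one_mul] at hlim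
  refine hlim.congr' ?_
  filter_upwards [self_mem_nhdsWithin] with e he using (hscale e he).symm

end

namespace ReducedData

variable {N : ℕ} {T : ℝ} {E : PolynomialExpansion N T} {c : ℝ} (R : ReducedData E c)

theorem evSym_self (t e : ℝ) :
    R.evSym t t e = fun ξ : ℝ => Complex.exp (-(e : ℂ) * (ξ : ℂ) ^ 2) := by
  ext ξ
  simp [evSym, lam]

theorem tendsto_integral_evKer_self (t : ℝ) {f : ℝ → ℝ} (hf : Continuous f) {D : ℝ} {K : ℕ}
    (hb : ∀ x, |f x| ≤ D * expWeight c K x) (x : ℝ) :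
    Tendsto (fun e : ℝ => ∫ y, R.evKer t t e (x - y) * f y) (𝓝[>] 0) (𝓝 (f x)) := by
  simp only [evKer, evSym_self]
  exact tendsto_integral_gaussian hf hb x

end ReducedData

/-! ### The zeroth order solution -/

theorem clamp_mem_Icc {τ : ℝ} (h0 : 0 ≤ τ) (t : ℝ) : max 0 (min t τ) ∈ Set.Icc 0 τ :=
  ⟨le_max_left _ _, max_le h0 (min_le_right _ _)⟩

theorem clamp_eq {τ t : ℝ} (h : t ∈ Set.Icc 0 τ) : max 0 (min t τ) = t := by
  rw [min_eq_left h.2, max_eq_right h.1]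

namespace ReducedData

variable {N : ℕ} {T : ℝ} {E : PolynomialExpansion N T} {c : ℝ} (R : ReducedData E c)

theorem rapidFamily_backward (hα : ∀ᵐ t ∂(volume.restrict (Set.Icc (0 : ℝ) T)), 0 < R.α 0 0 t)
    {τ : ℝ} (h0 : 0 ≤ τ) (hτ : τ < T) :
    RapidFamily c fun r => R.evKer (max 0 (min r τ)) T 0 :=
  (R.rapidSymbol_backward hα h0 hτ).rapidFamily

theorem u₀_eq (hα : ∀ᵐ t ∂(volume.restrict (Set.Icc (0 : ℝ) T)), 0 < R.α 0 0 t) (h : ℝ → ℝ)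
    {t : ℝ} (ht : t ∈ Set.Ico 0 T) (x : ℝ) :
    E.u₀ h t x = ∫ y, R.evKer t T 0 (x - y) * h y := by
  simp only [PolynomialExpansion.u₀, R.p₀_eq hα ht]

theorem integrable_p₀_mul (hα : ∀ᵐ t ∂(volume.restrict (Set.Icc (0 : ℝ) T)), 0 < R.α 0 0 t)
    {h : ℝ → ℝ} (hh : IsDatum c h) {t : ℝ} (ht : t ∈ Set.Ico 0 T) (x : ℝ) :
    Integrable fun y => E.p₀ t x T y * h y := by
  have := hh.integrable (R.rapidFamily_backward hα ht.1 ht.2) t x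
  simpa only [clamp_eq (Set.right_mem_Icc.2 ht.1), ← R.p₀_eq hα ht] using this

theorem u₀_clamp_eq (hα : ∀ᵐ t ∂(volume.restrict (Set.Icc (0 : ℝ) T)), 0 < R.α 0 0 t)
    {τ : ℝ} (h0 : 0 ≤ τ) (hτ : τ < T) (h : ℝ → ℝ) :
    (fun t => E.u₀ h (max 0 (min t τ))) =
      fun t x => ∫ y, R.evKer (max 0 (min t τ)) T 0 (x - y) * h y := by
  ext t x
  have := clamp_mem_Icc h0 t
  exact R.u₀_eq hα h ⟨this.1, this.2.trans_lt hτ⟩ x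

theorem tameFamily_u₀ (hα : ∀ᵐ t ∂(volume.restrict (Set.Icc (0 : ℝ) T)), 0 < R.α 0 0 t)
    {h : ℝ → ℝ} (hh : IsDatum c h) {τ : ℝ} (h0 : 0 ≤ τ) (hτ : τ < T) :
    TameFamily c fun t => E.u₀ h (max 0 (min t τ)) := by
  rw [R.u₀_clamp_eq hα h0 hτ]
  exact hh.tame (R.rapidFamily_backward hα h0 hτ)

theorem solves_u₀ (hα : ∀ᵐ t ∂(volume.restrict (Set.Icc (0 : ℝ) T)), 0 < R.α 0 0 t)
    {h : ℝ → ℝ} (hh : IsDatum c h) {τ : ℝ} (h0 : 0 ≤ τ) (hτ : τ < T) :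
    Solves (R.opB 0 0) (Set.Icc 0 τ) (fun t => E.u₀ h (max 0 (min t τ))) fun _ _ => 0 := by
  rw [R.u₀_clamp_eq hα h0 hτ]
  exact hh.solves (R.isTransOp_opB 0 0) (R.rapidFamily_backward hα h0 hτ) (R.solves_evKer hα h0 hτ)

theorem smoothGrowth_u₀ (hα : ∀ᵐ t ∂(volume.restrict (Set.Icc (0 : ℝ) T)), 0 < R.α 0 0 t)
    {h : ℝ → ℝ} (hh : IsDatum c h) {t : ℝ} (ht : t ∈ Set.Ico 0 T) : SmoothGrowth c (E.u₀ h t) := by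
  simpa only [clamp_eq (Set.right_mem_Icc.2 ht.1)] using
    (R.tameFamily_u₀ hα hh ht.1 ht.2).smoothGrowth t

theorem rapidSymbol_evSym_const
    (hα : ∀ᵐ t ∂(volume.restrict (Set.Icc (0 : ℝ) T)), 0 < R.α 0 0 t) {t s e : ℝ} (ht : 0 ≤ t)
    (hts : t ≤ s) (hs : s ≤ T) (he : 0 ≤ e) (he1 : e ≤ 1) (h : t < s ∨ 0 < e) :
    RapidSymbol fun _ : Unit => R.evSym t s e := by
  have hpos : 0 < R.diff t s + e := by
    rcases h with h | h
    · linarith [R.diff_pos hα ht h hs]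
    · linarith [R.diff_nonneg hα ht hts hs]
  exact R.rapidSymbol_evSym measurable_const measurable_const measurable_const
    (fun _ => by rwa [abs_of_nonneg he]) (fun _ => ht) (fun _ => hts) (fun _ => hs) hpos
    fun _ => le_rfl

/-! ### The zeroth order solution for smooth data -/

theorem integral_evKer_eq (hα : ∀ᵐ t ∂(volume.restrict (Set.Icc (0 : ℝ) T)), 0 < R.α 0 0 t)
    {t s e : ℝ} (ht : 0 ≤ t) (hts : t ≤ s) (hs : s ≤ T) (he : 0 ≤ e) (he1 : e ≤ 1)
    (h : t < s ∨ 0 < e) {f : ℝ → ℝ} (hf : SmoothGrowth c f) (x : ℝ) :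
    ∫ y, R.evKer t s e (x - y) * f y =
      ∫ y, symKernel c (fun ξ => (1 + Complex.I * ξ)⁻¹ ^ 2 * R.evSym t s e ξ) (x - y) *
        (shiftDeriv c)^[2] f y :=
  (R.rapidSymbol_evSym_const hα ht hts hs he he1 h).integral_symKernel_eq hf () 2 x

/-- The regularised symbols as a family in the time and in the regularisation. -/
theorem symFamily_evSym_clamp (hα : ∀ᵐ t ∂(volume.restrict (Set.Icc (0 : ℝ) T)), 0 < R.α 0 0 t)
    (hT : 0 ≤ T) (k : ℕ) :
    SymFamily k (-2) fun (q : ℝ × ℝ) ξ => (1 + Complex.I * ξ)⁻¹ ^ 2 *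
      R.evSym (max 0 (min q.1 T)) T (max 0 (min q.2 1)) ξ :=
  R.symFamily_evSym_mul hα (t := fun q : ℝ × ℝ => max 0 (min q.1 T)) (s := fun _ => T)
    (e := fun q => max 0 (min q.2 1)) (by fun_prop) measurable_const (by fun_prop)
    (fun q => (clamp_mem_Icc hT q.1).1) (fun q => (clamp_mem_Icc hT q.1).2) (fun _ => le_rfl)
    (fun q => (clamp_mem_Icc zero_le_one q.2).1) (fun q => (clamp_mem_Icc zero_le_one q.2).2) k

theorem continuous_evSym_fst (ξ : ℝ) : Continuous fun t => R.evSym t T 0 ξ := by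
  have h1 : Continuous fun t => R.lam T t (vline c ξ) :=
    intervalIntegral.continuous_primitive
      (fun a b => R.intervalIntegrable_expo (by simp) a b) T
  have h2 : (fun t => R.lam t T (vline c ξ)) = fun t => -R.lam T t (vline c ξ) := by
    ext t; exact intervalIntegral.integral_symm _ _
  unfold evSym
  have h3 : Continuous fun t => R.lam t T (vline c ξ) := h2 ▸ h1.neg
  fun_prop

/-- With two derivatives moved to the data, the kernels converge to the same limit as `t → T` without
regularisation and as the regularisation vanishes at `t = T`; the latter limit is an approximate
identity. -/
theorem tendsto_u₀ (hα : ∀ᵐ t ∂(volume.restrict (Set.Icc (0 : ℝ) T)), 0 < R.α 0 0 t)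
    (hT : 0 < T) {h : ℝ → ℝ} (hh : SmoothGrowth c h) (x : ℝ) :
    Tendsto (fun t => E.u₀ h t x) (𝓝[<] T) (𝓝 (h x)) := by
  have hg := hh.shiftDeriv_iterate 2
  obtain ⟨D, K, -, hD⟩ := hg.tame.bound_zero
  have hgm := hg.1.continuous.aestronglyMeasurable (μ := volume)
  have ha := R.symFamily_evSym_clamp hα hT.le (K + 2)
  have l1 := ha.tendsto_integral (c := c) hgm (hD ()) (l := 𝓝[<] T) (φ := fun t => (t, 0))
    (q₀ := (T, 0)) (fun ξ => ?_) x
  · have l2 := ha.tendsto_integral (c := c) hgm (hD ()) (l := 𝓝[>] 0) (φ := fun e => (T, e))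
      (q₀ := (T, 0)) (fun ξ => ?_) x
    · obtain ⟨D', K', -, hD'⟩ := hh.tame.bound_zero
      have l3 := R.tendsto_integral_evKer_self T hh.1.continuous (hD' ()) x
      have e1 : ∀ᶠ e in 𝓝[>] (0 : ℝ), ∫ y, symKernel c (fun ξ => (1 + Complex.I * ξ)⁻¹ ^ 2 *
          R.evSym (max 0 (min T T)) T (max 0 (min e 1)) ξ) (x - y) * (shiftDeriv c)^[2] h y =
          ∫ y, R.evKer T T e (x - y) * h y := by
        filter_upwards [Ioo_mem_nhdsGT (show (0 : ℝ) < 1 by norm_num)] with e he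
        rw [clamp_eq (Set.right_mem_Icc.2 hT.le), clamp_eq (Set.Ioo_subset_Icc_self he),
          R.integral_evKer_eq hα hT.le le_rfl le_rfl he.1.le he.2.le (Or.inr he.1) hh]
      have e2 := tendsto_nhds_unique (l2.congr' e1) l3
      rw [e2] at l1
      refine l1.congr' ?_
      filter_upwards [Ioo_mem_nhdsLT hT] with t ht
      rw [R.u₀_eq hα h ⟨ht.1.le, ht.2⟩, R.integral_evKer_eq hα ht.1.le ht.2.le le_rfl le_rfl
        zero_le_one (Or.inl ht.2) hh]
      simp only [clamp_eq (Set.Ioo_subset_Icc_self ht), clamp_eq (Set.left_mem_Icc.2 zero_le_one)]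
    · refine Tendsto.const_mul _ ?_
      have : Continuous fun e : ℝ => R.evSym (max 0 (min T T)) T (max 0 (min e 1)) ξ := by
        unfold evSym; fun_prop
      exact (this.tendsto 0).mono_left nhdsWithin_le_nhds
  · refine Tendsto.const_mul _ ?_
    have h1 : Continuous fun t : ℝ => R.evSym (max 0 (min t T)) T 0 ξ :=
      (R.continuous_evSym_fst ξ).comp (by fun_prop)
    simp only [clamp_eq (Set.left_mem_Icc.2 (zero_le_one' ℝ))]
    exact (h1.tendsto T).mono_left nhdsWithin_le_nhds

open Classical in
/-- The zeroth order solution, extended by the data to all times off `[0, T)`. -/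
noncomputable def _root_.PolynomialExpansion.u₀Ext (E : PolynomialExpansion N T) (h : ℝ → ℝ) (t : ℝ) :
    ℝ → ℝ :=
  if t ∈ Set.Ico 0 T then E.u₀ h t else h

/-- For smooth data, the growth of the zeroth order solution is uniform up to the final time. -/
theorem tameFamily_u₀Ext (hα : ∀ᵐ t ∂(volume.restrict (Set.Icc (0 : ℝ) T)), 0 < R.α 0 0 t)
    (hT : 0 < T) {h : ℝ → ℝ} (hh : SmoothGrowth c h) : TameFamily c (E.u₀Ext h) := by
  classical
  refine ⟨fun t => ?_, fun j => ?_, fun x => ?_⟩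
  · by_cases ht : t ∈ Set.Ico 0 T
    · rw [PolynomialExpansion.u₀Ext, if_pos ht]
      exact (R.smoothGrowth_u₀ hα hh.isDatum ht).1
    · rw [PolynomialExpansion.u₀Ext, if_neg ht]
      exact hh.1
  · have hj : SmoothGrowth c (iteratedDeriv j h) := (hh.tame.iteratedDeriv j).smoothGrowth ()
    obtain ⟨D', K', hD'0, hD'⟩ := hj.tame.bound_zero
    obtain ⟨D, K, hD0, hD⟩ := (hj.shiftDeriv_iterate 2).tame.bound_zero
    obtain ⟨C, hC, hb⟩ := (R.symFamily_evSym_clamp hα hT.le (K + 2)).symKernel_bound (c := c)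
    have hI : 0 ≤ ∫ y, symWeight (-2) y := integral_nonneg fun y => symWeight_nonneg _ _
    refine ⟨C * D * (∫ y, symWeight (-2) y) + D', max K K', by positivity, fun t x => ?_⟩
    have hw := expWeight_mono c (le_max_left K K') x
    have hw' := expWeight_mono c (le_max_right K K') x
    have hw0 := expWeight_nonneg c (max K K') x
    rw [add_mul]
    by_cases ht : t ∈ Set.Ico 0 T
    · rw [PolynomialExpansion.u₀Ext, if_pos ht]
      have hcl : max 0 (min t T) = t := clamp_eq (Set.Ico_subset_Icc_self ht)
      have e1 : E.u₀ h t = fun x => ∫ y, R.evKer t T 0 (x - y) * h y :=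
        funext fun x => R.u₀_eq hα h ht x
      have hK := R.rapidFamily_backward hα ht.1 ht.2
      have e2 := hK.iteratedDeriv_integral hh t j
      simp only [clamp_eq (Set.right_mem_Icc.2 ht.1)] at e2
      rw [e1, e2]
      simp only
      rw [R.integral_evKer_eq hα ht.1 ht.2.le le_rfl le_rfl zero_le_one (Or.inl ht.2) hj]
      have h3 := abs_integral_le_of_decay hC (hb (t, 0)) (hD ()) x
      simp only [hcl, clamp_eq (Set.left_mem_Icc.2 (zero_le_one' ℝ))] at h3
      refine h3.trans (le_add_of_le_of_nonneg ?_ (by positivity))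
      gcongr
    · rw [PolynomialExpansion.u₀Ext, if_neg ht]
      refine (hD' () x).trans (le_add_of_nonneg_of_le (by positivity) ?_)
      gcongr
  · -- the family is the pointwise limit of the families stopped before the final time
    have hτ : ∀ n : ℕ, 0 ≤ T - T / (n + 1) ∧ T - T / (n + 1) < T := fun n => by
      have : T / (n + 1) ≤ T := div_le_self hT.le (by linarith [n.cast_nonneg (α := ℝ)])
      exact ⟨by linarith, by linarith [show 0 < T / (n + 1) by positivity]⟩
    refine measurable_of_tendsto_metrizable (f := fun (n : ℕ) t =>
      if t ∈ Set.Icc 0 (T - T / (n + 1)) then E.u₀ h (max 0 (min t (T - T / (n + 1)))) x else h x)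
      (fun n => ?_) (tendsto_pi_nhds.2 fun t => ?_)
    · exact Measurable.ite measurableSet_Icc
        ((R.tameFamily_u₀ hα hh.isDatum (hτ n).1 (hτ n).2).meas x) measurable_const
    · refine tendsto_const_nhds.congr' ?_
      by_cases ht : t ∈ Set.Ico 0 T
      · have h1 : Tendsto (fun n : ℕ => T - T / ((n : ℝ) + 1)) atTop (𝓝 (T - 0)) :=
          tendsto_const_nhds.sub (tendsto_const_div_atTop_nhds_zero_nat T |>.comp
            (tendsto_add_atTop_nat 1) |>.congr fun n => by simp)
        rw [sub_zero] at h1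
        filter_upwards [h1.eventually (eventually_ge_nhds ht.2)] with n hn
        have hm : t ∈ Set.Icc 0 (T - T / ((n : ℝ) + 1)) := ⟨ht.1, hn⟩
        simp only [PolynomialExpansion.u₀Ext, if_pos ht, if_pos hm, clamp_eq hm]
      · refine Eventually.of_forall fun n => ?_
        have hm : t ∉ Set.Icc 0 (T - T / ((n : ℝ) + 1)) := fun hm =>
          ht ⟨hm.1, hm.2.trans_lt (hτ n).2⟩
        simp only [PolynomialExpansion.u₀Ext, if_neg ht, if_neg hm]

theorem solves_u₀Ext (hα : ∀ᵐ t ∂(volume.restrict (Set.Icc (0 : ℝ) T)), 0 < R.α 0 0 t)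
    {h : ℝ → ℝ} (hh : IsDatum c h) {τ : ℝ} (h0 : 0 ≤ τ) (hτ : τ < T) :
    Solves (R.opB 0 0) (Set.Icc 0 τ) (E.u₀Ext h) fun _ _ => 0 := by
  intro t ht t' ht' htt x
  have e : ∀ r ∈ Set.Icc 0 τ, E.u₀Ext h r = E.u₀ h (max 0 (min r τ)) := fun r hr => by
    rw [PolynomialExpansion.u₀Ext, if_pos ⟨hr.1, hr.2.trans_lt hτ⟩, clamp_eq hr]
  have h1 := R.solves_u₀ hα hh h0 hτ t ht t' ht' htt x
  simp only at h1
  rw [e t ht, e t' ht', h1]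
  congr 1
  refine intervalIntegral.integral_congr fun r hr => ?_
  rw [Set.uIcc_of_le htt] at hr
  simp only [e r ⟨ht.1.trans hr.1, hr.2.trans ht'.2⟩]

end ReducedData

/-! ### Families of twice differentiable functions -/

/-- A measurable family of twice continuously differentiable functions whose derivatives up to order
two are `O((1 + |x|)^K e^{cx})`, uniformly in the parameter. -/
structure C2Family (c : ℝ) {Q : Type} [MeasurableSpace Q] (F : Q → ℝ → ℝ) : Prop where
  contDiff : ∀ q, ContDiff ℝ 2 (F q)
  bound : ∃ (A : ℝ) (K : ℕ), 0 ≤ A ∧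
    ∀ j ≤ 2, ∀ q x, |iteratedDeriv j (F q) x| ≤ A * expWeight c K x
  meas : ∀ x, Measurable fun q => F q x

theorem TameFamily.c2Family {c : ℝ} {Q : Type} [MeasurableSpace Q] {F : Q → ℝ → ℝ}
    (hF : TameFamily c F) : C2Family c F :=
  ⟨fun q => by exact_mod_cast contDiff_infty.1 (hF.contDiff q) 2, hF.bound_le 2, hF.meas⟩

namespace C2Family

variable {c : ℝ} {P Q : Type} [MeasurableSpace P] [MeasurableSpace Q] {F G : Q → ℝ → ℝ}

theorem comp (hF : C2Family c F) {φ : P → Q} (hφ : Measurable φ) : C2Family c fun p => F (φ p) :=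
  ⟨fun p => hF.contDiff _, by
    obtain ⟨A, K, hA, h⟩ := hF.bound
    exact ⟨A, K, hA, fun j hj p x => h j hj _ x⟩, fun x => (hF.meas x).comp hφ⟩

theorem sub (hF : C2Family c F) (hG : C2Family c G) : C2Family c fun q x => F q x - G q x := by
  refine ⟨fun q => (hF.contDiff q).sub (hG.contDiff q), ?_, fun x => (hF.meas x).sub (hG.meas x)⟩
  obtain ⟨A, K, hA, h⟩ := hF.bound
  obtain ⟨A', K', hA', h'⟩ := hG.bound
  refine ⟨A + A', max K K', by positivity, fun j hj q x => ?_⟩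
  have e := iteratedDeriv_fun_sub (n := j) (x := x)
    (((hF.contDiff q).of_le (by exact_mod_cast hj)).contDiffAt)
    (((hG.contDiff q).of_le (by exact_mod_cast hj)).contDiffAt)
  rw [e, add_mul]
  refine (abs_sub _ _).trans (add_le_add ((h j hj q x).trans ?_) ((h' j hj q x).trans ?_))
  · exact mul_le_mul_of_nonneg_left (expWeight_mono c (le_max_left _ _) x) hA
  · exact mul_le_mul_of_nonneg_left (expWeight_mono c (le_max_right _ _) x) hA'

theorem differentiable (hF : C2Family c F) (q : Q) : Differentiable ℝ (F q) :=
  (hF.contDiff q).differentiable (by norm_num)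

theorem contDiff_deriv (hF : C2Family c F) (q : Q) : ContDiff ℝ 1 (deriv (F q)) :=
  ((contDiff_succ_iff_deriv (n := 1)).1 (by exact_mod_cast hF.contDiff q)).2.2

theorem differentiable_deriv (hF : C2Family c F) (q : Q) : Differentiable ℝ (deriv (F q)) :=
  (hF.contDiff_deriv q).differentiable (by norm_num)

theorem continuous_deriv_deriv (hF : C2Family c F) (q : Q) : Continuous (deriv (deriv (F q))) :=
  (hF.contDiff_deriv q).continuous_deriv le_rfl

theorem deriv_bound (hF : C2Family c F) : ∃ (A : ℝ) (K : ℕ), 0 ≤ A ∧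
    ∀ q x, |F q x| ≤ A * expWeight c K x ∧ |deriv (F q) x| ≤ A * expWeight c K x ∧
      |deriv (deriv (F q)) x| ≤ A * expWeight c K x := by
  obtain ⟨A, K, hA, h⟩ := hF.bound
  refine ⟨A, K, hA, fun q x => ⟨?_, ?_, ?_⟩⟩
  · simpa using h 0 (by norm_num) q x
  · simpa [iteratedDeriv_one] using h 1 (by norm_num) q x
  · simpa [iteratedDeriv_succ] using h 2 le_rfl q x

theorem measurable_uncurry_of_continuous (hF : ∀ q, Continuous (F q))
    (hm : ∀ x, Measurable fun q => F q x) : Measurable fun p : Q × ℝ => F p.1 p.2 :=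
  (measurable_uncurry_of_continuous_of_measurable (u := fun x q => F q x) hF hm).comp
    measurable_swap

theorem measurable_uncurry (hF : C2Family c F) : Measurable fun p : Q × ℝ => F p.1 p.2 :=
  measurable_uncurry_of_continuous (fun q => (hF.contDiff q).continuous) hF.meas

theorem measurable_uncurry_deriv (hF : C2Family c F) :
    Measurable fun p : Q × ℝ => deriv (F p.1) p.2 :=
  measurable_uncurry_of_continuous (fun q => (hF.contDiff_deriv q).continuous)
    (measurable_deriv_of_differentiable hF.differentiable hF.meas)

theorem measurable_uncurry_deriv_deriv (hF : C2Family c F) :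
    Measurable fun p : Q × ℝ => deriv (deriv (F p.1)) p.2 :=
  measurable_uncurry_of_continuous (fun q => hF.continuous_deriv_deriv q)
    (measurable_deriv_of_differentiable hF.differentiable_deriv
      (measurable_deriv_of_differentiable hF.differentiable hF.meas))

theorem measurable_jumpOp (hF : C2Family c F) {w : ℝ → ℝ≥0} (hw : Measurable w) :
    Measurable fun p : (Q × ℝ) × ℝ => jumpOp w p.2 (F p.1.1) p.1.2 := by
  simp only [jumpOp, incrOp, mul_one]
  have h1 : Measurable fun p : (Q × ℝ) × ℝ => F p.1.1 (p.1.2 + p.2) :=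
    hF.measurable_uncurry.comp (measurable_fst.fst.prodMk (measurable_fst.snd.add measurable_snd))
  exact ((h1.sub (hF.measurable_uncurry.comp measurable_fst)).sub
    (measurable_snd.mul (hF.measurable_uncurry_deriv.comp measurable_fst))).div
      (hw.comp measurable_snd).coe_nnreal_real

theorem jumpOp_bound (hF : C2Family c F) {ν : Measure ℝ} {w : ℝ → ℝ≥0} (hw : IsLevyWeight c ν w) :
    ∃ (C : ℝ) (K : ℕ), 0 ≤ C ∧ ∀ q z x, |jumpOp w z (F q) x| ≤ C * expWeight c K x := by
  obtain ⟨A, K, hA, h⟩ := hF.bound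
  obtain ⟨C, hC, hb⟩ := incrBound_jumpOp hw K
  refine ⟨C * A, K, by positivity, fun q z x => ?_⟩
  rw [mul_assoc]
  exact hb _ (hF.contDiff q) A hA (fun i hi x => h i hi q x) z x

theorem isDatum (hF : C2Family c F) (q : Q) : IsDatum c (F q) := by
  obtain ⟨A, K, -, h⟩ := hF.deriv_bound
  exact isDatum_of_bound (hF.contDiff q).continuous.aestronglyMeasurable fun x => (h q x).1

theorem isDatum_deriv (hF : C2Family c F) (q : Q) : IsDatum c (deriv (F q)) := by
  obtain ⟨A, K, -, h⟩ := hF.deriv_bound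
  exact isDatum_of_bound (hF.contDiff_deriv q).continuous.aestronglyMeasurable fun x => (h q x).2.1

theorem isDatum_deriv_deriv (hF : C2Family c F) (q : Q) : IsDatum c (deriv (deriv (F q))) := by
  obtain ⟨A, K, -, h⟩ := hF.deriv_bound
  exact isDatum_of_bound (hF.continuous_deriv_deriv q).aestronglyMeasurable fun x => (h q x).2.2

end C2Family

/-! ### Adjoint action on convolutions -/

namespace ReducedData

variable {N : ℕ} {T : ℝ} {E : PolynomialExpansion N T} {c : ℝ} (R : ReducedData E c)

section

variable {Q : Type} [MeasurableSpace Q]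

theorem measurable_lint_jumpOp {P : Type} [MeasurableSpace P] {F : P → ℝ → ℝ} (hF : C2Family c F)
    {φ : P → ℝ} (hφ : Measurable φ) (n k : ℕ) :
    Measurable fun p : P × ℝ => R.lint n k (φ p.1) fun z => jumpOp R.w z (F p.1) p.2 := by
  have hm := (hF.measurable_jumpOp R.w_meas).stronglyMeasurable
  have h : ∀ κ : Kernel ℝ ℝ, IsFiniteKernel κ → Measurable fun p : P × ℝ =>
      ∫ z, jumpOp R.w z (F p.1) p.2 ∂(κ (φ p.1)) := fun κ _ =>
    (hm.integral_kernel_prod_right'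
      (κ := κ.comap (fun p : P × ℝ => φ p.1) (hφ.comp measurable_fst))).measurable
  exact (h (R.kp n k) inferInstance).sub (h (R.km n k) inferInstance)

theorem measurable_opB {P : Type} [MeasurableSpace P] {F : P → ℝ → ℝ} (hF : C2Family c F)
    {φ : P → ℝ} (hφ : Measurable φ) (n k : ℕ) :
    Measurable fun p : P × ℝ => R.opB n k (φ p.1) (F p.1) p.2 := by
  have hφ' : Measurable fun p : P × ℝ => φ p.1 := hφ.comp measurable_fst
  have h0 := hF.measurable_uncurry
  have h1 := hF.measurable_uncurry_deriv
  have h2 := hF.measurable_uncurry_deriv_deriv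
  exact (((R.α_meas n k).comp hφ').mul (h2.sub h1) |>.add
    (((R.β_meas n k).comp hφ').mul (h1.sub h0))).add
    ((((R.measurable_drift n k).comp hφ').neg.mul h1).add (R.measurable_lint_jumpOp hF hφ n k))

theorem opB_bound {F : Q → ℝ → ℝ} (hF : C2Family c F) (n k : ℕ) : ∃ (C : ℝ) (K : ℕ),
    ∀ t q x, |R.opB n k t (F q) x| ≤ C * expWeight c K x := by
  obtain ⟨A, hA⟩ := R.α_bound n k
  obtain ⟨B, hB⟩ := R.β_bound n k
  obtain ⟨D, hD⟩ := R.drift_bound n k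
  obtain ⟨M, K, hM, h⟩ := hF.deriv_bound
  obtain ⟨C, L, hC, hb⟩ := hF.jumpOp_bound R.weight_zero
  refine ⟨A * (M + M) + B * (M + M) + (D * M + (C * (R.kp n k).bound.toReal +
    C * (R.km n k).bound.toReal)), max K L, fun t q x => ?_⟩
  have hK := expWeight_mono c (le_max_left K L) x
  have hL := expWeight_mono c (le_max_right K L) x
  have hw := expWeight_nonneg c (max K L) x
  set W := expWeight c (max K L) x
  obtain ⟨h0, h1, h2⟩ := h q x
  have hMK : M * expWeight c K x ≤ M * W := by gcongr
  have hj : ∀ z, |jumpOp R.w z (F q) x| ≤ C * W := fun z =>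
    (hb q z x).trans (by gcongr)
  have hl := (abs_sub _ _).trans (add_le_add
    (abs_integral_kernel_le (κ := R.kp n k) (g := fun z => jumpOp R.w z (F q) x) hj t)
    (abs_integral_kernel_le (κ := R.km n k) (g := fun z => jumpOp R.w z (F q) x) hj t))
  have hA0 : 0 ≤ A := (abs_nonneg _).trans (hA 0)
  have hB0 : 0 ≤ B := (abs_nonneg _).trans (hB 0)
  have hD0 : 0 ≤ D := (abs_nonneg _).trans (hD 0)
  have e1 : |R.α n k t * (deriv (deriv (F q)) x - deriv (F q) x)| ≤ A * (M * W + M * W) := by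
    rw [abs_mul]
    exact mul_le_mul (hA t) ((abs_sub _ _).trans (add_le_add (h2.trans hMK) (h1.trans hMK)))
      (abs_nonneg _) hA0
  have e2 : |R.β n k t * (deriv (F q) x - F q x)| ≤ B * (M * W + M * W) := by
    rw [abs_mul]
    exact mul_le_mul (hB t) ((abs_sub _ _).trans (add_le_add (h1.trans hMK) (h0.trans hMK)))
      (abs_nonneg _) hB0
  have e3 : |-(R.drift n k t) * deriv (F q) x| ≤ D * (M * W) := by
    rw [abs_mul, abs_neg]
    exact mul_le_mul (hD t) (h1.trans hMK) (abs_nonneg _) hD0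
  have e4 := (abs_add_le _ _).trans (add_le_add ((abs_add_le _ _).trans (add_le_add e1 e2))
    ((abs_add_le _ _).trans (add_le_add e3 hl)))
  refine e4.trans (le_of_eq ?_)
  ring

theorem integrable_mul_of_bound {Ker : Q → ℝ → ℝ} (hK : RapidFamily c Ker) {f : ℝ → ℝ}
    (hm : Measurable f) {C : ℝ} {K : ℕ} (hf : ∀ y, |f y| ≤ C * expWeight c K y) (q : Q) (x : ℝ) :
    Integrable fun y => Ker q (x - y) * f y :=
  (isDatum_of_bound hm.aestronglyMeasurable hf).integrable hK q x

/-- The jump integral may be moved from the data to the convolution. -/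
theorem integral_mul_lint_jumpOp {Ker : Q → ℝ → ℝ} (hK : RapidFamily c Ker) {f : ℝ → ℝ}
    (hf : C2Family c fun _ : Unit => f) (κ : Measure ℝ) [IsFiniteMeasure κ] (q : Q) (x : ℝ) :
    ∫ y, Ker q (x - y) * ∫ z, jumpOp R.w z f y ∂κ =
      ∫ z, jumpOp R.w z (fun x => ∫ y, Ker q (x - y) * f y) x ∂κ := by
  have hd := hf.isDatum ()
  have hd' := hf.isDatum_deriv ()
  obtain ⟨C, K, hC, hb⟩ := hf.jumpOp_bound R.weight_zero
  obtain ⟨D, hD, hb'⟩ := hK.bound 0 (K + 2)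
  have hjm : Measurable fun p : ℝ × ℝ => jumpOp R.w p.2 f p.1 :=
    (hf.measurable_jumpOp R.w_meas).comp (f := fun p : ℝ × ℝ => (((), p.1), p.2)) (by fun_prop)
  have hint : Integrable (Function.uncurry fun y z => Ker q (x - y) * jumpOp R.w z f y)
      (volume.prod κ) := by
    refine Integrable.mono' (((((integrable_symWeight le_rfl).comp_sub_left x).const_mul
      (D * C * expWeight c K x))).mul_prod (integrable_const (1 : ℝ)))
      (((hK.tame.continuous q).measurable.comp (measurable_const.sub measurable_fst)).mul
        hjm).aestronglyMeasurable (Eventually.of_forall fun p => ?_)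
    rw [mul_one]
    exact abs_mul_le_of_decay (f := Ker q) (g := jumpOp R.w p.2 f) hD
      (fun x => by simpa using hb' q x) (fun y => hb () p.2 y) x p.1
  simp only [← integral_const_mul]
  rw [integral_integral_swap hint]
  refine integral_congr_ae (Eventually.of_forall fun z => ?_)
  simp only [jumpOp, incrOp, mul_one]
  rw [hd.deriv_integral hK, integral_deriv_mul_eq hK (hf.differentiable ()) hd hd']
  have i1 : Integrable fun y => Ker q (x - y) * f (y + z) := by
    have := (hd.integrable hK q (x + z)).comp_add_right z
    refine this.congr (Eventually.of_forall fun y => ?_)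
    simp only
    congr 2
    ring
  have e1 : ∫ y, Ker q (x + z - y) * f y = ∫ y, Ker q (x - y) * f (y + z) := by
    rw [← integral_add_right_eq_self (fun y => Ker q (x + z - y) * f y) z]
    congr 1 with y
    congr 2
    ring
  have i2 := hd.integrable hK q x
  have i3 := hd'.integrable hK q x
  rw [e1, ← integral_sub i1 i2, ← integral_const_mul, ← integral_sub (i1.sub' i2) (i3.const_mul z),
    ← integral_div]
  congr 1 with y
  ring

/-- The operators `𝒜_0` may be moved from the data to the kernel of a convolution, even if the data
are only twice differentiable. -/
theorem integral_mul_opB {Ker : Q → ℝ → ℝ} (hK : RapidFamily c Ker) {f : ℝ → ℝ}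
    (hf : C2Family c fun _ : Unit => f) (n k : ℕ) (t : ℝ) (q : Q) (x : ℝ) :
    ∫ y, Ker q (x - y) * R.opB n k t f y = ∫ y, R.opB n k t (Ker q) (x - y) * f y := by
  have d0 := hf.isDatum ()
  have d1 := hf.isDatum_deriv ()
  have d2 := hf.isDatum_deriv_deriv ()
  rw [← d0.map_integral (R.isTransOp_opB n k) hK]
  have e1 : deriv (fun x => ∫ y, Ker q (x - y) * f y) =
      fun x => ∫ y, Ker q (x - y) * deriv f y := by
    ext x
    rw [d0.deriv_integral hK, integral_deriv_mul_eq hK (hf.differentiable ()) d0 d1]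
  have e2 : deriv (fun x => ∫ y, Ker q (x - y) * deriv f y) x =
      ∫ y, Ker q (x - y) * deriv (deriv f) y := by
    rw [d1.deriv_integral hK, integral_deriv_mul_eq hK (hf.differentiable_deriv ()) d1 d2]
  have i0 := d0.integrable hK q x
  have i1 := d1.integrable hK q x
  have i2 := d2.integrable hK q x
  obtain ⟨C, K, hC, hb⟩ := hf.jumpOp_bound R.weight_zero
  have ij : ∀ κ : Kernel ℝ ℝ, IsFiniteKernel κ →
      Integrable fun y => Ker q (x - y) * ∫ z, jumpOp R.w z f y ∂(κ t) := fun κ _ => by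
    have hm := ((hf.measurable_jumpOp R.w_meas).stronglyMeasurable.integral_prod_right'
      (ν := κ t)).measurable
    refine integrable_mul_of_bound hK (f := fun y => ∫ z, jumpOp R.w z f y ∂(κ t))
      (C := C * κ.bound.toReal) (K := K)
      (hm.comp (f := fun y : ℝ => ((), y)) (by fun_prop)) (fun y => ?_) q x
    refine (abs_integral_kernel_le (κ := κ) (fun z => hb () z y) t).trans_eq (by ring)
  have jp := ij (R.kp n k) inferInstance
  have jm := ij (R.km n k) inferInstance
  simp only [opB, lint]
  rw [e1, e2, ← R.integral_mul_lint_jumpOp hK hf, ← R.integral_mul_lint_jumpOp hK hf,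
    ← integral_sub i2 i1, ← integral_sub i1 i0, ← integral_sub jp jm, ← integral_const_mul,
    ← integral_const_mul, ← integral_const_mul, ← integral_add, ← integral_add, ← integral_add]
  · congr 1 with y
    ring
  · exact ((i2.sub' i1).const_mul _).fun_add ((i1.sub' i0).const_mul _)
  · exact (i1.const_mul _).fun_add (jp.sub' jm)
  · exact i1.const_mul _
  · exact jp.sub' jm
  · exact (i2.sub' i1).const_mul _
  · exact (i1.sub' i0).const_mul _

end

end ReducedData

/-! ### A conserved quantity -/

/-- The product rule for two primitives. -/
theorem mul_sub_mul_eq_integral {F G f g : ℝ → ℝ} {a b : ℝ} (hab : a ≤ b)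
    (hf : IntervalIntegrable f volume a b) (hg : IntervalIntegrable g volume a b)
    (hF : ∀ s ∈ Set.Icc a b, F s = F a + ∫ r in a..s, f r)
    (hG : ∀ s ∈ Set.Icc a b, G s = G a + ∫ r in a..s, g r) :
    F b * G b - F a * G a = ∫ r in a..b, (f r * G r + F r * g r) := by
  have hc : ∀ (C : ℝ) {f : ℝ → ℝ}, IntervalIntegrable f volume a b →
      AbsolutelyContinuousOnInterval (fun s => C + ∫ r in a..s, f r) a b := fun C f hf =>
    ((LipschitzWith.const C).lipschitzOnWith.absolutelyContinuousOnInterval).fun_add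
      (hf.absolutelyContinuousOnInterval_intervalIntegral Set.left_mem_uIcc)
  have h1 := (hc (F a) hf).integral_deriv_mul_eq_sub (hc (G a) hg)
  rw [← hF b (Set.right_mem_Icc.2 hab), ← hG b (Set.right_mem_Icc.2 hab),
    ← hF a (Set.left_mem_Icc.2 hab), ← hG a (Set.left_mem_Icc.2 hab)] at h1
  rw [← h1]
  refine intervalIntegral.integral_congr_ae ?_
  filter_upwards [hf.ae_hasDerivAt_integral, hg.ae_hasDerivAt_integral] with r h2 h3 hr
  have hr' := Set.uIoc_subset_uIcc hr
  have e1 := ((h2 hr' a Set.left_mem_uIcc).const_add (F a)).deriv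
  have e2 := ((h3 hr' a Set.left_mem_uIcc).const_add (G a)).deriv
  rw [e1, e2]
  rw [Set.uIcc_of_le hab] at hr'
  rw [← hF r hr', ← hG r hr']

namespace ReducedData

variable {N : ℕ} {T : ℝ} {E : PolynomialExpansion N T} {c : ℝ} (R : ReducedData E c)

/-- The kernels solve the forward equation, which is adjoint to the backward equation; so the
integral of a backward solution against a forward kernel does not depend on time. -/
theorem integral_evKer_mul_eq (hα : ∀ᵐ t ∂(volume.restrict (Set.Icc (0 : ℝ) T)), 0 < R.α 0 0 t)
    {τ : ℝ} (hτ : τ < T) {w : ℝ → ℝ → ℝ} (hw : C2Family c w)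
    (hS : Solves (R.opB 0 0) (Set.Icc 0 τ) w fun _ _ => 0) {t s e : ℝ} (ht : 0 ≤ t) (hts : t ≤ s)
    (hs : s ≤ τ) (he : 0 < e) (he1 : e ≤ 1) (x : ℝ) :
    ∫ y, R.evKer t s e (x - y) * w s y = ∫ y, R.evKer t t e (x - y) * w t y := by
  have htT : t ∈ Set.Icc 0 T := ⟨ht, (hts.trans hs).trans hτ.le⟩
  set b : ℝ → ℝ → ℂ := fun r => R.evSym t (max t (min r T)) e with hbdef
  have hb : RapidSymbol b := R.rapidSymbol_forward hα htT he he1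
  have hcl : ∀ r ∈ Set.Icc t s, max t (min r T) = r := fun r hr => by
    rw [min_eq_left ((hr.2.trans hs).trans hτ.le), max_eq_right hr.1]
  set Ker : ℝ → ℝ → ℝ := fun r => symKernel c (b r)
  have hK : RapidFamily c Ker := hb.rapidFamily
  have hKe : ∀ r ∈ Set.Icc t s, Ker r = R.evKer t r e := fun r hr => by
    simp only [Ker, hbdef, hcl r hr]; rfl
  set KA : ℝ → ℝ → ℝ := fun r => R.opB 0 0 r (Ker r)
  have hKA : RapidFamily c KA := by
    have h1 : KA = fun r => symKernel c fun ξ => R.expo r (vline c ξ) * b r ξ := by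
      ext r x; exact R.opB_symKernel hb r r x
    rw [h1]
    exact (hb.mul_sym fun k => R.symFamily_expo k).rapidFamily
  obtain ⟨C, K, hC⟩ := R.opB_bound hw 0 0
  obtain ⟨D, L, -, hD⟩ := hw.deriv_bound
  have hOm : Measurable fun p : ℝ × ℝ => R.opB 0 0 p.1 (w p.1) p.2 :=
    R.measurable_opB hw measurable_id 0 0
  obtain ⟨C1, hC1, hb1⟩ := hKA.bound 0 (L + 2)
  obtain ⟨C2, hC2, hb2⟩ := hK.bound 0 (K + 2)
  simp only [iteratedDeriv_zero] at hb1 hb2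
  have hbd1 := fun r y => abs_mul_le_of_decay (f := KA r) (g := w r) hC1 (hb1 r)
    (fun x => (hD r x).1) x y
  have hbd2 := fun r y => abs_mul_le_of_decay (f := Ker r) (g := R.opB 0 0 r (w r)) hC2 (hb2 r)
    (fun x => hC r r x) x y
  have hm : ∀ {F : ℝ → ℝ → ℝ}, RapidFamily c F → Measurable fun p : ℝ × ℝ => F p.1 (x - p.2) :=
    fun hF => hF.tame.measurable_uncurry.comp
      (measurable_fst.prodMk (measurable_const.sub measurable_snd))
  have hint : Integrable (Function.uncurry fun r y =>
      KA r (x - y) * w r y + Ker r (x - y) * (-R.opB 0 0 r (w r) y))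
      ((volume.restrict (Set.uIoc t s)).prod volume) := by
    have hfin : IsFiniteMeasure (volume.restrict (Set.uIoc t s)) :=
      ⟨by rw [Measure.restrict_apply_univ]; exact measure_Ioc_lt_top⟩
    refine Integrable.mono' ((integrable_const (1 : ℝ)).mul_prod
      (((integrable_symWeight le_rfl).comp_sub_left x).const_mul
        (C1 * D * expWeight c L x + C2 * C * expWeight c K x)))
      (((hm hKA).mul hw.measurable_uncurry).add ((hm hK).mul hOm.neg)).aestronglyMeasurable
      (Eventually.of_forall fun p => ?_)
    have h2 := hbd2 p.1 p.2
    rw [← abs_neg, ← mul_neg] at h2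
    rw [one_mul, add_mul]
    exact (abs_add_le _ _).trans (add_le_add (hbd1 p.1 p.2) h2)
  have hprod : ∀ y, Ker s (x - y) * w s y - Ker t (x - y) * w t y = ∫ r in t..s,
      (KA r (x - y) * w r y + Ker r (x - y) * (-R.opB 0 0 r (w r) y)) := by
    intro y
    refine mul_sub_mul_eq_integral (F := fun r => Ker r (x - y)) (G := fun r => w r y) hts
      ?_ ?_ (fun s' hs' => ?_) fun s' hs' => ?_
    · obtain ⟨C3, K3, -, h3⟩ := hKA.tame.bound_zero
      exact intervalIntegrable_of_bound (hKA.meas _) (fun r => h3 r (x - y)) t s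
    · refine (intervalIntegrable_of_bound ?_ (fun r => hC r r y) t s).neg
      exact hOm.comp (measurable_id.prodMk measurable_const)
    · have hst : Set.Icc t s' ⊆ Set.Icc t s := Set.Icc_subset_Icc_right hs'.2
      have h1 := R.evKer_forward hα htT he he1 le_rfl hs'.1 ((hs'.2.trans hs).trans hτ.le) (x - y)
      rw [hKe s' hs', hKe t (Set.left_mem_Icc.2 hts), ← sub_eq_iff_eq_add', h1]
      refine intervalIntegral.integral_congr fun r hr => ?_
      rw [Set.uIcc_of_le hs'.1] at hr
      simp only [KA, hKe r (hst hr)]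
    · have h1 := hS t ⟨ht, hts.trans hs⟩ s' ⟨ht.trans hs'.1, hs'.2.trans hs⟩ hs'.1 y
      simp only [add_zero] at h1
      rw [h1, intervalIntegral.integral_neg, sub_eq_add_neg]
  have i1 := (hw.isDatum s).integrable hK s x
  have i2 := (hw.isDatum t).integrable hK t x
  have hzero : ∫ y, (Ker s (x - y) * w s y - Ker t (x - y) * w t y) = 0 := by
    simp only [hprod]
    rw [← intervalIntegral_integral_swap hint]
    have : ∀ r, ∫ y, (KA r (x - y) * w r y + Ker r (x - y) * (-R.opB 0 0 r (w r) y)) = 0 := by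
      intro r
      have j1 := (hw.isDatum r).integrable hKA r x
      have hf : C2Family c fun _ : Unit => w r := hw.comp measurable_const
      have j2 := integrable_mul_of_bound hK (f := R.opB 0 0 r (w r))
        (hOm.comp (measurable_const.prodMk measurable_id)) (fun y => hC r r y) r x
      rw [integral_add j1 (by simpa only [mul_neg] using j2.fun_neg)]
      simp only [mul_neg]
      rw [integral_neg, R.integral_mul_opB hK hf, add_neg_cancel]
    simp only [this, intervalIntegral.integral_zero]
  rw [integral_sub i1 i2, sub_eq_zero, hKe s (Set.right_mem_Icc.2 hts),
    hKe t (Set.left_mem_Icc.2 hts)] at hzero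
  exact hzero

end ReducedData

/-! ### Limits of convolutions with data -/

namespace IsDatum

variable {c : ℝ} {P Q : Type} [MeasurableSpace Q] {Ker : Q → ℝ → ℝ} {l : Filter P}

theorem tendsto_integral [l.IsCountablyGenerated] {h : ℝ → ℝ} (hh : IsDatum c h)
    (hK : RapidFamily c Ker) {φ : P → Q} {q : Q}
    (hφ : ∀ y, Tendsto (fun p => Ker (φ p) y) l (𝓝 (Ker q y))) (x : ℝ) :
    Tendsto (fun p => ∫ y, Ker (φ p) (x - y) * h y) l (𝓝 (∫ y, Ker q (x - y) * h y)) := by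
  obtain ⟨k, hk⟩ := id hh
  obtain ⟨C, L, hC, hb⟩ := (hK.translate k).bound_zero
  refine tendsto_integral_filter_of_dominated_convergence
    (fun y => C * expWeight c L x * ‖h y * Real.exp (-(c * y)) / (1 + |y|) ^ k‖)
    (Eventually.of_forall fun p => (hh.integrable hK (φ p) x).1)
    (Eventually.of_forall fun p => Eventually.of_forall fun y => ?_) (hk.norm.const_mul _)
    (Eventually.of_forall fun y => (hφ (x - y)).mul_const _)
  rw [← expWeight_mul_eq c h k, norm_mul]
  exact mul_le_mul_of_nonneg_right (hb (φ p, y) x) (norm_nonneg _)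

/-- Convergence of the data in a weighted `L¹` norm may be combined with pointwise convergence of
the kernels. -/
theorem tendsto_integral_of_lintegral [l.IsCountablyGenerated] {h : ℝ → ℝ} (hh : IsDatum c h)
    (hK : RapidFamily c Ker) {φ : P → Q} {q : Q}
    (hφ : ∀ y, Tendsto (fun p => Ker (φ p) y) l (𝓝 (Ker q y))) {v : P → ℝ → ℝ}
    (hv : ∀ᶠ p in l, IsDatum c (v p)) {k : ℕ}
    (hlim : Tendsto (fun p => ∫⁻ y : ℝ, ENNReal.ofReal
      (|v p y - h y| * Real.exp (-(c * y)) / (1 + |y|) ^ k)) l (𝓝 0)) (x : ℝ) :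
    Tendsto (fun p => ∫ y, Ker (φ p) (x - y) * v p y) l (𝓝 (∫ y, Ker q (x - y) * h y)) := by
  obtain ⟨C, L, hC, hb⟩ := (hK.translate k).bound_zero
  have h1 : Tendsto (fun p => ∫ y, Ker (φ p) (x - y) * (v p y - h y)) l (𝓝 0) := by
    have h2 := ENNReal.Tendsto.const_mul (a := ENNReal.ofReal (C * expWeight c L x)) hlim
      (Or.inr ENNReal.ofReal_ne_top)
    rw [mul_zero] at h2
    rw [tendsto_zero_iff_enorm_tendsto_zero]
    refine tendsto_of_tendsto_of_tendsto_of_le_of_le tendsto_const_nhds h2 (fun _ => zero_le)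
      fun p => ?_
    refine (enorm_integral_le_lintegral_enorm _).trans ?_
    rw [← lintegral_const_mul' _ _ ENNReal.ofReal_ne_top]
    refine lintegral_mono fun y => ?_
    rw [← ENNReal.ofReal_mul (mul_nonneg hC (expWeight_nonneg _ _ _)), ← ofReal_norm]
    refine ENNReal.ofReal_le_ofReal ?_
    rw [← expWeight_mul_eq c (fun y => v p y - h y) k, norm_mul]
    refine (mul_le_mul_of_nonneg_right (hb (φ p, y) x) (norm_nonneg _)).trans_eq ?_
    rw [norm_div, norm_mul, Real.norm_eq_abs, Real.norm_of_nonneg (Real.exp_pos _).le,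
      Real.norm_of_nonneg (by positivity : (0 : ℝ) ≤ (1 + |y|) ^ k)]
  have h3 := h1.add (hh.tendsto_integral hK hφ x)
  rw [zero_add] at h3
  refine h3.congr' ?_
  filter_upwards [hv] with p hp
  have i1 := hp.integrable hK (φ p) x
  have i2 := hh.integrable hK (φ p) x
  simp only [mul_sub]
  rw [integral_sub i1 i2, sub_add_cancel]

end IsDatum

namespace ReducedData

variable {N : ℕ} {T : ℝ} {E : PolynomialExpansion N T} {c : ℝ} (R : ReducedData E c)

theorem continuous_evSym_snd (t e ξ : ℝ) : Continuous fun s => R.evSym t s e ξ := by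
  have h1 : Continuous fun s => R.lam t s (vline c ξ) :=
    intervalIntegral.continuous_primitive
      (fun a b => R.intervalIntegrable_expo (by simp) a b) t
  unfold evSym
  fun_prop

/-- The limit of the pairing of forward kernels with functions that attain a terminal value. -/
theorem tendsto_integral_evKer_terminal
    (hα : ∀ᵐ t ∂(volume.restrict (Set.Icc (0 : ℝ) T)), 0 < R.α 0 0 t) {t e : ℝ} (ht : t ∈ Set.Ico 0 T)
    (he : 0 < e) (he1 : e ≤ 1) {h : ℝ → ℝ} (hh : IsDatum c h) {v : ℝ → ℝ → ℝ}
    (hv : ∀ s ∈ Set.Ioo t T, IsDatum c (v s)) {k : ℕ}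
    (hlim : Tendsto (fun s => ∫⁻ y : ℝ, ENNReal.ofReal
      (|v s y - h y| * Real.exp (-(c * y)) / (1 + |y|) ^ k)) (𝓝[<] T) (𝓝 0)) (x : ℝ) :
    Tendsto (fun s => ∫ y, R.evKer t s e (x - y) * v s y) (𝓝[<] T)
      (𝓝 (∫ y, R.evKer t T e (x - y) * h y)) := by
  have htT : t ∈ Set.Icc 0 T := Set.Ico_subset_Icc_self ht
  have hb := R.rapidSymbol_forward hα htT he he1
  have hsb := (hb 0 (-2)).base
  obtain ⟨C, -, hC⟩ := hsb.bound
  have h1 := hh.tendsto_integral_of_lintegral (c := c) hb.rapidFamily (φ := id) (q := T)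
    (l := 𝓝[<] T) (fun y => tendsto_symKernel (fun s => hsb.cont s) hC (fun ξ => ?_) y) (v := v)
    ?_ hlim x
  · rw [show max t (min T T) = T by rw [min_self, max_eq_right ht.2.le]] at h1
    refine h1.congr' ?_
    filter_upwards [Ioo_mem_nhdsLT ht.2] with s hs
    simp only [id_eq, min_eq_left hs.2.le, max_eq_right hs.1.le]
    rfl
  · have h2 : Continuous fun s => R.evSym t (max t (min s T)) e ξ :=
      (R.continuous_evSym_snd t e ξ).comp (by fun_prop)
    exact (h2.tendsto T).mono_left nhdsWithin_le_nhds
  · filter_upwards [Ioo_mem_nhdsLT ht.2] with s hs using hv s hs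

theorem tendsto_integral_evKer_zero
    (hα : ∀ᵐ t ∂(volume.restrict (Set.Icc (0 : ℝ) T)), 0 < R.α 0 0 t) {t : ℝ} (ht : t ∈ Set.Ico 0 T)
    {h : ℝ → ℝ} (hh : IsDatum c h) (x : ℝ) :
    Tendsto (fun e => ∫ y, R.evKer t T e (x - y) * h y) (𝓝[>] 0)
      (𝓝 (∫ y, R.evKer t T 0 (x - y) * h y)) := by
  have hb : RapidSymbol fun e => R.evSym t T (max 0 (min e 1)) :=
    R.rapidSymbol_evSym measurable_const measurable_const (by fun_prop)
      (fun e => by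
        have := clamp_mem_Icc zero_le_one e
        rw [abs_of_nonneg this.1]; exact this.2)
      (fun _ => ht.1) (fun _ => ht.2.le) (fun _ => le_rfl) (R.diff_pos hα ht.1 ht.2 le_rfl)
      fun e => le_add_of_nonneg_right (clamp_mem_Icc zero_le_one e).1
  have hsb := (hb 0 (-2)).base
  obtain ⟨C, -, hC⟩ := hsb.bound
  have h1 := hh.tendsto_integral (c := c) hb.rapidFamily (φ := id) (q := 0)
    (l := 𝓝[>] 0) (fun y => tendsto_symKernel (fun s => hsb.cont s) hC (fun ξ => ?_) y) x
  · rw [clamp_eq (Set.left_mem_Icc.2 (zero_le_one' ℝ))] at h1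
    refine h1.congr' ?_
    filter_upwards [Ioo_mem_nhdsGT (show (0 : ℝ) < 1 by norm_num)] with e he
    simp only [id_eq, clamp_eq (Set.Ioo_subset_Icc_self he)]
    rfl
  · have h2 : Continuous fun e : ℝ => R.evSym t T (max 0 (min e 1)) ξ := by
      unfold evSym; fun_prop
    exact (h2.tendsto 0).mono_left nhdsWithin_le_nhds

end ReducedData

/-! ### Uniqueness -/

namespace ReducedData

variable {N : ℕ} {T : ℝ} {E : PolynomialExpansion N T} {c : ℝ} (R : ReducedData E c)

theorem ae_A_zero_eq : ∀ᵐ t ∂(volume.restrict (Set.Icc (0 : ℝ) T)),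
    ∀ f x, E.A 0 t f x = R.opB 0 0 t f x := by
  filter_upwards [R.ae_a₀_eq, R.ae_γ₀_eq, ae_restrict_mem measurableSet_Icc] with t h1 h2 ht f x
  have ea : (E.a 0 t).eval x = R.α 0 0 t := by
    rw [← h1, PolynomialExpansion.a₀, Polynomial.eq_C_of_natDegree_eq_zero (E.a_zero t ht)]
    simp
  have eγ : (E.γ 0 t).eval x = R.β 0 0 t := by
    rw [← h2, PolynomialExpansion.γ₀, Polynomial.eq_C_of_natDegree_eq_zero (E.γ_zero t ht)]
    simp
  rw [PolynomialExpansion.A, ea, eγ, E.M_zero, Finset.sum_range_one, pow_zero, one_mul,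
    R.levyInt_drift (Nat.zero_le _) (Nat.zero_le _) ht,
    R.levyInt_jump (Nat.zero_le _) (Nat.zero_le _) ht, opB]

theorem ae_A_eq_all : ∀ᵐ t ∂(volume.restrict (Set.Icc (0 : ℝ) T)),
    ∀ n ≤ N, ∀ f x, E.A n t f x = R.ops.opA n t f x := by
  refine ae_all_iff.2 fun n => ?_
  by_cases hn : n ≤ N
  · filter_upwards [R.ae_A_eq hn] with t ht _ using ht
  · exact Eventually.of_forall fun _ h => absurd h hn

theorem opB_sub {Q : Type} [MeasurableSpace Q] {F G : Q → ℝ → ℝ} (hF : C2Family c F)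
    (hG : C2Family c G) (n k : ℕ) (t : ℝ) (q : Q) (x : ℝ) :
    R.opB n k t (fun x => F q x - G q x) x = R.opB n k t (F q) x - R.opB n k t (G q) x := by
  have e1 : deriv (fun x => F q x - G q x) = fun x => deriv (F q) x - deriv (G q) x :=
    funext fun x => deriv_fun_sub (hF.differentiable q x) (hG.differentiable q x)
  have e2 : deriv (fun x => deriv (F q) x - deriv (G q) x) x =
      deriv (deriv (F q)) x - deriv (deriv (G q)) x :=
    deriv_fun_sub (hF.differentiable_deriv q x) (hG.differentiable_deriv q x)
  have e3 : ∀ z, jumpOp R.w z (fun x => F q x - G q x) x =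
      jumpOp R.w z (F q) x - jumpOp R.w z (G q) x := fun z => by
    simp only [jumpOp, incrOp, e1]
    ring
  have hi : ∀ {H : Q → ℝ → ℝ}, C2Family c H → ∀ κ : Kernel ℝ ℝ, IsFiniteKernel κ →
      Integrable (fun z => jumpOp R.w z (H q) x) (κ t) := fun hH κ _ => by
    obtain ⟨C, K, hC, h⟩ := hH.jumpOp_bound R.weight_zero
    exact Integrable.of_bound ((hH.measurable_jumpOp R.w_meas).comp
      (f := fun z : ℝ => ((q, x), z)) (by fun_prop)).aestronglyMeasurable _
      (Eventually.of_forall fun z => h q z x)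
  simp only [opB, lint, e3]
  rw [e1, e2, integral_sub (hi hF (R.kp n k) inferInstance) (hi hG (R.kp n k) inferInstance),
    integral_sub (hi hF (R.km n k) inferInstance) (hi hG (R.km n k) inferInstance)]
  ring

/-- The difference of two solutions of the inhomogeneous equation solves the homogeneous one. -/
theorem solves_sub {F G : ℝ → ℝ → ℝ} (hF : C2Family c F) (hG : C2Family c G) {g : ℝ → ℝ → ℝ}
    (hg : ∀ a b x, IntervalIntegrable (fun r => g r x) volume a b) {I : Set ℝ}
    (h : Solves (R.opB 0 0) I F g) (h' : Solves (R.opB 0 0) I G g) :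
    Solves (R.opB 0 0) I (fun r x => F r x - G r x) fun _ _ => 0 := by
  have hi : ∀ {H : ℝ → ℝ → ℝ}, C2Family c H → ∀ a b x,
      IntervalIntegrable (fun r => R.opB 0 0 r (H r) x) volume a b := fun hH a b x => by
    obtain ⟨C, K, hC⟩ := R.opB_bound hH 0 0
    exact intervalIntegrable_of_bound ((R.measurable_opB hH measurable_id 0 0).comp
      (measurable_id.prodMk measurable_const)) (fun r => hC r r x) a b
  intro t ht t' ht' htt x
  simp only [add_zero, R.opB_sub hF hG]
  rw [h t ht t' ht' htt x, h' t ht t' ht' htt x, intervalIntegral.integral_add (hi hF _ _ _)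
    (hg _ _ _), intervalIntegral.integral_add (hi hG _ _ _) (hg _ _ _),
    intervalIntegral.integral_sub (hi hF _ _ _) (hi hG _ _ _)]
  ring

/-- The source terms of the nested equations. -/
noncomputable def source (n : ℕ) (u : ℝ → ℝ → ℝ) (t x : ℝ) : ℝ :=
  ∑ k ∈ Finset.Icc 1 n, R.ops.opA k t (R.ops.opL (n - k) t t (u t)) x

theorem tame_source {u : ℝ → ℝ → ℝ} (hu : TameFamily c u) (n : ℕ) :
    TameFamily c (R.source n u) :=
  TameFamily.sum _ fun k _ => by
    have e : ∀ r f, R.ops.opG k r r f = R.ops.opA k r f := fun r f =>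
      funext fun x => R.ops.opG_self k r f x
    simpa only [e] using (R.ops.isTameOp_opG k).tame'
      (R.ops.tame_opL_diag hu (n - k)) (φ := fun r => (r, r)) (by fun_prop)

end ReducedData

namespace IsNestedSolution

variable {N : ℕ} {T : ℝ} {E : PolynomialExpansion N T} {c : ℝ} {h : ℝ → ℝ} {u : ℕ → ℝ → ℝ → ℝ}

theorem c2Family (hu : IsNestedSolution E c h u) {n : ℕ} (hn : n ≤ N) {τ : ℝ} (h0 : 0 ≤ τ)
    (hτ : τ < T) : C2Family c fun t => u n (max 0 (min t τ)) := by
  have hcl : ∀ t, max 0 (min t τ) ∈ Set.Icc 0 τ := clamp_mem_Icc h0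
  refine ⟨fun t => hu.contDiff n hn _ ⟨(hcl t).1, (hcl t).2.trans_lt hτ⟩, ?_, fun x => ?_⟩
  · choose! C K hC using hu.growth n hn τ ⟨h0, hτ⟩
    refine ⟨∑ j ∈ Finset.range 3, |C j|, (Finset.range 3).sup K,
      Finset.sum_nonneg fun j _ => abs_nonneg _, fun j hj t x => ?_⟩
    have hj' : j ∈ Finset.range 3 := Finset.mem_range.2 (by omega)
    have h1 := hC j hj _ (hcl t) x
    rw [mul_assoc] at h1
    refine h1.trans (mul_le_mul ((le_abs_self _).trans
      (Finset.single_le_sum (f := fun j => |C j|) (fun j _ => abs_nonneg _) hj'))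
      (expWeight_mono c (Finset.le_sup hj') x) (expWeight_nonneg _ _ _)
      (Finset.sum_nonneg fun j _ => abs_nonneg _))
  · have h1 := (hu.absCont n hn τ ⟨h0, hτ⟩ x).continuousOn
    rw [Set.uIcc_of_le h0] at h1
    have h2 : Continuous fun t => u n (max 0 (min t τ)) x :=
      h1.comp_continuous (by fun_prop) hcl
    exact h2.measurable

theorem isDatum (hu : IsNestedSolution E c h u) {n : ℕ} (hn : n ≤ N) {t : ℝ} (ht : t ∈ Set.Ico 0 T) :
    IsDatum c (u n t) := by
  simpa only [clamp_eq (Set.right_mem_Icc.2 ht.1)] using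
    (hu.c2Family hn ht.1 ht.2).isDatum t

/-- The equation in integrated form. -/
theorem solves (hu : IsNestedSolution E c h u) (R : ReducedData E c) {n : ℕ} (hn : n ≤ N) {τ : ℝ}
    (h0 : 0 ≤ τ) (hτ : τ < T) {V : ℕ → ℝ → ℝ → ℝ}
    (hV : ∀ k < n, ∀ t ∈ Set.Icc 0 τ, u k t = V k t) :
    Solves (R.opB 0 0) (Set.Icc 0 τ) (fun t => u n (max 0 (min t τ))) fun t x =>
      ∑ k ∈ Finset.Icc 1 n, R.ops.opA k t (V (n - k) t) x := by
  intro t ht t' ht' htt x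
  have hsub : Set.uIcc t t' ⊆ Set.Icc 0 τ := Set.uIcc_subset_Icc ht ht'
  have hac : AbsolutelyContinuousOnInterval (fun t => u n t x) t t' :=
    (hu.absCont n hn τ ⟨h0, hτ⟩ x).mono (by rwa [Set.uIcc_of_le h0])
  have h1 := hac.integral_deriv_eq_sub
  simp only [clamp_eq ht, clamp_eq ht']
  rw [eq_sub_iff_add_eq', ← eq_sub_iff_add_eq, ← neg_sub, ← h1, ← intervalIntegral.integral_neg]
  refine intervalIntegral.integral_congr_ae_restrict ?_
  have hsub' := Set.uIoc_subset_uIcc.trans hsub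
  filter_upwards [ae_restrict_of_ae_restrict_of_subset
      (hsub'.trans (Set.Icc_subset_Icc_right hτ.le)) R.ae_A_zero_eq,
    ae_restrict_of_ae_restrict_of_subset
      (hsub'.trans (Set.Icc_subset_Icc_right hτ.le)) R.ae_A_eq_all,
    ae_restrict_of_ae_restrict_of_subset
      (hsub'.trans (Set.Icc_subset_Ico_right hτ)) (hu.equation n hn x),
    ae_restrict_mem measurableSet_uIoc] with r hr1 hr2 hr3 hr
  have hrI := hsub' hr
  simp only [clamp_eq hrI]
  have e : ∑ k ∈ Finset.Icc 1 n, E.A k r (u (n - k) r) x =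
      ∑ k ∈ Finset.Icc 1 n, R.ops.opA k r (V (n - k) r) x :=
    Finset.sum_congr rfl fun k hk => by
      rw [Finset.mem_Icc] at hk
      rw [hr2 k (hk.2.trans hn), hV (n - k) (by omega) r hrI]
  rw [hr1, e] at hr3
  linarith

/-- The zeroth order term, paired with the regularised kernel at time `t`, equals the datum paired with
the kernel at the final time: the pairing is constant in time, and the terminal condition gives its
limit. -/
theorem integral_evKer_eq_zero_order (hu : IsNestedSolution E c h u) (R : ReducedData E c)
    (hα : ∀ᵐ t ∂(volume.restrict (Set.Icc (0 : ℝ) T)), 0 < R.α 0 0 t) (hh : IsDatum c h)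
    {t e : ℝ} (ht : t ∈ Set.Ico 0 T) (he : 0 < e) (he1 : e ≤ 1) (x : ℝ) :
    ∫ y, R.evKer t t e (x - y) * u 0 t y = ∫ y, R.evKer t T e (x - y) * h y := by
  obtain ⟨K, hK⟩ := hu.terminal 0 (Nat.zero_le _)
  simp only [if_true] at hK
  have h1 := R.tendsto_integral_evKer_terminal hα ht he he1 hh
    (fun s hs => hu.isDatum (Nat.zero_le _) ⟨ht.1.trans hs.1.le, hs.2⟩) hK x
  refine tendsto_nhds_unique (tendsto_const_nhds.congr' ?_) h1
  filter_upwards [Ioo_mem_nhdsLT ht.2] with s hs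
  have h0 : 0 ≤ s := ht.1.trans hs.1.le
  have hS := hu.solves R (Nat.zero_le _) h0 hs.2 (V := u) (by simp)
  simp only [Finset.Icc_eq_empty_of_lt zero_lt_one, Finset.sum_empty] at hS
  have h2 := R.integral_evKer_mul_eq hα hs.2 (hu.c2Family (Nat.zero_le _) h0 hs.2) hS ht.1 hs.1.le
    le_rfl he he1 x
  simp only [clamp_eq (Set.right_mem_Icc.2 h0), clamp_eq (show t ∈ Set.Icc 0 s from
    ⟨ht.1, hs.1.le⟩)] at h2
  exact h2.symm

/-- Removal of the regularisation in `integral_evKer_eq_zero_order`. -/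
theorem eq_u₀ (hu : IsNestedSolution E c h u) (R : ReducedData E c)
    (hα : ∀ᵐ t ∂(volume.restrict (Set.Icc (0 : ℝ) T)), 0 < R.α 0 0 t) (hh : IsDatum c h)
    {t : ℝ} (ht : t ∈ Set.Ico 0 T) (x : ℝ) : u 0 t x = E.u₀ h t x := by
  have hw := hu.c2Family (Nat.zero_le _) ht.1 ht.2
  obtain ⟨D, K, -, hD⟩ := hw.deriv_bound
  have hcl := clamp_eq (Set.right_mem_Icc.2 ht.1)
  have h1 := R.tendsto_integral_evKer_self t (hw.contDiff t).continuous
    (fun x => (hD t x).1) x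
  simp only [hcl] at h1
  rw [R.u₀_eq hα h ht]
  refine tendsto_nhds_unique h1 ((R.tendsto_integral_evKer_zero hα ht hh x).congr' ?_)
  filter_upwards [Ioo_mem_nhdsGT (show (0 : ℝ) < 1 by norm_num)] with e he
  exact (hu.integral_evKer_eq_zero_order R hα hh ht he.1 he.2.le x).symm

/-- Two pairings are constant in time: that of the difference of the two sides, and that of `ℒ_n u₀` with
the lower limit of the time integrals frozen. At time `s` they add up to the pairing of `u n s`,
which tends to zero as `s → T`; so does the second one, evaluated at time `t`. Hence the first is zero. -/
theorem eq_opL (hu : IsNestedSolution E c h u) (R : ReducedData E c)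
    (hα : ∀ᵐ t ∂(volume.restrict (Set.Icc (0 : ℝ) T)), 0 < R.α 0 0 t) (hh : IsDatum c h)
    {n : ℕ} (hn : n ≤ N) {t : ℝ} (ht : t ∈ Set.Ico 0 T) :
    u n t = R.ops.opL n t t (E.u₀ h t) := by
  induction n using Nat.strong_induction_on generalizing t with
  | _ n ih =>
  rcases Nat.eq_zero_or_pos n with rfl | hn1
  · rw [ExpansionOps.opL_zero]
    exact funext fun x => hu.eq_u₀ R hα hh ht x
  have hsm := R.smoothGrowth_u₀ hα hh ht
  obtain ⟨C, K, hC, hb⟩ := R.ops.opL_bound (TameFamily.const (Q := ℝ) hsm) hn1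
  -- the pairing of the difference of the two sides with the kernels vanishes
  have hzero : ∀ e, 0 < e → e ≤ 1 → ∀ x, ∫ y, R.evKer t t e (x - y) *
      (u n t y - R.ops.opL n t t (E.u₀ h t) y) = 0 := by
    intro e he he1 x
    obtain ⟨k, hk⟩ := hu.terminal n hn
    simp only [if_neg (Nat.pos_iff_ne_zero.1 hn1)] at hk
    have h1 := R.tendsto_integral_evKer_terminal hα ht he he1 SmoothGrowth.zero.isDatum
      (fun s hs => hu.isDatum hn ⟨ht.1.trans hs.1.le, hs.2⟩) hk x
    simp only [mul_zero, integral_zero] at h1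
    have hKe := (R.rapidSymbol_evSym_const hα ht.1 le_rfl ht.2.le he.le he1
      (Or.inr he)).rapidFamily (c := c)
    have h2 : Tendsto (fun s => ∫ y, R.evKer t t e (x - y) * R.ops.opL n t s (E.u₀ h t) y)
        (𝓝[<] T) (𝓝 0) := by
      obtain ⟨C', hC', hb'⟩ := hKe.bound 0 (K + 2)
      simp only [iteratedDeriv_zero] at hb'
      have h3 : Tendsto (fun s => C' * (|T - s| * C) * (∫ y, symWeight (-2) y) * expWeight c K x)
          (𝓝[<] T) (𝓝 0) := by
        have h4 : Continuous fun s =>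
            C' * (|T - s| * C) * (∫ y, symWeight (-2) y) * expWeight c K x := by fun_prop
        have := (h4.tendsto T).mono_left (nhdsWithin_le_nhds (s := Set.Iio T))
        simpa using this
      refine squeeze_zero_norm (fun s => ?_) h3
      exact abs_integral_le_of_decay hC' (hb' ()) (fun y => (hb t s y).trans_eq (by ring)) x
    refine tendsto_nhds_unique (tendsto_const_nhds.congr' ?_) ((h1.sub h2).trans_eq (by simp))
    filter_upwards [Ioo_mem_nhdsLT ht.2] with s hs
    have h0 : 0 ≤ s := ht.1.trans hs.1.le
    have hts : t ∈ Set.Icc 0 s := ⟨ht.1, hs.1.le⟩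
    have hss : s ∈ Set.Icc 0 s := Set.right_mem_Icc.2 h0
    have hU := hu.c2Family hn h0 hs.2
    have hu₀ := R.tameFamily_u₀ hα hh h0 hs.2
    have hSu := R.solves_u₀ hα hh h0 hs.2
    have hV := R.ops.tame_opL_diag hu₀ n
    have hV' : TameFamily c fun r => R.ops.opL n r s (E.u₀ h (max 0 (min r s))) :=
      (R.ops.tame_opL hu₀ n).comp (φ := fun r => (r, s)) (by fun_prop)
    have hS1 := hu.solves R hn h0 hs.2
      (V := fun k r => R.ops.opL k r r (E.u₀ h (max 0 (min r s)))) fun k hk r hr => by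
        simp only [clamp_eq hr]
        exact ih k hk (hk.le.trans hn) ⟨hr.1, hr.2.trans_lt hs.2⟩
    have hS2 := R.ops.solves_opL_diag hu₀ hSu n
    have hS := R.solves_sub hU hV.c2Family
      (fun a b x => (R.tame_source hu₀ n).intervalIntegrable a b x) hS1 hS2
    -- at time `s` the frozen and the diagonal `ℒ_n u₀` agree, so only `u n s` is left there
    have h3 := R.integral_evKer_mul_eq hα hs.2 (hU.sub hV.c2Family) hS ht.1 hs.1.le le_rfl he he1 x
    have h4 := R.integral_evKer_mul_eq hα hs.2 hV'.c2Family (R.ops.solves_opL hu₀ hSu n s) ht.1 hs.1.le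
      le_rfl he he1 x
    simp only [clamp_eq hts, clamp_eq hss] at h3 h4
    rw [← h3, ← h4]
    have hKs := (R.rapidSymbol_evSym_const hα ht.1 hs.1.le hs.2.le he.le he1
      (Or.inr he)).rapidFamily (c := c)
    have i1 := (hu.isDatum hn ⟨h0, hs.2⟩).integrable hKs () x
    have i2 := (hV.smoothGrowth s).isDatum.integrable hKs () x
    simp only [clamp_eq hss] at i2
    simp only [mul_sub]
    exact integral_sub i1 i2
  have hw := (hu.c2Family hn ht.1 ht.2).sub
    (R.ops.tame_opL_diag (TameFamily.const (Q := ℝ) hsm) n).c2Family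
  obtain ⟨D, L, -, hD⟩ := hw.deriv_bound
  ext x
  have h1 := R.tendsto_integral_evKer_self t (hw.contDiff t).continuous (fun x => (hD t x).1) x
  simp only [clamp_eq (Set.right_mem_Icc.2 ht.1)] at h1
  rw [← sub_eq_zero]
  refine tendsto_nhds_unique h1 (tendsto_const_nhds.congr' ?_)
  filter_upwards [Ioo_mem_nhdsGT (show (0 : ℝ) < 1 by norm_num)] with e he
  exact (hzero e he.1 he.2.le x).symm

end IsNestedSolution

/-! ### Existence for smooth data -/

/-- Two more powers of `1 + |x|` than in the bound make the dominating function integrable. -/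
theorem tendsto_lintegral_of_bound {c : ℝ} {P : Type*} {l : Filter P} [l.IsCountablyGenerated]
    {f : P → ℝ → ℝ} (hf : ∀ᶠ p in l, Measurable (f p)) {C : ℝ} {K : ℕ}
    (hb : ∀ᶠ p in l, ∀ x, |f p x| ≤ C * expWeight c K x)
    (hlim : ∀ x, Tendsto (fun p => f p x) l (𝓝 0)) :
    Tendsto (fun p => ∫⁻ x : ℝ, ENNReal.ofReal
      (|f p x| * Real.exp (-(c * x)) / (1 + |x|) ^ (K + 2))) l (𝓝 0) := by
  have h1 := tendsto_lintegral_filter_of_dominated_convergence (μ := volume) (l := l)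
    (F := fun p x => ENNReal.ofReal (|f p x| * Real.exp (-(c * x)) / (1 + |x|) ^ (K + 2)))
    (f := fun _ => 0) (fun x => ENNReal.ofReal (C * symWeight (-2) x)) ?_ ?_
    (((integrable_symWeight le_rfl).const_mul C).lintegral_lt_top.ne)
    (Eventually.of_forall fun x => ?_)
  · simpa using h1
  · filter_upwards [hf] with p hp
    fun_prop
  · filter_upwards [hb] with p hp
    refine Eventually.of_forall fun x => ENNReal.ofReal_le_ofReal ?_
    rw [← inv_one_add_abs_sq, div_le_iff₀ (by positivity)]
    calc |f p x| * Real.exp (-(c * x)) ≤ C * expWeight c K x * Real.exp (-(c * x)) := by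
          gcongr; exact hp x
      _ = C * (1 + |x|) ^ K * (Real.exp (c * x) * Real.exp (-(c * x))) := by rw [expWeight]; ring
      _ = C * ((1 + |x|) ^ 2)⁻¹ * (1 + |x|) ^ (K + 2) := by
        rw [← Real.exp_add, add_neg_cancel, Real.exp_zero, pow_add]
        have : (1 + |x|) ^ 2 ≠ 0 := by positivity
        field_simp
  · rw [← ENNReal.ofReal_zero]
    refine (ENNReal.continuous_ofReal.tendsto 0).comp ?_
    have := (((hlim x).abs).mul_const (Real.exp (-(c * x)))).div_const ((1 + |x|) ^ (K + 2))
    simpa using this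

namespace ReducedData

variable {N : ℕ} {T : ℝ} {E : PolynomialExpansion N T} {c : ℝ} (R : ReducedData E c) {h : ℝ → ℝ}

/-- The operators of `E` may be replaced by those of the reduced data. -/
theorem nested_eq (hα : ∀ᵐ t ∂(volume.restrict (Set.Icc (0 : ℝ) T)), 0 < R.α 0 0 t)
    (hh : IsDatum c h) {n : ℕ} (hn : n ≤ N) {t : ℝ} (ht : t ∈ Set.Ico 0 T) :
    (if n = 0 then E.u₀ h t else E.opL n t (E.u₀ h t)) = R.ops.opL n t t (E.u₀Ext h t) := by
  rw [PolynomialExpansion.u₀Ext, if_pos ht]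
  split_ifs with h0
  · rw [h0, ExpansionOps.opL_zero]
  · exact funext fun x => R.opL_eq (R.smoothGrowth_u₀ hα hh ht) (Nat.one_le_iff_ne_zero.2 h0) hn
      (Set.Ico_subset_Icc_self ht) x

theorem tendsto_nested (hα : ∀ᵐ t ∂(volume.restrict (Set.Icc (0 : ℝ) T)), 0 < R.α 0 0 t)
    (hT : 0 < T) (hh : SmoothGrowth c h) {n : ℕ} (hn : n ≤ N) (x : ℝ) :
    Tendsto (fun t => (if n = 0 then E.u₀ h t else E.opL n t (E.u₀ h t)) x) (𝓝[<] T)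
      (𝓝 (if n = 0 then h x else 0)) := by
  split_ifs with h0
  · exact R.tendsto_u₀ hα hT hh x
  · obtain ⟨C, K, hC, hb⟩ := R.ops.opL_bound (R.tameFamily_u₀Ext hα hT hh)
      (Nat.one_le_iff_ne_zero.2 h0)
    have h1 : Tendsto (fun t => |T - t| * (C * expWeight c K x)) (𝓝[<] T) (𝓝 0) := by
      have h2 : Continuous fun t => |T - t| * (C * expWeight c K x) := by fun_prop
      simpa using (h2.tendsto T).mono_left (nhdsWithin_le_nhds (s := Set.Iio T))
    refine squeeze_zero_norm' ?_ h1
    filter_upwards [Ioo_mem_nhdsLT hT] with t ht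
    have e := R.nested_eq hα hh.isDatum hn (Set.Ioo_subset_Ico_self ht)
    rw [if_neg h0] at e
    rw [e]
    exact hb t t x

/-- The terminal conditions follow by dominated convergence from the pointwise limits and the bounds that
are uniform up to the final time. -/
theorem isNestedSolution (hα : ∀ᵐ t ∂(volume.restrict (Set.Icc (0 : ℝ) T)), 0 < R.α 0 0 t)
    (hT : 0 < T) (hh : SmoothGrowth c h) : IsNestedSolution E c h
      fun n t => if n = 0 then E.u₀ h t else E.opL n t (E.u₀ h t) := by
  have hu := R.tameFamily_u₀Ext hα hT hh
  have hF := R.ops.tame_opL_diag hu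
  have hUF := fun {n : ℕ} (hn : n ≤ N) {t : ℝ} => R.nested_eq hα hh.isDatum hn (t := t)
  -- the right-hand side of the equation, up to sign
  have hH : ∀ n, TameFamily c fun t x =>
      R.opB 0 0 t (R.ops.opL n t t (E.u₀Ext h t)) x + R.source n (E.u₀Ext h) t x := fun n =>
    ((R.isTransOp_opB 0 0).toIsTameOp.tame' (hF n) measurable_id).add (R.tame_source hu n)
  have hS : ∀ n, ∀ t ∈ Set.Ico 0 T, ∀ s ∈ Set.Ico 0 T, t ≤ s → ∀ x,
      R.ops.opL n s s (E.u₀Ext h s) x = R.ops.opL n t t (E.u₀Ext h t) x - ∫ r in t..s,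
        (R.opB 0 0 r (R.ops.opL n r r (E.u₀Ext h r)) x + R.source n (E.u₀Ext h) r x) :=
    fun n t ht s hs hts x => R.ops.solves_opL_diag hu (R.solves_u₀Ext hα hh.isDatum hs.1 hs.2) n
      t ⟨ht.1, hts⟩ s ⟨hs.1, le_rfl⟩ hts x
  refine ⟨fun n hn t ht => ?_, fun n hn τ hτ j _ => ?_, fun n hn τ hτ x => ?_, fun n hn x => ?_,
    fun n hn => ?_⟩
  · rw [hUF hn ht]
    exact (hF n).c2Family.contDiff t
  · obtain ⟨C, K, -, hb⟩ := (hF n).bound j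
    refine ⟨C, K, fun t ht x => ?_⟩
    simp only
    rw [hUF hn ⟨ht.1, ht.2.trans_lt hτ.2⟩, mul_assoc]
    exact hb t x
  · obtain ⟨C, K, hC, hb⟩ := (hH n).bound_zero
    refine LipschitzOnWith.absolutelyContinuousOnInterval (K := (C * expWeight c K x).toNNReal) ?_
    rw [Set.uIcc_of_le hτ.1]
    have key : ∀ t ∈ Set.Icc 0 τ, ∀ s ∈ Set.Icc 0 τ, t ≤ s →
        |R.ops.opL n t t (E.u₀Ext h t) x - R.ops.opL n s s (E.u₀Ext h s) x| ≤
          C * expWeight c K x * |s - t| := fun t ht s hs hts => by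
      rw [hS n t ⟨ht.1, ht.2.trans_lt hτ.2⟩ s ⟨hs.1, hs.2.trans_lt hτ.2⟩ hts x, sub_sub_cancel]
      have h1 := intervalIntegral.norm_integral_le_of_norm_le_const (a := t) (b := s)
        (f := fun r => R.opB 0 0 r (R.ops.opL n r r (E.u₀Ext h r)) x + R.source n (E.u₀Ext h) r x)
        (C := C * expWeight c K x) fun r _ => hb r x
      exact h1
    refine LipschitzOnWith.of_dist_le_mul fun t ht s hs => ?_
    rw [hUF hn ⟨ht.1, ht.2.trans_lt hτ.2⟩, hUF hn ⟨hs.1, hs.2.trans_lt hτ.2⟩, Real.dist_eq,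
      Real.dist_eq, Real.coe_toNNReal _ (mul_nonneg hC (expWeight_nonneg _ _ _))]
    rcases le_total t s with hts | hts
    · rw [abs_sub_comm t s]
      exact key t ht s hs hts
    · rw [abs_sub_comm]
      exact key s hs t ht hts
  · have h1 := ((hH n).intervalIntegrable 0 T x).ae_hasDerivAt_integral
    have h2 : ∀ᵐ t : ℝ, t ≠ 0 := by simp [ae_iff]
    filter_upwards [ae_restrict_of_ae h1, ae_restrict_of_ae h2,
      ae_restrict_of_ae_restrict_of_subset Set.Ico_subset_Icc_self R.ae_A_zero_eq,
      ae_restrict_of_ae_restrict_of_subset Set.Ico_subset_Icc_self R.ae_A_eq_all,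
      ae_restrict_mem measurableSet_Ico] with t ht1 ht2 ht3 ht4 ht
    have ht0 : 0 < t := lt_of_le_of_ne ht.1 (Ne.symm ht2)
    have h3 := (ht1 (by rw [Set.uIcc_of_le hT.le]; exact Set.Ico_subset_Icc_self ht) 0
      Set.left_mem_uIcc).const_sub (R.ops.opL n 0 0 (E.u₀Ext h 0) x)
    have h4 : (fun s => (if n = 0 then E.u₀ h s else E.opL n s (E.u₀ h s)) x) =ᶠ[𝓝 t] fun s =>
        R.ops.opL n 0 0 (E.u₀Ext h 0) x - ∫ r in (0 : ℝ)..s,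
        (R.opB 0 0 r (R.ops.opL n r r (E.u₀Ext h r)) x + R.source n (E.u₀Ext h) r x) := by
      filter_upwards [Ioo_mem_nhds ht0 ht.2] with s hs
      rw [hUF hn (Set.Ioo_subset_Ico_self hs),
        hS n 0 ⟨le_rfl, hT⟩ s (Set.Ioo_subset_Ico_self hs) hs.1.le x]
    have h5 : ∑ k ∈ Finset.Icc 1 n,
        E.A k t (if n - k = 0 then E.u₀ h t else E.opL (n - k) t (E.u₀ h t)) x =
          R.source n (E.u₀Ext h) t x :=
      Finset.sum_congr rfl fun k hk => by
        rw [Finset.mem_Icc] at hk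
        rw [ht4 k (hk.2.trans hn), hUF ((Nat.sub_le n k).trans hn) ht]
    rw [h5, (h3.congr_of_eventuallyEq h4).deriv, ht3, hUF hn ht]
    ring
  · obtain ⟨C, K, hC, hb⟩ := (hF n).bound_zero
    obtain ⟨C', K', hC', hb'⟩ := hh.tame.bound_zero
    have hg : Continuous fun x => if n = 0 then h x else 0 := by
      split_ifs
      · exact hh.1.continuous
      · exact continuous_const
    refine ⟨max K K' + 2, tendsto_lintegral_of_bound (C := C + C') ?_ ?_ fun x => ?_⟩
    · filter_upwards [Ioo_mem_nhdsLT hT] with t ht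
      rw [hUF hn (Set.Ioo_subset_Ico_self ht)]
      exact ((hF n).continuous t).measurable.sub hg.measurable
    · filter_upwards [Ioo_mem_nhdsLT hT] with t ht x
      rw [hUF hn (Set.Ioo_subset_Ico_self ht), add_mul]
      have hw := expWeight_nonneg c (max K K') x
      refine (abs_sub _ _).trans (add_le_add ((hb t x).trans (mul_le_mul_of_nonneg_left
        (expWeight_mono c (le_max_left _ _) x) hC)) ?_)
      split_ifs
      · exact (hb' () x).trans (mul_le_mul_of_nonneg_left
          (expWeight_mono c (le_max_right _ _) x) hC')
      · rw [abs_zero]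
        positivity
    · have h1 := (R.tendsto_nested hα hT hh hn x).sub_const (if n = 0 then h x else 0)
      rwa [sub_self] at h1

end ReducedData

theorem theorem3p5 (N : ℕ) (T : ℝ) (hT : 0 < T) (E : PolynomialExpansion N T)
    (ha₀ : ∀ᵐ t ∂(volume.restrict (Set.Icc (0 : ℝ) T)), 0 < E.a₀ t)
    (c : ℝ) (hc : E.ExpMoments c) (h : ℝ → ℝ)
    (hh : ∃ K : ℕ, Integrable (fun x : ℝ => h x * Real.exp (-(c * x)) / (1 + |x|) ^ K)) :
    -- the integrals in `u_0` and in `ℒ_n u_0` converge absolutely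
    (∀ t ∈ Set.Ico (0 : ℝ) T,
      (∀ x : ℝ, Integrable (fun y => E.p₀ t x T y * h y)) ∧
      SmoothGrowth c (E.u₀ h t) ∧
      ∀ n ∈ Finset.Icc 1 N, ∀ r ∈ Finset.Icc 1 n, ∀ i ∈ indexSet n r,
        (∀ s ∈ timeSimplex t T r, SmoothGrowth c (E.prodG t r i s (E.u₀ h t))) ∧
        ∀ x : ℝ, IntegrableOn (fun s => E.prodG t r i s (E.u₀ h t) x) (timeSimplex t T r)) ∧
    -- the solution of the nested Cauchy problems is given by `u_n = ℒ_n u_0`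
    (∀ u : ℕ → ℝ → ℝ → ℝ, IsNestedSolution E c h u →
      ∀ t ∈ Set.Ico (0 : ℝ) T, ∀ x : ℝ,
        u 0 t x = E.u₀ h t x ∧
        ∀ n ∈ Finset.Icc 1 N, u n t x = E.opL n t (E.u₀ h t) x) ∧
    -- for smooth data these functions are a solution, with terminal values attained pointwise
    (SmoothGrowth c h →
      IsNestedSolution E c h
        (fun n t => if n = 0 then E.u₀ h t else E.opL n t (E.u₀ h t)) ∧
      ∀ x : ℝ, Tendsto (fun t => E.u₀ h t x) (𝓝[<] T) (𝓝 (h x)) ∧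
        ∀ n ∈ Finset.Icc 1 N,
          Tendsto (fun t => E.opL n t (E.u₀ h t) x) (𝓝[<] T) (𝓝 0)) := by
  obtain ⟨R⟩ := nonempty_reducedData E hc
  have hα : ∀ᵐ t ∂(volume.restrict (Set.Icc (0 : ℝ) T)), 0 < R.α 0 0 t := by
    filter_upwards [ha₀, R.ae_a₀_eq] with t h1 h2
    rwa [← h2]
  refine ⟨fun t ht => ?_, fun u hu t ht x => ?_, fun hs => ⟨R.isNestedSolution hα hT hs, fun x => ?_⟩⟩
  · have htI := Set.Ico_subset_Icc_self ht
    have hsm := R.smoothGrowth_u₀ hα hh ht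
    refine ⟨R.integrable_p₀_mul hα hh ht, hsm, fun n hn r _ i hi => ?_⟩
    have hi' : ∀ j, i j ≤ N := fun j =>
      (ReducedData.indexSet_le hi j).trans (Finset.mem_Icc.1 hn).2
    exact ⟨fun s hs => R.smoothGrowth_prodG hsm htI hi' fun j =>
      ⟨ht.1.trans (hs.1 j).1, (hs.1 j).2⟩, R.integrableOn_prodG hsm htI hi'⟩
  · refine ⟨hu.eq_u₀ R hα hh ht x, fun n hn => ?_⟩
    rw [Finset.mem_Icc] at hn
    rw [hu.eq_opL R hα hh hn.2 ht, R.opL_eq (R.smoothGrowth_u₀ hα hh ht) hn.1 hn.2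
      (Set.Ico_subset_Icc_self ht)]
  · refine ⟨R.tendsto_u₀ hα hT hs x, fun n hn => ?_⟩
    rw [Finset.mem_Icc] at hn
    have h0 : n ≠ 0 := Nat.one_le_iff_ne_zero.1 hn.1
    simpa only [if_neg h0] using R.tendsto_nested hα hT hs hn.2 x
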